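/- Let $n\ge 1$. Let $\mathcal D=\{u\in(0,\infty)^n:\sum_{i=1}^n u_i<1\}$ and let $A:\overline{\mathcal D}\to\mathbb R^{n\times n}$. **Target state.** Let $\bar\phi_0,\dots,\bar\phi_n>0$ and $\bar e_0>0$. Put $\bar v=\sum_{i=0}^n\bar\phi_i$, $\bar u=(\bar\phi_i/\bar v)_{1\le i\le n}$ and $\bar e(t)=\bar e_0+t\bar v$. The pair $(\bar u,\bar e)$ is called a target state. **Assumptions.** (A1) $\bar u\in\mathcal D$. (A2) $A$ is continuous on $\overline{\mathcal D}$ (H0). There is a function $h\in C^0(\overline{\mathcal D})\cap C^2(\mathcal D)$, strictly convex and bounded from below, such that $Dh:\mathcal D\to\mathbb R^n$ is bijective and $z^TD^2h(u)A(u)z\ge0$ for all $u\in\mathcal D$, $z\in\mathbb R^n$ (H1). There are $\alpha>0$ and $m_i\in(0,1]$ with $z^TD^2h(u)A(u)z\ge\alpha\sum_i u_i^{2m_i-2}z_i^2$ for all $u\in\mathcal D$, $z\in\mathbb R^n$ (H2). The matrix $M(\bar u)=A(\bar u)(D^2h(\bar u))^{-1}$ is symmetric. **Linearized system.** For $\delta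 u^0\in L^2(0,\bar e_0)^n$ and $\delta e_0\in\mathbb R$, consider $$\partial_t\delta u-A(\bar u)\partial_{xx}\delta u=0\ \ (t>0,\ 0<x<\bar e(t)),\qquad A(\bar u)\partial_x\delta u(t,0)=0,$$ $$A(\bar u)\partial_x\delta u(t,\bar e(t))+\bar v\,\delta u(t,\bar e(t))=\delta\psi(t),\qquad \delta u(0,\cdot)=\delta u^0,\qquad \delta e(t)=\delta e_0+\int_0^t\delta\theta(s)\,ds ,$$ with feedbacks $\delta\psi(t)=H_{nl}(t)\delta u(t)+H_l(t)\delta u(t)$ and $\delta\theta(t)=\Theta(t,\delta e(t))$, where the following properties are required: * (P1) for a.e. $t\ge0$, $H_{nl}(t):L^2(0,\bar e(t))^n\to\mathbb R^n$ is linear and continuous; * (P2) for every $T>0$ there is $C(T)>0$ such that, for every measurable $z$ with $\int_0^T\|z(t)\|^2_{L^2(0,\bar e(t))}dt<\infty$, the function $t\mapsto H_{nl}(t)z(t)$ is in $L^2(0,T)^n$ with norm at most $C(T)\big(\int_0^T\|z(t)\|^2_{L^2(0,\bar e(t))}dt\big)^{1/2}$; * (P3) $H_l(t)z=K_l(t)z(\bar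 e(t))$ for $z\in H^1(0,\bar e(t))^n$, with $K_l\in L^\infty_{loc}((0,\infty);\mathbb R^{n\times n})$; * $\Theta\in L^1_{loc}((0,\infty);C^0(\mathbb R))$. An $L^2$-weak solution $\delta u$ is a function such that $(t,y)\mapsto\delta u(t,\bar e(t)y)$ is in $C^0([0,\infty);L^2(0,1)^n)$, such that $\partial_t\delta u\in L^2(0,\infty;(H^1(0,\bar e(t))^n)')$, and such that for every $T>0$ $$\int_0^T\!\!\int_0^{\bar e(t)}\!\delta u\cdot[\partial_tv+A(\bar u)^T\partial_{xx}v]\,dx\,dt+\int_0^{\bar e_0}\!\delta u^0\cdot v(0,x)\,dx+\int_0^T\! (H_{nl}(t)\delta u(t))\cdot v(t,\bar e(t))\,dt=0$$ for all $v\in L^2(0,T;H^2(0,\bar e(t))^n)\cap C^0([0,T];L^2(0,\bar e(t))^n)$ with $\partial_tv\in L^2(0,T;L^2(0,\bar e(t))^n)$, $v(T,\cdot)=0$ and, for a.e. $t\in(0,T)$, $A(\bar u)^T\partial_xv(t,0)=0$ and $K_l(t)^Tv(t,\bar e(t))=A(\bar u)^T\partial_xv(t,\bar e(t))$. **Definition.**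 $(\bar u,\bar e)$ is $\mu$-exponentially stabilizable in $L^2$ if there are $C_1,C_2>0$ such that: (a) there are $H_{nl},H_l$ with (P1)–(P3) such that for every $\delta u^0\in L^2(0,\bar e_0)^n$ there is a unique $L^2$-weak solution, and it satisfies $\|\delta u(t)\|_{L^2(0,\bar e(t))}\le C_1e^{-\mu t}\|\delta u^0\|_{L^2(0,\bar e_0)}$ for all $t\ge0$; (b) there is $\Theta\in L^1_{loc}((0,\infty);C^0(\mathbb R))$ such that for every $\delta e_0\in\mathbb R$ the equation $\delta e(t)=\delta e_0+\int_0^t\Theta(s,\delta e(s))\,ds$ has a unique solution on $[0,\infty)$, and it satisfies $|\delta e(t)|\le C_2e^{-\mu t}|\delta e_0|$ for all $t\ge0$. **Kernels.** For $\sigma,\lambda>0$ and $\alpha=\lambda/\sigma$, let $k=k_\lambda^\sigma$ be the unique weak solution on $\{0\le y\le x\}$ of $$\partial_{xx}k-\partial_{yy}k=\alpha k,\qquad \partial_yk(x,0)=0,\qquad k(x,x)=-\tfrac{\alpha}{2}x .$$ A weak solution is a function $k$ whose extension $\bar k$ by $-\frac\alpha2x$ to $y>x$ satisfies, for all $L>0$,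 $\bar k\in C^0([0,L];H^1(0,L))$, $\partial_x\bar k\in C^0([0,L];L^2(0,L))$ and $\partial_{xx}\bar k\in C^0([0,L];H^1(0,L)')$ (as functions of $x$ with values in functions of $y$), and, for all $v,w\in H^1(0,L)$, $$-\int_0^L\!\Big(\int_0^x\!\partial_xk\,v\,dy\Big)w'\,dx+w(L)\!\int_0^L\!\partial_xk(L,y)v\,dy+\int_0^L\!\Big(\int_0^x\!\partial_yk\,v'\,dy\Big)w\,dx=\alpha\int_0^L\!\Big(\int_0^x\!k\,v\,dy\Big)w\,dx-\frac\alpha2\int_0^L\!vw\,dx .$$ **Theorem.** Assume (A1)–(A2) and let $\mu>0$. Then $(\bar u,\bar e)$ is $\mu$-exponentially stabilizable in $L^2$. More precisely, $A(\bar u)$ is diagonalizable with positive eigenvalues; and for every invertible $Q$ and $\sigma_1,\dots,\sigma_n$ with $A(\bar u)=Q^{-1}\mathrm{diag}(\sigma_1,\dots,\sigma_n)Q$ there is $\lambda_0>0$ such that for every $\lambda\ge\lambda_0$ the kernels $k_\lambda^{\sigma_i}$ exist and are unique, and the feedbacks $$\Theta(t,w)=-\mu w,\qquad H_{l}(t)u=Q^{-1}\Big(\sigma_i\,k_\lambda^{\sigma_i}(\bar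 e(t),\bar e(t))\,(Qu)_i(\bar e(t))\Big)_{1\le i\le n},$$ $$H_{nl}(t)u=Q^{-1}\Big(\int_0^{\bar e(t)}\big[\sigma_i\partial_xk_\lambda^{\sigma_i}(\bar e(t),y)+\bar v\,k_\lambda^{\sigma_i}(\bar e(t),y)\big](Qu)_i(y)\,dy\Big)_{1\le i\le n}$$ satisfy the conditions of the definition. -/

import Mathlib

open MeasureTheory Set Filter Topology
open scoped ContDiff Matrix

noncomputable section

namespace CrossDiffusion

/-! ## Entropy structure of the diffusion matrix -/

/-- The open simplex `{u ∈ (0,∞)ⁿ : ∑ uᵢ < 1}` of admissible volume fractions. -/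
def simplex (n : ℕ) : Set (Fin n → ℝ) :=
  {u | (∀ i, 0 < u i) ∧ ∑ i, u i < 1}

/-- The derivative `Dh(u)`, as a vector of partial derivatives. -/
def gradVec {n : ℕ} (h : (Fin n → ℝ) → ℝ) (u : Fin n → ℝ) : Fin n → ℝ :=
  fun i => fderiv ℝ h u (Pi.single i 1)

/-- The Hessian matrix `D²h(u)`. -/
def hessian {n : ℕ} (h : (Fin n → ℝ) → ℝ) (u : Fin n → ℝ) : Matrix (Fin n) (Fin n) ℝ :=
  Matrix.of fun i j => fderiv ℝ (fun w => gradVec h w j) u (Pi.single i 1)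

/-- `h` is an entropy density for the diffusion matrix `A`: conditions (H0), (H1), (H2). -/
structure IsEntropyDensity {n : ℕ} (A : (Fin n → ℝ) → Matrix (Fin n) (Fin n) ℝ)
    (h : (Fin n → ℝ) → ℝ) : Prop where
  /-- (H0) -/
  contA : ContinuousOn A (closure (simplex n))
  /-- (H1), regularity and convexity of `h` -/
  contH : ContinuousOn h (closure (simplex n))
  bddBelow : BddBelow (h '' closure (simplex n))
  strictConvex : StrictConvexOn ℝ (closure (simplex n)) h
  contDiff : ContDiffOn ℝ 2 h (simplex n)
  /-- (H1), the derivative is invertible from the simplex onto the whole space -/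
  gradBij : Set.BijOn (gradVec h) (simplex n) Set.univ
  /-- (H1), positive semidefiniteness of the symmetric part of `D²h A` -/
  posSemidef : ∀ u ∈ simplex n, ∀ z : Fin n → ℝ, 0 ≤ z ⬝ᵥ ((hessian h u * A u) *ᵥ z)
  /-- (H2) -/
  coercive : ∃ a : ℝ, 0 < a ∧ ∃ m : Fin n → ℝ, (∀ i, 0 < m i ∧ m i ≤ 1) ∧
    ∀ z : Fin n → ℝ, ∀ u ∈ simplex n,
      a * ∑ i, (u i) ^ (2 * m i - 2) * (z i) ^ 2 ≤ z ⬝ᵥ ((hessian h u * A u) *ᵥ z)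

/-- The mobility matrix `M(u) = A(u) (D²h(u))⁻¹` (under (H2) the Hessian is invertible on the
simplex). -/
def mobility {n : ℕ} (A : (Fin n → ℝ) → Matrix (Fin n) (Fin n) ℝ)
    (h : (Fin n → ℝ) → ℝ) (u : Fin n → ℝ) : Matrix (Fin n) (Fin n) ℝ :=
  A u * (hessian h u)⁻¹

/-! ## Target states -/

/-- A target state: the uniform state generated by constant positive fluxes `φ₀, …, φₙ`,
with initial thickness `e₀ > 0`. -/
structure TargetState (n : ℕ) where
  phi : Fin (n + 1) → ℝ
  phi_pos : ∀ i, 0 < phi i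
  e0 : ℝ
  e0_pos : 0 < e0

namespace TargetState

variable {n : ℕ} (S : TargetState n)

/-- The growth speed `v̄ = ∑ φᵢ`. -/
def speed : ℝ := ∑ i, S.phi i

/-- The uniform volume fractions `ūᵢ = φᵢ / v̄`, `1 ≤ i ≤ n`. -/
def ubar : Fin n → ℝ := fun i => S.phi i.succ / S.speed

/-- The thickness `ē(t) = e₀ + t v̄`. -/
def ebar (t : ℝ) : ℝ := S.e0 + t * S.speed

end TargetState

/-! ## Function spaces

A vector-valued function of `x` is given by its components `z : Fin n → ℝ → ℝ` (`z i x`), a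
vector-valued function of `(t, x)` by `u : Fin n → ℝ → ℝ → ℝ` (`u i t x`). -/

/-- Lebesgue measure on `(0, l)`. -/
def mu (l : ℝ) : Measure ℝ := volume.restrict (Ioo 0 l)

/-- The norm of `L²(0, l)ⁿ`. -/
def normL2 {n : ℕ} (l : ℝ) (z : Fin n → ℝ → ℝ) : ℝ :=
  Real.sqrt (∫ x in (0 : ℝ)..l, ∑ i, (z i x) ^ 2)

/-- `f ∈ H¹(0, l)` with derivative `g ∈ L²(0, l)`. As usual in one dimension, `f` denotes the
absolutely continuous representative on `[0, l]`, so that the boundary values are `f 0`, `f l`. -/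
def IsH1 (l : ℝ) (f g : ℝ → ℝ) : Prop :=
  MemLp g 2 (mu l) ∧ ∀ x ∈ Icc 0 l, f x = f 0 + ∫ y in (0 : ℝ)..x, g y

/-- `f ∈ C⁰(I; L²(0, l))`. -/
def ContL2 (l : ℝ) (I : Set ℝ) (f : ℝ → ℝ → ℝ) : Prop :=
  (∀ t ∈ I, MemLp (f t) 2 (mu l)) ∧
    ∀ t ∈ I, Tendsto (fun s => eLpNorm (fun y => f s y - f t y) 2 (mu l)) (𝓝[I] t) (𝓝 0)

/-- `f ∈ [C⁰(I; L²)]_e`: the function `(t, y) ↦ f(t, e(t) y)` is in `C⁰(I; L²(0, 1))`. -/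
def MovContL2 (e : ℝ → ℝ) (I : Set ℝ) (f : ℝ → ℝ → ℝ) : Prop :=
  ContL2 1 I (fun t y => f t (e t * y))

/-- The moving domain `{(t, x) : 0 < t, 0 < x < e(t)}`. -/
def domain (e : ℝ → ℝ) : Set (ℝ × ℝ) := {p | 0 < p.1 ∧ 0 < p.2 ∧ p.2 < e p.1}

/-- The moving domain `{(t, x) : 0 < t < T, 0 < x < e(t)}`. -/
def domainT (e : ℝ → ℝ) (T : ℝ) : Set (ℝ × ℝ) := {p | p ∈ domain e ∧ p.1 < T}

/-- `f ∈ [L²((0, T), L²)]_e`. -/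
def MovL2 (e : ℝ → ℝ) (T : ℝ) (f : ℝ → ℝ → ℝ) : Prop :=
  MemLp (Function.uncurry f) 2 (volume.restrict (domainT e T))

/-- `g ∈ [L²((0, T), L²)]_e` is the weak time derivative of `f` on the moving domain. -/
def HasWeakTimeDeriv (e : ℝ → ℝ) (T : ℝ) (f g : ℝ → ℝ → ℝ) : Prop :=
  MovL2 e T g ∧
    ∀ φ : ℝ × ℝ → ℝ, ContDiff ℝ ∞ φ → HasCompactSupport φ → tsupport φ ⊆ domainT e T →
      ∫ p in domainT e T, f p.1 p.2 * fderiv ℝ φ p (1, 0) =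
        -∫ p in domainT e T, g p.1 p.2 * φ p

/-- `∂ₜ f ∈ [L²(ℝ₊; (H¹)')]_e`: on smooth `φ` with compact support in `(0,∞) × ℝ`, the functional
`φ ↦ -∫∫ f ∂ₜφ` over the moving domain is given by a square integrable family of elements of the
dual of `H¹(0, e(t))`; by Riesz, such a family is `φ ↦ ∫∫ (f₀ φ + f₁ ∂ₓφ)` with `f₀, f₁` square
integrable over the moving domain. The `φ` need not vanish at `x = 0` and `x = e(t)`, as required
for the dual of `H¹`; a boundary term at `x = e(t)` is itself of this form. -/
def TimeDerivInDualH1 (e : ℝ → ℝ) (f : ℝ → ℝ → ℝ) : Prop :=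
  ∃ f0 f1 : ℝ → ℝ → ℝ,
    MemLp (Function.uncurry f0) 2 (volume.restrict (domain e)) ∧
    MemLp (Function.uncurry f1) 2 (volume.restrict (domain e)) ∧
    ∀ φ : ℝ × ℝ → ℝ, ContDiff ℝ ∞ φ → HasCompactSupport φ → tsupport φ ⊆ {p | 0 < p.1} →
      -∫ p in domain e, f p.1 p.2 * fderiv ℝ φ p (1, 0) =
        ∫ p in domain e, (f0 p.1 p.2 * φ p + f1 p.1 p.2 * fderiv ℝ φ p (0, 1))

/-! ## Feedback operators

The nonlocal part is a family `Hnl t : L²(0, ē(t))ⁿ → ℝⁿ`; the local part is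
`H_l(t) z = K_l(t) z(ē(t))`, and is represented by its matrix `Kl t`. -/

/-- (P1): for a.e. `t ≥ 0`, `Hnl t` is a continuous linear map `L²(0, e(t))ⁿ → ℝⁿ`. -/
def PropP1 {n : ℕ} (e : ℝ → ℝ) (Hnl : ℝ → (Fin n → ℝ → ℝ) → (Fin n → ℝ)) : Prop :=
  ∀ᵐ t ∂(volume.restrict (Ici (0 : ℝ))),
    (∀ z z' : Fin n → ℝ → ℝ, (∀ i, MemLp (z i) 2 (mu (e t))) → (∀ i, MemLp (z' i) 2 (mu (e t))) →
      Hnl t (z + z') = Hnl t z + Hnl t z') ∧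
    (∀ (c : ℝ) (z : Fin n → ℝ → ℝ), (∀ i, MemLp (z i) 2 (mu (e t))) →
      Hnl t (c • z) = c • Hnl t z) ∧
    ∃ C : ℝ, ∀ z : Fin n → ℝ → ℝ, (∀ i, MemLp (z i) 2 (mu (e t))) →
      ‖Hnl t z‖ ≤ C * normL2 (e t) z

/-- (P2): for every `T`, `z ↦ (t ↦ Hnl t (z t))` is bounded from `[L²((0,T), L²)ⁿ]_e` to
`L²(0, T)ⁿ`. -/
def PropP2 {n : ℕ} (e : ℝ → ℝ) (Hnl : ℝ → (Fin n → ℝ → ℝ) → (Fin n → ℝ)) : Prop :=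
  ∀ T : ℝ, 0 < T → ∃ C : ℝ, 0 < C ∧ ∀ z : Fin n → ℝ → ℝ → ℝ, (∀ i, MovL2 e T (z i)) →
    (∀ i, MemLp (fun t => Hnl t (fun j => z j t) i) 2 (mu T)) ∧
    normL2 T (fun i t => Hnl t (fun j => z j t) i) ≤
      C * Real.sqrt (∫ t in (0 : ℝ)..T, (normL2 (e t) (fun j => z j t)) ^ 2)

/-- (P3): the matrix of the local part is in `L^∞_loc((0, ∞); ℝ^{n × n})`. -/
def PropP3 {n : ℕ} (Kl : ℝ → Matrix (Fin n) (Fin n) ℝ) : Prop :=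
  ∀ i j, AEStronglyMeasurable (fun t => Kl t i j) (volume.restrict (Ioi (0 : ℝ))) ∧
    ∀ a b : ℝ, 0 < a → a < b →
      ∃ C : ℝ, ∀ᵐ t ∂(volume.restrict (Icc a b)), |Kl t i j| ≤ C

/-! ## Weak solutions of the linearized system -/

/-- `v` is a test function on `(0, T)`, with derivatives `vt = ∂ₜv`, `vx = ∂ₓv`, `vxx = ∂ₓₓv`. -/
structure IsTestFunction {n : ℕ} (Abar : Matrix (Fin n) (Fin n) ℝ) (e : ℝ → ℝ)
    (Kl : ℝ → Matrix (Fin n) (Fin n) ℝ) (T : ℝ) (v vt vx vxx : Fin n → ℝ → ℝ → ℝ) : Prop where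
  /-- `v ∈ [L²((0,T); H²)ⁿ]_e` -/
  memL2 : ∀ i, MovL2 e T (v i) ∧ MovL2 e T (vx i) ∧ MovL2 e T (vxx i)
  memH2 : ∀ᵐ t ∂(mu T), ∀ i, IsH1 (e t) (v i t) (vx i t) ∧ IsH1 (e t) (vx i t) (vxx i t)
  /-- `v ∈ [C⁰([0,T]; L²)ⁿ]_e` -/
  cont : ∀ i, MovContL2 e (Icc 0 T) (v i)
  /-- `∂ₜv ∈ [L²((0,T); L²)ⁿ]_e` -/
  timeDeriv : ∀ i, HasWeakTimeDeriv e T (v i) (vt i)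
  /-- `v(T, ·) = 0` -/
  final : ∀ i, ∀ᵐ x ∂(mu (e T)), v i T x = 0
  /-- `Āᵀ ∂ₓv(t, 0) = 0` -/
  bdryZero : ∀ᵐ t ∂(mu T), Abarᵀ *ᵥ (fun i => vx i t 0) = 0
  /-- `K_l(t)ᵀ v(t, e(t)) - Āᵀ ∂ₓv(t, e(t)) = 0` -/
  bdryMoving : ∀ᵐ t ∂(mu T),
    (Kl t)ᵀ *ᵥ (fun i => v i t (e t)) - Abarᵀ *ᵥ (fun i => vx i t (e t)) = 0

/-- `u` is an `L²`-weak solution of the linearized system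
`∂ₜu - Ā ∂ₓₓu = 0` on the moving domain, `Ā ∂ₓu(t, 0) = 0`,
`Ā ∂ₓu(t, ē(t)) + v̄ u(t, ē(t)) = Hnl(t) u(t) + Kl(t) u(t, ē(t))`, `u(0, ·) = u0`. -/
structure IsWeakSolution {n : ℕ} (Abar : Matrix (Fin n) (Fin n) ℝ) (S : TargetState n)
    (Hnl : ℝ → (Fin n → ℝ → ℝ) → (Fin n → ℝ)) (Kl : ℝ → Matrix (Fin n) (Fin n) ℝ)
    (u0 : Fin n → ℝ → ℝ) (u : Fin n → ℝ → ℝ → ℝ) : Prop where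
  meas : ∀ i, AEStronglyMeasurable (Function.uncurry (u i)) (volume.restrict (domain S.ebar))
  cont : ∀ i, MovContL2 S.ebar (Ici 0) (u i)
  timeDeriv : ∀ i, TimeDerivInDualH1 S.ebar (u i)
  weak : ∀ T : ℝ, 0 < T → ∀ v vt vx vxx : Fin n → ℝ → ℝ → ℝ,
    IsTestFunction Abar S.ebar Kl T v vt vx vxx →
      (∫ t in (0 : ℝ)..T, ∫ x in (0 : ℝ)..S.ebar t,
          (fun i => u i t x) ⬝ᵥ ((fun i => vt i t x) + Abarᵀ *ᵥ (fun i => vxx i t x)))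
        + (∫ x in (0 : ℝ)..S.e0, (fun i => u0 i x) ⬝ᵥ (fun i => v i 0 x))
        + (∫ t in (0 : ℝ)..T,
            Hnl t (fun i => u i t) ⬝ᵥ (fun i => v i t (S.ebar t))) = 0

/-! ## Exponential stabilization -/

/-- The feedback `(Hnl, Kl)` is admissible and stabilizes the volume fractions at rate `m`, with
constant `C`: for every initial perturbation there is exactly one weak solution, and it decays. -/
def StabilizesFractions {n : ℕ} (Abar : Matrix (Fin n) (Fin n) ℝ) (S : TargetState n) (m C : ℝ)
    (Hnl : ℝ → (Fin n → ℝ → ℝ) → (Fin n → ℝ)) (Kl : ℝ → Matrix (Fin n) (Fin n) ℝ) : Prop :=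
  PropP1 S.ebar Hnl ∧ PropP2 S.ebar Hnl ∧ PropP3 Kl ∧
    ∀ u0 : Fin n → ℝ → ℝ, (∀ i, MemLp (u0 i) 2 (mu S.e0)) →
      ∃ u : Fin n → ℝ → ℝ → ℝ, IsWeakSolution Abar S Hnl Kl u0 u ∧
        (∀ u' : Fin n → ℝ → ℝ → ℝ, IsWeakSolution Abar S Hnl Kl u0 u' →
          ∀ t : ℝ, 0 ≤ t → ∀ i, u' i t =ᵐ[mu (S.ebar t)] u i t) ∧
        ∀ t : ℝ, 0 ≤ t →
          normL2 (S.ebar t) (fun i => u i t) ≤ C * Real.exp (-m * t) * normL2 S.e0 u0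

/-- `Θ ∈ L¹_loc((0, ∞); C⁰(ℝ))`. -/
def IsThicknessFeedback (Θ : ℝ → ℝ → ℝ) : Prop :=
  (∀ᵐ t ∂(volume.restrict (Ioi (0 : ℝ))), Continuous (Θ t)) ∧
  (∀ w, AEStronglyMeasurable (fun t => Θ t w) (volume.restrict (Ioi (0 : ℝ)))) ∧
  ∀ R a b : ℝ, 0 < R → 0 < a → a < b → ∃ g : ℝ → ℝ, IntegrableOn g (Icc a b) ∧
    ∀ᵐ t ∂(volume.restrict (Icc a b)), ∀ w : ℝ, |w| ≤ R → |Θ t w| ≤ g t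

/-- `de` is the thickness perturbation: `δe(t) = ∫₀ᵗ Θ(s, δe(s)) ds + δe₀` for `t ≥ 0`. -/
def IsThickness (Θ : ℝ → ℝ → ℝ) (de0 : ℝ) (de : ℝ → ℝ) : Prop :=
  ∀ t : ℝ, 0 ≤ t → IntervalIntegrable (fun s => Θ s (de s)) volume 0 t ∧
    de t = (∫ s in (0 : ℝ)..t, Θ s (de s)) + de0

/-- The feedback `Θ` is admissible and stabilizes the thickness at rate `m`, with constant `C`. -/
def StabilizesThickness (m C : ℝ) (Θ : ℝ → ℝ → ℝ) : Prop :=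
  IsThicknessFeedback Θ ∧
    ∀ de0 : ℝ, ∃ de : ℝ → ℝ, IsThickness Θ de0 de ∧
      (∀ de' : ℝ → ℝ, IsThickness Θ de0 de' → Set.EqOn de' de (Ici 0)) ∧
      ∀ t : ℝ, 0 ≤ t → |de t| ≤ C * Real.exp (-m * t) * |de0|

/-- The target state is `m`-exponentially stabilizable in `L²`. -/
def ExpStabilizable {n : ℕ} (A : (Fin n → ℝ) → Matrix (Fin n) (Fin n) ℝ) (S : TargetState n)
    (m : ℝ) : Prop :=
  ∃ Cu Ce : ℝ, 0 < Cu ∧ 0 < Ce ∧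
    (∃ (Hnl : ℝ → (Fin n → ℝ → ℝ) → (Fin n → ℝ)) (Kl : ℝ → Matrix (Fin n) (Fin n) ℝ),
      StabilizesFractions (A S.ubar) S m Cu Hnl Kl) ∧
    ∃ Θ : ℝ → ℝ → ℝ, StabilizesThickness m Ce Θ

/-! ## The backstepping kernels -/

/-- The extension of a kernel on the triangle `0 ≤ y ≤ x` by `-α x / 2` to `y > x`. -/
def kbar (α : ℝ) (k : ℝ → ℝ → ℝ) (x y : ℝ) : ℝ := if y ≤ x then k x y else -(α / 2) * x

/-- `k` is a weak solution on `0 < y ≤ x` of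
`∂ₓₓk - ∂_yy k = α k`, `∂_y k(x, 0) = 0`, `k(x, x) = -α x / 2`;
`kx` and `ky` are the weak partial derivatives of the extension `kbar`, hence of `k` for `y < x`. -/
structure IsWeakKernel (α : ℝ) (k kx ky : ℝ → ℝ → ℝ) : Prop where
  /-- `kbar ∈ C⁰([0,L]; H¹(0,L))` -/
  memH1 : ∀ L : ℝ, 0 < L → ∀ x ∈ Icc 0 L, IsH1 L (kbar α k x) (ky x)
  contH1 : ∀ L : ℝ, 0 < L → ContL2 L (Icc 0 L) (kbar α k) ∧ ContL2 L (Icc 0 L) ky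
  /-- `∂ₓ kbar ∈ C⁰([0,L]; L²(0,L))` -/
  derivX : ∀ L : ℝ, 0 < L → ContL2 L (Icc 0 L) kx ∧
    ∀ x ∈ Icc 0 L, Tendsto
      (fun s => eLpNorm (fun y => (kbar α k s y - kbar α k x y) / (s - x) - kx x y) 2 (mu L))
      (𝓝[Icc 0 L \ {x}] x) (𝓝 0)
  /-- `∂ₓₓ kbar ∈ C⁰([0,L]; H¹(0,L)')`, where a continuous family in the dual of `H¹(0,L)` is
  written, by Riesz, as `φ ↦ ∫ (f₀(x) φ + f₁(x) φ')` with `f₀, f₁ ∈ C⁰([0,L]; L²(0,L))` -/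
  derivXX : ∀ L : ℝ, 0 < L → ∃ f0 f1 : ℝ → ℝ → ℝ,
    ContL2 L (Icc 0 L) f0 ∧ ContL2 L (Icc 0 L) f1 ∧
    ∀ φ dφ : ℝ → ℝ, IsH1 L φ dφ → ∀ x ∈ Icc 0 L,
      HasDerivWithinAt (fun s => ∫ y in (0 : ℝ)..L, kx s y * φ y)
        (∫ y in (0 : ℝ)..L, (f0 x y * φ y + f1 x y * dφ y)) (Icc 0 L) x
  /-- the weak formulation -/
  weak : ∀ L : ℝ, 0 < L → ∀ v dv w dw : ℝ → ℝ, IsH1 L v dv → IsH1 L w dw →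
    -(∫ x in (0 : ℝ)..L, (∫ y in (0 : ℝ)..x, kx x y * v y) * dw x)
        + w L * (∫ y in (0 : ℝ)..L, kx L y * v y)
        + (∫ x in (0 : ℝ)..L, (∫ y in (0 : ℝ)..x, ky x y * dv y) * w x)
      = α * (∫ x in (0 : ℝ)..L, (∫ y in (0 : ℝ)..x, k x y * v y) * w x)
        - α / 2 * (∫ x in (0 : ℝ)..L, v x * w x)

/-- `k` (with weak derivatives `kx`, `ky`) is the unique weak solution of the kernel problem. -/
def IsUniqueWeakKernel (α : ℝ) (k kx ky : ℝ → ℝ → ℝ) : Prop :=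
  IsWeakKernel α k kx ky ∧
    ∀ k' kx' ky' : ℝ → ℝ → ℝ, IsWeakKernel α k' kx' ky' →
      ∀ x y : ℝ, 0 ≤ y → y ≤ x → k' x y = k x y

/-- `B = Q⁻¹ diag(σ) Q` with `Q` invertible. -/
def IsDiagonalization {n : ℕ} (B Q : Matrix (Fin n) (Fin n) ℝ) (σ : Fin n → ℝ) : Prop :=
  IsUnit Q.det ∧ B = Q⁻¹ * Matrix.diagonal σ * Q

/-- The nonlocal backstepping feedback: in the coordinates `Q z`, its `i`-th component is
`∫₀^{ē(t)} (σᵢ ∂ₓkᵢ(ē(t), y) + v̄ kᵢ(ē(t), y)) (Q z(y))ᵢ dy`. -/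
def backstepNonlocal {n : ℕ} (S : TargetState n) (Q : Matrix (Fin n) (Fin n) ℝ) (σ : Fin n → ℝ)
    (k kx : Fin n → ℝ → ℝ → ℝ) (t : ℝ) (z : Fin n → ℝ → ℝ) : Fin n → ℝ :=
  Q⁻¹ *ᵥ fun i => ∫ y in (0 : ℝ)..S.ebar t,
    (σ i * kx i (S.ebar t) y + S.speed * k i (S.ebar t) y) * (Q *ᵥ fun j => z j y) i

/-- The matrix of the local backstepping feedback: in the coordinates `Q z`, the `i`-th component
of the feedback is `σᵢ kᵢ(ē(t), ē(t)) (Q z(ē(t)))ᵢ`. -/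
def backstepLocal {n : ℕ} (S : TargetState n) (Q : Matrix (Fin n) (Fin n) ℝ) (σ : Fin n → ℝ)
    (k : Fin n → ℝ → ℝ → ℝ) (t : ℝ) : Matrix (Fin n) (Fin n) ℝ :=
  Q⁻¹ * Matrix.diagonal (fun i => σ i * k i (S.ebar t) (S.ebar t)) * Q

end CrossDiffusion

end

noncomputable section

open Real (exp cos sin smoothTransition exp_pos exp_add norm_eq_abs sqrt_nonneg sq_sqrt exp_le_exp
  exp_nat_mul sqrt_le_sqrt pow_div_factorial_le_exp sin_nat_mul_pi one_le_exp)
open scoped Real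
open Function (uncurry uncurry_def)
open ENNReal (ofReal ofReal_le_ofReal toReal_ofReal ofReal_ne_top ofReal_le_ofReal_iff)
open Finset (sum_congr mul_sum sum_nonneg sum_add_distrib sum_mul single_le_sum sum_comm
  sum_neg_distrib sum_le_sum)
open intervalIntegral (integral_hasDerivAt_right integral_mul_deriv_eq_deriv_mul
  integral_add_adjacent_intervals integral_eq_sub_of_hasDerivAt
  continuous_parametric_intervalIntegral_of_continuous integral_interval_sub_left
  continuousOn_primitive_interval continuous_parametric_primitive_of_continuous integral_comp_neg
  integral_pos)
open intervalIntegral renaming integral_const_mul → int_const_mul, integral_add → int_add,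
  integral_sub → int_sub, integral_mono_on → int_mono_on, integral_congr → int_congr,
  integral_nonneg → int_nonneg, integral_of_le → int_of_le, integral_mul_const → int_mul_const,
  integral_symm → int_symm, integral_zero → int_zero, integral_congr_ae → int_congr_ae,
  integral_finsetSum → int_finsetSum

namespace CrossDiffusion

variable {B C L T a' c e0 h l lam m s t v x y α δ η σ : ℝ}
variable {E a b f f' g r u u' w0 z0 κ : ℝ → ℝ}
variable {G W k w z ν νt νx νxx φ : ℝ → ℝ → ℝ}


lemma cont_ii {f : ℝ → ℝ} {a b : ℝ} (hf : Continuous f := by fun_prop) :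
    IntervalIntegrable f volume a b := hf.intervalIntegrable _ _

lemma uIcc_subset_left (hx : x ∈ Icc 0 l) : uIcc 0 x ⊆ uIcc 0 l :=
  uIcc_subset_uIcc_left (Icc_subset_uIcc hx)

lemma uIcc_subset_right (hx : x ∈ Icc 0 l) : uIcc x l ⊆ uIcc 0 l :=
  uIcc_subset_uIcc_right (Icc_subset_uIcc hx)

lemma int_congr_Icc (hl : 0 ≤ l) (h : ∀ x ∈ Icc 0 l, f x = g x) :
    ∫ x in 0..l, f x = ∫ x in 0..l, g x :=
  int_congr fun x hx => h x (by rwa [uIcc_of_le hl] at hx)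
/-! ## Smooth functions of two variables -/

/-- `f` is a smooth function of its two real variables. -/
def Smooth2 (f : ℝ → ℝ → ℝ) : Prop := ContDiff ℝ ∞ (uncurry f)

/-- The partial derivative in the first variable. -/
def pdt (f : ℝ → ℝ → ℝ) (t x : ℝ) : ℝ := deriv (fun s => f s x) t

/-- The partial derivative in the second variable. -/
def pdx (f : ℝ → ℝ → ℝ) (t x : ℝ) : ℝ := deriv (f t) x

namespace Smooth2

variable {f g : ℝ → ℝ → ℝ}

lemma continuous (hf : Smooth2 f) : Continuous (uncurry f) := ContDiff.continuous hf

lemma differentiable (hf : Smooth2 f) : Differentiable ℝ (uncurry f) :=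
  ContDiff.differentiable hf (by simp)

lemma hasDerivAt_fst_fderiv (hf : Smooth2 f) (t x : ℝ) :
    HasDerivAt (fun s => f s x) (fderiv ℝ (uncurry f) (t, x) (1, 0)) t := by
  have h1 : HasDerivAt (fun s : ℝ => (s, x)) ((1 : ℝ), (0 : ℝ)) t :=
    (hasDerivAt_id t).prodMk (hasDerivAt_const t x)
  exact (hf.differentiable (t, x)).hasFDerivAt.comp_hasDerivAt t h1

lemma hasDerivAt_snd_fderiv (hf : Smooth2 f) (t x : ℝ) :
    HasDerivAt (f t) (fderiv ℝ (uncurry f) (t, x) (0, 1)) x := by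
  have h1 : HasDerivAt (fun s : ℝ => (t, s)) ((0 : ℝ), (1 : ℝ)) x :=
    (hasDerivAt_const x t).prodMk (hasDerivAt_id x)
  exact (hf.differentiable (t, x)).hasFDerivAt.comp_hasDerivAt x h1

lemma pdt_eq_fderiv (hf : Smooth2 f) (t x : ℝ) : pdt f t x = fderiv ℝ (uncurry f) (t, x) (1, 0) :=
  (hf.hasDerivAt_fst_fderiv t x).deriv

lemma pdx_eq_fderiv (hf : Smooth2 f) (t x : ℝ) : pdx f t x = fderiv ℝ (uncurry f) (t, x) (0, 1) :=
  (hf.hasDerivAt_snd_fderiv t x).deriv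

lemma hasDerivAt_pdt (hf : Smooth2 f) (t x : ℝ) :
    HasDerivAt (fun s => f s x) (CrossDiffusion.pdt f t x) t := by
  rw [hf.pdt_eq_fderiv]; exact hf.hasDerivAt_fst_fderiv t x

lemma hasDerivAt_pdx (hf : Smooth2 f) (t x : ℝ) :
    HasDerivAt (f t) (CrossDiffusion.pdx f t x) x := by
  rw [hf.pdx_eq_fderiv]; exact hf.hasDerivAt_snd_fderiv t x

lemma pdt (hf : Smooth2 f) : Smooth2 (pdt f) := by
  have h : uncurry (CrossDiffusion.pdt f) = fun p => fderiv ℝ (uncurry f) p (1, 0) := by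
    ext ⟨t, x⟩; exact hf.pdt_eq_fderiv t x
  unfold Smooth2
  rw [h]
  exact (ContDiff.fderiv_right hf (m := ∞) (by simp)).clm_apply contDiff_const

lemma pdx (hf : Smooth2 f) : Smooth2 (pdx f) := by
  have h : uncurry (CrossDiffusion.pdx f) = fun p => fderiv ℝ (uncurry f) p (0, 1) := by
    ext ⟨t, x⟩; exact hf.pdx_eq_fderiv t x
  unfold Smooth2
  rw [h]
  exact (ContDiff.fderiv_right hf (m := ∞) (by simp)).clm_apply contDiff_const

lemma pdt_pdx_comm (hf : Smooth2 f) (t x : ℝ) : CrossDiffusion.pdt (CrossDiffusion.pdx f) t x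
      = CrossDiffusion.pdx (CrossDiffusion.pdt f) t x := by
  have hx : uncurry (CrossDiffusion.pdx f) = fun p => fderiv ℝ (uncurry f) p (0, 1) := by
    ext ⟨t, x⟩; exact hf.pdx_eq_fderiv t x
  have ht : uncurry (CrossDiffusion.pdt f) = fun p => fderiv ℝ (uncurry f) p (1, 0) := by
    ext ⟨t, x⟩; exact hf.pdt_eq_fderiv t x
  have hd : DifferentiableAt ℝ (fderiv ℝ (uncurry f)) (t, x) :=
    ((ContDiff.fderiv_right hf (m := ∞) (by simp)).differentiable (by simp)) _
  rw [hf.pdx.pdt_eq_fderiv, hf.pdt.pdx_eq_fderiv, hx, ht,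
    fderiv_clm_apply hd (differentiableAt_const _), fderiv_clm_apply hd (differentiableAt_const _)]
  simp only [fderiv_fun_const, _root_.add_apply, ContinuousLinearMap.comp_apply,
    ContinuousLinearMap.flip_apply, Pi.zero_apply, _root_.zero_apply, map_zero,
    zero_add]
  have hs : IsSymmSndFDerivAt ℝ (uncurry f) (t, x) :=
    (contDiff_infty.1 hf 2).contDiffAt.isSymmSndFDerivAt (by simp)
  exact hs _ _

lemma add (hf : Smooth2 f) (hg : Smooth2 g) : Smooth2 (fun t x => f t x + g t x) :=
  ContDiff.add hf hg

lemma sub (hf : Smooth2 f) (hg : Smooth2 g) : Smooth2 (fun t x => f t x - g t x) :=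
  ContDiff.sub hf hg

lemma mul (hf : Smooth2 f) (hg : Smooth2 g) : Smooth2 (fun t x => f t x * g t x) :=
  ContDiff.mul hf hg

lemma neg (hf : Smooth2 f) : Smooth2 (fun t x => - f t x) := ContDiff.neg hf

lemma const (c : ℝ) : Smooth2 (fun _ _ => c) := contDiff_const

lemma of_fst (ha : ContDiff ℝ ∞ a) : Smooth2 (fun t _ => a t) := ha.comp contDiff_fst

lemma of_snd (ha : ContDiff ℝ ∞ a) : Smooth2 (fun _ x => a x) := ha.comp contDiff_snd

lemma comp_fst (ha : ContDiff ℝ ∞ a) (hf : Smooth2 f) :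
    Smooth2 (fun t x => a (f t x)) := ContDiff.comp ha hf

lemma comp₂ {a b : ℝ → ℝ → ℝ} (hf : Smooth2 f) (ha : Smooth2 a) (hb : Smooth2 b) :
    Smooth2 (fun t x => f (a t x) (b t x)) :=
  ContDiff.comp (g := uncurry f) hf (ContDiff.prodMk (f := uncurry a) ha hb)

lemma comp_curve (hf : Smooth2 f) (ha : ContDiff ℝ ∞ a) (hb : ContDiff ℝ ∞ b) :
    ContDiff ℝ ∞ (fun t => f (a t) (b t)) :=
  ContDiff.comp (g := uncurry f) hf (ContDiff.prodMk ha hb)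

lemma slice (hf : Smooth2 f) (t : ℝ) : ContDiff ℝ ∞ (f t) :=
  hf.comp_curve contDiff_const contDiff_id

lemma sum {ι : Type*} (s : Finset ι) {F : ι → ℝ → ℝ → ℝ} (hF : ∀ i ∈ s, Smooth2 (F i)) :
    Smooth2 (fun t x => ∑ i ∈ s, F i t x) := by
  have : ContDiff ℝ ∞ (fun p : ℝ × ℝ => ∑ i ∈ s, F i p.1 p.2) := ContDiff.sum fun i hi => hF i hi
  exact this

end Smooth2

/-! ## Integrals depending on parameters -/

lemma hasFDerivAt_integral_of_continuous {E G : Type} [NormedAddCommGroup E] [NormedSpace ℝ E]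
    [ProperSpace E] [NormedAddCommGroup G] [NormedSpace ℝ G] {F : E → ℝ → G}
    {F' : E → ℝ → E →L[ℝ] G} (hF : Continuous (uncurry F))
    (hF' : Continuous (uncurry F')) (hd : ∀ p y, HasFDerivAt (fun q => F q y) (F' p y) p)
    (a b : ℝ) (p : E) :
    HasFDerivAt (fun q => ∫ y in a..b, F q y) (∫ y in a..b, F' p y) p := by
  obtain ⟨C, hC⟩ := ((isCompact_closedBall p 1).prod (isCompact_uIcc (a := a) (b := b))).bddAbove_image
    hF'.norm.continuousOn
  refine intervalIntegral.hasFDerivAt_integral_of_dominated_of_fderiv_le (F' := F')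
    (bound := fun _ => C) (s := Metric.closedBall p 1)
    (Metric.closedBall_mem_nhds p one_pos) ?_ ?_ ?_ ?_ ?_ ?_
  · exact .of_forall fun q =>
      (hF.comp (Continuous.prodMk continuous_const continuous_id)).aestronglyMeasurable
  · exact (hF.comp (Continuous.prodMk continuous_const continuous_id)).intervalIntegrable _ _
  · exact (hF'.comp (Continuous.prodMk continuous_const continuous_id)).aestronglyMeasurable
  · refine .of_forall fun y hy q hq => ?_
    exact hC ⟨(q, y), ⟨hq, uIoc_subset_uIcc hy⟩, rfl⟩
  · exact intervalIntegrable_const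
  · exact .of_forall fun y _ q _ => hd q y

lemma hasFDerivAt_primitive {E G : Type} [NormedAddCommGroup E] [NormedSpace ℝ E]
    [ProperSpace E] [NormedAddCommGroup G] [NormedSpace ℝ G] [CompleteSpace G] {F : E → ℝ → G}
    {F' : E → ℝ → E →L[ℝ] G} (hF : Continuous (uncurry F))
    (hF' : Continuous (uncurry F')) (hd : ∀ p y, HasFDerivAt (fun q => F q y) (F' p y) p)
    (c : ℝ) (p : E × ℝ) :
    HasFDerivAt (fun q : E × ℝ => ∫ y in c..q.2, F q.1 y) ((∫ y in c..p.2, F' p.1 y).coprod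
        (ContinuousLinearMap.toSpanSingleton ℝ (F p.1 p.2))) p := by
  have h := hasStrictFDerivAt_uncurry_coprod (𝕜 := ℝ) (u := p)
    (f := fun (q : E) (a : ℝ) => ∫ y in c..a, F q y)
    (f₁ := fun q a => ∫ y in c..a, F' q y)
    (f₂ := fun q a => ContinuousLinearMap.toSpanSingleton ℝ (F q a)) ?_ ?_ ?_ ?_
  · exact h.hasFDerivAt
  · exact .of_forall fun v => hasFDerivAt_integral_of_continuous hF hF' hd c v.2 v.1
  · refine .of_forall fun v => ?_
    have hc : Continuous (F v.1) := hF.comp (Continuous.prodMk continuous_const continuous_id)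
    exact (integral_hasDerivAt_right (hc.intervalIntegrable _ _)
      (hc.stronglyMeasurableAtFilter _ _) hc.continuousAt).hasFDerivAt
  · exact (continuous_parametric_primitive_of_continuous hF').continuousAt
  · refine Continuous.continuousAt ?_
    exact (ContinuousLinearMap.toSpanSingletonCLE (𝕜 := ℝ) (E := G)).continuous.comp hF

lemma contDiff_primitive {E : Type} [NormedAddCommGroup E] [NormedSpace ℝ E]
    [ProperSpace E] (c : ℝ) (n : ℕ) : ∀ {G : Type} [NormedAddCommGroup G] [NormedSpace ℝ G]
    [CompleteSpace G] {F : E → ℝ → G}, ContDiff ℝ ∞ (uncurry F) →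
    ContDiff ℝ n (fun q : E × ℝ => ∫ y in c..q.2, F q.1 y) := by
  induction n with
  | zero =>
    intro G _ _ _ F hF
    exact contDiff_zero.2 (continuous_parametric_primitive_of_continuous hF.continuous)
  | succ n ih =>
    intro G _ _ _ F hF
    set F' : E → ℝ → E →L[ℝ] G := fun p y =>
      (fderiv ℝ (uncurry F) (p, y)).comp (ContinuousLinearMap.inl ℝ E ℝ) with hF'
    have hF's : ContDiff ℝ ∞ (uncurry F') :=
      (hF.fderiv_right (m := ∞) (by simp)).clm_comp contDiff_const
    have hd : ∀ p y, HasFDerivAt (fun q => F q y) (F' p y) p := fun p y => by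
      have h1 : HasFDerivAt (fun q : E => (q, y)) (ContinuousLinearMap.inl ℝ E ℝ) p :=
        hasFDerivAt_prodMk_left p y
      exact ((hF.differentiable (by simp)) (p, y)).hasFDerivAt.comp p h1
    refine contDiff_succ_iff_hasFDerivAt.2 ⟨_, ?_, fun p =>
      hasFDerivAt_primitive hF.continuous hF's.continuous hd c p⟩
    have h1 := ih hF's
    have h2 : ContDiff ℝ n (fun p : E × ℝ => ContinuousLinearMap.toSpanSingleton ℝ (F p.1 p.2)) :=
      ((ContinuousLinearMap.toSpanSingletonCLE (𝕜 := ℝ) (E := G)).contDiff.comp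
        hF).of_le (by exact_mod_cast le_top)
    have h3 : ∀ p : E × ℝ, (∫ y in c..p.2, F' p.1 y).coprod
        (ContinuousLinearMap.toSpanSingleton ℝ (F p.1 p.2))
        = (∫ y in c..p.2, F' p.1 y).comp (ContinuousLinearMap.fst ℝ E ℝ)
          + (ContinuousLinearMap.toSpanSingleton ℝ (F p.1 p.2)).comp
            (ContinuousLinearMap.snd ℝ E ℝ) := fun p => by
      ext <;> simp
    simp only [h3]
    exact (h1.clm_comp contDiff_const).add (h2.clm_comp contDiff_const)

/-- The integral of a smooth function of `(t, x, y)` over `y` between `c` and a smooth bound. -/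
lemma smooth2_integral {F : ℝ × ℝ → ℝ → ℝ} (hF : ContDiff ℝ ∞ (uncurry F))
    {a : ℝ → ℝ → ℝ} (ha : Smooth2 a) (c : ℝ) :
    Smooth2 (fun t x => ∫ y in c..a t x, F (t, x) y) := by
  refine contDiff_infty.2 fun n => ?_
  have h := contDiff_primitive c n hF
  have h2 : ContDiff ℝ n (fun p : ℝ × ℝ => (p, a p.1 p.2)) :=
    contDiff_id.prodMk (ContDiff.of_le (n := ∞) ha (by exact_mod_cast le_top))
  exact h.comp h2

/-- Leibniz' rule for an integral with variable upper limit. -/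
lemma hasDerivAt_leibniz {G' : ℝ → ℝ → ℝ} (hG : Continuous (uncurry G))
    (hG' : Continuous (uncurry G'))
    (hd : ∀ s y, HasDerivAt (fun s => G s y) (G' s y) s) (c : ℝ)
    (ha : HasDerivAt a a' x) :
    HasDerivAt (fun s => ∫ y in c..a s, G s y) (a' * G x (a x) + ∫ y in c..a x, G' x y) x := by
  have hc : Continuous (uncurry fun s y =>
      ContinuousLinearMap.toSpanSingleton ℝ (G' s y)) :=
    (ContinuousLinearMap.toSpanSingletonCLE (𝕜 := ℝ) (E := ℝ)).continuous.comp hG'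
  have h := hasFDerivAt_primitive hG hc (fun p y => (hd p y).hasFDerivAt) c (x, a x)
  have h2 : HasDerivAt (fun s => (s, a s)) ((1 : ℝ), a') x := (hasDerivAt_id x).prodMk ha
  have h3 := h.comp_hasDerivAt x h2
  refine h3.congr_deriv ?_
  have hi : IntervalIntegrable (fun y => ContinuousLinearMap.toSpanSingleton ℝ (G' x y)) volume
      c (a x) := (hc.comp (Continuous.prodMk continuous_const continuous_id)).intervalIntegrable _ _
  simp only [ContinuousLinearMap.coprod_apply]
  rw [ContinuousLinearMap.intervalIntegral_apply hi]
  simp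
  ring

lemma Smooth2.hasDerivAt_integral (hG : Smooth2 G) (c : ℝ) (ha : HasDerivAt a a' x) :
    HasDerivAt (fun s => ∫ y in c..a s, G s y)
      (a' * G x (a x) + ∫ y in c..a x, CrossDiffusion.pdt G x y) x :=
  hasDerivAt_leibniz hG.continuous hG.pdt.continuous hG.hasDerivAt_pdt c ha

/-- A primitive of a smooth function is smooth. -/
lemma contDiff_integral (hf : ContDiff ℝ ∞ f) (c : ℝ) :
    ContDiff ℝ ∞ (fun t => ∫ y in c..t, f y) := by
  have h := smooth2_integral (F := fun _ y => f y) (a := fun t _ => t)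
    (hf.comp contDiff_snd) contDiff_fst c
  exact h.comp_curve contDiff_id (contDiff_const (c := 0))

/-! ## Cosine approximation -/

lemma cos_mul_mem_span (hf : f ∈ Submodule.span ℝ (range fun (j : ℕ) (θ : ℝ) => cos (j * θ))) :
    (fun θ => cos θ * f θ) ∈ Submodule.span ℝ (range fun (j : ℕ) (θ : ℝ) => cos (j * θ)) := by
  induction hf using Submodule.span_induction with
  | mem x hx =>
    obtain ⟨j, rfl⟩ := hx
    rcases j with _ | j
    · refine Submodule.subset_span ⟨1, ?_⟩
      ext θ; simp
    · have : (fun θ => cos θ * cos ((j + 1 : ℕ) * θ))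
          = (1 / 2 : ℝ) • ((fun θ => cos ((j + 2 : ℕ) * θ)) + fun θ => cos (j * θ)) := by
        ext θ
        simp only [Pi.smul_apply, Pi.add_apply, smul_eq_mul]
        have h1 : ((j + 2 : ℕ) : ℝ) * θ = (j + 1 : ℕ) * θ + θ := by push_cast; ring
        have h2 : ((j : ℕ) : ℝ) * θ = (j + 1 : ℕ) * θ - θ := by push_cast; ring
        rw [h1, h2, Real.cos_add, Real.cos_sub]; ring
      rw [this]
      exact Submodule.smul_mem _ _ (Submodule.add_mem _ (Submodule.subset_span ⟨j + 2, rfl⟩)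
        (Submodule.subset_span ⟨j, rfl⟩))
  | zero => convert! Submodule.zero_mem _ using 1; ext; simp
  | add x y _ _ hx hy => convert! Submodule.add_mem _ hx hy using 1; ext; simp [mul_add]
  | smul a x _ hx => convert! Submodule.smul_mem _ a hx using 1; ext; simp; ring

lemma polynomial_cos_mem_span (p : Polynomial ℝ) : (fun θ => p.eval (cos θ)) ∈
      Submodule.span ℝ (range fun (j : ℕ) (θ : ℝ) => cos (j * θ)) := by
  have hpow : ∀ m : ℕ, (fun θ => cos θ ^ m) ∈
      Submodule.span ℝ (range fun (j : ℕ) (θ : ℝ) => cos (j * θ)) := by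
    intro m
    induction m with
    | zero => exact Submodule.subset_span ⟨0, by ext; simp⟩
    | succ m ih => convert! cos_mul_mem_span ih using 1; ext; ring
  induction p using Polynomial.induction_on' with
  | add p q hp hq => convert! Submodule.add_mem _ hp hq using 1; ext; simp
  | monomial m a => convert! Submodule.smul_mem _ a (hpow m) using 1; ext; simp

lemma exists_cos_approx (hL : 0 < L) (hg : ContinuousOn g (Icc 0 L)) {ε : ℝ} (hε : 0 < ε) :
    ∃ c : ℕ →₀ ℝ, ∀ y ∈ Icc 0 L,
      |g y - c.sum fun j a => a * cos (j * (π * y / L))| < ε := by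
  have hpi := Real.pi_pos
  have hcont : ContinuousOn (fun s => g (L / π * Real.arccos s)) (Icc (-1) 1) := by
    refine hg.comp (by fun_prop) fun s _ => ⟨by have := Real.arccos_nonneg s; positivity, ?_⟩
    have := Real.arccos_le_pi s
    calc L / π * Real.arccos s ≤ L / π * π := by gcongr
      _ = L := by field_simp
  obtain ⟨p, hp⟩ := exists_polynomial_near_of_continuousOn (-1) 1 _ hcont ε hε
  obtain ⟨c, hc⟩ := Finsupp.mem_span_range_iff_exists_finsupp.1 (polynomial_cos_mem_span p)
  refine ⟨c, fun y hy => ?_⟩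
  have h1 := hp (cos (π * y / L)) ⟨Real.neg_one_le_cos _, Real.cos_le_one _⟩
  have h0 : 0 ≤ π * y / L := by have := hy.1; positivity
  have h2 : π * y / L ≤ π := by
    rw [div_le_iff₀ hL]; exact mul_le_mul_of_nonneg_left hy.2 hpi.le
  rw [Real.arccos_cos h0 h2] at h1
  have h3 : L / π * (π * y / L) = y := by field_simp
  rw [h3] at h1
  have h4 : _ = p.eval (cos (π * y / L)) := congrFun hc (π * y / L)
  rw [← h4, abs_sub_comm] at h1
  convert! h1 using 3
  simp [Finsupp.sum, Finset.sum_apply]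

lemma eq_zero_of_cos (hL : 0 < L) (hf : ContinuousOn f (Icc 0 L))
    (h : ∀ j : ℕ, ∫ y in 0..L, f y * cos (j * (π * y / L)) = 0) :
    ∀ y ∈ Icc 0 L, f y = 0 := by
  have hfi : IntervalIntegrable f volume 0 L := hf.intervalIntegrable_of_Icc hL.le
  have hsq : ∫ y in 0..L, f y ^ 2 = 0 := by
    set I := ∫ y in 0..L, |f y| with hI
    have hI0 : 0 ≤ I := int_nonneg hL.le fun y _ => abs_nonneg _
    have hbound : ∀ ε : ℝ, 0 < ε → ∫ y in 0..L, f y ^ 2 ≤ ε * I := by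
      intro ε hε
      obtain ⟨c, hc⟩ := exists_cos_approx hL hf hε
      set C : ℝ → ℝ := fun y => c.sum fun j a => a * cos (j * (π * y / L)) with hC
      have hCc : Continuous C := by
        simp only [hC, Finsupp.sum]; fun_prop
      have h0 : ∫ y in 0..L, f y * C y = 0 := by
        have : ∀ y, f y * C y = ∑ j ∈ c.support, c j * (f y * cos (j * (π * y / L))) := by
          intro y; simp only [hC, Finsupp.sum, mul_sum]
          exact sum_congr rfl fun j _ => by ring
        simp only [this]
        rw [int_finsetSum]
        · simp [h]
        · intro j _
          exact (hfi.mul_continuousOn (by fun_prop)).const_mul _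
      have h1 : ∫ y in 0..L, f y ^ 2 = ∫ y in 0..L, f y * (f y - C y) := by
        have : ∀ y, f y * (f y - C y) = f y ^ 2 - f y * C y := fun y => by ring
        simp only [this]
        rw [int_sub, h0, sub_zero]
        · exact (hf.pow 2).intervalIntegrable_of_Icc hL.le
        · exact hfi.mul_continuousOn hCc.continuousOn
      rw [h1, hI, ← int_const_mul]
      refine int_mono_on hL.le ?_ (hfi.abs.const_mul _) ?_
      · exact (hf.mul (hf.sub hCc.continuousOn)).intervalIntegrable_of_Icc hL.le
      · intro y hy
        calc f y * (f y - C y) ≤ |f y * (f y - C y)| := le_abs_self _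
          _ = |f y - C y| * |f y| := by rw [abs_mul, mul_comm]
          _ ≤ ε * |f y| := mul_le_mul_of_nonneg_right (hc y hy).le (abs_nonneg _)
    refine le_antisymm ?_ (int_nonneg hL.le fun y _ => sq_nonneg _)
    refine le_of_forall_pos_le_add fun ε hε => ?_
    have h1 := hbound (ε / (I + 1)) (by positivity)
    have h2 : ε / (I + 1) * I ≤ ε := by
      rw [div_mul_eq_mul_div, div_le_iff₀ (by positivity)]; nlinarith
    linarith
  intro y hy
  by_contra hne
  have := integral_pos hL (hf.pow 2) (fun y _ => sq_nonneg _)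
    ⟨y, hy, lt_of_le_of_ne (sq_nonneg _) (Ne.symm (pow_ne_zero 2 hne))⟩
  simp only [Pi.pow_apply] at this
  linarith

lemma eq_zero_of_integral_sin_eq_zero (hL : 0 < L) (hf : ContinuousOn f (Icc 0 L))
    (h : ∀ j : ℕ, ∫ y in 0..L, f y * sin ((j + 1 : ℕ) * (π * y / L)) = 0) :
    ∀ y ∈ Ioo 0 L, f y = 0 := by
  have h' : ∀ j : ℕ, ∫ y in 0..L, f y * sin (j * (π * y / L)) = 0 := by
    rintro (_ | j)
    · simp
    · exact h j
  have hfi : IntervalIntegrable f volume 0 L := hf.intervalIntegrable_of_Icc hL.le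
  have key := eq_zero_of_cos hL
    (f := fun y => f y * sin (π * y / L)) (hf.mul (by fun_prop)) ?_
  · intro y hy
    have h1 := key y ⟨hy.1.le, hy.2.le⟩
    have h2 : 0 < sin (π * y / L) := by
      have := Real.pi_pos
      refine Real.sin_pos_of_pos_of_lt_pi (by have := hy.1; positivity) ?_
      rw [div_lt_iff₀ hL]; exact mul_lt_mul_of_pos_left hy.2 this
    exact (mul_eq_zero.1 h1).resolve_right h2.ne'
  · intro j
    rcases j with _ | j
    · simpa using h' 1
    · have : ∀ y, f y * sin (π * y / L) * cos ((j + 1 : ℕ) * (π * y / L))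
          = 1 / 2 * (f y * sin ((j + 2 : ℕ) * (π * y / L)))
            - 1 / 2 * (f y * sin (j * (π * y / L))) := by
        intro y
        have e1 : ((j + 2 : ℕ) : ℝ) * (π * y / L)
          = (j + 1 : ℕ) * (π * y / L) + π * y / L := by push_cast; ring
        have e2 : (j : ℝ) * (π * y / L)
          = (j + 1 : ℕ) * (π * y / L) - π * y / L := by push_cast; ring
        rw [e1, e2, Real.sin_add, Real.sin_sub]; ring
      simp only [this]
      rw [int_sub, int_const_mul, int_const_mul, h', h']
      · simp
      · exact (hfi.mul_continuousOn (by fun_prop)).const_mul _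
      · exact (hfi.mul_continuousOn (by fun_prop)).const_mul _

/-! ## The Bessel-type series -/

/-- `∑ s ^ m / (m! (m + j)!)`, an entire function related to the modified Bessel function
`I_j` by `I_j(2 √s) = s ^ (j / 2) bessel j s`. -/
def bessel (j : ℕ) (s : ℝ) : ℝ := ∑' m : ℕ, s ^ m / (m.factorial * (m + j).factorial)

lemma bessel_term_le (j m : ℕ) (s : ℝ) :
    ‖s ^ m / (m.factorial * (m + j).factorial : ℝ)‖ ≤ |s| ^ m / m.factorial := by
  rw [norm_div, norm_pow, norm_eq_abs, norm_eq_abs,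
    abs_of_nonneg (by positivity : (0 : ℝ) ≤ m.factorial * (m + j).factorial)]
  have h1 : (1 : ℝ) ≤ (m + j).factorial := by exact_mod_cast Nat.factorial_pos _
  have h2 : (0 : ℝ) < m.factorial := by exact_mod_cast Nat.factorial_pos _
  gcongr
  nlinarith

lemma summable_bessel (j : ℕ) (s : ℝ) :
    Summable fun m : ℕ => s ^ m / (m.factorial * (m + j).factorial : ℝ) :=
  Summable.of_norm_bounded (Real.summable_pow_div_factorial |s|) (bessel_term_le j · s)

lemma bessel_zero_right (j : ℕ) : bessel j 0 = 1 / j.factorial := by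
  unfold bessel
  rw [tsum_eq_single 0 (fun m hm => by simp [hm])]
  simp

lemma hasDerivAt_bessel (j : ℕ) (s : ℝ) :
    HasDerivAt (bessel j) (bessel (j + 1) s) s := by
  set R := |s| + 1 with hR
  have hR0 : 0 ≤ R := by positivity
  set u : ℕ → ℝ := fun m => m * (R ^ (m - 1) / m.factorial) with hu
  have husum : Summable u := by
    rw [← summable_nat_add_iff 1]
    have : ∀ m : ℕ, u (m + 1) = R ^ m / m.factorial := by
      intro m
      simp only [hu, Nat.add_sub_cancel, Nat.factorial_succ]
      push_cast
      field_simp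
    simp only [this]
    exact Real.summable_pow_div_factorial R
  have key := hasDerivAt_tsum_of_isPreconnected (𝕜 := ℝ) (u := u) (t := Metric.ball (0 : ℝ) R)
    (g := fun m s => s ^ m / (m.factorial * (m + j).factorial : ℝ))
    (g' := fun m s => m * s ^ (m - 1) / (m.factorial * (m + j).factorial : ℝ)) (y₀ := 0) (y := s)
    husum Metric.isOpen_ball (convex_ball _ _).isPreconnected ?_ ?_ (by simp [hR]; positivity)
    (summable_bessel j 0) (by simp [hR])
  · refine key.congr_deriv ?_
    unfold bessel
    have hs : Summable fun m : ℕ => (m : ℝ) * s ^ (m - 1) / (m.factorial * (m + j).factorial : ℝ) := by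
      refine (summable_nat_add_iff 1).1 ?_
      have := summable_bessel (j + 1) s
      refine this.congr fun m => ?_
      simp only [Nat.add_sub_cancel, Nat.factorial_succ m]
      rw [show m + 1 + j = m + (j + 1) by ring]
      push_cast
      field_simp
    rw [hs.tsum_eq_zero_add]
    simp only [Nat.cast_zero, zero_mul, zero_div, zero_add]
    refine tsum_congr fun m => ?_
    simp only [Nat.add_sub_cancel, Nat.factorial_succ m]
    rw [show m + 1 + j = m + (j + 1) by ring]
    push_cast
    field_simp
  · intro m y _
    exact (hasDerivAt_pow m y).div_const _
  · intro m y hy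
    have hy' : |y| ≤ R := by
      rw [Metric.mem_ball, dist_zero_right, norm_eq_abs] at hy; exact hy.le
    rw [norm_div, norm_mul, norm_pow, norm_eq_abs, norm_eq_abs, norm_eq_abs,
      abs_of_nonneg (by positivity : (0 : ℝ) ≤ m.factorial * (m + j).factorial), Nat.abs_cast]
    have h1 : (1 : ℝ) ≤ (m + j).factorial := by exact_mod_cast Nat.factorial_pos _
    have h2 : (0 : ℝ) < m.factorial := by exact_mod_cast Nat.factorial_pos _
    simp only [hu]
    rw [mul_div_assoc]
    gcongr
    nlinarith

lemma contDiff_bessel (j : ℕ) : ContDiff ℝ ∞ (bessel j) := by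
  refine contDiff_infty.2 fun n => ?_
  induction n generalizing j with
  | zero => exact contDiff_zero.2 (continuous_iff_continuousAt.2 fun s =>
      (hasDerivAt_bessel j s).continuousAt)
  | succ n ih =>
    have hd : deriv (bessel j) = bessel (j + 1) :=
      funext fun s => (hasDerivAt_bessel j s).deriv
    push_cast
    refine contDiff_succ_iff_deriv.2
      ⟨fun s => (hasDerivAt_bessel j s).differentiableAt, by simp, ?_⟩
    rw [hd]; exact ih (j + 1)

lemma bessel_ode (s : ℝ) :
    s * bessel 3 s + 2 * bessel 2 s = bessel 1 s := by
  unfold bessel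
  have h2 := summable_bessel 2 s
  have h3 := summable_bessel 3 s
  have hs : Summable fun m : ℕ => (m : ℝ) * s ^ m / (m.factorial * (m + 2).factorial : ℝ) := by
    refine (summable_nat_add_iff 1).1 ((h3.mul_left s).congr fun m => ?_)
    rw [Nat.factorial_succ m, show m + 1 + 2 = m + 3 by ring, pow_succ]
    push_cast
    field_simp
  have e : s * ∑' m : ℕ, s ^ m / (m.factorial * (m + 3).factorial : ℝ)
      = ∑' m : ℕ, (m : ℝ) * s ^ m / (m.factorial * (m + 2).factorial : ℝ) := by
    rw [hs.tsum_eq_zero_add, ← tsum_mul_left]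
    simp only [Nat.cast_zero, zero_mul, zero_div, zero_add]
    refine tsum_congr fun m => ?_
    rw [Nat.factorial_succ m, show m + 1 + 2 = m + 3 by ring, pow_succ]
    push_cast
    field_simp
  rw [e, ← tsum_mul_left, ← hs.tsum_add (h2.mul_left 2)]
  refine tsum_congr fun m => ?_
  rw [show m + 2 = (m + 1) + 1 by ring, Nat.factorial_succ (m + 1)]
  have h0 : ((m.factorial : ℕ) : ℝ) ≠ 0 := by exact_mod_cast (Nat.factorial_pos _).ne'
  have h1 : (((m + 1).factorial : ℕ) : ℝ) ≠ 0 := by exact_mod_cast (Nat.factorial_pos _).ne'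
  push_cast
  field_simp
  ring

lemma abs_bessel_le (j : ℕ) (s : ℝ) :
    |bessel j s| ≤ exp (2 * √|s|) := by
  set r := √|s| with hr
  have hr0 : 0 ≤ r := sqrt_nonneg _
  have hexp : HasSum (fun m : ℕ => r ^ m / m.factorial) (exp r) := by
    rw [Real.exp_eq_exp_ℝ]; exact NormedSpace.expSeries_div_hasSum_exp r
  have h1 := tsum_of_norm_bounded (hexp.mul_left (exp r)) (f := fun m : ℕ =>
    s ^ m / (m.factorial * (m + j).factorial : ℝ)) fun m => ?_
  · rw [norm_eq_abs] at h1
    refine h1.trans_eq ?_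
    rw [← exp_add]; ring_nf
  · have h2 : r ^ m / m.factorial ≤ exp r := pow_div_factorial_le_exp r hr0 m
    have h3 : (m.factorial : ℝ) ≤ (m + j).factorial := by
      exact_mod_cast Nat.factorial_le (Nat.le_add_right _ _)
    have h4 : (0 : ℝ) < m.factorial := by exact_mod_cast Nat.factorial_pos _
    calc ‖s ^ m / (m.factorial * (m + j).factorial : ℝ)‖
        = (r ^ 2) ^ m / (m.factorial * (m + j).factorial : ℝ) := by
          rw [norm_div, norm_pow, norm_eq_abs, norm_eq_abs,
            abs_of_nonneg (by positivity : (0 : ℝ) ≤ m.factorial * (m + j).factorial), hr,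
            sq_sqrt (abs_nonneg _)]
      _ ≤ (r ^ 2) ^ m / (m.factorial * m.factorial : ℝ) := by gcongr
      _ = (r ^ m / m.factorial) * (r ^ m / m.factorial) := by rw [← pow_mul]; field_simp; ring
      _ ≤ exp r * (r ^ m / m.factorial) := by gcongr

/-! ## The kernel and the Volterra transform -/

/-- The backstepping kernel `-(α / 2) x Φ(α (x² - y²) / 4)`. -/
def kern (α x y : ℝ) : ℝ := -(α / 2) * x * bessel 1 (α * (x ^ 2 - y ^ 2) / 4)

lemma contDiff_kern (α : ℝ) : ContDiff ℝ ∞ (fun p : ℝ × ℝ => kern α p.1 p.2) := by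
  unfold kern
  refine ContDiff.mul (by fun_prop) ((contDiff_bessel 1).comp (by fun_prop))

lemma smooth2_kern (α : ℝ) : Smooth2 (kern α) := contDiff_kern α

lemma kern_diag (α x : ℝ) : kern α x x = -(α / 2) * x := by
  simp [kern, bessel_zero_right]

lemma kern_zero_left (α y : ℝ) : kern α 0 y = 0 := by simp [kern]

lemma hasDerivAt_kern_fst (α x y : ℝ) :
    HasDerivAt (fun s => kern α s y) (-(α / 2) * (bessel 1 (α * (x ^ 2 - y ^ 2) / 4)
      + x * (α * x / 2) * bessel 2 (α * (x ^ 2 - y ^ 2) / 4))) x := by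
  have h1 : HasDerivAt (fun s : ℝ => α * (s ^ 2 - y ^ 2) / 4) (α * x / 2) x := by
    have := ((((hasDerivAt_pow 2 x).sub_const (y ^ 2)).const_mul α).div_const 4)
    refine this.congr_deriv ?_
    push_cast; ring
  have h2 := (hasDerivAt_bessel 1 _).comp x h1
  have h3 := ((hasDerivAt_id x).const_mul (-(α / 2))).mul h2
  refine h3.congr_deriv ?_
  simp only [Function.comp_apply, id]
  ring

lemma hasDerivAt_kern_snd (α x y : ℝ) :
    HasDerivAt (kern α x) (α ^ 2 / 4 * x * y * bessel 2 (α * (x ^ 2 - y ^ 2) / 4)) y := by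
  have h1 : HasDerivAt (fun s : ℝ => α * (x ^ 2 - s ^ 2) / 4) (-(α * y / 2)) y := by
    have := ((((hasDerivAt_pow 2 y).const_sub (x ^ 2)).const_mul α).div_const 4)
    refine this.congr_deriv ?_
    push_cast; ring
  have h2 := ((hasDerivAt_bessel 1 _).comp y h1).const_mul (-(α / 2) * x)
  refine h2.congr_deriv ?_
  ring

lemma pdt_kern (α x y : ℝ) : pdt (kern α) x y =
    -(α / 2) * (bessel 1 (α * (x ^ 2 - y ^ 2) / 4)
      + x * (α * x / 2) * bessel 2 (α * (x ^ 2 - y ^ 2) / 4)) :=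
  (hasDerivAt_kern_fst α x y).deriv

lemma pdx_kern (α x y : ℝ) : pdx (kern α) x y =
    α ^ 2 / 4 * x * y * bessel 2 (α * (x ^ 2 - y ^ 2) / 4) :=
  (hasDerivAt_kern_snd α x y).deriv

lemma pdx_kern_zero_right (α x : ℝ) : pdx (kern α) x 0 = 0 := by simp [pdx_kern]

lemma pdt_kern_diag (α x : ℝ) : pdt (kern α) x x = -(α / 2) - α ^ 2 * x ^ 2 / 8 := by
  rw [pdt_kern]; simp [bessel_zero_right]; ring

lemma pdx_kern_diag (α x : ℝ) : pdx (kern α) x x = α ^ 2 * x ^ 2 / 8 := by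
  rw [pdx_kern]; simp [bessel_zero_right]; ring

lemma kern_wave (α x y : ℝ) :
    pdt (pdt (kern α)) x y - pdx (pdx (kern α)) x y = α * kern α x y := by
  have h1 : HasDerivAt (fun s : ℝ => α * (s ^ 2 - y ^ 2) / 4) (α * x / 2) x := by
    have := ((((hasDerivAt_pow 2 x).sub_const (y ^ 2)).const_mul α).div_const 4)
    refine this.congr_deriv ?_
    push_cast; ring
  have h2 : HasDerivAt (fun s : ℝ => α * (x ^ 2 - s ^ 2) / 4) (-(α * y / 2)) y := by
    have := ((((hasDerivAt_pow 2 y).const_sub (x ^ 2)).const_mul α).div_const 4)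
    refine this.congr_deriv ?_
    push_cast; ring
  have e1 : pdt (pdt (kern α)) x y = -(α / 2) * x * (3 * α / 2 *
      bessel 2 (α * (x ^ 2 - y ^ 2) / 4)
        + α ^ 2 * x ^ 2 / 4 * bessel 3 (α * (x ^ 2 - y ^ 2) / 4)) := by
    have h3 := (((hasDerivAt_bessel 1 _).comp x h1).add
      (((hasDerivAt_id x).mul ((hasDerivAt_id x).const_mul (α / 2))).mul
        ((hasDerivAt_bessel 2 _).comp x h1))).const_mul (-(α / 2))
    have h4 : pdt (pdt (kern α)) x y = deriv (fun s => pdt (kern α) s y) x := rfl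
    rw [h4]
    have h5 : (fun s => pdt (kern α) s y) = _ := funext fun s => pdt_kern α s y
    rw [h5]
    refine (HasDerivAt.congr_deriv (HasDerivAt.congr_of_eventuallyEq h3 ?_) ?_).deriv
    · refine .of_forall fun s => ?_
      simp only [Function.comp_apply, id, Pi.add_apply, Pi.mul_apply]
      ring
    · simp only [Function.comp_apply, id, Pi.mul_apply]
      ring
  have e2 : pdx (pdx (kern α)) x y = α ^ 2 / 4 * x * (bessel 2 (α * (x ^ 2 - y ^ 2) / 4)
      - α * y ^ 2 / 2 * bessel 3 (α * (x ^ 2 - y ^ 2) / 4)) := by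
    have h3 := ((hasDerivAt_id y).const_mul (α ^ 2 / 4 * x)).mul
      ((hasDerivAt_bessel 2 _).comp y h2)
    have h4 : pdx (pdx (kern α)) x y = deriv (fun s => pdx (kern α) x s) y := rfl
    rw [h4]
    have h5 : (fun s => pdx (kern α) x s) = _ := funext fun s => pdx_kern α x s
    rw [h5]
    refine (HasDerivAt.congr_deriv (HasDerivAt.congr_of_eventuallyEq h3 ?_) ?_).deriv
    · exact .of_forall fun s => rfl
    · simp only [Function.comp_apply, id]
      ring
  rw [e1, e2, kern, ← bessel_ode]
  ring

/-- The Volterra transform `f ↦ f - ∫₀ˣ k(x, y) f(y) dy`. -/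
def volt (α : ℝ) (f : ℝ → ℝ) (x : ℝ) : ℝ := f x - ∫ y in 0..x, kern α x y * f y

lemma volt_zero (α : ℝ) (f : ℝ → ℝ) : volt α f 0 = f 0 := by simp [volt]

lemma continuous_kern_mul (hf : Continuous f) :
    Continuous (uncurry fun x y => kern α x y * f y) :=
  (smooth2_kern α).continuous.mul (hf.comp continuous_snd)

lemma volt_linear (α : ℝ) (hf : Continuous f) (hg : Continuous g) (a b x : ℝ) :
    volt α (fun y => a * f y + b * g y) x = a * volt α f x + b * volt α g x := by
  have hk : Continuous (kern α x) := (smooth2_kern α).slice x |>.continuous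
  have h : ∀ y, kern α x y * (a * f y + b * g y)
      = a * (kern α x y * f y) + b * (kern α x y * g y) := fun y => by ring
  simp only [volt, h]
  rw [int_add, int_const_mul, int_const_mul]
  · ring
  · exact (continuous_const.mul (hk.mul hf)).intervalIntegrable _ _
  · exact (continuous_const.mul (hk.mul hg)).intervalIntegrable _ _

/-- The transform of a smooth function of `(t, x)` in the variable `x`. -/
lemma smooth2_volt (α : ℝ) (hw : Smooth2 w) : Smooth2 (fun t => volt α (w t)) := by
  have h : ContDiff ℝ ∞ (uncurry fun (p : ℝ × ℝ) y => kern α p.2 y * w p.1 y) := by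
    have h1 : ContDiff ℝ ∞ (fun q : (ℝ × ℝ) × ℝ => kern α q.1.2 q.2) :=
      (contDiff_kern α).comp (f := fun q : (ℝ × ℝ) × ℝ => (q.1.2, q.2)) (by fun_prop)
    have h2 : ContDiff ℝ ∞ (fun q : (ℝ × ℝ) × ℝ => w q.1.1 q.2) :=
      ContDiff.comp (g := uncurry w) hw (f := fun q : (ℝ × ℝ) × ℝ => (q.1.1, q.2)) (by fun_prop)
    exact h1.mul h2
  exact hw.sub (smooth2_integral (a := fun _ x => x) h contDiff_snd 0)

lemma contDiff_volt (α : ℝ) (hf : ContDiff ℝ ∞ f) : ContDiff ℝ ∞ (volt α f) :=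
  (smooth2_volt α (Smooth2.of_snd hf)).slice 0

lemma pdt_volt (α : ℝ) (hw : Smooth2 w) (t x : ℝ) :
    pdt (fun t => volt α (w t)) t x = volt α (pdt w t) x := by
  have hk : Smooth2 (fun t y => kern α x y * w t y) :=
    (Smooth2.of_snd ((smooth2_kern α).slice x)).mul hw
  have h1 := hk.hasDerivAt_integral (x := t) 0 (hasDerivAt_const t x)
  refine ((hw.hasDerivAt_pdt t x).sub h1).deriv.trans ?_
  simp only [volt, zero_mul, zero_add]
  congr 1
  refine int_congr fun y _ => ?_
  exact ((hw.hasDerivAt_pdt t y).const_mul _).deriv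

lemma hasDerivAt_volt (α : ℝ) (hf : Continuous f) (hd : HasDerivAt f (f' x) x) :
    HasDerivAt (volt α f) (f' x + α / 2 * x * f x - ∫ y in 0..x, pdt (kern α) x y * f y) x := by
  have h := hasDerivAt_leibniz (G := fun x y => kern α x y * f y)
    (G' := fun x y => pdt (kern α) x y * f y) (continuous_kern_mul hf)
    ((smooth2_kern α).pdt.continuous.mul (hf.comp continuous_snd))
    (fun s y => ((smooth2_kern α).hasDerivAt_pdt s y).mul_const _) 0 (hasDerivAt_id x)
  refine (hd.sub h).congr_deriv ?_
  simp only [id, kern_diag]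
  ring

/-- The transform intertwines `∂ₓₓ + α` and `∂ₓₓ` on functions with vanishing derivative
at the origin. -/
lemma hasDerivAt_deriv_volt (α : ℝ) {f'' : ℝ → ℝ} (hf : ∀ x, HasDerivAt f (f' x) x)
    (hf' : ∀ x, HasDerivAt f' (f'' x) x) (hc : Continuous f'') (h0 : f' 0 = 0) (x : ℝ) :
    HasDerivAt (fun x => f' x + α / 2 * x * f x - ∫ y in 0..x, pdt (kern α) x y * f y)
      (volt α (fun y => f'' y + α * f y) x) x := by
  have cf : Continuous f := continuous_iff_continuousAt.2 fun x => (hf x).continuousAt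
  have cf' : Continuous f' := continuous_iff_continuousAt.2 fun x => (hf' x).continuousAt
  have hk := smooth2_kern α
  have h := hasDerivAt_leibniz (G := fun x y => pdt (kern α) x y * f y)
    (G' := fun x y => pdt (pdt (kern α)) x y * f y) (hk.pdt.continuous.mul (cf.comp continuous_snd))
    (hk.pdt.pdt.continuous.mul (cf.comp continuous_snd))
    (fun s y => (hk.pdt.hasDerivAt_pdt s y).mul_const _) 0 (hasDerivAt_id x)
  have h2 := ((hf' x).add (((hasDerivAt_id x).const_mul (α / 2)).mul (hf x))).sub h
  refine h2.congr_deriv ?_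
  have ck : Continuous (kern α x) := (hk.slice x).continuous
  have ck1 : Continuous (pdx (kern α) x) := (hk.pdx.slice x).continuous
  have ck2 : Continuous (pdx (pdx (kern α)) x) := (hk.pdx.pdx.slice x).continuous
  have ckt : Continuous (pdt (pdt (kern α)) x) := (hk.pdt.pdt.slice x).continuous
  have i1 := integral_mul_deriv_eq_deriv_mul (a := 0) (b := x)
    (u := kern α x) (v := f') (fun y _ => hk.hasDerivAt_pdx x y) (fun y _ => hf' y)
    (ck1.intervalIntegrable _ _) (hc.intervalIntegrable _ _)
  have i2 := integral_mul_deriv_eq_deriv_mul (a := 0) (b := x)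
    (u := pdx (kern α) x) (v := f) (fun y _ => hk.pdx.hasDerivAt_pdx x y) (fun y _ => hf y)
    (ck2.intervalIntegrable _ _) (cf'.intervalIntegrable _ _)
  have i3 : ∫ y in 0..x, kern α x y * (f'' y + α * f y)
      = (∫ y in 0..x, kern α x y * f'' y) + α * ∫ y in 0..x, kern α x y * f y := by
    rw [← int_const_mul, ← int_add]
    · exact int_congr fun y _ => by ring
    · exact (ck.mul hc).intervalIntegrable _ _
    · exact (continuous_const.mul (ck.mul cf)).intervalIntegrable _ _
  have i4 : ∫ y in 0..x, pdt (pdt (kern α)) x y * f y = (∫ y in 0..x, pdx (pdx (kern α)) x y * f y)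
        + α * ∫ y in 0..x, kern α x y * f y := by
    rw [← int_const_mul, ← int_add]
    · refine int_congr fun y _ => ?_
      have := kern_wave α x y
      rw [sub_eq_iff_eq_add] at this
      rw [this]; ring
    · exact (ck2.mul cf).intervalIntegrable _ _
    · exact (continuous_const.mul (ck.mul cf)).intervalIntegrable _ _
  simp only [volt, i3, i1, i2, i4, id, h0, pdx_kern_zero_right, pdt_kern_diag, pdx_kern_diag,
    kern_diag]
  ring

/-! ## The inverse transform -/

lemma triangle_integral_swap (hx : 0 ≤ x) {g : ℝ → ℝ → ℝ}
    (hg : IntegrableOn (uncurry g) (Ioc 0 x ×ˢ Ioc 0 x)) :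
    ∫ ξ in 0..x, ∫ y in 0..ξ, g ξ y = ∫ y in 0..x, ∫ ξ in y..x, g ξ y := by
  set S : Set (ℝ × ℝ) := {p | p.2 ≤ p.1} with hS
  have hSm : MeasurableSet S := measurableSet_le measurable_snd measurable_fst
  have hint : Integrable (uncurry fun ξ y => S.indicator (uncurry g) (ξ, y))
      ((volume.restrict (Ioc 0 x)).prod (volume.restrict (Ioc 0 x))) := by
    rw [Measure.prod_restrict]
    exact Integrable.indicator hg hSm
  have hsw := integral_integral_swap hint
  rw [int_of_le hx, int_of_le hx]
  calc _ = ∫ ξ in Ioc 0 x, ∫ y in Ioc 0 x, S.indicator (uncurry g) (ξ, y) := by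
        refine setIntegral_congr_fun measurableSet_Ioc fun ξ hξ => ?_
        rw [int_of_le hξ.1.le]
        have e : Ioc 0 ξ = Ioc 0 x ∩ Iic ξ := by
          ext y; simp only [mem_Ioc, mem_inter_iff, mem_Iic]
          exact ⟨fun h => ⟨⟨h.1, h.2.trans hξ.2⟩, h.2⟩, fun h => ⟨h.1.1, h.2⟩⟩
        rw [e, ← setIntegral_indicator measurableSet_Iic]
        refine setIntegral_congr_fun measurableSet_Ioc fun y _ => ?_
        by_cases hy : y ≤ ξ <;> simp [indicator, hS, hy]
    _ = ∫ y in Ioc 0 x, ∫ ξ in Ioc 0 x, S.indicator (uncurry g) (ξ, y) := hsw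
    _ = _ := by
        refine setIntegral_congr_fun measurableSet_Ioc fun y hy => ?_
        rw [int_of_le hy.2, ← integral_Icc_eq_integral_Ioc (x := y) (y := x)]
        have e : Icc y x = Ioc 0 x ∩ Ici y := by
          ext ξ; simp only [mem_Ioc, mem_Icc, mem_inter_iff, mem_Ici]
          exact ⟨fun h => ⟨⟨hy.1.trans_le h.1, h.2⟩, h.1⟩, fun h => ⟨h.2, h.1.2⟩⟩
        rw [e, ← setIntegral_indicator measurableSet_Ici]
        refine setIntegral_congr_fun measurableSet_Ioc fun ξ _ => ?_
        by_cases h : y ≤ ξ <;> simp [indicator, hS, h]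

lemma linear_ode_eq_zero {v : ℝ → ℝ} (hu : ∀ x ∈ Icc 0 L, HasDerivWithinAt u (v x) (Icc 0 L) x)
    (hv : ∀ x ∈ Icc 0 L, HasDerivWithinAt v (c * u x) (Icc 0 L) x) (hu0 : u 0 = 0) (hv0 : v 0 = 0) :
    ∀ x ∈ Icc 0 L, u x = 0 := by
  have h := eq_zero_of_abs_deriv_le_mul_abs_self_of_eq_zero_right
    (f := fun x => (u x, v x)) (f' := fun x => (v x, c * u x)) (K := max 1 |c|) (a := 0) (b := L)
    (fun x hx => (hu x hx).continuousWithinAt.prodMk (hv x hx).continuousWithinAt)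
    (fun x hx => ?_) (by simp [hu0, hv0]) (fun x _ => ?_)
  · intro x hx
    exact (Prod.ext_iff.1 (h x hx)).1
  · have hx' : x ∈ Icc 0 L := ⟨hx.1, hx.2.le⟩
    have h1 : HasDerivWithinAt (fun x => (u x, v x)) (v x, c * u x) (Icc 0 L) x :=
      (hu x hx').prodMk (hv x hx')
    have h2 : Icc x L ⊆ Icc 0 L := Icc_subset_Icc_left hx.1
    exact (h1.mono h2).mono_of_mem_nhdsWithin (Icc_mem_nhdsGE hx.2)
  · rw [Prod.norm_mk, Prod.norm_mk, norm_eq_abs, norm_eq_abs, norm_eq_abs, abs_mul]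
    refine max_le ?_ ?_
    · calc |v x| ≤ 1 * max |u x| |v x| := by rw [one_mul]; exact le_max_right _ _
        _ ≤ _ := by gcongr; exact le_max_left _ _
    · gcongr
      · exact le_max_right _ _
      · exact le_max_left _ _

lemma volt_neg_volt_cos (α ν x : ℝ) (hx : 0 ≤ x) :
    volt (-α) (volt α fun y => cos (ν * y)) x = cos (ν * x) := by
  set f : ℝ → ℝ := fun y => cos (ν * y) with hf
  set f' : ℝ → ℝ := fun y => -(ν * sin (ν * y)) with hf'
  have d1 : ∀ x, HasDerivAt f (f' x) x := fun x => by
    have := ((hasDerivAt_id x).const_mul ν).cos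
    refine this.congr_deriv ?_
    simp [hf']; ring
  have d2 : ∀ x, HasDerivAt f' (-(ν ^ 2) * f x) x := fun x => by
    have := (((hasDerivAt_id x).const_mul ν).sin.const_mul ν).neg
    refine this.congr_deriv ?_
    simp [hf]; ring
  have cf : Continuous f := by fun_prop
  set g := volt α f with hg
  have cg : Continuous g := (contDiff_volt α (by fun_prop)).continuous
  set g' : ℝ → ℝ := fun x => f' x + α / 2 * x * f x - ∫ y in 0..x, pdt (kern α) x y * f y with hg'
  have d3 : ∀ x, HasDerivAt g (g' x) x := fun x => hasDerivAt_volt α cf (d1 x)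
  have d4 : ∀ x, HasDerivAt g' ((α - ν ^ 2) * g x) x := fun x => by
    refine (hasDerivAt_deriv_volt α d1 d2 (by fun_prop) (by simp [hf']) x).congr_deriv ?_
    have := volt_linear α cf cf (α - ν ^ 2) 0 x
    rw [← hg, zero_mul, add_zero] at this
    rw [← this]
    congr 1; ext y; ring
  have hg0 : g' 0 = 0 := by simp [hg', hf']
  set h := volt (-α) g with hh
  set h' : ℝ → ℝ := fun x => g' x + (-α) / 2 * x * g x
    - ∫ y in 0..x, pdt (kern (-α)) x y * g y with hh'
  have d5 : ∀ x, HasDerivAt h (h' x) x := fun x => hasDerivAt_volt (-α) cg (d3 x)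
  have d6 : ∀ x, HasDerivAt h' (-(ν ^ 2) * h x) x := fun x => by
    refine (hasDerivAt_deriv_volt (-α) d3 d4 (by fun_prop) hg0 x).congr_deriv ?_
    have := volt_linear (-α) cg cg (-(ν ^ 2)) 0 x
    rw [← hh, zero_mul, add_zero] at this
    rw [← this]
    congr 1; ext y; ring
  have hu := linear_ode_eq_zero (u := fun x => h x - f x) (v := fun x => h' x - f' x)
    (c := -(ν ^ 2)) (L := x) (fun x _ => ((d5 x).sub (d1 x)).hasDerivWithinAt)
    (fun x _ => (((d6 x).sub (d2 x)).congr_deriv (by ring)).hasDerivWithinAt)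
    (by simp [hh, hg, volt_zero]) (by simp [hh', hg0, hf']) x ⟨hx, le_rfl⟩
  exact sub_eq_zero.1 hu

lemma integrableOn_kern_mul_kern (α β x : ℝ) (hf : IntervalIntegrable f volume 0 x)
    (hx : 0 ≤ x) : IntegrableOn (uncurry fun ξ y => kern α x ξ * (kern β ξ y * f y))
      (Ioc 0 x ×ˢ Ioc 0 x) := by
  have h1 : Integrable (fun p : ℝ × ℝ => f p.2)
      ((volume.restrict (Ioc 0 x)).prod (volume.restrict (Ioc 0 x))) :=
    ((intervalIntegrable_iff_integrableOn_Ioc_of_le hx).1 hf).comp_snd _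
  rw [Measure.prod_restrict] at h1
  have hc : Continuous (fun p : ℝ × ℝ => kern α x p.1 * kern β p.1 p.2) :=
    (((smooth2_kern α).slice x).continuous.comp continuous_fst).mul (smooth2_kern β).continuous
  obtain ⟨C, hC⟩ := ((isCompact_Icc (a := (0 : ℝ)) (b := x)).prod
    (isCompact_Icc (a := (0 : ℝ)) (b := x))).bddAbove_image hc.norm.continuousOn
  have h2 := Integrable.bdd_mul (c := C) h1 hc.aestronglyMeasurable ?_
  · refine h2.congr (.of_forall fun p => ?_)
    simp only [uncurry]; ring
  · refine (ae_restrict_iff' (measurableSet_Ioc.prod measurableSet_Ioc)).2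
      (.of_forall fun p hp => ?_)
    exact hC ⟨p, ⟨Ioc_subset_Icc_self hp.1, Ioc_subset_Icc_self hp.2⟩, rfl⟩

lemma volt_volt_eq (α β : ℝ) (hx : 0 ≤ x) (hf : IntervalIntegrable f volume 0 x) :
    volt β (volt α f) x = f x - ∫ y in 0..x,
      (kern α x y + kern β x y - ∫ ξ in y..x, kern β x ξ * kern α ξ y) * f y := by
  have hk : ∀ a, Continuous (kern a x) := fun a => ((smooth2_kern a).slice x).continuous
  have hi := integrableOn_kern_mul_kern β α x hf hx
  have sw := triangle_integral_swap hx hi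
  have e1 : ∫ ξ in 0..x, kern β x ξ * volt α f ξ = (∫ ξ in 0..x, kern β x ξ * f ξ)
        - ∫ ξ in 0..x, ∫ y in 0..ξ, kern β x ξ * (kern α ξ y * f y) := by
    rw [← int_sub]
    · refine int_congr fun ξ _ => ?_
      simp only [volt, int_const_mul]; ring
    · exact hf.continuousOn_mul (hk β).continuousOn
    · rw [intervalIntegrable_iff_integrableOn_Ioc_of_le hx]
      set S : Set (ℝ × ℝ) := {p | p.2 ≤ p.1} with hS
      have hSm : MeasurableSet S := measurableSet_le measurable_snd measurable_fst
      have hint := Integrable.indicator hi hSm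
      rw [Measure.volume_eq_prod, ← Measure.prod_restrict] at hint
      refine hint.integral_prod_left.congr ?_
      refine ae_restrict_of_forall_mem measurableSet_Ioc (fun ξ hξ => ?_)
      beta_reduce
      rw [int_of_le hξ.1.le]
      have e : Ioc 0 ξ = Ioc 0 x ∩ Iic ξ := by
        ext y; simp only [mem_Ioc, mem_inter_iff, mem_Iic]
        exact ⟨fun h => ⟨⟨h.1, h.2.trans hξ.2⟩, h.2⟩, fun h => ⟨h.1.1, h.2⟩⟩
      rw [e, ← setIntegral_indicator measurableSet_Iic]
      refine setIntegral_congr_fun measurableSet_Ioc fun y _ => ?_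
      by_cases hy : y ≤ ξ <;> simp [indicator, hS, hy]
  have e2 : ∫ y in 0..x, ∫ ξ in y..x, kern β x ξ * (kern α ξ y * f y)
      = ∫ y in 0..x, (∫ ξ in y..x, kern β x ξ * kern α ξ y) * f y := by
    refine int_congr fun y _ => ?_
    simp only [← int_mul_const]
    exact int_congr fun ξ _ => by ring
  have hJ : Continuous fun y => ∫ ξ in y..x, kern β x ξ * kern α ξ y := by
    have : (fun y => ∫ ξ in y..x, kern β x ξ * kern α ξ y)
        = fun y => -∫ ξ in x..y, kern β x ξ * kern α ξ y := by
      ext y; rw [int_symm]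
    rw [this]
    refine (continuous_parametric_intervalIntegral_of_continuous ?_ continuous_id).neg
    exact ((hk β).comp continuous_snd).mul ((smooth2_kern α).continuous.comp continuous_swap)
  have e3 : ∀ y, (kern α x y + kern β x y - ∫ ξ in y..x, kern β x ξ * kern α ξ y) * f y
      = kern α x y * f y + kern β x y * f y
        - (∫ ξ in y..x, kern β x ξ * kern α ξ y) * f y := fun y => by ring
  have iα := hf.continuousOn_mul (hk α).continuousOn
  have iβ := hf.continuousOn_mul (hk β).continuousOn
  have iJ := hf.continuousOn_mul hJ.continuousOn
  simp only [e3]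
  rw [int_sub (iα.add iβ) iJ, int_add iα iβ, ← e2, ← sw]
  conv_lhs => rw [volt, e1]
  rw [volt]
  ring

/-- The kernels with opposite parameters are resolvent kernels of each other. -/
lemma kern_resolvent (α : ℝ) (hy : y ∈ Icc 0 x) :
    kern α x y + kern (-α) x y - ∫ ξ in y..x, kern (-α) x ξ * kern α ξ y = 0 := by
  rcases (hy.1.trans hy.2).eq_or_lt with h0 | hx
  · subst h0
    have : y = 0 := le_antisymm hy.2 hy.1
    subst this
    simp [kern_zero_left]
  have hk : ∀ a, Continuous (kern a x) := fun a => ((smooth2_kern a).slice x).continuous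
  have hJ : Continuous fun y => ∫ ξ in y..x, kern (-α) x ξ * kern α ξ y := by
    have : (fun y => ∫ ξ in y..x, kern (-α) x ξ * kern α ξ y)
        = fun y => -∫ ξ in x..y, kern (-α) x ξ * kern α ξ y := by
      ext y; rw [int_symm]
    rw [this]
    refine (continuous_parametric_intervalIntegral_of_continuous ?_ continuous_id).neg
    exact ((hk _).comp continuous_snd).mul ((smooth2_kern α).continuous.comp continuous_swap)
  refine eq_zero_of_cos hx (f := fun y => kern α x y + kern (-α) x y
    - ∫ ξ in y..x, kern (-α) x ξ * kern α ξ y)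
    (((hk α).add (hk _)).sub hJ).continuousOn (fun j => ?_) y hy
  have h1 := volt_volt_eq α (-α) hx.le (f := fun y => cos (j * π / x * y))
    cont_ii
  rw [volt_neg_volt_cos α _ x hx.le] at h1
  have h2 : ∀ y, (j : ℝ) * (π * y / x) = j * π / x * y := fun y => by ring
  simp only [h2]
  linarith

lemma volt_neg_volt (α : ℝ) (hx : 0 ≤ x)
    (hf : IntervalIntegrable f volume 0 x) : volt (-α) (volt α f) x = f x := by
  rw [volt_volt_eq α (-α) hx hf, sub_eq_self]
  rw [int_congr (g := fun _ => 0)]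
  · simp
  · intro y hy
    rw [uIcc_of_le hx] at hy
    simp only [kern_resolvent α hy, zero_mul]

/-! ## Square integrable functions -/

section SquareIntegrable

variable {X : Type*} [MeasurableSpace X] {μ : Measure X} {f g : X → ℝ}

lemma eLpNorm_two_eq (hf : MemLp f 2 μ) : eLpNorm f 2 μ = ofReal (√(∫ x, f x ^ 2 ∂μ)) := by
  rw [hf.eLpNorm_eq_integral_rpow_norm (by norm_num) (by norm_num), Real.sqrt_eq_rpow]
  simp

lemma integral_mul_sq_le (hf : MemLp f 2 μ) (hg : MemLp g 2 μ) :
    |∫ x, f x * g x ∂μ| ≤ √(∫ x, f x ^ 2 ∂μ) * √(∫ x, g x ^ 2 ∂μ) := by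
  have h1 : ∫ x, f x * g x ∂μ = inner ℝ (hf.toLp f) (hg.toLp g) := by
    rw [L2.inner_def]
    refine integral_congr_ae ?_
    filter_upwards [hf.coeFn_toLp, hg.coeFn_toLp] with x hx hy
    simp [hx, hy, mul_comm]
  have h2 : ∀ {f : X → ℝ} (hf : MemLp f 2 μ), ‖hf.toLp f‖ = √(∫ x, f x ^ 2 ∂μ) := by
    intro f hf
    rw [Lp.norm_toLp, eLpNorm_two_eq hf, toReal_ofReal (sqrt_nonneg _)]
  rw [h1, ← h2 hf, ← h2 hg]
  exact abs_real_inner_le_norm _ _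

lemma sqrt_integral_add_sq_le (hf : MemLp f 2 μ) (hg : MemLp g 2 μ) : √(∫ x, (f x + g x) ^ 2 ∂μ)
      ≤ √(∫ x, f x ^ 2 ∂μ) + √(∫ x, g x ^ 2 ∂μ) := by
  have h := eLpNorm_add_le hf.1 hg.1 (p := 2) (by norm_num)
  rw [eLpNorm_two_eq hf, eLpNorm_two_eq hg, eLpNorm_two_eq (hf.add hg),
    ← ENNReal.ofReal_add (sqrt_nonneg _) (sqrt_nonneg _)] at h
  exact (ofReal_le_ofReal_iff (by positivity)).1 h

lemma memLp_two_of_bound [IsFiniteMeasure μ] (hf : AEStronglyMeasurable f μ) (C : ℝ)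
    (h : ∀ᵐ x ∂μ, |f x| ≤ C) : MemLp f 2 μ :=
  MemLp.of_bound hf C (by simpa using h)

lemma tendsto_eLpNorm_of_dominated [IsFiniteMeasure μ] {ι : Type*} {l : Filter ι}
    [l.IsCountablyGenerated] {F : ι → X → ℝ} (C : ℝ)
    (hm : ∀ᶠ s in l, AEStronglyMeasurable (F s) μ) (hb : ∀ᶠ s in l, ∀ᵐ x ∂μ, |F s x| ≤ C)
    (ht : ∀ᵐ x ∂μ, Tendsto (fun s => F s x) l (𝓝 0)) :
    Tendsto (fun s => eLpNorm (F s) 2 μ) l (𝓝 0) := by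
  have h := tendsto_lintegral_filter_of_dominated_convergence' (μ := μ) (l := l)
    (F := fun s x => ‖F s x‖ₑ ^ (2 : ℝ)) (f := fun _ => 0) (fun _ => ofReal C ^ (2 : ℝ))
    ?_ ?_ ?_ ?_
  · simp only [lintegral_zero] at h
    have h2 : ∀ s, eLpNorm (F s) 2 μ = (∫⁻ x, ‖F s x‖ₑ ^ (2 : ℝ) ∂μ) ^ (1 / (2 : ℝ)) := fun s => by
      rw [eLpNorm_eq_lintegral_rpow_enorm_toReal (by norm_num) (by norm_num)]; simp
    simp only [h2]
    have h3 := (ENNReal.continuous_rpow_const (y := 1 / (2 : ℝ))).tendsto 0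
    rw [ENNReal.zero_rpow_of_pos (by norm_num)] at h3
    exact h3.comp h
  · filter_upwards [hm] with s hs
    exact hs.enorm.pow_const _
  · filter_upwards [hb] with s hs
    filter_upwards [hs] with x hx
    gcongr
    rw [Real.enorm_eq_ofReal_abs]
    exact ofReal_le_ofReal hx
  · rw [lintegral_const]
    exact ENNReal.mul_ne_top (ENNReal.rpow_ne_top_of_nonneg (by norm_num) ofReal_ne_top)
      (measure_ne_top _ _)
  · filter_upwards [ht] with x hx
    have h3 : Tendsto (fun s => ‖F s x‖ₑ) l (𝓝 0) := by simpa using hx.enorm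
    have h4 := (ENNReal.continuous_rpow_const (y := (2 : ℝ))).tendsto 0
    rw [ENNReal.zero_rpow_of_pos (by norm_num)] at h4
    exact h4.comp h3

end SquareIntegrable

instance (l : ℝ) : IsFiniteMeasure (mu l) := by unfold mu; infer_instance

lemma integral_mu (hl : 0 ≤ l) (f : ℝ → ℝ) : ∫ x, f x ∂(mu l) = ∫ x in 0..l, f x := by
  rw [int_of_le hl, integral_Ioc_eq_integral_Ioo]; rfl

lemma ii_of_mu (hl : 0 ≤ l) (hf : Integrable f (mu l)) :
    IntervalIntegrable f volume 0 l := by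
  rw [intervalIntegrable_iff_integrableOn_Ioc_of_le hl, integrableOn_Ioc_iff_integrableOn_Ioo]
  exact hf

lemma MemLp.ii_mu (hl : 0 ≤ l) (hf : MemLp f 2 (mu l)) :
    IntervalIntegrable f volume 0 l :=
  ii_of_mu hl (hf.integrable (by norm_num))

lemma memLp_mu_of_cont (hf : ContinuousOn f (Icc 0 l)) : MemLp f 2 (mu l) := by
  obtain ⟨C, hC⟩ := (isCompact_Icc (a := (0 : ℝ)) (b := l)).bddAbove_image hf.norm
  refine memLp_two_of_bound
    ((hf.mono Ioo_subset_Icc_self).aestronglyMeasurable measurableSet_Ioo) C ?_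
  refine ae_restrict_of_forall_mem measurableSet_Ioo (fun x hx => ?_)
  exact hC ⟨x, Ioo_subset_Icc_self hx, rfl⟩

/-- Integration by parts of a primitive against a `C¹` function. -/
lemma int_mul_primitive (hgi : IntervalIntegrable g volume 0 l)
    (hFf : ∀ x ∈ Icc 0 l, f x = f 0 + ∫ y in 0..x, g y) (hl : 0 ≤ l)
    (hu : ∀ x, HasDerivAt u (u' x) x) (hu' : Continuous u') :
    ∫ x in 0..l, u x * g x = u l * f l - u 0 * f 0 - ∫ x in 0..l, u' x * f x := by
  set F : ℝ → ℝ := fun x => f 0 + ∫ y in 0..x, g y with hF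
  have hFf : ∀ x ∈ Icc 0 l, f x = F x := hFf
  have acF : AbsolutelyContinuousOnInterval F 0 l := by
    have h1 := hgi.absolutelyContinuousOnInterval_intervalIntegral (c := 0) left_mem_uIcc
    have h0 : AbsolutelyContinuousOnInterval (fun _ : ℝ => f 0) 0 l :=
      contDiffOn_const.absolutelyContinuousOnInterval
    exact h0.add h1
  have hder : deriv u = u' := funext fun x => (hu x).deriv
  have acu : AbsolutelyContinuousOnInterval u 0 l := by
    refine ContDiffOn.absolutelyContinuousOnInterval (ContDiff.contDiffOn ?_)
    refine contDiff_one_iff_deriv.2 ⟨fun x => (hu x).differentiableAt, ?_⟩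
    rw [hder]; exact hu'
  have key := acu.integral_mul_deriv_eq_deriv_mul acF
  have e1 : ∫ x in 0..l, u x * deriv F x = ∫ x in 0..l, u x * g x := by
    refine int_congr_ae ?_
    filter_upwards [hgi.ae_hasDerivAt_integral] with x hx hx2
    have h2 := hx (uIoc_subset_uIcc hx2) 0 left_mem_uIcc
    rw [(h2.const_add (f 0)).deriv]
  have e2 : ∫ x in 0..l, deriv u x * F x = ∫ x in 0..l, u' x * f x := by
    refine int_congr_Icc hl fun x hx => ?_
    simp only [hder, hFf x hx]
  rw [e1, e2, ← hFf l ⟨hl, le_rfl⟩, ← hFf 0 ⟨le_rfl, hl⟩] at key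
  exact key

/-! ## Functions in `H¹` of an interval -/

namespace IsH1

lemma intervalIntegrable (h : IsH1 l f g) (hl : 0 ≤ l) : IntervalIntegrable g volume 0 l :=
  MemLp.ii_mu hl h.1

lemma continuousOn (h : IsH1 l f g) (hl : 0 ≤ l) : ContinuousOn f (Icc 0 l) := by
  have h1 : ContinuousOn (fun x => f 0 + ∫ y in 0..x, g y) (Icc 0 l) := by
    have := continuousOn_primitive_interval (a := 0) (b := l) (f := g) (μ := volume) ?_
    · rw [uIcc_of_le hl] at this
      exact continuousOn_const.add this
    · rw [uIcc_of_le hl, integrableOn_Icc_iff_integrableOn_Ioc]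
      exact (intervalIntegrable_iff_integrableOn_Ioc_of_le hl).1 (h.intervalIntegrable hl)
  exact h1.congr h.2

lemma mono (h : IsH1 l f g) (hx : x ≤ l) : IsH1 x f g :=
  ⟨h.1.mono_measure (Measure.restrict_mono (Ioo_subset_Ioo_right hx) le_rfl),
    fun y hy => h.2 y ⟨hy.1, hy.2.trans hx⟩⟩

/-- Integration by parts of an `H¹` function against a `C¹` function. -/
lemma integral_mul (h : IsH1 l f g) (hl : 0 ≤ l)
    (hu : ∀ x, HasDerivAt u (u' x) x) (hu' : Continuous u') :
    ∫ x in 0..l, u x * g x = u l * f l - u 0 * f 0 - ∫ x in 0..l, u' x * f x :=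
  int_mul_primitive (h.intervalIntegrable hl) h.2 hl hu hu'

end IsH1

lemma isH1_of_hasDerivAt (h : ∀ x, HasDerivAt f (f' x) x) (hc : Continuous f') : IsH1 l f f' := by
  refine ⟨memLp_mu_of_cont hc.continuousOn, fun x _ => ?_⟩
  rw [integral_eq_sub_of_hasDerivAt (fun y _ => h y) (hc.intervalIntegrable _ _)]
  ring

/-! ## Continuity with values in `L²` -/

lemma contL2_ite {a b : ℝ → ℝ → ℝ} (ha : Continuous (uncurry a)) (hb : Continuous (uncurry b)) :
    ContL2 L (Icc 0 L) (fun x y => if y ≤ x then a x y else b x y) := by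
  obtain ⟨C, hC⟩ := ((isCompact_Icc (a := (0 : ℝ)) (b := L)).prod
    (isCompact_Icc (a := (0 : ℝ)) (b := L))).bddAbove_image ha.norm.continuousOn
  obtain ⟨D, hD⟩ := ((isCompact_Icc (a := (0 : ℝ)) (b := L)).prod
    (isCompact_Icc (a := (0 : ℝ)) (b := L))).bddAbove_image hb.norm.continuousOn
  have hbd : ∀ x ∈ Icc 0 L, ∀ y ∈ Icc 0 L, |if y ≤ x then a x y else b x y| ≤ max C D := by
    intro x hx y hy
    split_ifs
    · exact (hC ⟨(x, y), ⟨hx, hy⟩, rfl⟩).trans (le_max_left _ _)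
    · exact (hD ⟨(x, y), ⟨hx, hy⟩, rfl⟩).trans (le_max_right _ _)
  have hms : ∀ x, Measurable fun y => if y ≤ x then a x y else b x y := fun x =>
    Measurable.ite measurableSet_Iic (ha.comp (Continuous.prodMk_right x)).measurable
      (hb.comp (Continuous.prodMk_right x)).measurable
  refine ⟨fun x hx => memLp_two_of_bound (hms x).aestronglyMeasurable (max C D) ?_, fun x hx => ?_⟩
  · exact ae_restrict_of_forall_mem measurableSet_Ioo (fun y hy => hbd x hx y (Ioo_subset_Icc_self hy))
  · refine tendsto_eLpNorm_of_dominated (max C D + max C D) ?_ ?_ ?_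
    · exact .of_forall fun s => ((hms s).sub (hms x)).aestronglyMeasurable
    · filter_upwards [self_mem_nhdsWithin] with s hs
      refine ae_restrict_of_forall_mem measurableSet_Ioo (fun y hy => ?_)
      exact (abs_sub _ _).trans (add_le_add (hbd s hs y (Ioo_subset_Icc_self hy))
        (hbd x hx y (Ioo_subset_Icc_self hy)))
    · have hne : ∀ᵐ y ∂(mu L), y ≠ x := by
        refine ae_restrict_of_ae ?_
        simp [ae_iff]
      filter_upwards [hne] with y hy
      have ha' : Tendsto (fun s => a s y) (𝓝[Icc 0 L] x) (𝓝 (a x y)) :=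
        ((ha.comp (Continuous.prodMk_left y)).tendsto x).mono_left nhdsWithin_le_nhds
      have hb' : Tendsto (fun s => b s y) (𝓝[Icc 0 L] x) (𝓝 (b x y)) :=
        ((hb.comp (Continuous.prodMk_left y)).tendsto x).mono_left nhdsWithin_le_nhds
      rcases lt_or_gt_of_ne hy with h | h
      · have hev : ∀ᶠ s in 𝓝[Icc 0 L] x, y ≤ s :=
          nhdsWithin_le_nhds ((lt_mem_nhds h).mono fun s hs => hs.le)
        have := ha'.sub_const (a x y)
        rw [sub_self] at this
        refine this.congr' ?_
        filter_upwards [hev] with s hs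
        simp [hs, h.le]
      · have hev : ∀ᶠ s in 𝓝[Icc 0 L] x, ¬ y ≤ s :=
          nhdsWithin_le_nhds ((gt_mem_nhds h).mono fun s hs => not_le.2 hs)
        have := hb'.sub_const (b x y)
        rw [sub_self] at this
        refine this.congr' ?_
        filter_upwards [hev] with s hs
        simp [hs, not_le.2 h]

/-! ## The kernel is a weak solution -/

lemma tendsto_int_mul_const (hL : 0 ≤ L) {ι : Type*} {l : Filter ι}
    {F : ι → ℝ → ℝ} {v : ℝ → ℝ} (hm : ∀ᶠ s in l, MemLp (F s) 2 (mu L))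
    (h : Tendsto (fun s => eLpNorm (F s) 2 (mu L)) l (𝓝 0)) (hv : MemLp v 2 (mu L)) :
    Tendsto (fun s => ∫ y in 0..L, F s y * v y) l (𝓝 0) := by
  have h1 : Tendsto (fun s => (eLpNorm (F s) 2 (mu L)).toReal
      * √(∫ x, v x ^ 2 ∂(mu L))) l (𝓝 0) := by
    have := ((ENNReal.tendsto_toReal ENNReal.zero_ne_top).comp h).mul_const
      (√(∫ x, v x ^ 2 ∂(mu L)))
    simpa using this
  refine squeeze_zero_norm' ?_ h1
  filter_upwards [hm] with s hs
  rw [← integral_mu hL, eLpNorm_two_eq hs, toReal_ofReal (sqrt_nonneg _)]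
  exact integral_mul_sq_le hs hv

/-- The derivative `∂ₓ` of the extension of the kernel. -/
def kernX (α x y : ℝ) : ℝ := if y ≤ x then pdt (kern α) x y else -(α / 2)

/-- The derivative `∂_y` of the extension of the kernel. -/
def kernY (α x y : ℝ) : ℝ := if y ≤ x then pdx (kern α) x y else 0

lemma contL2_kbar (α L : ℝ) : ContL2 L (Icc 0 L) (kbar α (kern α)) :=
  contL2_ite (smooth2_kern α).continuous (b := fun x _ => -(α / 2) * x) (by fun_prop)

lemma contL2_kernX (α L : ℝ) : ContL2 L (Icc 0 L) (kernX α) :=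
  contL2_ite (smooth2_kern α).pdt.continuous (b := fun _ _ => -(α / 2)) (by fun_prop)

lemma contL2_kernY (α L : ℝ) : ContL2 L (Icc 0 L) (kernY α) :=
  contL2_ite (smooth2_kern α).pdx.continuous (b := fun _ _ => 0) (by fun_prop)

lemma int_congr_of_le {a b : ℝ} (hab : a ≤ b)
    (h : ∀ y ∈ Ioc a b, f y = g y) : ∫ y in a..b, f y = ∫ y in a..b, g y := by
  refine int_congr_ae (.of_forall fun y hy => h y ?_)
  rwa [uIoc_of_le hab] at hy

lemma isH1_kbar (α : ℝ) (hx : x ∈ Icc 0 L) : IsH1 L (kbar α (kern α) x) (kernY α x) := by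
  have hk := smooth2_kern α
  have hc : Continuous (pdx (kern α) x) := (hk.pdx.slice x).continuous
  have hftc : ∀ y, ∫ s in 0..y, pdx (kern α) x s = kern α x y - kern α x 0 := fun y =>
    integral_eq_sub_of_hasDerivAt (fun s _ => hk.hasDerivAt_pdx x s) (hc.intervalIntegrable _ _)
  refine ⟨(contL2_kernY α L).1 x hx, fun y hy => ?_⟩
  have h0 : kbar α (kern α) x 0 = kern α x 0 := by simp [kbar, hx.1]
  rw [h0]
  by_cases hyx : y ≤ x
  · rw [int_congr_of_le hy.1 (g := pdx (kern α) x), hftc]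
    · simp [kbar, hyx]
    · intro s hs; simp [kernY, hs.2.trans hyx]
  · have hxy := (not_le.1 hyx).le
    have e1 : ∫ s in 0..x, kernY α x s = kern α x x - kern α x 0 := by
      rw [int_congr_of_le hx.1 (g := pdx (kern α) x), hftc]
      intro s hs; simp [kernY, hs.2]
    have e2 : ∫ s in x..y, kernY α x s = 0 := by
      rw [int_congr_of_le hxy (g := fun _ => 0)]
      · simp
      · intro s hs; simp [kernY, hs.1]
    have hi := MemLp.ii_mu (hx.1.trans hx.2) ((contL2_kernY α L).1 x hx)
    rw [← integral_add_adjacent_intervals (b := x), e1, e2, kern_diag]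
    · simp [kbar, hyx]
    · exact hi.mono_set (by rw [uIcc_of_le hx.1, uIcc_of_le (hx.1.trans hx.2)]
                            exact Icc_subset_Icc_right hx.2)
    · exact hi.mono_set (by rw [uIcc_of_le hxy, uIcc_of_le (hx.1.trans hx.2)]
                            exact Icc_subset_Icc hx.1 hy.2)

lemma kbar_lipschitz (α : ℝ) : ∃ K, ∀ s ∈ Icc 0 L, ∀ x ∈ Icc 0 L,
    ∀ y ∈ Icc 0 L, |kbar α (kern α) s y - kbar α (kern α) x y| ≤ K * |s - x| := by
  have hk := smooth2_kern α
  obtain ⟨C, hC⟩ := ((isCompact_Icc (a := (0 : ℝ)) (b := L)).prod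
    (isCompact_Icc (a := (0 : ℝ)) (b := L))).bddAbove_image hk.pdt.continuous.norm.continuousOn
  have lip : ∀ s ∈ Icc 0 L, ∀ x ∈ Icc 0 L, ∀ y ∈ Icc 0 L,
      |kern α s y - kern α x y| ≤ C * |s - x| := by
    intro s hs x hx y hy
    exact (convex_Icc (0 : ℝ) L).norm_image_sub_le_of_norm_hasDerivWithin_le
      (f := fun s => kern α s y) (fun z _ => (hk.hasDerivAt_pdt z y).hasDerivWithinAt)
      (fun z hz => hC ⟨(z, y), ⟨hz, hy⟩, rfl⟩) hx hs
  set K := max C |α / 2| with hK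
  have main : ∀ s ∈ Icc 0 L, ∀ x ∈ Icc 0 L, s ≤ x →
    ∀ y ∈ Icc 0 L, |kbar α (kern α) s y - kbar α (kern α) x y| ≤ K * |s - x| := by
    intro s hs x hx hsx y hy
    have hlin : ∀ a b : ℝ, |-(α / 2) * a - -(α / 2) * b| ≤ K * |a - b| := fun a b => by
      rw [← mul_sub, abs_mul, abs_neg]
      exact mul_le_mul_of_nonneg_right (le_max_right _ _) (abs_nonneg _)
    have hlip : ∀ s ∈ Icc 0 L, ∀ x ∈ Icc 0 L, |kern α s y - kern α x y| ≤ K * |s - x| :=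
      fun s hs x hx => (lip s hs x hx y hy).trans
        (mul_le_mul_of_nonneg_right (le_max_left _ _) (abs_nonneg _))
    unfold kbar
    by_cases h1 : y ≤ s
    · rw [if_pos h1, if_pos (h1.trans hsx)]; exact hlip s hs x hx
    · by_cases h2 : y ≤ x
      · rw [if_neg h1, if_pos h2]
        have e : -(α / 2) * s - kern α x y
            = (-(α / 2) * s - -(α / 2) * y) + (kern α y y - kern α x y) := by
          rw [kern_diag]; ring
        rw [e]
        refine (abs_add_le _ _).trans ((add_le_add (hlin s y) (hlip y hy x hx)).trans ?_)
        rw [← mul_add, abs_of_nonpos (by linarith : s - x ≤ 0), abs_of_nonpos (by linarith),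
          abs_of_nonpos (by linarith)]
        exact le_of_eq (by ring)
      · rw [if_neg h1, if_neg h2]; exact hlin s x
  refine ⟨K, fun s hs x hx y hy => ?_⟩
  rcases le_total s x with h | h
  · exact main s hs x hx h y hy
  · rw [abs_sub_comm, abs_sub_comm s]; exact main x hx s hs h y hy

lemma derivX_kbar (α : ℝ) (hx : x ∈ Icc 0 L) :
    Tendsto (fun s => eLpNorm (fun y => (kbar α (kern α) s y - kbar α (kern α) x y) / (s - x)
      - kernX α x y) 2 (mu L)) (𝓝[Icc 0 L \ {x}] x) (𝓝 0) := by
  have hk := smooth2_kern α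
  obtain ⟨K, hK⟩ := kbar_lipschitz α (L := L)
  obtain ⟨C, hC⟩ := ((isCompact_Icc (a := (0 : ℝ)) (b := L)).prod
    (isCompact_Icc (a := (0 : ℝ)) (b := L))).bddAbove_image hk.pdt.continuous.norm.continuousOn
  have hmk : ∀ s ∈ Icc 0 L, AEStronglyMeasurable (kbar α (kern α) s) (mu L) := fun s hs =>
    ((contL2_kbar α L).1 s hs).1
  refine tendsto_eLpNorm_of_dominated (K + max C |α / 2|) ?_ ?_ ?_
  · filter_upwards [self_mem_nhdsWithin] with s hs
    simp only [div_eq_mul_inv]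
    exact (((hmk s hs.1).sub (hmk x hx)).mul_const _).sub ((contL2_kernX α L).1 x hx).1
  · filter_upwards [self_mem_nhdsWithin] with s hs
    refine ae_restrict_of_forall_mem measurableSet_Ioo (fun y hy => ?_)
    have hy' := Ioo_subset_Icc_self hy
    refine (abs_sub _ _).trans (add_le_add ?_ ?_)
    · rw [abs_div, div_le_iff₀ (abs_pos.2 (sub_ne_zero.2 hs.2))]
      exact hK s hs.1 x hx y hy'
    · unfold kernX
      split_ifs
      · exact (hC ⟨(x, y), ⟨hx, hy'⟩, rfl⟩).trans (le_max_left _ _)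
      · rw [abs_neg]; exact le_max_right _ _
  · have hne : ∀ᵐ y ∂(mu L), y ≠ x := by
      refine ae_restrict_of_ae ?_
      simp [ae_iff]
    filter_upwards [hne] with y hy
    have hd : HasDerivAt (fun s => kbar α (kern α) s y) (kernX α x y) x := by
      rcases lt_or_gt_of_ne hy with h | h
      · have e : kernX α x y = pdt (kern α) x y := by simp [kernX, h.le]
        rw [e]
        refine (hk.hasDerivAt_pdt x y).congr_of_eventuallyEq ?_
        filter_upwards [lt_mem_nhds h] with s hs
        simp [kbar, hs.le]
      · have e : kernX α x y = -(α / 2) := by simp [kernX, h]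
        rw [e]
        have h2 := (hasDerivAt_id x).const_mul (-(α / 2))
        rw [mul_one] at h2
        refine h2.congr_of_eventuallyEq ?_
        filter_upwards [gt_mem_nhds h] with s hs
        simp [kbar, hs]
    have h3 := (hasDerivAt_iff_tendsto_slope.1 hd).mono_left
      (nhdsWithin_mono x (fun s hs => hs.2 : Icc 0 L \ {x} ⊆ {x}ᶜ))
    have h4 := h3.sub_const (kernX α x y)
    rw [sub_self] at h4
    refine h4.congr fun s => ?_
    rw [slope_def_field]

/-- A continuous function on the line agreeing with `f` on `[0, L]`. -/
lemma exists_cont_ext (hL : 0 ≤ L)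
    (hf : ContinuousOn f (Icc 0 L)) : ∃ g : ℝ → ℝ, Continuous g ∧ ∀ x ∈ Icc 0 L, g x = f x :=
  ⟨IccExtend hL ((Icc 0 L).domRestrict f), (continuousOn_iff_continuous_domRestrict.1 hf).Icc_extend',
    fun x hx => by rw [IccExtend_of_mem hL _ hx]; rfl⟩

lemma derivXX_kern (α : ℝ) (hL : 0 < L) : ∃ f0 f1 : ℝ → ℝ → ℝ,
    ContL2 L (Icc 0 L) f0 ∧ ContL2 L (Icc 0 L) f1 ∧
    ∀ φ dφ : ℝ → ℝ, IsH1 L φ dφ → ∀ x ∈ Icc 0 L,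
      HasDerivWithinAt (fun s => ∫ y in 0..L, kernX α s y * φ y)
        (∫ y in 0..L, (f0 x y * φ y + f1 x y * dφ y)) (Icc 0 L) x := by
  have hk := smooth2_kern α
  set c : ℝ → ℝ := fun x => pdt (kern α) x x + α / 2 with hc
  have cc : Continuous c := (hk.pdt.comp_curve contDiff_id contDiff_id).continuous.add
    continuous_const
  refine ⟨fun x y => if y ≤ x then pdt (pdt (kern α)) x y + c x / L else c x / L,
    fun x y => if y ≤ x then c x * y / L else c x * y / L - c x,
    contL2_ite (hk.pdt.pdt.continuous.add (by fun_prop)) (b := fun x _ => c x / L) (by fun_prop),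
    contL2_ite (a := fun x y => c x * y / L) (b := fun x y => c x * y / L - c x)
      (by fun_prop) (by fun_prop), ?_⟩
  intro φ dφ hφ x hx
  obtain ⟨ψ, hψ, hψe⟩ := exists_cont_ext hL.le (hφ.continuousOn hL.le)
  have hdi := hφ.intervalIntegrable hL.le
  have hψi : ∀ a b, IntervalIntegrable ψ volume a b := fun a b => hψ.intervalIntegrable a b
  have hkψ : ∀ x, Continuous fun y => pdt (kern α) x y * ψ y := fun x =>
    (hk.pdt.slice x).continuous.mul hψ
  have split : ∀ s ∈ Icc 0 L, ∫ y in 0..L, kernX α s y * φ y = (∫ y in 0..s, pdt (kern α) s y * ψ y)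
        + -(α / 2) * ((∫ y in 0..L, ψ y) - ∫ y in 0..s, ψ y) := by
    intro s hs
    rw [int_congr_of_le hL.le (g := fun y => kernX α s y * ψ y) (fun y hy => by
      rw [hψe y (Ioc_subset_Icc_self hy)])]
    have h1 : ∫ y in 0..s, kernX α s y * ψ y = ∫ y in 0..s, pdt (kern α) s y * ψ y :=
      int_congr_of_le hs.1 fun y hy => by simp [kernX, hy.2]
    have h2 : ∫ y in s..L, kernX α s y * ψ y = ∫ y in s..L, -(α / 2) * ψ y :=
      int_congr_of_le hs.2 fun y hy => by simp [kernX, hy.1]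
    have hint : IntervalIntegrable (fun y => kernX α s y * ψ y) volume 0 L :=
      (MemLp.ii_mu hL.le ((contL2_kernX α L).1 s hs)).mul_continuousOn
        hψ.continuousOn
    rw [← integral_add_adjacent_intervals (b := s), h1, h2, int_const_mul,
      integral_interval_sub_left (hψi _ _) (hψi _ _)]
    · exact hint.mono_set (uIcc_subset_left hs)
    · exact hint.mono_set (uIcc_subset_right hs)
  have hder : HasDerivAt (fun s => (∫ y in 0..s, pdt (kern α) s y * ψ y)
        + -(α / 2) * ((∫ y in 0..L, ψ y) - ∫ y in 0..s, ψ y))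
      ((∫ y in 0..x, pdt (pdt (kern α)) x y * ψ y) + c x * ψ x) x := by
    have h1 := hasDerivAt_leibniz (G := fun x y => pdt (kern α) x y * ψ y)
      (G' := fun x y => pdt (pdt (kern α)) x y * ψ y)
      (hk.pdt.continuous.mul (hψ.comp continuous_snd))
      (hk.pdt.pdt.continuous.mul (hψ.comp continuous_snd))
      (fun s y => (hk.pdt.hasDerivAt_pdt s y).mul_const _) 0 (hasDerivAt_id x)
    have h2 : HasDerivAt (fun s => ∫ y in 0..s, ψ y) (ψ x) x := integral_hasDerivAt_right (hψi _ _)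
        (hψ.stronglyMeasurableAtFilter _ _) hψ.continuousAt
    refine (h1.add ((h2.const_sub (∫ y in 0..L, ψ y)).const_mul (-(α / 2)))).congr_deriv ?_
    simp only [hc, id]; ring
  refine (hder.hasDerivWithinAt.congr split (split x hx)).congr_deriv ?_
  -- the value of `φ` at a point as a functional on `H¹`
  have ibp := hφ.integral_mul hL.le (u := fun y => y) (u' := fun _ => 1)
    (fun y => hasDerivAt_id y) continuous_const
  have hval : φ L - φ x = ∫ y in x..L, dφ y := by
    rw [hφ.2 L ⟨hL.le, le_rfl⟩, hφ.2 x hx, add_sub_add_left_eq_sub, integral_interval_sub_left hdi]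
    exact hdi.mono_set (uIcc_subset_left hx)
  have hφi : IntervalIntegrable φ volume 0 L :=
    (hφ.continuousOn hL.le).intervalIntegrable_of_Icc hL.le
  have sub1 : uIcc 0 x ⊆ uIcc 0 L := by
    rw [uIcc_of_le hx.1, uIcc_of_le hL.le]; exact Icc_subset_Icc_right hx.2
  have sub2 : uIcc x L ⊆ uIcc 0 L := by
    rw [uIcc_of_le hx.2, uIcc_of_le hL.le]; exact Icc_subset_Icc_left hx.1
  have hkφ : IntervalIntegrable (fun y => pdt (pdt (kern α)) x y * φ y) volume 0 L :=
    hφi.continuousOn_mul (hk.pdt.pdt.slice x).continuous.continuousOn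
  have hyd : IntervalIntegrable (fun y => c x * y / L * dφ y) volume 0 L :=
    hdi.continuousOn_mul (by fun_prop)
  have hconst : IntervalIntegrable (fun y => c x / L * φ y) volume 0 L := hφi.const_mul _
  have hd2 : IntervalIntegrable (fun y => c x * dφ y) volume 0 L := hdi.const_mul _
  have e1 : ∫ y in 0..x, ((if y ≤ x then pdt (pdt (kern α)) x y + c x / L else c x / L) * φ y
      + (if y ≤ x then c x * y / L else c x * y / L - c x) * dφ y)
      = ∫ y in 0..x, (pdt (pdt (kern α)) x y * φ y + (c x / L * φ y + c x * y / L * dφ y)) :=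
    int_congr_of_le hx.1 fun y hy => by simp only [hy.2, if_true]; ring
  have e2 : ∫ y in x..L, ((if y ≤ x then pdt (pdt (kern α)) x y + c x / L else c x / L) * φ y
      + (if y ≤ x then c x * y / L else c x * y / L - c x) * dφ y)
      = ∫ y in x..L, ((c x / L * φ y + c x * y / L * dφ y) - c x * dφ y) :=
    int_congr_of_le hx.2 fun y hy => by simp only [not_le.2 hy.1, if_false]; ring
  have hA := hconst.add hyd
  have i1 : IntervalIntegrable (fun y =>
      ((if y ≤ x then pdt (pdt (kern α)) x y + c x / L else c x / L) * φ y
      + (if y ≤ x then c x * y / L else c x * y / L - c x) * dφ y)) volume 0 x := by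
    refine (((hkφ.mono_set sub1).add (hA.mono_set sub1))).congr fun y hy => ?_
    rw [uIoc_of_le hx.1] at hy
    simp only [hy.2, if_true]; ring
  have i2 : IntervalIntegrable (fun y =>
      ((if y ≤ x then pdt (pdt (kern α)) x y + c x / L else c x / L) * φ y
      + (if y ≤ x then c x * y / L else c x * y / L - c x) * dφ y)) volume x L := by
    refine (((hA.mono_set sub2).sub (hd2.mono_set sub2))).congr fun y hy => ?_
    rw [uIoc_of_le hx.2] at hy
    simp only [not_le.2 hy.1, if_false]; ring
  rw [← integral_add_adjacent_intervals i1 i2, e1, e2,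
    int_add (hkφ.mono_set sub1) (hA.mono_set sub1),
    int_sub (hA.mono_set sub2) (hd2.mono_set sub2),
    int_const_mul (c x), ← hval]
  have e3 := integral_add_adjacent_intervals (hA.mono_set sub1) (hA.mono_set sub2)
  rw [int_add hconst hyd, int_const_mul] at e3
  have e4 : ∫ y in 0..L, c x * y / L * dφ y = c x / L * ∫ y in 0..L, y * dφ y := by
    rw [← int_const_mul]
    exact int_congr fun y _ => by ring
  rw [e4, ibp] at e3
  have e5 : ∫ y in 0..x, pdt (pdt (kern α)) x y * ψ y = ∫ y in 0..x, pdt (pdt (kern α)) x y * φ y :=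
    int_congr_of_le hx.1 fun y hy => by
      rw [hψe y ⟨hy.1.le, hy.2.trans hx.2⟩]
  rw [e5, hψe x hx]
  simp only [one_mul, zero_mul, sub_zero] at e3
  have e6 : c x / L * (∫ y in 0..L, φ y)
      + c x / L * (L * φ L - ∫ y in 0..L, φ y) = c x * φ L := by field_simp; ring
  rw [e6] at e3
  linarith

lemma weak_kern (α : ℝ) (hL : 0 < L) {v dv w dw : ℝ → ℝ} (hv : IsH1 L v dv) (hw : IsH1 L w dw) :
    -(∫ x in 0..L, (∫ y in 0..x, kernX α x y * v y) * dw x) + w L * (∫ y in 0..L, kernX α L y * v y)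
        + (∫ x in 0..L, (∫ y in 0..x, kernY α x y * dv y) * w x)
      = α * (∫ x in 0..L, (∫ y in 0..x, kern α x y * v y) * w x)
        - α / 2 * (∫ x in 0..L, v x * w x) := by
  have hk := smooth2_kern α
  obtain ⟨ψ, hψ, hψe⟩ := exists_cont_ext hL.le (hv.continuousOn hL.le)
  set G : ℝ → ℝ := fun x => ∫ y in 0..x, pdt (kern α) x y * ψ y with hG
  set K : ℝ → ℝ := fun x => ∫ y in 0..x, kern α x y * ψ y with hK
  set G' : ℝ → ℝ := fun x => pdt (kern α) x x * ψ x
    + ∫ y in 0..x, pdt (pdt (kern α)) x y * ψ y with hG'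
  have hGd : ∀ x, HasDerivAt G (G' x) x := fun x => by
    have h1 := hasDerivAt_leibniz (G := fun x y => pdt (kern α) x y * ψ y)
      (G' := fun x y => pdt (pdt (kern α)) x y * ψ y)
      (hk.pdt.continuous.mul (hψ.comp continuous_snd))
      (hk.pdt.pdt.continuous.mul (hψ.comp continuous_snd))
      (fun s y => (hk.pdt.hasDerivAt_pdt s y).mul_const _) 0 (hasDerivAt_id x)
    simpa using h1
  have prim : ∀ {f : ℝ → ℝ → ℝ}, Smooth2 f → Continuous fun x => ∫ y in 0..x, f x y * ψ y :=
    fun hf => continuous_parametric_intervalIntegral_of_continuous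
      (hf.continuous.mul (hψ.comp continuous_snd)) continuous_id
  have hG'c : Continuous G' :=
    ((hk.pdt.comp_curve contDiff_id contDiff_id).continuous.mul hψ).add (prim hk.pdt.pdt)
  have hKc : Continuous K := prim hk
  have repl : ∀ x ∈ Icc 0 L, ∀ f : ℝ → ℝ,
      ∫ y in 0..x, f y * v y = ∫ y in 0..x, f y * ψ y := fun x hx f =>
    int_congr_of_le hx.1 fun y hy => by rw [hψe y ⟨hy.1.le, hy.2.trans hx.2⟩]
  have eG : ∀ x ∈ Icc 0 L, ∫ y in 0..x, kernX α x y * v y = G x := fun x hx => by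
    rw [repl x hx]
    exact int_congr_of_le hx.1 fun y hy => by simp [kernX, hy.2]
  have eY : ∀ x ∈ Icc 0 L, ∫ y in 0..x, kernY α x y * dv y
      = pdx (kern α) x x * ψ x - ∫ y in 0..x, pdx (pdx (kern α)) x y * ψ y := fun x hx => by
    have h1 := (hv.mono hx.2).integral_mul hx.1 (u := pdx (kern α) x) (u' := pdx (pdx (kern α)) x)
      (fun y => hk.pdx.hasDerivAt_pdx x y) (hk.pdx.pdx.slice x).continuous
    rw [int_congr_of_le hx.1 (g := fun y => pdx (kern α) x y * dv y) (fun y hy => by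
      simp [kernY, hy.2]), h1, pdx_kern_zero_right, repl x hx, hψe x hx]
    ring
  have ibp := hw.integral_mul hL.le hGd hG'c
  have hG0 : G 0 = 0 := by simp [hG]
  have hwc := hw.continuousOn hL.le
  have hwi : ∀ {f : ℝ → ℝ}, Continuous f → IntervalIntegrable (fun x => f x * w x) volume 0 L :=
    fun hf => (hf.continuousOn.mul hwc).intervalIntegrable_of_Icc hL.le
  have r1 : ∫ x in 0..L, (∫ y in 0..x, kernX α x y * v y) * dw x = ∫ x in 0..L, G x * dw x :=
    int_congr_of_le hL.le fun x hx => by rw [eG x (Ioc_subset_Icc_self hx)]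
  set Y : ℝ → ℝ := fun x => pdx (kern α) x x * ψ x
    - ∫ y in 0..x, pdx (pdx (kern α)) x y * ψ y with hY
  have hYc : Continuous Y :=
    ((hk.pdx.comp_curve contDiff_id contDiff_id).continuous.mul hψ).sub (prim hk.pdx.pdx)
  have r2 : ∫ x in 0..L, (∫ y in 0..x, kernY α x y * dv y) * w x = ∫ x in 0..L, Y x * w x :=
    int_congr_of_le hL.le fun x hx => by rw [eY x (Ioc_subset_Icc_self hx)]
  have r3 : ∫ x in 0..L, (∫ y in 0..x, kern α x y * v y) * w x = ∫ x in 0..L, K x * w x :=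
    int_congr_of_le hL.le fun x hx => by rw [repl x (Ioc_subset_Icc_self hx)]
  have r4 : ∫ x in 0..L, v x * w x = ∫ x in 0..L, ψ x * w x :=
    int_congr_of_le hL.le fun x hx => by rw [hψe x (Ioc_subset_Icc_self hx)]
  rw [r1, r2, r3, r4, eG L ⟨hL.le, le_rfl⟩, ibp, hG0]
  have key : ∫ x in 0..L, Y x * w x = α * (∫ x in 0..L, K x * w x)
      - α / 2 * (∫ x in 0..L, ψ x * w x) - ∫ x in 0..L, G' x * w x := by
    rw [← int_const_mul, ← int_const_mul, ← int_sub ((hwi hKc).const_mul _) ((hwi hψ).const_mul _),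
      ← int_sub (((hwi hKc).const_mul _).sub ((hwi hψ).const_mul _)) (hwi hG'c)]
    refine int_congr fun x _ => ?_
    have i4 : ∫ y in 0..x, pdt (pdt (kern α)) x y * ψ y
        = (∫ y in 0..x, pdx (pdx (kern α)) x y * ψ y) + α * K x := by
      rw [hK, ← int_const_mul, ← int_add]
      · refine int_congr fun y _ => ?_
        have := kern_wave α x y
        rw [sub_eq_iff_eq_add] at this
        simp only [this]; ring
      · exact ((hk.pdx.pdx.slice x).continuous.mul hψ).intervalIntegrable _ _
      · exact (continuous_const.mul ((hk.slice x).continuous.mul hψ)).intervalIntegrable _ _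
    simp only [hY, hG', i4, pdt_kern_diag, pdx_kern_diag]
    ring
  rw [key]
  ring

lemma isWeakKernel_kern (α : ℝ) : IsWeakKernel α (kern α) (kernX α) (kernY α) where
  memH1 _ _ _ hx := isH1_kbar α hx
  contH1 L _ := ⟨contL2_kbar α L, contL2_kernY α L⟩
  derivX L _ := ⟨contL2_kernX α L, fun _ hx => derivX_kbar α hx⟩
  derivXX _ hL := derivXX_kern α hL
  weak _ hL _ _ _ _ hv hw := weak_kern α hL hv hw

/-! ## Uniqueness of the kernel -/

namespace IsWeakKernel

variable {kx ky : ℝ → ℝ → ℝ}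

lemma kbar_diag (h : IsWeakKernel α k kx ky) (hx : 0 ≤ x) : kbar α k x x = -(α / 2) * x := by
  have hc := (h.memH1 (x + 1) (by linarith) x ⟨hx, by linarith⟩).continuousOn (by linarith)
  have h1 : Tendsto (kbar α k x) (𝓝[Ioo x (x + 1)] x) (𝓝 (kbar α k x x)) :=
    (hc x ⟨hx, by linarith⟩).mono_left (nhdsWithin_mono x fun y hy => ⟨hx.trans hy.1.le, hy.2.le⟩)
  have h2 : Tendsto (kbar α k x) (𝓝[Ioo x (x + 1)] x) (𝓝 (-(α / 2) * x)) := by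
    refine tendsto_const_nhds.congr' ?_
    filter_upwards [self_mem_nhdsWithin] with y hy
    simp [kbar, hy.1]
  have : (𝓝[Ioo x (x + 1)] x).NeBot := by
    rw [nhdsWithin_Ioo_eq_nhdsGT (by linarith)]; infer_instance
  exact tendsto_nhds_unique h1 h2

lemma integral_kx_above (h : IsWeakKernel α k kx ky) (hx : x ∈ Ioc 0 L) {v : ℝ → ℝ}
    (hv : Continuous v) : ∫ y in x..L, kx x y * v y = ∫ y in x..L, -(α / 2) * v y := by
  have hL : 0 < L := hx.1.trans_le hx.2
  have hxI : x ∈ Icc 0 L := ⟨hx.1.le, hx.2⟩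
  have hkx := ((h.derivX L hL).1.1 x hxI)
  have hkb := (h.contH1 L hL).1.1
  set F : ℝ → ℝ → ℝ := fun s y => (kbar α k s y - kbar α k x y) / (s - x) - kx x y with hF
  have hmono : 𝓝[Ico 0 x] x ≤ 𝓝[Icc 0 L \ {x}] x :=
    nhdsWithin_mono x fun s hs => ⟨⟨hs.1, hs.2.le.trans hx.2⟩, hs.2.ne⟩
  have hvm : MemLp ((Ioi x).indicator v) 2 (mu L) :=
    (memLp_mu_of_cont hv.continuousOn).indicator measurableSet_Ioi
  have hFm : ∀ s ∈ Ico 0 x, MemLp (F s) 2 (mu L) := fun s hs => by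
    have h1 := ((hkb s ⟨hs.1, hs.2.le.trans hx.2⟩).sub (hkb x hxI)).mul_const ((s - x)⁻¹)
    exact h1.sub hkx
  have ht := tendsto_int_mul_const hL.le (F := F) (l := 𝓝[Ico 0 x] x)
    (by filter_upwards [self_mem_nhdsWithin] with s hs using hFm s hs)
    (((h.derivX L hL).2 x hxI).mono_left hmono) hvm
  have hval : ∀ s ∈ Ico 0 x, ∫ y in 0..L, F s y * (Ioi x).indicator v y
      = ∫ y in x..L, (-(α / 2) * v y - kx x y * v y) := by
    intro s hs
    have hi : IntervalIntegrable (fun y => F s y * (Ioi x).indicator v y) volume 0 L :=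
      ii_of_mu hL.le ((hFm s hs).integrable_mul hvm)
    rw [← integral_add_adjacent_intervals (b := x)
      (hi.mono_set (uIcc_subset_left ⟨hx.1.le, hx.2⟩))
      (hi.mono_set (uIcc_subset_right ⟨hx.1.le, hx.2⟩)),
      int_congr_of_le hx.1.le (g := fun _ => 0) (fun y hy => by
        simp [indicator, not_lt.2 hy.2])]
    simp only [int_zero, zero_add]
    refine int_congr_of_le hx.2 fun y hy => ?_
    have hsx : s - x ≠ 0 := (sub_neg.2 hs.2).ne
    have h1 : kbar α k s y = -(α / 2) * s := by simp [kbar, hs.2.trans hy.1]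
    have h2 : kbar α k x y = -(α / 2) * x := by simp [kbar, hy.1]
    simp only [hF, h1, h2, indicator, mem_Ioi, hy.1, if_true]
    rw [← mul_sub, mul_div_assoc, div_self hsx]; ring
  have hne : (𝓝[Ico 0 x] x).NeBot := by
    rw [nhdsWithin_Ico_eq_nhdsLT hx.1]; infer_instance
  have h3 : ∫ y in x..L, (-(α / 2) * v y - kx x y * v y) = 0 := by
    refine tendsto_nhds_unique (Tendsto.congr' ?_ tendsto_const_nhds) ht
    filter_upwards [self_mem_nhdsWithin] with s hs
    exact (hval s hs).symm
  rw [int_sub] at h3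
  · linarith
  · exact (continuous_const.mul hv).intervalIntegrable _ _
  · refine ((MemLp.ii_mu hL.le hkx).mul_continuousOn hv.continuousOn).mono_set ?_
    rw [uIcc_of_le hx.2, uIcc_of_le hL.le]; exact Icc_subset_Icc_left hx.1.le

/-- The cosine moments of a weak kernel solve an ordinary differential equation that only
depends on the parameters. -/
lemma moment_ode (h : IsWeakKernel α k kx ky) (hL : 0 < L) {ν : ℝ}
    (ha : a = fun x => ∫ y in 0..L, kbar α k x y * cos (ν * y))
    (hb : b = fun x => ∫ y in 0..L, kx x y * cos (ν * y)) :
    (∀ x ∈ Icc 0 L, HasDerivWithinAt a (b x) (Icc 0 L) x) ∧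
    (∀ x ∈ Icc 0 L, HasDerivWithinAt b ((α - ν ^ 2) * a x +
      ((α - ν ^ 2) * (α / 2 * x * ∫ y in x..L, cos (ν * y))
        - α / 2 * x * (ν * sin (ν * x)))) (Icc 0 L) x) ∧
    a 0 = 0 ∧ b 0 = -(α / 2) * ∫ y in 0..L, cos (ν * y) := by
  set v : ℝ → ℝ := fun y => cos (ν * y) with hv
  have cv : Continuous v := by fun_prop
  have dv : ∀ y, HasDerivAt v (-(ν * sin (ν * y))) y := fun y => by
    have := ((hasDerivAt_id y).const_mul ν).cos
    refine this.congr_deriv ?_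
    simp; ring
  have ddv : ∀ y, HasDerivAt (fun y => -(ν * sin (ν * y))) (-(ν ^ 2) * v y) y := fun y => by
    have := (((hasDerivAt_id y).const_mul ν).sin.const_mul ν).neg
    refine this.congr_deriv ?_
    simp [hv]; ring
  have hvH1 : IsH1 L v (fun y => -(ν * sin (ν * y))) := isH1_of_hasDerivAt dv (by fun_prop)
  have hvm : MemLp v 2 (mu L) := memLp_mu_of_cont cv.continuousOn
  have hkb := (h.contH1 L hL).1.1
  have hkxm := (h.derivX L hL).1.1
  have hA : ∀ x ∈ Icc 0 L, HasDerivWithinAt a (b x) (Icc 0 L) x := by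
    intro x hx
    rw [hasDerivWithinAt_iff_tendsto_slope]
    have hFm : ∀ s ∈ Icc 0 L, MemLp (fun y => (kbar α k s y - kbar α k x y) / (s - x) - kx x y) 2
        (mu L) := fun s hs => by
      have h1 := ((hkb s hs).sub (hkb x hx)).mul_const ((s - x)⁻¹)
      exact h1.sub (hkxm x hx)
    have ht := tendsto_int_mul_const hL.le (l := 𝓝[Icc 0 L \ {x}] x)
      (by filter_upwards [self_mem_nhdsWithin] with s hs using hFm s hs.1)
      ((h.derivX L hL).2 x hx) hvm
    have ht2 := ht.add_const (b x)
    rw [zero_add] at ht2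
    refine ht2.congr' ?_
    filter_upwards [self_mem_nhdsWithin] with s hs
    have i1 : ∀ s ∈ Icc 0 L, IntervalIntegrable (fun y => kbar α k s y * v y) volume 0 L :=
      fun s hs => (MemLp.ii_mu hL.le (hkb s hs)).mul_continuousOn cv.continuousOn
    have i2 : IntervalIntegrable (fun y => kx x y * v y) volume 0 L :=
      (MemLp.ii_mu hL.le (hkxm x hx)).mul_continuousOn cv.continuousOn
    have e : ∀ y, ((kbar α k s y - kbar α k x y) / (s - x) - kx x y) * v y
        = (s - x)⁻¹ * (kbar α k s y * v y - kbar α k x y * v y) - kx x y * v y := fun y => by ring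
    simp only [e]
    rw [int_sub (((i1 s hs.1).sub (i1 x hx)).const_mul _) i2,
      int_const_mul, int_sub (i1 s hs.1) (i1 x hx),
      slope_def_field, ha, hb]
    simp only [hv]
    ring
  have ca : ContinuousOn a (Icc 0 L) := fun x hx => (hA x hx).continuousWithinAt
  have cb : ContinuousOn b (Icc 0 L) := by
    obtain ⟨f0, f1, -, -, hd⟩ := h.derivXX L hL
    intro x hx
    rw [hb]
    exact (hd v _ hvH1 x hx).continuousWithinAt
  set V : ℝ → ℝ := fun x => ∫ y in x..L, v y with hV
  have dV : ∀ x, HasDerivAt V (-v x) x := fun x =>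
    intervalIntegral.integral_hasDerivAt_left (cv.intervalIntegrable _ _)
      (cv.stronglyMeasurableAtFilter _ _) cv.continuousAt
  have cV : Continuous V := continuous_iff_continuousAt.2 fun x => (dV x).continuousAt
  set β : ℝ → ℝ := fun x => b x + α / 2 * V x with hβ
  set aT : ℝ → ℝ := fun x => a x + α / 2 * x * V x with haT
  set c : ℝ → ℝ := fun x => (α - ν ^ 2) * aT x - α / 2 * v x - α / 2 * x * (ν * sin (ν * x)) with hc
  have caT : ContinuousOn aT (Icc 0 L) := ca.add (by fun_prop)
  have cc : ContinuousOn c (Icc 0 L) := by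
    refine ((continuousOn_const.mul caT).sub ?_).sub ?_ <;> fun_prop
  have cβ : ContinuousOn β (Icc 0 L) := cb.add (by fun_prop)
  have eβ : ∀ x ∈ Ioc 0 L, ∫ y in 0..x, kx x y * v y = β x := by
    intro x hx
    have hxI : x ∈ Icc 0 L := ⟨hx.1.le, hx.2⟩
    have hi : IntervalIntegrable (fun y => kx x y * v y) volume 0 L :=
      (MemLp.ii_mu hL.le (hkxm x hxI)).mul_continuousOn cv.continuousOn
    have h1 := integral_add_adjacent_intervals (b := x)
      (hi.mono_set (uIcc_subset_left ⟨hx.1.le, hx.2⟩))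
      (hi.mono_set (uIcc_subset_right ⟨hx.1.le, hx.2⟩))
    rw [h.integral_kx_above hx cv, int_const_mul] at h1
    simp only [hβ, hV, hb]
    simp only [hv] at h1 ⊢
    linarith
  have eT : ∀ x ∈ Ioc 0 L, ∫ y in 0..x, kbar α k x y * v y = aT x := by
    intro x hx
    have hxI : x ∈ Icc 0 L := ⟨hx.1.le, hx.2⟩
    have hi : IntervalIntegrable (fun y => kbar α k x y * v y) volume 0 L :=
      (MemLp.ii_mu hL.le (hkb x hxI)).mul_continuousOn cv.continuousOn
    have h1 := integral_add_adjacent_intervals (b := x)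
      (hi.mono_set (uIcc_subset_left ⟨hx.1.le, hx.2⟩))
      (hi.mono_set (uIcc_subset_right ⟨hx.1.le, hx.2⟩))
    have h2 : ∫ y in x..L, kbar α k x y * v y = -(α / 2) * x * V x := by
      rw [hV, ← int_const_mul]
      exact int_congr_of_le hx.2 fun y hy => by simp [kbar, hy.1]
    rw [h2] at h1
    simp only [haT, ha]
    simp only [hv] at h1 ⊢
    linarith
  have eY : ∀ x ∈ Ioc 0 L, ∫ y in 0..x, ky x y * -(ν * sin (ν * y))
      = α / 2 * x * (ν * sin (ν * x)) + ν ^ 2 * aT x := by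
    intro x hx
    have hxI : x ∈ Icc 0 L := ⟨hx.1.le, hx.2⟩
    have h1 := ((h.memH1 L hL x hxI).mono hx.2).integral_mul hx.1.le ddv (by fun_prop)
    rw [h.kbar_diag hx.1.le] at h1
    have h2 : ∫ y in 0..x, -(ν ^ 2) * v y * kbar α k x y = -(ν ^ 2) * aT x := by
      rw [← eT x hx, ← int_const_mul]
      exact int_congr fun y _ => by ring
    rw [h2] at h1
    have h3 : ∫ y in 0..x, ky x y * -(ν * sin (ν * y)) = ∫ y in 0..x, -(ν * sin (ν * y)) * ky x y :=
      int_congr fun y _ => by ring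
    rw [h3, h1]
    simp; ring
  have weak : ∀ w dw : ℝ → ℝ, IsH1 L w dw →
      -(∫ x in 0..L, β x * dw x) + w L * β L = ∫ x in 0..L, c x * w x := by
    intro w dw hw
    have h1 := h.weak L hL v _ w dw hvH1 hw
    rw [int_congr_of_le hL.le (f := fun x => (∫ y in 0..x, kx x y * v y) * dw x)
        (g := fun x => β x * dw x) (fun x hx => by rw [eβ x hx]),
      eβ L ⟨hL, le_rfl⟩,
      int_congr_of_le hL.le (f := fun x => (∫ y in 0..x, ky x y * -(ν * sin (ν * y))) * w x)
        (g := fun x => (α / 2 * x * (ν * sin (ν * x)) + ν ^ 2 * aT x) * w x)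
        (fun x hx => by rw [eY x hx]),
      int_congr_of_le hL.le (f := fun x => (∫ y in 0..x, k x y * v y) * w x)
        (g := fun x => aT x * w x) (fun x hx => by
          rw [← eT x hx]
          congr 1
          exact int_congr_of_le hx.1.le fun y hy => by simp [kbar, hy.2])] at h1
    have hwc := hw.continuousOn hL.le
    have i1 : IntervalIntegrable (fun x => (α / 2 * x * (ν * sin (ν * x)) + ν ^ 2 * aT x)
        * w x) volume 0 L := by
      refine ContinuousOn.intervalIntegrable_of_Icc hL.le (ContinuousOn.mul ?_ hwc)
      exact ContinuousOn.add (by fun_prop) (continuousOn_const.mul caT)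
    have i2 : IntervalIntegrable (fun x => aT x * w x) volume 0 L :=
      (caT.mul hwc).intervalIntegrable_of_Icc hL.le
    have i3 : IntervalIntegrable (fun x => v x * w x) volume 0 L :=
      (cv.continuousOn.mul hwc).intervalIntegrable_of_Icc hL.le
    have e : ∀ x, c x * w x = α * (aT x * w x) - α / 2 * (v x * w x)
        - (α / 2 * x * (ν * sin (ν * x)) + ν ^ 2 * aT x) * w x := fun x => by
      simp only [hc]; ring
    simp only [e]
    rw [int_sub ((i2.const_mul _).sub (i3.const_mul _)) i1,
      int_sub (i2.const_mul _) (i3.const_mul _),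
      int_const_mul, int_const_mul]
    linarith
  -- `β` is the primitive of `c`
  obtain ⟨c', hc', hce⟩ := exists_cont_ext hL.le cc
  obtain ⟨β', hβ', hβe⟩ := exists_cont_ext hL.le cβ
  set C : ℝ → ℝ := fun x => ∫ s in 0..x, c' s with hC
  have dC : ∀ x, HasDerivAt C (c' x) x := fun x =>
    integral_hasDerivAt_right (hc'.intervalIntegrable _ _)
      (hc'.stronglyMeasurableAtFilter _ _) hc'.continuousAt
  have cC : Continuous C := continuous_iff_continuousAt.2 fun x => (dC x).continuousAt
  have hC0 : C 0 = 0 := by simp [hC]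
  have weak2 : ∀ w dw : ℝ → ℝ, IsH1 L w dw →
      ∫ x in 0..L, (C x - β' x) * dw x = w L * (C L - β L) := by
    intro w dw hw
    have h1 := weak w dw hw
    have h2 := hw.integral_mul hL.le dC hc'
    have hdw := hw.intervalIntegrable hL.le
    have e1 : ∫ x in 0..L, c' x * w x = ∫ x in 0..L, c x * w x :=
      int_congr_of_le hL.le fun x hx => by rw [hce x (Ioc_subset_Icc_self hx)]
    have e2 : ∫ x in 0..L, β' x * dw x = ∫ x in 0..L, β x * dw x :=
      int_congr_of_le hL.le fun x hx => by rw [hβe x (Ioc_subset_Icc_self hx)]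
    simp only [sub_mul]
    rw [int_sub (hdw.continuousOn_mul cC.continuousOn)
      (hdw.continuousOn_mul hβ'.continuousOn), h2, e1, e2, hC0]
    linarith
  have hend : C L - β L = 0 := by
    have := weak2 (fun _ => 1) (fun _ => 0)
      (isH1_of_hasDerivAt (fun x => hasDerivAt_const x 1) continuous_const)
    simpa using this.symm
  have hsq : ∫ x in 0..L, (C x - β' x) * (C x - β' x) = 0 := by
    rw [weak2 (fun x => ∫ s in 0..x, (C s - β' s)) (fun x => C x - β' x)
      (isH1_of_hasDerivAt (fun x => integral_hasDerivAt_right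
        ((cC.sub hβ').intervalIntegrable _ _) ((cC.sub hβ').stronglyMeasurableAtFilter _ _)
        (cC.sub hβ').continuousAt) (cC.sub hβ')), hend, mul_zero]
  have hCβ : ∀ x ∈ Icc 0 L, β x = C x := by
    intro x hx
    by_contra hne
    have hpos := integral_pos hL
      ((cC.sub hβ').mul (cC.sub hβ')).continuousOn (fun y _ => mul_self_nonneg _)
      ⟨x, hx, mul_self_pos.2 (by
        show C x - β' x ≠ 0
        rw [hβe x hx]
        exact fun h0 => hne (sub_eq_zero.1 h0).symm)⟩
    simp only [Pi.mul_apply, Pi.sub_apply] at hpos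
    linarith
  have h00 : (0 : ℝ) ∈ Icc 0 L := ⟨le_rfl, hL.le⟩
  refine ⟨hA, fun x hx => ?_, ?_, ?_⟩
  · have h1 : HasDerivWithinAt β (c x) (Icc 0 L) x := by
      rw [← hce x hx]
      exact (dC x).hasDerivWithinAt.congr hCβ (hCβ x hx)
    have h2 := h1.sub ((dV x).const_mul (α / 2)).hasDerivWithinAt
    have h3 : HasDerivWithinAt b (c x - α / 2 * -v x) (Icc 0 L) x := by
      refine h2.congr (fun y _ => ?_) ?_ <;> simp [hβ]
    refine h3.congr_deriv ?_
    simp only [hc, haT, hV]; ring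
  · rw [ha]
    refine (int_congr_of_le hL.le (g := fun _ => 0) fun y hy => ?_).trans (by simp)
    simp [kbar, hy.1]
  · have := hCβ 0 h00
    rw [hC0] at this
    simp only [hβ, hV] at this
    linarith

end IsWeakKernel

lemma isUniqueWeakKernel_kern (α : ℝ) : IsUniqueWeakKernel α (kern α) (kernX α) (kernY α) := by
  refine ⟨isWeakKernel_kern α, fun k' kx' ky' h' x y hy hyx => ?_⟩
  have h := isWeakKernel_kern α
  have hx : 0 ≤ x := hy.trans hyx
  set L := x + 1 with hLdef
  have hL : 0 < L := by linarith
  have hxI : x ∈ Icc 0 L := ⟨hx, by linarith⟩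
  have hc' := (h'.memH1 L hL x hxI).continuousOn hL.le
  have hc := (h.memH1 L hL x hxI).continuousOn hL.le
  have key := eq_zero_of_cos hL
    (f := fun y => kbar α k' x y - kbar α (kern α) x y) (hc'.sub hc) (fun j => ?_) y
    ⟨hy, by linarith⟩
  · simpa [kbar, hyx, sub_eq_zero] using key
  · obtain ⟨a1, b1, z1, w1⟩ := h'.moment_ode hL (ν := j * π / L) rfl rfl
    obtain ⟨a2, b2, z2, w2⟩ := h.moment_ode hL (ν := j * π / L) rfl rfl
    have h0 := linear_ode_eq_zero (c := α - (j * π / L) ^ 2) (L := L)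
      (u := fun x => (∫ y in 0..L, kbar α k' x y * cos (j * π / L * y))
        - ∫ y in 0..L, kbar α (kern α) x y * cos (j * π / L * y))
      (v := fun x => (∫ y in 0..L, kx' x y * cos (j * π / L * y))
        - ∫ y in 0..L, kernX α x y * cos (j * π / L * y))
      (fun x hx => (a1 x hx).sub (a2 x hx))
      (fun x hx => ((b1 x hx).sub (b2 x hx)).congr_deriv (by ring))
      (sub_eq_zero.2 (z1.trans z2.symm)) (sub_eq_zero.2 (w1.trans w2.symm)) x hxI
    rw [← int_sub] at h0
    · refine Eq.trans ?_ h0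
      refine int_congr fun y _ => ?_
      have : (j : ℝ) * (π * y / L) = j * π / L * y := by ring
      simp only [this]; ring
    · exact (hc'.intervalIntegrable_of_Icc hL.le).mul_continuousOn (by fun_prop)
    · exact (hc.intervalIntegrable_of_Icc hL.le).mul_continuousOn (by fun_prop)


/-! ## Diagonalization of the diffusion matrix -/

section LinearAlgebra

variable {n : ℕ} {H B Q : Matrix (Fin n) (Fin n) ℝ} {σ : Fin n → ℝ}

open scoped MatrixOrder Matrix.Norms.L2Operator in
lemma exists_conjTranspose_mul_self {P : Matrix (Fin n) (Fin n) ℝ} (hP : P.PosSemidef) :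
    ∃ C : Matrix (Fin n) (Fin n) ℝ, P = Cᴴ * C :=
  CStarAlgebra.nonneg_iff_eq_star_mul_self.mp hP.nonneg

lemma exists_isDiagonalization (hH : H.PosDef) (hP : (H * B).PosDef) :
    ∃ (Q : Matrix (Fin n) (Fin n) ℝ) (σ : Fin n → ℝ), (∀ i, 0 < σ i) ∧ IsDiagonalization B Q σ := by
  obtain ⟨C, hC⟩ := exists_conjTranspose_mul_self hP.posSemidef
  have hHu : IsUnit H.det := (Matrix.isUnit_iff_isUnit_det _).1 hH.isUnit
  have hCu : IsUnit C.det := by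
    have h1 : IsUnit (Cᴴ * C).det := hC ▸ (Matrix.isUnit_iff_isUnit_det _).1 hP.isUnit
    rw [Matrix.det_mul] at h1
    exact isUnit_of_mul_isUnit_right h1
  have hN : (C * H⁻¹ * Cᴴ).PosDef := by
    refine hH.inv.mul_mul_conjTranspose_same ?_
    intro x y hxy
    have := congrArg (fun v => v ᵥ* C⁻¹) hxy
    simpa [Matrix.vecMul_vecMul, Matrix.mul_nonsing_inv _ hCu] using this
  have hB : B = C⁻¹ * (C * H⁻¹ * Cᴴ) * C := by
    calc B = H⁻¹ * (H * B) := by rw [← mul_assoc, Matrix.nonsing_inv_mul _ hHu, one_mul]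
      _ = H⁻¹ * (Cᴴ * C) := by rw [hC]
      _ = (C⁻¹ * C) * (H⁻¹ * (Cᴴ * C)) := by rw [Matrix.nonsing_inv_mul _ hCu, one_mul]
      _ = C⁻¹ * (C * H⁻¹ * Cᴴ) * C := by simp only [mul_assoc]
  set U : Matrix (Fin n) (Fin n) ℝ := hN.isHermitian.eigenvectorUnitary.1 with hU
  have hUU : star U * U = 1 := by simp [hU]
  have hUU' : U * star U = 1 := by simp [hU]
  have hsp := hN.isHermitian.spectral_theorem
  rw [Unitary.conjStarAlgAut_apply] at hsp
  refine ⟨star U * C, hN.isHermitian.eigenvalues, hN.eigenvalues_pos, ?_, ?_⟩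
  · rw [Matrix.det_mul]
    refine IsUnit.mul ?_ hCu
    have : (star U).det * U.det = 1 := by rw [← Matrix.det_mul, hUU, Matrix.det_one]
    exact IsUnit.of_mul_eq_one _ this
  · have hinv : (star U * C)⁻¹ = C⁻¹ * U := by
      refine Matrix.inv_eq_left_inv ?_
      calc C⁻¹ * U * (star U * C) = C⁻¹ * (U * star U) * C := by simp only [mul_assoc]
        _ = 1 := by rw [hUU', mul_one, Matrix.nonsing_inv_mul _ hCu]
    rw [hinv]
    conv_lhs => rw [hB, hsp]
    simp only [mul_assoc, RCLike.ofReal_real_eq_id, Function.id_comp, hU]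

lemma IsDiagonalization.pos (hH : H.PosSemidef) (hP : ∀ z ≠ 0, 0 < z ⬝ᵥ ((H * B) *ᵥ z))
    (hd : IsDiagonalization B Q σ) (i : Fin n) : 0 < σ i := by
  obtain ⟨hQ, hB⟩ := hd
  set v : Fin n → ℝ := Q⁻¹ *ᵥ Pi.single i 1 with hv
  have hQv : Q *ᵥ v = Pi.single i 1 := by
    rw [hv, Matrix.mulVec_mulVec, Matrix.mul_nonsing_inv _ hQ, Matrix.one_mulVec]
  have hv0 : v ≠ 0 := by
    intro h0
    have h1 := congrFun (hQv.symm.trans (by rw [h0, Matrix.mulVec_zero])) i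
    simp at h1
  have hBv : B *ᵥ v = σ i • v := by
    rw [hB, ← Matrix.mulVec_mulVec, hQv, ← Matrix.mulVec_mulVec, Matrix.diagonal_mulVec_single,
      mul_one, hv, ← Matrix.mulVec_smul, ← Pi.single_smul, smul_eq_mul, mul_one]
  have h1 := hP v hv0
  rw [← Matrix.mulVec_mulVec, hBv, Matrix.mulVec_smul, dotProduct_smul, smul_eq_mul] at h1
  have h2 : 0 ≤ v ⬝ᵥ (H *ᵥ v) := by simpa using hH.dotProduct_mulVec_nonneg v
  exact pos_of_mul_pos_left h1 h2

end LinearAlgebra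

lemma isOpen_simplex (n : ℕ) : IsOpen (simplex n) := by
  have : simplex n = (⋂ i, {u : Fin n → ℝ | 0 < u i}) ∩ {u | ∑ i, u i < 1} := by
    ext u; simp [simplex]
  rw [this]
  refine (isOpen_iInter_of_finite fun i => ?_).inter ?_
  · exact isOpen_lt continuous_const (continuous_apply i)
  · exact isOpen_lt (by fun_prop) continuous_const

section Hessian

variable {n : ℕ} {h : (Fin n → ℝ) → ℝ} {u : Fin n → ℝ}

lemma hessian_apply (hd : DifferentiableAt ℝ (fderiv ℝ h) u) (i j : Fin n) :
    hessian h u i j = fderiv ℝ (fderiv ℝ h) u (Pi.single i 1) (Pi.single j 1) := by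
  have h1 : HasFDerivAt (fun w => gradVec h w j)
      ((ContinuousLinearMap.apply ℝ ℝ (Pi.single j 1 : Fin n → ℝ)).comp
        (fderiv ℝ (fderiv ℝ h) u)) u :=
    (ContinuousLinearMap.apply ℝ ℝ (Pi.single j 1 : Fin n → ℝ)).hasFDerivAt.comp u hd.hasFDerivAt
  simp [hessian, h1.fderiv]

lemma dotProduct_hessian (hd : DifferentiableAt ℝ (fderiv ℝ h) u) (z : Fin n → ℝ) :
    z ⬝ᵥ (hessian h u *ᵥ z) = fderiv ℝ (fderiv ℝ h) u z z := by
  have hz : z = ∑ i, z i • (Pi.single i 1 : Fin n → ℝ) := by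
    ext j; simp [Finset.sum_apply, Pi.single_apply]
  have h1 : fderiv ℝ (fderiv ℝ h) u z z = ∑ i, z i * ∑ j, z j * hessian h u i j := by
    conv_lhs => rw [hz]
    simp only [map_sum, map_smul, _root_.sum_apply, _root_.smul_apply, smul_eq_mul,
      mul_sum, hessian_apply hd]
    rw [sum_comm]
    refine sum_congr rfl fun i _ => sum_congr rfl fun j _ => ?_
    ring
  rw [h1]
  simp only [dotProduct, Matrix.mulVec]
  refine sum_congr rfl fun i _ => ?_
  congr 1
  exact sum_congr rfl fun j _ => mul_comm _ _

lemma hessian_posSemidef {s : Set (Fin n → ℝ)} (hs : IsOpen s) (hu : u ∈ s)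
    (hc : ContDiffOn ℝ 2 h s) (hconv : ConvexOn ℝ s h) : (hessian h u).PosSemidef := by
  have hat : ContDiffAt ℝ 2 h u := hc.contDiffAt (hs.mem_nhds hu)
  have hd : DifferentiableAt ℝ (fderiv ℝ h) u :=
    (hat.fderiv_right (m := 1) (by norm_num)).differentiableAt (by norm_num)
  have hsym := hat.isSymmSndFDerivAt (by simp)
  refine Matrix.PosSemidef.of_dotProduct_mulVec_nonneg ?_ fun z => ?_
  · ext i j
    simp only [Matrix.conjTranspose_apply, star_trivial, hessian_apply hd]
    exact hsym _ _
  rw [star_trivial, dotProduct_hessian hd]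
  set g : ℝ → Fin n → ℝ := fun r => u + r • z with hg
  have hgc : Continuous g := by fun_prop
  have hg' : ∀ r, HasDerivAt g z r := fun r => by
    simpa [hg] using ((hasDerivAt_id r).smul_const z).const_add u
  obtain ⟨δ, hδ, hball⟩ := Metric.isOpen_iff.1 (hs.preimage hgc) 0 (by simpa [hg] using hu)
  have hdiff : ∀ r ∈ Metric.ball (0 : ℝ) δ, HasDerivAt (h ∘ g) (fderiv ℝ h (g r) z) r := by
    intro r hr
    have : DifferentiableAt ℝ h (g r) :=
      ((hc.contDiffAt (hs.mem_nhds (hball hr))).differentiableAt (by norm_num))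
    exact this.hasFDerivAt.comp_hasDerivAt r (hg' r)
  have hcv : ConvexOn ℝ (Metric.ball (0 : ℝ) δ) (h ∘ g) := by
    refine ⟨convex_ball _ _, fun x hx y hy a b ha hb hab => ?_⟩
    have h1 := hconv.2 (hball hx) (hball hy) ha hb hab
    have h2 : g (a • x + b • y) = a • g x + b • g y := by
      simp only [hg]
      have : u = (a + b) • u := by rw [hab, one_smul]
      conv_lhs => rw [this]
      simp only [smul_eq_mul]
      module
    simp only [smul_eq_mul] at h1 h2 ⊢
    simpa [Function.comp, h2] using h1
  have hmono := hcv.monotoneOn_deriv fun r hr => (hdiff r hr).differentiableAt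
  have hmono2 : MonotoneOn (fun r => fderiv ℝ h (g r) z) (Metric.ball (0 : ℝ) δ) := by
    intro x hx y hy hxy
    have := hmono hx hy hxy
    rwa [(hdiff x hx).deriv, (hdiff y hy).deriv] at this
  have h0 : g 0 = u := by simp [hg]
  have hd2 : HasDerivAt (fun r => fderiv ℝ h (g r) z) (fderiv ℝ (fderiv ℝ h) u z z) 0 := by
    have h1 : HasFDerivAt (fderiv ℝ h) (fderiv ℝ (fderiv ℝ h) u) (g 0) := h0 ▸ hd.hasFDerivAt
    have h2 := h1.comp_hasDerivAt (0 : ℝ) (hg' 0)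
    exact ((ContinuousLinearMap.apply ℝ ℝ z).hasFDerivAt.comp_hasDerivAt (0 : ℝ) h2)
  refine (hd2.hasDerivWithinAt (s := Metric.ball (0 : ℝ) δ)).nonneg_of_monotoneOn ?_ hmono2
  have hb := Metric.ball_mem_nhds (0 : ℝ) hδ
  rw [accPt_principal_iff_nhdsWithin, sdiff_eq, inter_comm, nhdsWithin_inter_of_mem']
  · infer_instance
  · exact mem_nhdsWithin_of_mem_nhds hb

/-- The entropy structure makes the Hessian and its product with the diffusion matrix positive
definite at points where the mobility is symmetric. -/
lemma IsEntropyDensity.posDef {A : (Fin n → ℝ) → Matrix (Fin n) (Fin n) ℝ}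
    (hA : IsEntropyDensity A h) (hu : u ∈ simplex n) (hsymm : (mobility A h u).IsSymm) :
    (hessian h u).PosDef ∧ (hessian h u * A u).PosDef := by
  have hconvS : Convex ℝ (simplex n) := by
    have hE : simplex n = (⋂ i, {u : Fin n → ℝ | 0 < u i}) ∩ {u | ∑ i, u i < 1} := by
      ext u; simp [simplex]
    rw [hE]
    refine (convex_iInter fun i => ?_).inter ?_
    · exact convex_halfSpace_gt (f := fun u : Fin n → ℝ => u i) ⟨fun _ _ => rfl, fun _ _ => rfl⟩ 0
    · exact convex_halfSpace_lt (f := fun u : Fin n → ℝ => ∑ i, u i)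
        ⟨fun x y => by simp [sum_add_distrib], fun c x => by simp [mul_sum]⟩ 1
  have hH : (hessian h u).PosSemidef := hessian_posSemidef (isOpen_simplex n) hu hA.contDiff
    (hA.strictConvex.convexOn.subset subset_closure hconvS)
  obtain ⟨a, ha, m, hm, hco⟩ := hA.coercive
  have hpos : ∀ z : Fin n → ℝ, z ≠ 0 → 0 < z ⬝ᵥ ((hessian h u * A u) *ᵥ z) := by
    intro z hz
    refine lt_of_lt_of_le (mul_pos ha ?_) (hco z u hu)
    obtain ⟨i, hi⟩ := Function.ne_iff.1 hz
    refine Finset.sum_pos' (fun j _ => ?_) ⟨i, Finset.mem_univ i, ?_⟩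
    · exact mul_nonneg (Real.rpow_nonneg (hu.1 j).le _) (sq_nonneg _)
    · exact mul_pos (Real.rpow_pos_of_pos (hu.1 i) _) (by simpa using pow_pos (abs_pos.2 hi) 2)
  have hPu : IsUnit (hessian h u * A u).det := by
    by_contra hne
    have h0 : (hessian h u * A u).det = 0 := not_not.1 fun h => hne (isUnit_iff_ne_zero.2 h)
    obtain ⟨v, hv, hv2⟩ := Matrix.exists_mulVec_eq_zero_iff.2 h0
    have := hpos v hv
    rw [hv2] at this
    simp at this
  have hHu : IsUnit (hessian h u).det := by
    rw [Matrix.det_mul] at hPu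
    exact isUnit_of_mul_isUnit_left hPu
  have hHsym : (hessian h u)ᵀ = hessian h u := by
    have := hH.isHermitian
    rwa [Matrix.IsHermitian, Matrix.conjTranspose_eq_transpose_of_trivial] at this
  have hP : hessian h u * A u = hessian h u * mobility A h u * hessian h u := by
    rw [mobility, mul_assoc, mul_assoc (A u), Matrix.nonsing_inv_mul _ hHu, mul_one]
  refine ⟨hH.posDef_iff_isUnit.2 ((Matrix.isUnit_iff_isUnit_det _).2 hHu),
    Matrix.PosDef.of_dotProduct_mulVec_pos ?_ fun z hz => by simpa using hpos z hz⟩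
  rw [Matrix.IsHermitian, Matrix.conjTranspose_eq_transpose_of_trivial, hP]
  simp only [Matrix.transpose_mul, hHsym, hsymm.eq, mul_assoc]

end Hessian

/-! ## The thickness equation -/

lemma stabilizesThickness_linear (hm : 0 < m) : StabilizesThickness m 1 (fun _ w => -m * w) := by
  refine ⟨⟨.of_forall fun t => by fun_prop, fun w => aestronglyMeasurable_const,
    fun R a b _ _ _ => ⟨fun _ => m * R, integrableOn_const (by simp), .of_forall
      fun t w hw => ?_⟩⟩, fun d => ⟨fun t => d * exp (-m * t), ?_, ?_, ?_⟩⟩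
  · rw [abs_mul, abs_neg, abs_of_pos hm]
    exact mul_le_mul_of_nonneg_left hw hm.le
  · intro t _
    have hc : Continuous fun s : ℝ => -m * (d * exp (-m * s)) := by fun_prop
    refine ⟨hc.intervalIntegrable _ _, ?_⟩
    have hder : ∀ s ∈ uIcc 0 t, HasDerivAt (fun s => d * exp (-m * s))
        (-m * (d * exp (-m * s))) s := by
      intro s _
      have := (((hasDerivAt_id s).const_mul (-m)).exp).const_mul d
      simp only [id] at this
      refine this.congr_deriv ?_
      ring
    rw [integral_eq_sub_of_hasDerivAt hder (hc.intervalIntegrable _ _)]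
    simp
  · intro de hde t ht
    simp only [mem_Ici] at ht
    have hint : ∀ r ≥ 0, IntervalIntegrable (fun s => -m * de s) volume 0 r :=
      fun r hr => (hde r hr).1
    have hcont : ContinuousOn de (Icc 0 t) := by
      have h1 : ContinuousOn (fun r => (∫ s in 0..r, -m * de s) + d) (Icc 0 t) := by
        have := continuousOn_primitive_interval (a := 0) (b := t)
          (f := fun s => -m * de s) (μ := volume) (by
            rw [uIcc_of_le ht, integrableOn_Icc_iff_integrableOn_Ioc]
            exact (intervalIntegrable_iff_integrableOn_Ioc_of_le ht).1 (hint t ht))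
        rw [uIcc_of_le ht] at this
        exact this.add continuousOn_const
      exact h1.congr fun r hr => (hde r hr.1).2
    have hder : ∀ r ∈ Ioo 0 t, HasDerivAt de (-m * de r) r := by
      intro r hr
      have hcr : ContinuousAt de r := hcont.continuousAt (Icc_mem_nhds hr.1 hr.2)
      have hmeas : StronglyMeasurableAtFilter (fun s => -m * de s) (𝓝 r) volume :=
        ((continuousOn_const.mul hcont).mono Ioo_subset_Icc_self).stronglyMeasurableAtFilter
          isOpen_Ioo r hr
      have h2 := (integral_hasDerivAt_right (hint r hr.1.le) hmeas
        (continuousAt_const.mul hcr)).add_const d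
      refine h2.congr_of_eventuallyEq ?_
      filter_upwards [Ioi_mem_nhds hr.1] with s hs
      exact (hde s (le_of_lt hs)).2
    have h0 : de 0 = d := by simpa using (hde 0 le_rfl).2
    have hg : ∀ r ∈ Ico 0 t, HasDerivWithinAt (fun s => de s * exp (m * s)) 0 (Ici r) r := by
      intro r hr
      have he : HasDerivAt (fun s => exp (m * s)) (m * exp (m * r)) r := by
        simpa [mul_comm] using ((hasDerivAt_id r).const_mul m).exp
      rcases eq_or_lt_of_le hr.1 with h | h
      · subst h
        have hd : HasDerivWithinAt de (-m * de 0) (Ici 0) 0 := by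
          have hcI : ContinuousWithinAt (fun s => -m * de s) (Ici 0) 0 := by
            have h3 := (continuousOn_const.mul hcont).continuousWithinAt (x := 0) (s := Icc 0 t)
              (f := fun s => -m * de s) ⟨le_rfl, ht⟩
            exact h3.mono_of_mem_nhdsWithin (Icc_mem_nhdsGE hr.2)
          have h4 := intervalIntegral.integral_hasDerivWithinAt_right (a := 0) (b := 0)
            (f := fun s => -m * de s) (s := Ici 0) (t := Ioi 0) (by simp)
            (by
              have h5 := ((continuousOn_const (c := -m)).mul hcont).mono
                (Ioo_subset_Icc_self (a := (0 : ℝ)) (b := t))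
              have h5 := h5.aestronglyMeasurable (μ := volume) measurableSet_Ioo
              exact ⟨Ioo 0 t, Ioo_mem_nhdsGT hr.2, h5⟩)
            (hcI.mono Ioi_subset_Ici_self)
          refine (h4.add_const d).congr_of_eventuallyEq ?_ (hde 0 le_rfl).2
          filter_upwards [self_mem_nhdsWithin] with s hs
          exact (hde s hs).2
        refine (hd.mul he.hasDerivWithinAt).congr_deriv ?_
        ring
      · refine (((hder r ⟨h, hr.2⟩).mul he).hasDerivWithinAt (s := Ici r)).congr_deriv ?_
        ring
    have hconst := constant_of_has_deriv_right_zero (f := fun s => de s * exp (m * s))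
      (a := 0) (b := t) (hcont.mul (by fun_prop)) hg t ⟨ht, le_rfl⟩
    simp only [mul_zero, Real.exp_zero, mul_one, h0] at hconst
    show de t = d * exp (-m * t)
    rw [← hconst, mul_assoc, ← exp_add]
    simp
  · intro t _
    rw [abs_mul, abs_of_pos (exp_pos _)]
    linarith

/-! ## The moving front -/

/-- `E` is a smooth positive function on the line which grows with constant speed `v` for
nonnegative times. -/
structure IsFront (v : ℝ) (E : ℝ → ℝ) : Prop where
  smooth : ContDiff ℝ ∞ E
  pos : ∀ t, 0 < E t
  speed_nonneg : 0 ≤ v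
  eq : ∀ t ≥ 0, E t = E 0 + t * v
  hasDerivAt : ∀ t ≥ 0, HasDerivAt E v t

lemma IsFront.cont (hE : IsFront v E) : Continuous E := hE.smooth.continuous

lemma exists_isFront (he : 0 < e0) (hv : 0 < v) : ∃ E : ℝ → ℝ, IsFront v E ∧ E 0 = e0 := by
  set δ : ℝ := e0 / (4 * v) with hδ
  have hδ0 : 0 < δ := by positivity
  set s : ℝ → ℝ := fun t => smoothTransition ((t + 2 * δ) / δ) with hs
  have hs1 : ∀ t, -δ ≤ t → s t = 1 := fun t ht =>
    smoothTransition.one_of_one_le ((one_le_div hδ0).2 (by linarith))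
  have hs0 : ∀ t, t ≤ -2 * δ → s t = 0 := fun t ht =>
    smoothTransition.zero_of_nonpos (div_nonpos_of_nonpos_of_nonneg (by linarith) hδ0.le)
  have hsc : ContDiff ℝ ∞ s := smoothTransition.contDiff.comp (by fun_prop)
  have heq : ∀ t, -δ ≤ t → e0 + v * (t * s t) = e0 + t * v := fun t ht => by
    rw [hs1 t ht]; ring
  refine ⟨fun t => e0 + v * (t * s t), ⟨by fun_prop, fun t => ?_, hv.le, fun t ht => ?_,
    fun t ht => ?_⟩, by simp⟩
  · have h1 : -2 * δ ≤ t * s t := by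
      rcases le_total t (-2 * δ) with h | h
      · rw [hs0 t h]; linarith
      · rcases le_total 0 t with h' | h'
        · have : 0 ≤ t * s t := mul_nonneg h' (smoothTransition.nonneg _)
          linarith
        · nlinarith [smoothTransition.le_one ((t + 2 * δ) / δ),
            smoothTransition.nonneg ((t + 2 * δ) / δ)]
    have h2 : v * (-2 * δ) = -(e0 / 2) := by rw [hδ]; field_simp; ring
    have h3 := mul_le_mul_of_nonneg_left h1 hv.le
    linarith
  · have := heq t (by linarith)
    simpa using this
  · have h1 : HasDerivAt (fun t => e0 + t * v) v t := by
      simpa using ((hasDerivAt_id t).mul_const v).const_add e0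
    refine h1.congr_of_eventuallyEq ?_
    filter_upwards [Ioi_mem_nhds (show -δ < t by linarith)] with r hr using heq r (le_of_lt hr)

namespace IsFront

lemma zero_le (h : IsFront v E) (ht : 0 ≤ t) : E 0 ≤ E t := by
  rw [h.eq t ht]; nlinarith [h.speed_nonneg]

lemma mono (h : IsFront v E) (hs : 0 ≤ s) (hst : s ≤ t) : E s ≤ E t := by
  rw [h.eq t (hs.trans hst), h.eq s hs]; nlinarith [h.speed_nonneg]

end IsFront

/-! ## Regular solutions of the target system and the energy estimate -/

/-- `w` is smooth and satisfies the zero flux conditions at `x = 0` and at the moving front. -/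
structure IsRegular (σ v : ℝ) (E : ℝ → ℝ) (w : ℝ → ℝ → ℝ) : Prop where
  smooth : Smooth2 w
  bdryZero : ∀ t ≥ 0, pdx w t 0 = 0
  bdryFront : ∀ t ≥ 0, σ * pdx w t (E t) + v * w t (E t) = 0

/-- The residual of `w` in the equation `∂ₜw - σ ∂ₓₓw + λ w = 0`. -/
def resid (σ lam : ℝ) (w : ℝ → ℝ → ℝ) (t x : ℝ) : ℝ := pdt w t x - σ * pdx (pdx w) t x + lam * w t x

lemma Smooth2.pdt_sub {f g : ℝ → ℝ → ℝ} (hf : Smooth2 f) (hg : Smooth2 g) :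
    CrossDiffusion.pdt (fun t x => f t x - g t x)
      = fun t x => CrossDiffusion.pdt f t x - CrossDiffusion.pdt g t x := by
  ext t x; exact ((hf.hasDerivAt_pdt t x).sub (hg.hasDerivAt_pdt t x)).deriv

lemma Smooth2.pdx_sub {f g : ℝ → ℝ → ℝ} (hf : Smooth2 f) (hg : Smooth2 g) :
    CrossDiffusion.pdx (fun t x => f t x - g t x)
      = fun t x => CrossDiffusion.pdx f t x - CrossDiffusion.pdx g t x := by
  ext t x; exact ((hf.hasDerivAt_pdx t x).sub (hg.hasDerivAt_pdx t x)).deriv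

lemma Smooth2.resid {f : ℝ → ℝ → ℝ} (hf : Smooth2 f) (σ lam : ℝ) : Smooth2 (resid σ lam f) :=
  (hf.pdt.sub ((Smooth2.const σ).mul hf.pdx.pdx)).add ((Smooth2.const lam).mul hf)

lemma resid_sub {f g : ℝ → ℝ → ℝ} (hf : Smooth2 f) (hg : Smooth2 g) (σ lam t x : ℝ) :
    resid σ lam (fun t x => f t x - g t x) t x = resid σ lam f t x - resid σ lam g t x := by
  unfold resid
  rw [hf.pdt_sub hg, hf.pdx_sub hg, hf.pdx.pdx_sub hg.pdx]
  ring

lemma IsRegular.sub {f g : ℝ → ℝ → ℝ} (hf : IsRegular σ v E f)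
    (hg : IsRegular σ v E g) : IsRegular σ v E (fun t x => f t x - g t x) := by
  refine ⟨hf.smooth.sub hg.smooth, fun t ht => ?_, fun t ht => ?_⟩
  · rw [hf.smooth.pdx_sub hg.smooth]
    simp [hf.bdryZero t ht, hg.bdryZero t ht]
  · rw [hf.smooth.pdx_sub hg.smooth]
    linear_combination hf.bdryFront t ht - hg.bdryFront t ht

lemma Smooth2.continuous_integral (hG : Smooth2 G)
    (ha : ContDiff ℝ ∞ a) (c : ℝ) : Continuous fun t => ∫ y in c..a t, G t y := by
  have h := smooth2_integral (F := fun p y => G p.1 y) (a := fun t _ => a t)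
    (hG.comp (contDiff_fst.fst.prodMk contDiff_snd)) (Smooth2.of_fst ha) c
  exact (h.comp_curve contDiff_id (contDiff_const (c := 0))).continuous

/-- The energy estimate for the damped diffusion equation on the growing domain. -/
lemma IsRegular.energy (hlam : 0 < lam) (hE : IsFront v E) (hw : IsRegular σ v E w) (hT : 0 ≤ T) :
    exp (lam * T) * (∫ x in 0..E T, w T x ^ 2) + ∫ t in 0..T, exp (lam * t)
          * (v * w t (E t) ^ 2 + 2 * σ * ∫ x in 0..E t, pdx w t x ^ 2)
      ≤ (∫ x in 0..E 0, w 0 x ^ 2) + lam⁻¹ * ∫ t in 0..T, exp (lam * t)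
            * ∫ x in 0..E t, resid σ lam w t x ^ 2 := by
  have hs := hw.smooth
  have hsq : ∀ {g : ℝ → ℝ → ℝ}, Smooth2 g → Smooth2 (fun t x => g t x ^ 2) := fun hg => by
    simpa [sq] using hg.mul hg
  have hi : ∀ {g : ℝ → ℝ → ℝ}, Smooth2 g → ∀ t a b, IntervalIntegrable (g t) volume a b :=
    fun hg t a b => (hg.slice t).continuous.intervalIntegrable a b
  set f := resid σ lam w with hf
  have hfs : Smooth2 f := hs.resid σ lam
  set N : ℝ → ℝ := fun t => ∫ x in 0..E t, w t x ^ 2 with hN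
  set D : ℝ → ℝ := fun t => v * w t (E t) ^ 2 + 2 * σ * ∫ x in 0..E t, pdx w t x ^ 2 with hD
  set F : ℝ → ℝ := fun t => ∫ x in 0..E t, f t x ^ 2 with hF
  have hNd : ∀ t ≥ 0, HasDerivAt N (-D t - 2 * lam * N t
      + 2 * ∫ x in 0..E t, w t x * f t x) t := by
    intro t ht
    have h1 := (hsq hs).hasDerivAt_integral 0 (hE.hasDerivAt t ht)
    refine h1.congr_deriv ?_
    have h2 : ∀ x, pdt (fun t x => w t x ^ 2) t x = 2 * (w t x * f t x) - 2 * lam * (w t x ^ 2)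
        + 2 * σ * (w t x * pdx (pdx w) t x) := by
      intro x
      have : pdt (fun t x => w t x ^ 2) t x = 2 * w t x * pdt w t x := by
        exact
        ((hs.hasDerivAt_pdt t x).fun_pow 2).deriv.trans (by norm_num)
      rw [this, hf, resid]; ring
    have h3 : ∫ x in 0..E t, w t x * pdx (pdx w) t x
        = w t (E t) * pdx w t (E t) - ∫ x in 0..E t, pdx w t x ^ 2 := by
      rw [integral_mul_deriv_eq_deriv_mul
        (fun x _ => hs.hasDerivAt_pdx t x) (fun x _ => hs.pdx.hasDerivAt_pdx t x)
        (hi hs.pdx t _ _) (hi hs.pdx.pdx t _ _), hw.bdryZero t ht]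
      simp [sq]
    simp only [h2]
    rw [int_add (((hi (hs.mul hfs) t _ _).const_mul _).sub ((hi (hsq hs) t _ _).const_mul _))
      ((hi (hs.mul hs.pdx.pdx) t _ _).const_mul _),
      int_sub ((hi (hs.mul hfs) t _ _).const_mul _) ((hi (hsq hs) t _ _).const_mul _),
      int_const_mul, int_const_mul,
      int_const_mul, h3, hD, hN]
    linear_combination 2 * w t (E t) * hw.bdryFront t ht
  have hYoung : ∀ t ≥ 0, 2 * ∫ x in 0..E t, w t x * f t x ≤ lam * N t + lam⁻¹ * F t := by
    intro t _
    rw [hN, hF, ← int_const_mul, ← int_const_mul, ← int_const_mul, ← int_add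
        ((hi (hsq hs) t _ _).const_mul _) ((hi (hsq hfs) t _ _).const_mul _)]
    refine int_mono_on (hE.pos t).le ((hi (hs.mul hfs) t _ _).const_mul _)
      (((hi (hsq hs) t _ _).const_mul _).add ((hi (hsq hfs) t _ _).const_mul _)) fun x _ => ?_
    have h1 : lam * w t x ^ 2 + lam⁻¹ * f t x ^ 2 - 2 * (w t x * f t x)
        = lam⁻¹ * (lam * w t x - f t x) ^ 2 := by field_simp; ring
    have h2 : 0 ≤ lam⁻¹ * (lam * w t x - f t x) ^ 2 := by positivity
    linarith
  have hexp : ∀ t, HasDerivAt (fun t => exp (lam * t)) (lam * exp (lam * t)) t :=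
    fun t => by simpa [mul_comm] using ((hasDerivAt_id t).const_mul lam).exp
  have hDc : Continuous D :=
    (continuous_const.mul ((hs.comp_curve contDiff_id hE.smooth).continuous.pow 2)).add
      (continuous_const.mul ((hsq hs.pdx).continuous_integral hE.smooth 0))
  have hFc : Continuous F := (hsq hfs).continuous_integral hE.smooth 0
  have hNc : Continuous N := (hsq hs).continuous_integral hE.smooth 0
  have hec : Continuous fun t : ℝ => exp (lam * t) := by fun_prop
  have hWc : Continuous fun t => ∫ x in 0..E t, w t x * f t x :=
    (hs.mul hfs).continuous_integral hE.smooth 0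
  have hder : ∀ t ∈ uIcc 0 T, HasDerivAt (fun t => exp (lam * t) * N t)
      (lam * exp (lam * t) * N t + exp (lam * t) * (-D t - 2 * lam * N t
      + 2 * ∫ x in 0..E t, w t x * f t x)) t := by
    intro t ht
    rw [uIcc_of_le hT] at ht
    exact (hexp t).mul (hNd t ht.1)
  have hcd : Continuous fun t => lam * exp (lam * t) * N t + exp (lam * t) *
      (-D t - 2 * lam * N t + 2 * ∫ x in 0..E t, w t x * f t x) := by fun_prop
  have hftc := integral_eq_sub_of_hasDerivAt hder (hcd.intervalIntegrable _ _)
  have hle : ∫ t in 0..T, (lam * exp (lam * t) * N t + exp (lam * t) *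
      (-D t - 2 * lam * N t + 2 * ∫ x in 0..E t, w t x * f t x))
      ≤ ∫ t in 0..T, (lam⁻¹ * (exp (lam * t) * F t) - exp (lam * t) * D t) := by
    refine int_mono_on hT (hcd.intervalIntegrable _ _)
      cont_ii fun t ht => ?_
    have h1 := mul_le_mul_of_nonneg_left (hYoung t ht.1) (exp_pos (lam * t)).le
    linarith
  rw [hftc, int_sub cont_ii
    cont_ii, int_const_mul] at hle
  simp only [mul_zero, Real.exp_zero, one_mul] at hle
  linarith

/-! ## Sine approximation and linear equations -/

lemma Smooth2.hasDerivAt_curve {f : ℝ → ℝ → ℝ} (hf : Smooth2 f) (ha : HasDerivAt a a' t) :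
    HasDerivAt (fun s => f s (a s))
      (CrossDiffusion.pdt f t (a t) + a' * CrossDiffusion.pdx f t (a t)) t := by
  have h := (hf.differentiable (t, a t)).hasFDerivAt.comp_hasDerivAt t ((hasDerivAt_id t).prodMk ha)
  refine h.congr_deriv ?_
  have : ((1 : ℝ), a') = (1, 0) + a' • (0, 1) := by simp
  simp only [this, map_add, map_smul, smul_eq_mul, hf.pdt_eq_fderiv, hf.pdx_eq_fderiv]

lemma exists_sin_approx {g' : ℝ → ℝ} (hg : ∀ y, HasDerivAt g (g' y) y) (hg' : Continuous g')
    (h0 : g 0 = 0) (h1 : g 1 = 0) (hη : 0 < η) :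
    ∃ (c : ℕ → ℝ) (s : Finset ℕ), ∀ s', s ⊆ s' → ∀ y ∈ Icc (0 : ℝ) 1,
      |g y - ∑ n ∈ s', c n * sin (n * π * y)| ≤ η ∧
      |g' y - ∑ n ∈ s', c n * (n * π * cos (n * π * y))| ≤ η := by
  obtain ⟨a, ha⟩ := exists_cos_approx (L := 1) one_pos hg'.continuousOn (half_pos hη)
  refine ⟨fun n => a n / (n * π), a.support, fun s hs y hy => ?_⟩
  have hS : ∀ y, HasDerivAt (fun y => ∑ n ∈ s, a n / (n * π) * sin (n * π * y))
      (∑ n ∈ s, a n / (n * π) * (n * π * cos (n * π * y))) y := by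
    intro y
    refine HasDerivAt.fun_sum fun n _ => ?_
    have h := (((hasDerivAt_id y).const_mul ((n : ℝ) * π)).sin).const_mul (a n / (n * π))
    refine h.congr_deriv ?_
    simp only [id]
    ring
  have hsplit : ∀ y, (a.sum fun j b => b * cos (j * (π * y / 1)))
      = a 0 + ∑ n ∈ s, a n / (n * π) * (n * π * cos (n * π * y)) := by
    intro y
    rw [Finsupp.sum_of_support_subset _ (hs.trans (Finset.subset_insert 0 s)) _ (by simp)]
    have h2 : ∀ n ∈ insert 0 s, a n * cos (n * (π * y / 1)) = (if n = 0 then a 0 else 0)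
          + a n / (n * π) * (n * π * cos (n * π * y)) := by
      intro n _
      rcases eq_or_ne n 0 with rfl | hn
      · simp
      · have hn' : (n : ℝ) ≠ 0 := by exact_mod_cast hn
        have := Real.pi_ne_zero
        rw [if_neg hn, div_one, ← mul_assoc]
        field_simp
        ring
    rw [sum_congr rfl h2, sum_add_distrib]
    congr 1
    · simp
    · by_cases h0s : 0 ∈ s
      · rw [Finset.insert_eq_of_mem h0s]
      · rw [Finset.sum_insert h0s]; simp
  have key : ∀ b : ℝ, ∀ C : ℝ, (∀ y ∈ Icc (0 : ℝ) 1, |g' y - (∑ n ∈ s, a n / (n * π) *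
      (n * π * cos (n * π * y))) - b| ≤ C) → ∀ y ∈ Icc (0 : ℝ) 1,
      |g y - (∑ n ∈ s, a n / (n * π) * sin (n * π * y)) - b * y| ≤ C * y := by
    intro b C hC y hy
    have hd : ∀ y ∈ Icc (0 : ℝ) 1, HasDerivWithinAt (fun y => g y
        - (∑ n ∈ s, a n / (n * π) * sin (n * π * y)) - b * y)
        (g' y - (∑ n ∈ s, a n / (n * π) * (n * π * cos (n * π * y))) - b)
        (Icc 0 1) y := by
      intro y _
      have := (((hg y).sub (hS y)).sub ((hasDerivAt_id y).const_mul b)).hasDerivWithinAt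
        (s := Icc 0 1)
      exact this.congr_deriv (by simp)
    have := norm_image_sub_le_of_norm_deriv_le_segment' hd (C := C)
      (fun x hx => by simpa using hC x (Ico_subset_Icc_self hx)) y hy
    simpa [h0] using this
  have ha0 : |a 0| ≤ η / 2 := by
    have h2 := key (a 0) (η / 2) (fun y hy => by
      have := (ha y hy).le
      rw [hsplit] at this
      rwa [sub_sub, add_comm]) 1 ⟨zero_le_one, le_rfl⟩
    simpa [h1, sin_nat_mul_pi] using h2
  have hb : ∀ y ∈ Icc (0 : ℝ) 1, |g' y - ∑ n ∈ s, a n / (n * π) *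
      (n * π * cos (n * π * y))| ≤ η := by
    intro y hy
    have h3 := (ha y hy).le
    rw [hsplit] at h3
    have h4 := abs_add_le (g' y - (a 0 + ∑ n ∈ s, a n / (n * π) * (n * π * cos (n * π * y)))) (a 0)
    rw [show g' y - (a 0 + ∑ n ∈ s, a n / (n * π) *
      (n * π * cos (n * π * y))) + a 0 = g' y - ∑ n ∈ s, a n / (n * π) *
      (n * π * cos (n * π * y)) by ring] at h4
    linarith
  refine ⟨?_, hb y hy⟩
  have h5 := key 0 η (fun y hy => by simpa using hb y hy) y hy
  rw [zero_mul, sub_zero] at h5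
  nlinarith [hy.1, hy.2]

lemma exists_linear_ode {p : ℝ → ℝ} (hp : ContDiff ℝ ∞ p) (hg : ContDiff ℝ ∞ g) (t0 c0 : ℝ) :
    ∃ c : ℝ → ℝ, ContDiff ℝ ∞ c ∧ c t0 = c0 ∧ ∀ t, HasDerivAt c (p t * c t + g t) t := by
  set P : ℝ → ℝ := fun t => ∫ s in t0..t, p s with hP
  have hPs : ContDiff ℝ ∞ P := contDiff_integral hp t0
  have hPd : ∀ t, HasDerivAt P (p t) t := fun t =>
    integral_hasDerivAt_right (hp.continuous.intervalIntegrable _ _)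
      (hp.continuous.stronglyMeasurableAtFilter _ _) hp.continuous.continuousAt
  have hk : ContDiff ℝ ∞ fun s => exp (-P s) * g s := hPs.neg.exp.mul hg
  refine ⟨fun t => exp (P t) * (c0 + ∫ s in t0..t, exp (-P s) * g s),
    hPs.exp.mul (contDiff_const.add (contDiff_integral hk t0)), by simp [hP], fun t => ?_⟩
  have h2 : HasDerivAt (fun t => ∫ s in t0..t, exp (-P s) * g s) (exp (-P t) * g t) t :=
    integral_hasDerivAt_right (hk.continuous.intervalIntegrable _ _)
      (hk.continuous.stronglyMeasurableAtFilter _ _) hk.continuous.continuousAt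
  refine ((hPd t).exp.mul (h2.const_add c0)).congr_deriv ?_
  have h3 : exp (P t) * (exp (-P t) * g t) = g t := by
    rw [← mul_assoc, ← exp_add]; simp
  linear_combination h3

/-! ## Symmetrization on the growing interval -/

/-- The weight which turns the diffusion operator on the growing interval into a self-adjoint
operator with constant potential in the rescaled variable. -/
def weight (σ v : ℝ) (E : ℝ → ℝ) (t x : ℝ) : ℝ := exp (v / (4 * σ) * (E t - x ^ 2 / E t))

section Symmetrization

lemma IsFront.smooth_div (hE : IsFront v E) : Smooth2 fun t x => x / E t :=
  contDiff_snd.div (hE.smooth.comp contDiff_fst) fun p => (hE.pos p.1).ne'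

lemma IsFront.smooth_weight (hE : IsFront v E) : Smooth2 (weight σ v E) := by
  have h : Smooth2 fun t x => v / (4 * σ) * (E t - x * (x / E t)) :=
    (Smooth2.const _).mul ((Smooth2.of_fst hE.smooth).sub
      ((Smooth2.of_snd contDiff_id).mul hE.smooth_div))
  have h2 := Smooth2.comp_fst Real.contDiff_exp h
  convert h2 using 3
  unfold weight
  ring_nf

lemma weight_pos (t x : ℝ) : 0 < weight σ v E t x := exp_pos _

lemma weight_front (hE : IsFront v E) (t : ℝ) : weight σ v E t (E t) = 1 := by
  have := (hE.pos t).ne'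
  unfold weight
  rw [sq, mul_div_assoc, div_self this]; simp

lemma hasDerivAt_weight_snd (t x : ℝ) :
    HasDerivAt (weight σ v E t) (-(v / (2 * σ)) * (x / E t) * weight σ v E t x) x := by
  have h := (((((hasDerivAt_id x).pow 2).div_const (E t)).const_sub (E t)).const_mul
    (v / (4 * σ))).exp
  refine h.congr_deriv ?_
  simp only [weight, id, Pi.pow_apply]
  have h4 : v / (4 * σ) = v / (2 * σ) / 2 := by rw [div_div]; ring_nf
  rw [h4]
  norm_num
  ring

lemma hasDerivAt_weight_fst (hE : IsFront v E) (ht : 0 ≤ t) (x : ℝ) :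
    HasDerivAt (fun s => weight σ v E s x)
      (v / (4 * σ) * (v + v * (x / E t) ^ 2) * weight σ v E t x) t := by
  have h := (((hE.hasDerivAt t ht).sub (((hasDerivAt_const t (x ^ 2)).div (hE.hasDerivAt t ht)
    (hE.pos t).ne'))).const_mul (v / (4 * σ))).exp
  refine h.congr_deriv ?_
  simp only [weight, Pi.sub_apply, Pi.div_apply]
  ring

lemma hasDerivAt_div_fst (hE : IsFront v E) (ht : 0 ≤ t) (x : ℝ) :
    HasDerivAt (fun s => x / E s) (-(v * (x / E t) / E t)) t := by
  refine ((hasDerivAt_const t x).div (hE.hasDerivAt t ht) (hE.pos t).ne').congr_deriv ?_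
  ring

/-- The function with profile `Y` in the rescaled variable and weight `weight`. -/
def profile (σ v : ℝ) (E : ℝ → ℝ) (Y : ℝ → ℝ → ℝ) (t x : ℝ) : ℝ := weight σ v E t x * Y t (x / E t)

variable {Y : ℝ → ℝ → ℝ}

lemma smooth_profile (hE : IsFront v E) (hY : Smooth2 Y) : Smooth2 (profile σ v E Y) :=
  hE.smooth_weight.mul (hY.comp₂ (Smooth2.of_fst contDiff_id) hE.smooth_div)

lemma pdx_profile (hY : Smooth2 Y) (t x : ℝ) : pdx (profile σ v E Y) t x = weight σ v E t x *
      (-(v / (2 * σ)) * (x / E t) * Y t (x / E t) + pdx Y t (x / E t) / E t) := by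
  have h1 : HasDerivAt (fun x => Y t (x / E t)) (pdx Y t (x / E t) * (1 / E t)) x :=
    (hY.hasDerivAt_pdx t (x / E t)).comp x ((hasDerivAt_id x).div_const (E t))
  refine ((hasDerivAt_weight_snd t x).mul h1).deriv.trans ?_
  ring

lemma pdx_pdx_profile (hY : Smooth2 Y) (t x : ℝ) :
    pdx (pdx (profile σ v E Y)) t x = weight σ v E t x *
      (((v / (2 * σ) * (x / E t)) ^ 2 - v / (2 * σ) / E t) * Y t (x / E t)
        - 2 * (v / (2 * σ)) * (x / E t) * (pdx Y t (x / E t) / E t)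
        + pdx (pdx Y) t (x / E t) / E t ^ 2) := by
  have hy : HasDerivAt (fun x => x / E t) (1 / E t) x := (hasDerivAt_id x).div_const (E t)
  have h1 : HasDerivAt (fun x => Y t (x / E t)) (pdx Y t (x / E t) * (1 / E t)) x :=
    (hY.hasDerivAt_pdx t (x / E t)).comp x hy
  have h2 : HasDerivAt (fun x => pdx Y t (x / E t)) (pdx (pdx Y) t (x / E t) * (1 / E t)) x :=
    (hY.pdx.hasDerivAt_pdx t (x / E t)).comp x hy
  have h3 : pdx (profile σ v E Y) t = fun x => weight σ v E t x *
      (-(v / (2 * σ)) * (x / E t) * Y t (x / E t) + pdx Y t (x / E t) / E t) :=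
    funext fun x => pdx_profile hY t x
  have h4 := (hasDerivAt_weight_snd (σ := σ) (v := v) (E := E) t x).mul
    (((hy.const_mul (-(v / (2 * σ)))).mul h1).add (h2.div_const (E t)))
  refine ((congrArg (fun f => deriv f x) h3).trans h4.deriv).trans ?_
  simp only [Pi.add_apply, Pi.mul_apply]
  ring

lemma pdt_profile (hE : IsFront v E) (hY : Smooth2 Y) (ht : 0 ≤ t) (x : ℝ) :
    pdt (profile σ v E Y) t x = weight σ v E t x *
      (v / (4 * σ) * (v + v * (x / E t) ^ 2) * Y t (x / E t) + pdt Y t (x / E t)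
        - v * (x / E t) / E t * pdx Y t (x / E t)) := by
  have h1 := hY.hasDerivAt_curve (hasDerivAt_div_fst hE ht x)
  refine ((hasDerivAt_weight_fst hE ht x).mul h1).deriv.trans ?_
  ring

/-- The constant potential of the symmetrized operator. -/
def potential (σ v : ℝ) (E : ℝ → ℝ) (t : ℝ) : ℝ := v * E t / σ / 2 + (v * E t / σ) ^ 2 / 4

/-- The heat operator in the symmetrized rescaled variables. -/
lemma heat_profile (hσ : σ ≠ 0) (hE : IsFront v E) (hY : Smooth2 Y) (ht : 0 ≤ t) (x : ℝ) :
    pdt (profile σ v E Y) t x - σ * pdx (pdx (profile σ v E Y)) t x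
      = weight σ v E t x * (σ / E t ^ 2) * (E t ^ 2 / σ * pdt Y t (x / E t)
        + potential σ v E t * Y t (x / E t) - pdx (pdx Y) t (x / E t)) := by
  rw [pdt_profile hE hY ht, pdx_pdx_profile hY, potential]
  have := (hE.pos t).ne'
  field_simp
  ring

end Symmetrization

/-! ## Regular approximate solutions -/

section Approximation

/-- The corrector `q` with `q'' = y`, `q(0) = q(1) = 0`. -/
def corrector (y : ℝ) : ℝ := (y ^ 3 - y) / 6

lemma hasDerivAt_corrector (y : ℝ) : HasDerivAt corrector ((3 * y ^ 2 - 1) / 6) y := by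
  have := ((hasDerivAt_pow 3 y).sub (hasDerivAt_id y)).div_const 6
  exact this.congr_deriv (by norm_num)

/-- A profile with mass `M`, built on the modes `n ∈ s`. -/
def modal (σ v : ℝ) (E : ℝ → ℝ) (M : ℝ) (s : Finset ℕ) (c : ℕ → ℝ → ℝ) (t y : ℝ) : ℝ :=
  M * (y + potential σ v E t * corrector y) + ∑ n ∈ s, c n t * sin (n * π * y)

lemma smooth_potential (hE : IsFront v E) : ContDiff ℝ ∞ (potential σ v E) := by
  have := hE.smooth
  unfold potential
  fun_prop

lemma hasDerivAt_potential (hE : IsFront v E) (ht : 0 ≤ t) :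
    HasDerivAt (potential σ v E) ((1 / 2 + v * E t / σ / 2) * (v * v / σ)) t := by
  have h := ((hE.hasDerivAt t ht).const_mul v).div_const σ
  have h2 := (h.div_const 2).add ((h.fun_pow 2).div_const 4)
  refine h2.congr_deriv ?_
  norm_num
  ring

variable {M : ℝ} {s : Finset ℕ} {c : ℕ → ℝ → ℝ}

lemma smooth_modal (hE : IsFront v E) (hc : ∀ n, ContDiff ℝ ∞ (c n)) :
    Smooth2 (modal σ v E M s c) := by
  refine Smooth2.add ?_ (Smooth2.sum s fun n _ => ?_)
  · refine (Smooth2.const M).mul (Smooth2.add (Smooth2.of_snd contDiff_id)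
      ((Smooth2.of_fst (smooth_potential hE)).mul (Smooth2.of_snd ?_)))
    unfold corrector
    fun_prop
  · exact (Smooth2.of_fst (hc n)).mul (Smooth2.of_snd (by fun_prop))

lemma pdt_modal (hE : IsFront v E) {c' : ℕ → ℝ} (ht : 0 ≤ t)
    (hc : ∀ n, HasDerivAt (c n) (c' n) t) (y : ℝ) :
    pdt (modal σ v E M s c) t y = M * ((1 / 2 + v * E t / σ / 2) * (v * v / σ) * corrector y)
      + ∑ n ∈ s, c' n * sin (n * π * y) := by
  have h1 := (((hasDerivAt_potential (σ := σ) hE ht).mul_const (corrector y)).const_add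
    y).const_mul M
  exact (h1.add (HasDerivAt.fun_sum fun n (_ : n ∈ s) =>
    (hc n).mul_const (sin (n * π * y)))).deriv

lemma hasDerivAt_modal (t y : ℝ) :
    HasDerivAt (modal σ v E M s c t) (M * (1 + potential σ v E t * ((3 * y ^ 2 - 1) / 6))
      + ∑ n ∈ s, c n t * (n * π * cos (n * π * y))) y := by
  refine ((((hasDerivAt_id y).add ((hasDerivAt_corrector y).const_mul _)).const_mul M).add
    (HasDerivAt.fun_sum fun n _ => (?_ : HasDerivAt (fun y => c n t * sin (n * π * y))
      _ y)))
  have h := (((hasDerivAt_id y).const_mul ((n : ℝ) * π)).sin).const_mul (c n t)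
  refine h.congr_deriv ?_
  simp only [id]
  ring

lemma pdx_pdx_modal (t y : ℝ) : pdx (pdx (modal σ v E M s c)) t y = M * (potential σ v E t * y)
      - ∑ n ∈ s, c n t * ((n * π) ^ 2 * sin (n * π * y)) := by
  have h0 : pdx (modal σ v E M s c) t = fun y => M * (1 + potential σ v E t *
      ((3 * y ^ 2 - 1) / 6)) + ∑ n ∈ s, c n t * (n * π * cos (n * π * y)) :=
    funext fun y => (hasDerivAt_modal t y).deriv
  have h1 : HasDerivAt (fun y => M * (1 + potential σ v E t * ((3 * y ^ 2 - 1) / 6)))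
      (M * (potential σ v E t * y)) y := by
    have := ((((((hasDerivAt_pow 2 y).const_mul 3).sub_const 1).div_const 6).const_mul
      (potential σ v E t)).const_add 1).const_mul M
    refine this.congr_deriv ?_
    rw [show (2 : ℕ) - 1 = 1 from rfl, pow_one]
    push_cast
    ring
  have h2 : ∀ n ∈ s, HasDerivAt (fun y => c n t * (n * π * cos (n * π * y)))
      (-(c n t * ((n * π) ^ 2 * sin (n * π * y)))) y := by
    intro n _
    have h := ((((hasDerivAt_id y).const_mul ((n : ℝ) * π)).cos).const_mul
      ((n : ℝ) * π)).const_mul (c n t)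
    refine h.congr_deriv ?_
    simp only [id]
    ring
  refine ((congrArg (fun f => deriv f y) h0).trans (h1.add (HasDerivAt.fun_sum h2)).deriv).trans ?_
  rw [sum_neg_distrib]
  ring

/-- The size of the residual produced by the corrector. -/
def forcing (σ v : ℝ) (E : ℝ → ℝ) (t : ℝ) : ℝ :=
  (1 / 2 + v * E t / σ / 2) * (v * E t / σ) ^ 2 + potential σ v E t ^ 2

lemma heat_modal (hσ : σ ≠ 0) (hE : IsFront v E) {a : ℕ → ℝ} (hc : ∀ n, ContDiff ℝ ∞ (c n))
    (hode : ∀ n t, HasDerivAt (c n) (-(σ / E t ^ 2) * (potential σ v E t + (n * π) ^ 2) * c n t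
      + -(σ / E t ^ 2) * (forcing σ v E t * a n)) t) (ht : 0 ≤ t) (x : ℝ) :
    pdt (profile σ v E (modal σ v E M s c)) t x
      - σ * pdx (pdx (profile σ v E (modal σ v E M s c))) t x
    = weight σ v E t x * (σ / E t ^ 2) * (forcing σ v E t *
        (M * corrector (x / E t) - ∑ n ∈ s, a n * sin (n * π * (x / E t)))) := by
  rw [heat_profile hσ hE (smooth_modal hE hc) ht, pdt_modal hE ht (fun n => hode n t),
    pdx_pdx_modal]
  congr 1
  have hEt := (hE.pos t).ne'
  have h1 : ∑ n ∈ s, (-(σ / E t ^ 2) * (potential σ v E t + (n * π) ^ 2) * c n t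
      + -(σ / E t ^ 2) * (forcing σ v E t * a n)) * sin (n * π * (x / E t))
      = -(σ / E t ^ 2) * (potential σ v E t * (∑ n ∈ s, c n t * sin (n * π * (x / E t)))
        + (∑ n ∈ s, c n t * ((n * π) ^ 2 * sin (n * π * (x / E t))))
        + forcing σ v E t * ∑ n ∈ s, a n * sin (n * π * (x / E t))) := by
    simp only [mul_sum, ← sum_add_distrib]
    exact sum_congr rfl fun n _ => by ring
  rw [h1, modal, forcing]
  generalize ∑ n ∈ s, c n t * sin (n * π * (x / E t)) = A
  generalize ∑ n ∈ s, c n t * ((n * π) ^ 2 * sin (n * π * (x / E t))) = B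
  generalize ∑ n ∈ s, a n * sin (n * π * (x / E t)) = D
  generalize x / E t = y
  field_simp
  ring

lemma modal_zero (t : ℝ) : modal σ v E M s c t 0 = 0 := by simp [modal, corrector]

lemma modal_one (t : ℝ) : modal σ v E M s c t 1 = M := by
  simp [modal, corrector, sin_nat_mul_pi]

/-- The damped derivative of a primitive. -/
def damped (lam : ℝ) (W : ℝ → ℝ → ℝ) (t x : ℝ) : ℝ := exp (-lam * t) * pdx W t x

lemma smooth_damped (hW : Smooth2 W) : Smooth2 (damped lam W) :=
  (Smooth2.of_fst (by fun_prop)).mul hW.pdx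

lemma pdx_damped (hW : Smooth2 W) : pdx (damped lam W) = damped lam (pdx W) := by
  ext t x
  exact ((hW.pdx.hasDerivAt_pdx t x).const_mul _).deriv

lemma resid_damped (hW : Smooth2 W) (t x : ℝ) : resid σ lam (damped lam W) t x
      = exp (-lam * t) * deriv (fun x => pdt W t x - σ * pdx (pdx W) t x) x := by
  have h1 : HasDerivAt (fun t => exp (-lam * t)) (-lam * exp (-lam * t)) t := by
    simpa [mul_comm] using ((hasDerivAt_id t).const_mul (-lam)).exp
  have h2 : pdt (damped lam W) t x = -lam * damped lam W t x
      + exp (-lam * t) * pdx (pdt W) t x := by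
    refine (h1.mul (hW.pdx.hasDerivAt_pdt t x)).deriv.trans ?_
    rw [hW.pdt_pdx_comm, damped]; ring
  have h3 : deriv (fun x => pdt W t x - σ * pdx (pdx W) t x) x
      = pdx (pdt W) t x - σ * pdx (pdx (pdx W)) t x :=
    ((hW.pdt.hasDerivAt_pdx t x).sub ((hW.pdx.pdx.hasDerivAt_pdx t x).const_mul σ)).deriv
  rw [resid, h2, h3, pdx_damped hW, pdx_damped hW.pdx]
  unfold damped
  ring

lemma isRegular_damped (hσ : σ ≠ 0) (hE : IsFront v E) (hW : Smooth2 W)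
    (h0 : ∀ t, W t 0 = 0) (hM : ∀ t, W t (E t) = M)
    (hh0 : ∀ t ≥ 0, pdt W t 0 - σ * pdx (pdx W) t 0 = 0)
    (hh1 : ∀ t ≥ 0, pdt W t (E t) - σ * pdx (pdx W) t (E t) = 0) :
    IsRegular σ v E (damped lam W) := by
  refine ⟨smooth_damped hW, fun t ht => ?_, fun t ht => ?_⟩
  · have h1 : pdt W t 0 = 0 := by simp [pdt, h0]
    have h2 := hh0 t ht
    rw [h1, zero_sub, neg_eq_zero, mul_eq_zero] at h2
    rw [pdx_damped hW, damped, h2.resolve_left hσ, mul_zero]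
  · have h1 := (hW.hasDerivAt_curve (hE.hasDerivAt t ht)).deriv
    simp only [hM, deriv_const] at h1
    rw [pdx_damped hW]
    unfold damped
    linear_combination (-exp (-lam * t)) * hh1 t ht - exp (-lam * t) * h1

lemma forcing_le (hσ : 0 < σ) (hE : IsFront v E) (t : ℝ) :
    0 ≤ forcing σ v E t ∧ forcing σ v E t ≤ 696 * exp (v * E t / σ / 4) := by
  set r := v * E t / σ / 4 with hr
  have hv := hE.speed_nonneg
  have hr0 : 0 ≤ r := by have := (hE.pos t).le; positivity
  have hf : forcing σ v E t = 12 * r ^ 2 + 48 * r ^ 3 + 16 * r ^ 4 := by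
    rw [forcing, potential, show v * E t / σ = 4 * r by rw [hr]; ring]
    ring
  have h2 := pow_div_factorial_le_exp r hr0 2
  have h3 := pow_div_factorial_le_exp r hr0 3
  have h4 := pow_div_factorial_le_exp r hr0 4
  norm_num [Nat.factorial] at h2 h3 h4
  rw [hf]
  exact ⟨by positivity, by linarith⟩

lemma weight_le (hσ : 0 < σ) (hE : IsFront v E) (t x : ℝ) :
    weight σ v E t x ≤ exp (v * E t / σ / 4) := by
  refine exp_le_exp.2 ?_
  have hv := hE.speed_nonneg
  have h1 : 0 ≤ v / (4 * σ) * (x ^ 2 / E t) := by have := (hE.pos t).le; positivity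
  have h2 : v * E t / σ / 4 = v / (4 * σ) * E t := by field_simp
  rw [h2]
  linarith

end Approximation

lemma integral_sq_le_of_abs_le (hl : 0 ≤ l) (hf : Continuous f)
    (hB : ∀ x ∈ Icc 0 l, |f x| ≤ B) : ∫ x in 0..l, f x ^ 2 ≤ l * B ^ 2 := by
  have h : ∫ x in 0..l, f x ^ 2 ≤ ∫ _ in 0..l, B ^ 2 :=
    int_mono_on hl cont_ii
      cont_ii fun x hx => by
        rw [← sq_abs]
        exact pow_le_pow_left₀ (abs_nonneg _) (hB x hx) 2
  simpa using h

section Approximation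

/-- The derivative of a weighted profile is controlled by its profile. -/
lemma abs_pdx_profile_le (hσ : 0 < σ) (hE : IsFront v E) {r' : ℝ → ℝ}
    (hr : ContDiff ℝ ∞ r) (hr' : ∀ y, HasDerivAt r (r' y) y)
    (hb : ∀ y ∈ Icc (0 : ℝ) 1, |r y| ≤ η ∧ |r' y| ≤ η) (ht : 0 ≤ t)
    (hx : x ∈ Icc 0 (E t)) :
    |pdx (profile σ v E (fun _ y => r y)) t x|
      ≤ exp (v * E t / σ / 4) * ((v / (2 * σ) + 1 / E 0) * η) := by
  have hEt := hE.pos t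
  have hv := hE.speed_nonneg
  have hy : x / E t ∈ Icc (0 : ℝ) 1 := ⟨div_nonneg hx.1 hEt.le, (div_le_one hEt).2 hx.2⟩
  obtain ⟨hb1, hb2⟩ := hb _ hy
  have hη : 0 ≤ η := (abs_nonneg _).trans hb1
  rw [pdx_profile (Smooth2.of_snd hr), abs_mul, abs_of_pos (weight_pos t x)]
  refine mul_le_mul (weight_le hσ hE t x) ?_ (abs_nonneg _) (exp_pos _).le
  have hp : pdx (fun _ y => r y) t (x / E t) = r' (x / E t) := (hr' _).deriv
  rw [hp]
  have h1 : |-(v / (2 * σ)) * (x / E t) * r (x / E t)| ≤ v / (2 * σ) * η := by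
    rw [abs_mul, abs_mul, abs_neg, abs_of_nonneg (show 0 ≤ v / (2 * σ) by positivity),
      abs_of_nonneg hy.1]
    have h0 : v / (2 * σ) * (x / E t) ≤ v / (2 * σ) := mul_le_of_le_one_right (by positivity) hy.2
    exact mul_le_mul h0 hb1 (abs_nonneg _) (by positivity)
  have h2 : |r' (x / E t) / E t| ≤ 1 / E 0 * η := by
    rw [abs_div, abs_of_pos hEt, div_eq_mul_one_div, mul_comm]
    have := hE.pos 0
    exact mul_le_mul (one_div_le_one_div_of_le this (hE.zero_le ht)) hb2 (abs_nonneg _)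
      (by positivity)
  calc _ ≤ _ := abs_add_le _ _
    _ ≤ v / (2 * σ) * η + 1 / E 0 * η := add_le_add h1 h2
    _ = _ := by ring

lemma exists_regular_approx (hσ : 0 < σ) (hE : IsFront v E) (hlam : v ^ 2 / σ + 1 ≤ lam)
 (hw0 : Continuous w0) (hη : 0 < η) :
    ∃ w : ℝ → ℝ → ℝ, IsRegular σ v E w ∧ (∀ x ∈ Icc 0 (E 0), |w 0 x - w0 x| ≤ η) ∧
      ∀ t ≥ 0, exp (lam * t) * ∫ x in 0..E t, resid σ lam w t x ^ 2 ≤ η * exp (-t) := by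
  have hE0 := hE.pos 0
  have hv := hE.speed_nonneg
  set ε0 := v * E 0 / σ with hε0
  set K1 : ℝ := v / (2 * σ) + 1 / E 0 with hK1
  have hK1p : 0 < K1 := by positivity
  set K2 : ℝ := σ ^ 2 / E 0 ^ 3 * (696 * K1) ^ 2 * exp ε0 with hK2
  have hK2p : 0 < K2 := by positivity
  obtain ⟨ρ, hρ, hρ1, hρ2⟩ : ∃ ρ : ℝ, 0 < ρ ∧ exp (ε0 / 4) * (K1 * ρ) ≤ η ∧ K2 * ρ ^ 2 ≤ η := by
    refine ⟨min (η / (exp (ε0 / 4) * K1)) (√(η / K2)), by positivity, ?_, ?_⟩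
    · have h1 := min_le_left (η / (exp (ε0 / 4) * K1)) (√(η / K2))
      rw [le_div_iff₀ (by positivity)] at h1
      linarith
    · have h1 := min_le_right (η / (exp (ε0 / 4) * K1)) (√(η / K2))
      have h2 := pow_le_pow_left₀ (by positivity) h1 2
      rw [sq_sqrt (by positivity), le_div_iff₀ hK2p] at h2
      linarith
  -- the initial profile
  set W0 : ℝ → ℝ := fun x => ∫ y in 0..x, w0 y with hW0
  have hW0d : ∀ x, HasDerivAt W0 (w0 x) x := fun x =>
    integral_hasDerivAt_right (hw0.intervalIntegrable _ _)
      (hw0.stronglyMeasurableAtFilter _ _) hw0.continuousAt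
  set M : ℝ := W0 (E 0) with hM
  set G : ℝ → ℝ := fun y => W0 (E 0 * y) * exp (-(ε0 / 4) * (1 - y ^ 2)) with hG
  set G' : ℝ → ℝ := fun y => w0 (E 0 * y) * E 0 * exp (-(ε0 / 4) * (1 - y ^ 2))
    + W0 (E 0 * y) * (ε0 / 2 * y * exp (-(ε0 / 4) * (1 - y ^ 2))) with hG'
  have hGd : ∀ y, HasDerivAt G (G' y) y := by
    intro y
    have h1 : HasDerivAt (fun y => W0 (E 0 * y)) (w0 (E 0 * y) * (E 0)) y := by
      have h0 : HasDerivAt (fun y => E 0 * y) (E 0) y := by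
        simpa using (hasDerivAt_id y).const_mul (E 0)
      exact (hW0d (E 0 * y)).comp y h0
    have h2 := ((((hasDerivAt_pow 2 y).const_sub 1).const_mul (-(ε0 / 4))).exp)
    refine (h1.mul h2).congr_deriv ?_
    simp only [hG']
    norm_num
    ring_nf
    simp
  have hW0c : Continuous W0 := continuous_iff_continuousAt.2 fun x => (hW0d x).continuousAt
  have hG'c : Continuous G' := by fun_prop
  set g : ℝ → ℝ := fun y => G y - M * (y + potential σ v E 0 * corrector y) with hg
  have hgd : ∀ y, HasDerivAt g (G' y - M * (1 + potential σ v E 0 * ((3 * y ^ 2 - 1) / 6))) y :=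
    fun y => (hGd y).sub
      (((hasDerivAt_id y).add ((hasDerivAt_corrector y).const_mul _)).const_mul M)
  have hg'c : Continuous fun y => G' y - M * (1 + potential σ v E 0 * ((3 * y ^ 2 - 1) / 6)) := by
    fun_prop
  obtain ⟨c0, s0, hc0⟩ := exists_sin_approx hgd hg'c (by simp [hg, hG, hW0, corrector])
    (by simp [hg, hG, hM, corrector]) hρ
  obtain ⟨a, s1, ha⟩ := exists_sin_approx (g := fun y => M * corrector y)
    (fun y => (hasDerivAt_corrector y).const_mul M) (by fun_prop) (by simp [corrector])
    (by simp [corrector]) hρ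
  set s := s0 ∪ s1 with hs
  have hc0 := hc0 s Finset.subset_union_left
  have ha := ha s Finset.subset_union_right
  have hpot := smooth_potential (σ := σ) hE
  have hforc : ContDiff ℝ ∞ (forcing σ v E) := by
    have := hE.smooth
    unfold forcing
    fun_prop
  have hσE : ContDiff ℝ ∞ fun t => -(σ / E t ^ 2) :=
    (contDiff_const.div (hE.smooth.pow 2) fun t => (pow_pos (hE.pos t) 2).ne').neg
  have hode := fun n : ℕ => exists_linear_ode
    (p := fun t => -(σ / E t ^ 2) * (potential σ v E t + (n * π) ^ 2))
    (g := fun t => -(σ / E t ^ 2) * (forcing σ v E t * a n))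
    (hσE.mul (hpot.add contDiff_const)) (hσE.mul (hforc.mul contDiff_const)) 0 (c0 n)
  choose c hcs hc00 hcd using hode
  set Y := modal σ v E M s c with hY
  have hYs : Smooth2 Y := smooth_modal hE hcs
  set W := profile σ v E Y with hW
  have hWs : Smooth2 W := smooth_profile hE hYs
  set r : ℝ → ℝ := fun y => M * corrector y - ∑ n ∈ s, a n * sin (n * π * y) with hr
  have hrs : ContDiff ℝ ∞ r := by
    simp only [hr]
    unfold corrector
    fun_prop
  have hsind : ∀ (b : ℕ → ℝ) y, HasDerivAt (fun y => ∑ n ∈ s, b n * sin (n * π * y))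
      (∑ n ∈ s, b n * (n * π * cos (n * π * y))) y := by
    intro b y
    refine HasDerivAt.fun_sum fun n _ => ?_
    refine ((((hasDerivAt_id y).const_mul ((n : ℝ) * π)).sin).const_mul (b n)).congr_deriv ?_
    simp only [id]
    ring
  have hrd : ∀ y, HasDerivAt r (M * ((3 * y ^ 2 - 1) / 6)
      - ∑ n ∈ s, a n * (n * π * cos (n * π * y))) y := fun y =>
    ((hasDerivAt_corrector y).const_mul M).sub (hsind a y)
  have hheat : ∀ t ≥ 0, ∀ x, pdt W t x - σ * pdx (pdx W) t x
      = σ / E t ^ 2 * forcing σ v E t * profile σ v E (fun _ y => r y) t x := by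
    intro t ht x
    rw [hW, hY, heat_modal hσ.ne' hE hcs hcd ht, profile]
    ring
  have hr0 : r 0 = 0 := by simp [hr, corrector]
  have hr1 : r 1 = 0 := by simp [hr, corrector, sin_nat_mul_pi]
  refine ⟨damped lam W, ?_, fun x hx => ?_, fun t ht => ?_⟩
  · refine isRegular_damped (M := M) hσ.ne' hE hWs (fun t => ?_) (fun t => ?_)
      (fun t ht => ?_) fun t ht => ?_
    · simp [hW, profile, hY, modal_zero]
    · simp [hW, profile, hY, div_self (hE.pos t).ne', modal_one, weight_front hE]
    · simp [hheat t ht, profile, hr0]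
    · simp [hheat t ht, profile, div_self (hE.pos t).ne', hr1]
  · -- the initial value
    set d : ℝ → ℝ := fun y => Y 0 y - G y with hd
    have hdeq : ∀ y, d y = -(g y - ∑ n ∈ s, c0 n * sin (n * π * y)) := by
      intro y
      simp only [hd, hY, modal, hg, hc00]
      ring
    have hY0 : ∀ y, HasDerivAt (Y 0) (M * (1 + potential σ v E 0 * ((3 * y ^ 2 - 1) / 6))
      + ∑ n ∈ s, c n 0 * (n * π * cos (n * π * y))) y := fun y =>
        hasDerivAt_modal 0 y
    have hwx : HasDerivAt (fun x => weight σ v E 0 x * G (x / E 0)) (w0 x) x := by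
      refine (hW0d x).congr_of_eventuallyEq (.of_forall fun x => ?_)
      simp only [hG, weight]
      rw [mul_div_cancel₀ x hE0.ne', mul_comm, mul_assoc, ← exp_add]
      have : -(ε0 / 4) * (1 - (x / E 0) ^ 2) + v / (4 * σ) * (E 0 - x ^ 2 / E 0) = 0 := by
        rw [hε0]; field_simp; ring
      rw [this]; simp
    have hy : HasDerivAt (fun x => x / E 0) (1 / E 0) x := (hasDerivAt_id x).div_const _
    have hG1 : HasDerivAt (fun x => G (x / E 0)) (G' (x / E 0) * (1 / E 0)) x :=
      HasDerivAt.comp (h₂ := G) x (hGd (x / E 0)) hy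
    have hval : w0 x = weight σ v E 0 x * (-(v / (2 * σ)) * (x / E 0) * G (x / E 0)
        + G' (x / E 0) / E 0) := by
      refine hwx.unique (((hasDerivAt_weight_snd 0 x).mul hG1).congr_deriv ?_)
      ring
    have hY0' : pdx Y 0 (x / E 0) = _ := (hY0 (x / E 0)).deriv
    have hval2 : damped lam W 0 x = weight σ v E 0 x * (-(v / (2 * σ)) * (x / E 0) * Y 0 (x / E 0)
        + pdx Y 0 (x / E 0) / E 0) := by
      rw [damped, hW, pdx_profile hYs]
      simp
    have hyI : x / E 0 ∈ Icc (0 : ℝ) 1 := ⟨div_nonneg hx.1 hE0.le, (div_le_one hE0).2 hx.2⟩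
    obtain ⟨hb1, hb2⟩ := hc0 _ hyI
    have h1 : |d (x / E 0)| ≤ ρ := by rw [hdeq, abs_neg]; exact hb1
    have h2 : |pdx Y 0 (x / E 0) - G' (x / E 0)| ≤ ρ := by
      rw [hY0', abs_sub_comm]
      simp only [hc00]
      convert hb2 using 2
      ring
    have h3 : damped lam W 0 x - w0 x = weight σ v E 0 x * (-(v / (2 * σ)) * (x / E 0)
        * d (x / E 0) + (pdx Y 0 (x / E 0) - G' (x / E 0)) / E 0) := by
      rw [hval, hval2]; simp only [hd]; ring
    rw [h3, abs_mul, abs_of_pos (weight_pos _ _)]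
    refine le_trans (mul_le_mul (weight_le hσ hE 0 x) ?_ (abs_nonneg _) (exp_pos _).le) hρ1
    have h4 : |-(v / (2 * σ)) * (x / E 0) * d (x / E 0)| ≤ v / (2 * σ) * ρ := by
      rw [abs_mul, abs_mul, abs_neg, abs_of_nonneg (show 0 ≤ v / (2 * σ) by positivity),
        abs_of_nonneg hyI.1]
      exact mul_le_mul (mul_le_of_le_one_right (by positivity) hyI.2) h1 (abs_nonneg _)
        (by positivity)
    have h5 : |(pdx Y 0 (x / E 0) - G' (x / E 0)) / E 0| ≤ 1 / E 0 * ρ := by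
      rw [abs_div, abs_of_pos hE0, div_eq_mul_one_div, mul_comm]
      exact mul_le_mul_of_nonneg_left h2 (by positivity)
    calc _ ≤ _ := abs_add_le _ _
      _ ≤ v / (2 * σ) * ρ + 1 / E 0 * ρ := add_le_add h4 h5
      _ = _ := by rw [hK1]; ring
  · -- the residual
    set ε := v * E t / σ with hε
    have hEt := hE.pos t
    have hres : ∀ x ∈ Icc 0 (E t), |resid σ lam (damped lam W) t x|
        ≤ exp (-lam * t) * (σ / E t ^ 2 * (696 * exp (ε / 4)) * (exp (ε / 4) * (K1 * ρ))) := by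
      intro x hx
      have h1 : deriv (fun x => pdt W t x - σ * pdx (pdx W) t x) x
          = σ / E t ^ 2 * forcing σ v E t * pdx (profile σ v E (fun _ y => r y)) t x := by
        have h0 : (fun x => pdt W t x - σ * pdx (pdx W) t x)
          = fun x => σ / E t ^ 2 * forcing σ v E t * profile σ v E (fun _ y => r y) t x :=
          funext fun x => hheat t ht x
        rw [h0]
        exact (((smooth_profile hE (Smooth2.of_snd hrs)).hasDerivAt_pdx t x).const_mul _).deriv
      obtain ⟨hf0, hf1⟩ := forcing_le hσ hE t
      rw [resid_damped hWs, h1, abs_mul, abs_mul, abs_of_pos (exp_pos _),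
        abs_of_nonneg (show 0 ≤ σ / E t ^ 2 * forcing σ v E t by positivity)]
      refine mul_le_mul_of_nonneg_left (mul_le_mul ?_ ?_ (abs_nonneg _) (by positivity))
        (exp_pos _).le
      · exact mul_le_mul_of_nonneg_left hf1 (by positivity)
      · exact abs_pdx_profile_le hσ hE hrs hrd ha ht hx
    have hsm := (smooth_damped (lam := lam) hWs).resid σ lam
    have h2 := integral_sq_le_of_abs_le hEt.le (hsm.slice t).continuous hres
    have h3 := mul_le_mul_of_nonneg_left h2 (exp_pos (lam * t)).le
    refine h3.trans ?_
    have hexp : exp (lam * t) * (exp (-lam * t)) ^ 2 = exp (-lam * t) := by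
      rw [← exp_nat_mul, ← exp_add]; congr 1; push_cast; ring
    have hexp2 : (exp (ε / 4) * exp (ε / 4)) ^ 2 = exp ε := by
      rw [← exp_add, ← exp_nat_mul]; congr 1; push_cast; ring
    have h4 : exp (lam * t) * (E t * (exp (-lam * t) * (σ / E t ^ 2 *
        (696 * exp (ε / 4)) * (exp (ε / 4) * (K1 * ρ)))) ^ 2)
        = σ ^ 2 / E t ^ 3 * (696 * K1) ^ 2 * ρ ^ 2 * (exp (-lam * t) * exp ε) := by
      have hE3 : E t * (σ / E t ^ 2) ^ 2 = σ ^ 2 / E t ^ 3 := by field_simp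
      calc _ = (exp (lam * t) * (exp (-lam * t)) ^ 2) * (E t * (σ / E t ^ 2) ^ 2)
            * (696 * K1) ^ 2 * ρ ^ 2 * (exp (ε / 4) * exp (ε / 4)) ^ 2 := by ring
        _ = _ := by rw [hexp, hexp2, hE3]; ring
    rw [h4]
    have h5 : exp (-lam * t) * exp ε ≤ exp ε0 * exp (-t) := by
      rw [← exp_add, ← exp_add]
      refine exp_le_exp.2 ?_
      have h6 : ε = ε0 + v ^ 2 / σ * t := by rw [hε, hε0, hE.eq t ht]; field_simp
      rw [h6]
      nlinarith
    have h6 : σ ^ 2 / E t ^ 3 ≤ σ ^ 2 / E 0 ^ 3 := by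
      have := pow_le_pow_left₀ hE0.le (hE.zero_le ht) 3
      exact div_le_div_of_nonneg_left (by positivity) (by positivity) this
    calc _ ≤ σ ^ 2 / E 0 ^ 3 * (696 * K1) ^ 2 * ρ ^ 2 * (exp ε0 * exp (-t)) := by gcongr
      _ = K2 * ρ ^ 2 * exp (-t) := by rw [hK2]; ring
      _ ≤ _ := mul_le_mul_of_nonneg_right hρ2 (exp_pos _).le

end Approximation

/-! ## The backstepping transform of regular functions -/

/-- The inverse backstepping transform, slice by slice. -/
def unstep (α : ℝ) (w : ℝ → ℝ → ℝ) (t : ℝ) : ℝ → ℝ := volt (-α) (w t)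

/-- The integral kernel of the nonlocal feedback. -/
def gain (σ v α : ℝ) (e y : ℝ) : ℝ := σ * pdt (kern α) e y + v * kern α e y

lemma smooth2_gain (σ v α : ℝ) : Smooth2 (gain σ v α) :=
  ((Smooth2.const σ).mul (smooth2_kern α).pdt).add ((Smooth2.const v).mul (smooth2_kern α))

section Unstep

lemma smooth_unstep (hw : Smooth2 w) : Smooth2 (unstep α w) := smooth2_volt (-α) hw

lemma volt_unstep (hw : Smooth2 w) (t : ℝ) (hx : 0 ≤ x) : volt α (unstep α w t) x = w t x := by
  have h := volt_neg_volt (-α) hx ((hw.slice t).continuous.intervalIntegrable 0 x)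
  rwa [neg_neg] at h

lemma pdx_unstep (hw : Smooth2 w) (t x : ℝ) :
    pdx (unstep α w) t x = pdx w t x + -α / 2 * x * w t x
      - ∫ y in 0..x, pdt (kern (-α)) x y * w t y :=
  (hasDerivAt_volt (-α) (hw.slice t).continuous (hw.hasDerivAt_pdx t x)).deriv

lemma heat_unstep (hα : lam = σ * α) (hw : IsRegular σ v E w) (ht : 0 ≤ t) (x : ℝ) :
    pdt (unstep α w) t x - σ * pdx (pdx (unstep α w)) t x = volt (-α) (resid σ lam w t) x := by
  have hs := hw.smooth
  have h1 : pdt (unstep α w) t x = volt (-α) (pdt w t) x := pdt_volt (-α) hs t x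
  have h2 : pdx (pdx (unstep α w)) t x = volt (-α) (fun y => pdx (pdx w) t y + -α * w t y) x := by
    have h0 : pdx (unstep α w) t = fun x => pdx w t x + -α / 2 * x * w t x
        - ∫ y in 0..x, pdt (kern (-α)) x y * w t y := funext fun x => pdx_unstep hs t x
    exact (congrArg (fun f => deriv f x) h0).trans (hasDerivAt_deriv_volt (-α)
      (hs.hasDerivAt_pdx t) (hs.pdx.hasDerivAt_pdx t) (hs.pdx.pdx.slice t).continuous
      (hw.bdryZero t ht) x).deriv
  have c1 := (hs.pdt.slice t).continuous
  have c2 : Continuous fun y => pdx (pdx w) t y + -α * w t y :=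
    (hs.pdx.pdx.slice t).continuous.add (continuous_const.mul (hs.slice t).continuous)
  have h3 := volt_linear (-α) c1 c2 1 (-σ) x
  rw [h1, h2]
  rw [one_mul] at h3
  have h4 : resid σ lam w t = fun y => 1 * pdt w t y + -σ * (pdx (pdx w) t y + -α * w t y) := by
    ext y; rw [resid, hα]; ring
  rw [h4, h3]
  ring

lemma unstep_bdryZero (hw : IsRegular σ v E w) (ht : 0 ≤ t) : pdx (unstep α w) t 0 = 0 := by
  rw [pdx_unstep hw.smooth, hw.bdryZero t ht]; simp

/-- The closed loop boundary condition at the moving front. -/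
lemma unstep_bdryFront (hE : IsFront v E) (hw : IsRegular σ v E w) (ht : 0 ≤ t) :
    σ * pdx (unstep α w) t (E t) + v * unstep α w t (E t)
      = (∫ y in 0..E t, gain σ v α (E t) y * unstep α w t y)
        + σ * kern α (E t) (E t) * unstep α w t (E t) := by
  have hz := smooth_unstep (α := α) hw.smooth
  have hzc := (hz.slice t).continuous
  have h1 : HasDerivAt (w t) (pdx (unstep α w) t (E t) + α / 2 * E t * unstep α w t (E t)
      - ∫ y in 0..E t, pdt (kern α) (E t) y * unstep α w t y) (E t) := by
    refine (hasDerivAt_volt α hzc (hz.hasDerivAt_pdx t (E t))).congr_of_eventuallyEq ?_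
    filter_upwards [Ioi_mem_nhds (hE.pos t)] with x hx
    exact (volt_unstep hw.smooth t (le_of_lt hx)).symm
  have h2 := h1.unique (hw.smooth.hasDerivAt_pdx t (E t))
  have h3 := volt_unstep (α := α) hw.smooth t (hE.pos t).le
  have h4 := hw.bdryFront t ht
  rw [← h2, ← h3, volt] at h4
  have ck := ((smooth2_kern α).slice (E t)).continuous
  have ckx := ((smooth2_kern α).pdt.slice (E t)).continuous
  have h5 : ∫ y in 0..E t, gain σ v α (E t) y * unstep α w t y
      = σ * (∫ y in 0..E t, pdt (kern α) (E t) y * unstep α w t y)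
        + v * ∫ y in 0..E t, kern α (E t) y * unstep α w t y := by
    rw [← int_const_mul, ← int_const_mul,
      ← int_add cont_ii
        cont_ii]
    congr 1; ext y; unfold gain; ring
  rw [h5, kern_diag]
  linear_combination h4

/-- The flux of the transform at the moving front in terms of the target function. -/
lemma unstep_flux (hw : IsRegular σ v E w) (ht : 0 ≤ t) :
    σ * pdx (unstep α w) t (E t) + v * unstep α w t (E t) = -(σ * α / 2) * E t * w t (E t)
        - ∫ y in 0..E t, gain σ v (-α) (E t) y * w t y := by
  have cw := (hw.smooth.slice t).continuous
  have ck := ((smooth2_kern (-α)).slice (E t)).continuous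
  have ckx := ((smooth2_kern (-α)).pdt.slice (E t)).continuous
  have h5 : ∫ y in 0..E t, gain σ v (-α) (E t) y * w t y
      = σ * (∫ y in 0..E t, pdt (kern (-α)) (E t) y * w t y)
        + v * ∫ y in 0..E t, kern (-α) (E t) y * w t y := by
    rw [← int_const_mul, ← int_const_mul,
      ← int_add cont_ii
        cont_ii]
    congr 1; ext y; unfold gain; ring
  rw [h5, pdx_unstep hw.smooth, unstep, volt]
  linear_combination hw.bdryFront t ht

end Unstep

/-! ## Integration over the moving domain -/

section MovingDomain

lemma measurableSet_domain (hE : Measurable E) : MeasurableSet (domain E) :=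
  (measurableSet_lt measurable_const measurable_fst).inter
    ((measurableSet_lt measurable_const measurable_snd).inter
      (measurableSet_lt measurable_snd (hE.comp measurable_fst)))

lemma meas_domainT (hE : Measurable E) (T : ℝ) : MeasurableSet (domainT E T) :=
  (measurableSet_domain hE).inter (measurableSet_lt measurable_fst measurable_const)

lemma indicator_domainT {M : Type*} [Zero M] (F : ℝ × ℝ → M) (t x : ℝ) :
    (domainT E T).indicator F (t, x)
      = (Ioo 0 T).indicator (fun t => (Ioo 0 (E t)).indicator (fun x => F (t, x)) x) t := by
  have h : (t, x) ∈ domainT E T ↔ t ∈ Ioo 0 T ∧ x ∈ Ioo 0 (E t) := by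
    simp only [domainT, domain, mem_ofPred_eq, mem_Ioo]; tauto
  by_cases h1 : t ∈ Ioo 0 T <;> by_cases h2 : x ∈ Ioo 0 (E t) <;> simp [indicator, h, h1, h2]

lemma lintegral_domainT (hE : Measurable E) {F : ℝ × ℝ → ENNReal}
    (hF : AEMeasurable F (volume.restrict (domainT E T))) :
    ∫⁻ p in domainT E T, F p = ∫⁻ t, ∫⁻ x, F (t, x) ∂(mu (E t)) ∂(mu T) := by
  have hD := meas_domainT hE T
  rw [← lintegral_indicator hD, Measure.volume_eq_prod, lintegral_prod _
    ((aemeasurable_indicator_iff hD).2 hF)]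
  unfold mu
  rw [← lintegral_indicator measurableSet_Ioo]
  refine lintegral_congr fun t => ?_
  simp only [indicator_domainT]
  by_cases h : t ∈ Ioo 0 T
  · simp only [indicator_of_mem h]
    rw [lintegral_indicator measurableSet_Ioo]
  · simp [indicator_of_notMem h]

lemma ae_of_domainT (hE : Measurable E) {P : ℝ × ℝ → Prop}
    (h : ∀ᵐ p ∂(volume.restrict (domainT E T)), P p) :
    ∀ᵐ t ∂(mu T), ∀ᵐ x ∂(mu (E t)), P (t, x) := by
  rw [ae_restrict_iff' (meas_domainT hE T), Measure.volume_eq_prod] at h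
  have h2 := Measure.ae_ae_of_ae_prod h
  refine (ae_restrict_iff' measurableSet_Ioo).2 ?_
  filter_upwards [h2] with t ht htT
  refine (ae_restrict_iff' measurableSet_Ioo).2 ?_
  filter_upwards [ht] with x hx hxE
  exact hx ⟨⟨htT.1, hxE.1, hxE.2⟩, htT.2⟩

lemma integrable_indicator_domainT (hE : Measurable E) {F : ℝ × ℝ → ℝ}
    (hF : IntegrableOn F (domainT E T)) :
    Integrable ((domainT E T).indicator F) ((volume : Measure ℝ).prod (volume : Measure ℝ)) := by
  rw [← Measure.volume_eq_prod]
  exact (integrable_indicator_iff (meas_domainT hE T)).2 hF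

lemma aestronglyMeasurable_slice (hE : Measurable E) {F : ℝ × ℝ → ℝ}
    (hF : AEStronglyMeasurable F (volume.restrict (domainT E T))) :
    ∀ᵐ t ∂(mu T), AEStronglyMeasurable (fun x => F (t, x)) (mu (E t)) := by
  filter_upwards [ae_of_domainT hE hF.ae_eq_mk] with t ht
  exact ⟨fun x => hF.mk F (t, x),
    hF.stronglyMeasurable_mk.comp_measurable measurable_prodMk_left, ht⟩

lemma integrable_slice (hE : Measurable E) {F : ℝ × ℝ → ℝ} (hF : IntegrableOn F (domainT E T)) :
    ∀ᵐ t ∂(mu T), Integrable (fun x => F (t, x)) (mu (E t)) := by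
  have h := (integrable_indicator_domainT hE hF).prod_right_ae
  refine (ae_restrict_iff' measurableSet_Ioo).2 ?_
  filter_upwards [h] with t ht htT
  simp only [indicator_domainT, indicator_of_mem htT] at ht
  exact (integrable_indicator_iff measurableSet_Ioo).1 ht

lemma inner_integral_eq (hpos : ∀ t, 0 < E t) (F : ℝ × ℝ → ℝ) (t : ℝ) :
    ∫ x, (domainT E T).indicator F (t, x)
      = (Ioo 0 T).indicator (fun t => ∫ x in 0..E t, F (t, x)) t := by
  simp only [indicator_domainT]
  by_cases h : t ∈ Ioo 0 T
  · simp only [indicator_of_mem h]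
    rw [integral_indicator measurableSet_Ioo, ← integral_mu (hpos t).le]
    rfl
  · simp [indicator_of_notMem h]

lemma integrable_int_slice (hE : Measurable E) (hpos : ∀ t, 0 < E t) {F : ℝ × ℝ → ℝ}
    (hF : IntegrableOn F (domainT E T)) :
    Integrable (fun t => ∫ x in 0..E t, F (t, x)) (mu T) := by
  have h := (integrable_indicator_domainT hE hF).integral_prod_left
  simp only [inner_integral_eq hpos] at h
  exact (integrable_indicator_iff measurableSet_Ioo).1 h

lemma integral_domainT (hE : Measurable E) (hpos : ∀ t, 0 < E t) (hT : 0 ≤ T) {F : ℝ × ℝ → ℝ}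
    (hF : IntegrableOn F (domainT E T)) :
    ∫ p in domainT E T, F p = ∫ t in 0..T, ∫ x in 0..E t, F (t, x) := by
  rw [← integral_indicator (meas_domainT hE T), Measure.volume_eq_prod,
    integral_prod _ (integrable_indicator_domainT hE hF), ← integral_mu hT, mu,
    ← integral_indicator measurableSet_Ioo]
  simp only [inner_integral_eq hpos]

lemma MovL2.slice (hE : Measurable E) {f : ℝ → ℝ → ℝ} (hf : MovL2 E T f) :
    ∀ᵐ t ∂(mu T), MemLp (f t) 2 (mu (E t)) := by
  filter_upwards [integrable_slice hE hf.integrable_sq, aestronglyMeasurable_slice hE hf.1]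
    with t h1 h2
  exact (memLp_two_iff_integrable_sq h2).2 h1

lemma MovL2.integrable_mul {f g : ℝ → ℝ → ℝ} (hf : MovL2 E T f) (hg : MovL2 E T g) :
    IntegrableOn (fun p : ℝ × ℝ => f p.1 p.2 * g p.1 p.2) (domainT E T) :=
  MemLp.integrable_mul hf hg

lemma domainT_subset (hC : ∀ t ∈ Icc 0 T, E t ≤ C) :
    domainT E T ⊆ Icc 0 T ×ˢ Icc 0 C := fun _ hp =>
  ⟨⟨hp.1.1.le, hp.2.le⟩, ⟨hp.1.2.1.le, hp.1.2.2.le.trans (hC _ ⟨hp.1.1.le, hp.2.le⟩)⟩⟩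

lemma finite_domainT (hE : Continuous E) :
    IsFiniteMeasure ((volume : Measure (ℝ × ℝ)).restrict (domainT E T)) := by
  obtain ⟨C, hC⟩ := (isCompact_Icc (a := (0 : ℝ)) (b := T)).bddAbove_image hE.continuousOn
  refine ⟨?_⟩
  rw [Measure.restrict_apply_univ]
  refine lt_of_le_of_lt (measure_mono (domainT_subset (C := C) fun t ht => hC ⟨t, ht, rfl⟩)) ?_
  exact (isCompact_Icc.prod isCompact_Icc).measure_lt_top

lemma exists_bound_domainT (hE : Continuous E) (T : ℝ) {f : ℝ → ℝ → ℝ}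
    (hf : Continuous (uncurry f)) :
    ∃ C, 0 ≤ C ∧ ∀ t ∈ Icc 0 T, ∀ x ∈ Icc 0 (E t), |f t x| ≤ C := by
  obtain ⟨R, hR⟩ := (isCompact_Icc (a := (0 : ℝ)) (b := T)).bddAbove_image hE.continuousOn
  obtain ⟨C, hC⟩ := ((isCompact_Icc (a := (0 : ℝ)) (b := T)).prod
    (isCompact_Icc (a := (0 : ℝ)) (b := R))).bddAbove_image hf.norm.continuousOn
  refine ⟨max C 0, le_max_right _ _, fun t ht x hx => le_max_of_le_left ?_⟩
  exact hC ⟨(t, x), ⟨ht, hx.1, hx.2.trans (hR ⟨t, ht, rfl⟩)⟩, rfl⟩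

lemma movL2_of_bound (hE : Continuous E) {f : ℝ → ℝ → ℝ}
    (hm : AEStronglyMeasurable (uncurry f) (volume.restrict (domainT E T)))
    (hC : ∀ t ∈ Icc 0 T, ∀ x ∈ Icc 0 (E t), |f t x| ≤ C) : MovL2 E T f := by
  have := finite_domainT (T := T) hE
  refine memLp_two_of_bound hm C ?_
  refine (ae_restrict_iff' (meas_domainT hE.measurable T)).2
    (.of_forall fun p hp => hC p.1 ⟨hp.1.1.le, hp.2.le⟩ p.2 ⟨hp.1.2.1.le, hp.1.2.2.le⟩)

lemma movL2_of_cont (hE : Continuous E) {f : ℝ → ℝ → ℝ}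
    (hf : Continuous (uncurry f)) : MovL2 E T f := by
  obtain ⟨C, -, hC⟩ := exists_bound_domainT hE T hf
  exact movL2_of_bound hE hf.aestronglyMeasurable hC

lemma MovL2.bdd_mul (hE : Continuous E) {f g : ℝ → ℝ → ℝ}
    (hf : Continuous (uncurry f)) (hg : MovL2 E T g) :
    MovL2 E T (fun t x => f t x * g t x) := by
  obtain ⟨C, -, hC⟩ := exists_bound_domainT hE T hf
  refine MemLp.of_le_mul (c := C) (g := uncurry g) hg (hf.aestronglyMeasurable.mul hg.1) ?_
  refine (ae_restrict_iff' (meas_domainT hE.measurable T)).2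
    (.of_forall fun p hp => ?_)
  simp only [uncurry, norm_mul]
  exact mul_le_mul_of_nonneg_right
    (hC p.1 ⟨hp.1.1.le, hp.2.le⟩ p.2 ⟨hp.1.2.1.le, hp.1.2.2.le⟩) (norm_nonneg _)

end MovingDomain

/-! ## Continuous families in `L²` -/

lemma abs_integral_mul_le_eLpNorm (hl : 0 ≤ l) (hf : MemLp f 2 (mu l))
    (hg : MemLp g 2 (mu l)) : |∫ y in 0..l, f y * g y|
      ≤ (eLpNorm f 2 (mu l)).toReal * (eLpNorm g 2 (mu l)).toReal := by
  rw [eLpNorm_two_eq hf, eLpNorm_two_eq hg, toReal_ofReal (sqrt_nonneg _),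
    toReal_ofReal (sqrt_nonneg _), ← integral_mu hl]
  exact integral_mul_sq_le hf hg

namespace ContL2

variable {I : Set ℝ} {f g : ℝ → ℝ → ℝ}

lemma continuousOn_integral_mul (hl : 0 ≤ l) (hf : ContL2 l I f) (hg : ContL2 l I g) :
    ContinuousOn (fun t => ∫ y in 0..l, f t y * g t y) I := by
  intro t ht
  have hI : ∀ᶠ s in 𝓝[I] t, s ∈ I := self_mem_nhdsWithin
  have mf := hf.1 t ht
  have mg := hg.1 t ht
  have df : ∀ᶠ s in 𝓝[I] t, MemLp (fun y => f s y - f t y) 2 (mu l) :=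
    hI.mono fun s hs => (hf.1 s hs).sub mf
  have dg : ∀ᶠ s in 𝓝[I] t, MemLp (fun y => g s y - g t y) 2 (mu l) :=
    hI.mono fun s hs => (hg.1 s hs).sub mg
  have h1 := tendsto_int_mul_const hl df (hf.2 t ht) mg
  have h2 := tendsto_int_mul_const hl dg (hg.2 t ht) mf
  have h3 : Tendsto (fun s => ∫ y in 0..l, (f s y - f t y) * (g s y - g t y)) (𝓝[I] t) (𝓝 0) := by
    have h4 := ((ENNReal.tendsto_toReal ENNReal.zero_ne_top).comp (hf.2 t ht)).mul
      ((ENNReal.tendsto_toReal ENNReal.zero_ne_top).comp (hg.2 t ht))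
    simp only [ENNReal.toReal_zero, mul_zero] at h4
    refine squeeze_zero_norm' ?_ h4
    filter_upwards [df, dg] with s hs hs'
    exact abs_integral_mul_le_eLpNorm hl hs hs'
  have h5 := ((h1.add h2).add h3).add (tendsto_const_nhds (x := ∫ y in 0..l, f t y * g t y))
  simp only [zero_add] at h5
  refine h5.congr' ?_
  filter_upwards [hI, df, dg] with s hs hs1 hs2
  have i1 := ii_of_mu hl (hs1.integrable_mul mg)
  have i2 := ii_of_mu hl (hs2.integrable_mul mf)
  have i3 := ii_of_mu hl (hs1.integrable_mul hs2)
  have i4 := ii_of_mu hl (mf.integrable_mul mg)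
  simp only [Pi.mul_def] at i1 i2 i3 i4
  rw [← int_add i1 i2, ← int_add (i1.add i2) i3, ← int_add ((i1.add i2).add i3) i4]
  congr 1; ext y; ring

lemma sub (hf : ContL2 l I f) (hg : ContL2 l I g) : ContL2 l I (fun t y => f t y - g t y) := by
  refine ⟨fun t ht => (hf.1 t ht).sub (hg.1 t ht), fun t ht => ?_⟩
  have h := (hf.2 t ht).add (hg.2 t ht)
  rw [add_zero] at h
  refine tendsto_of_tendsto_of_tendsto_of_le_of_le' tendsto_const_nhds h
    (.of_forall fun _ => zero_le) ?_
  filter_upwards [self_mem_nhdsWithin] with s hs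
  have h1 := (hf.1 s hs).sub (hf.1 t ht)
  have h2 := (hg.1 s hs).sub (hg.1 t ht)
  refine le_trans (le_of_eq ?_) (eLpNorm_sub_le h1.1 h2.1 (by norm_num))
  congr 1; ext y; simp only [Pi.sub_apply]; ring

lemma mono (hf : ContL2 l I f) {J : Set ℝ} (h : J ⊆ I) : ContL2 l J f :=
  ⟨fun t ht => hf.1 t (h ht), fun t ht => (hf.2 t (h ht)).mono_left (nhdsWithin_mono t h)⟩

/-- A uniform limit of continuous families is continuous. -/
lemma of_uniform_limit {F : ℕ → ℝ → ℝ → ℝ} {δ : ℕ → ENNReal} (hδ : Tendsto δ atTop (𝓝 0))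
    (hF : ∀ n, ContL2 l I (F n)) (hf : ∀ t ∈ I, AEStronglyMeasurable (f t) (mu l))
    (h : ∀ n, ∀ t ∈ I, eLpNorm (fun y => F n t y - f t y) 2 (mu l) ≤ δ n) : ContL2 l I f := by
  have hmem : ∀ t ∈ I, MemLp (f t) 2 (mu l) := by
    intro t ht
    obtain ⟨n, hn⟩ := (hδ.eventually (gt_mem_nhds (zero_lt_one (α := ENNReal)))).exists
    have h1 : MemLp (fun y => F n t y - f t y) 2 (mu l) :=
      ⟨((hF n).1 t ht).1.sub (hf t ht), ((h n t ht).trans_lt hn).trans ENNReal.one_lt_top⟩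
    refine (((hF n).1 t ht).sub h1).ae_eq (.of_forall fun y => ?_)
    simp
  refine ⟨hmem, fun t ht => ?_⟩
  refine ENNReal.tendsto_nhds_zero.2 fun ε hε => ?_
  have h3 : (0 : ENNReal) < ε / 3 := ENNReal.div_pos hε.ne' (by norm_num)
  obtain ⟨n, hn⟩ := (hδ.eventually (gt_mem_nhds h3)).exists
  have h4 := ENNReal.tendsto_nhds_zero.1 ((hF n).2 t ht) _ h3
  filter_upwards [h4, self_mem_nhdsWithin] with s hs hsI
  have m1 : MemLp (fun y => F n s y - f s y) 2 (mu l) := ((hF n).1 s hsI).sub (hmem s hsI)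
  have m2 : MemLp (fun y => F n t y - f t y) 2 (mu l) := ((hF n).1 t ht).sub (hmem t ht)
  have m3 : MemLp (fun y => F n s y - F n t y) 2 (mu l) := ((hF n).1 s hsI).sub ((hF n).1 t ht)
  have e : (fun y => f s y - f t y) = (fun y => F n s y - F n t y) - (fun y => F n s y - f s y)
      + fun y => F n t y - f t y := by
    ext y; simp only [Pi.sub_apply, Pi.add_apply]; ring
  rw [e]
  refine (eLpNorm_add_le (m3.sub m1).1 m2.1 (by norm_num)).trans ?_
  refine (add_le_add (eLpNorm_sub_le m3.1 m1.1 (by norm_num)) le_rfl).trans ?_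
  refine (add_le_add (add_le_add hs ((h n s hsI).trans hn.le)) ((h n t ht).trans hn.le)).trans ?_
  exact (ENNReal.add_thirds ε).le

end ContL2

lemma contL2_of_continuous_on (l : ℝ) (I : Set ℝ) {a : ℝ → ℝ → ℝ}
    (ha : Continuous (uncurry a)) : ContL2 l I a := by
  have hs : ∀ t, Continuous (a t) := fun t => ha.comp (by fun_prop : Continuous fun x => (t, x))
  refine ⟨fun t _ => memLp_mu_of_cont (hs t).continuousOn, fun t _ => ?_⟩
  obtain ⟨C, hC⟩ := ((isCompact_Icc (a := t - 1) (b := t + 1)).prod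
    (isCompact_Icc (a := (0 : ℝ)) (b := l))).bddAbove_image ha.norm.continuousOn
  have hb : ∀ s ∈ Icc (t - 1) (t + 1), ∀ x ∈ Icc 0 l, |a s x| ≤ C := fun s hs x hx =>
    hC ⟨(s, x), ⟨hs, hx⟩, rfl⟩
  refine tendsto_eLpNorm_of_dominated (C + C)
    (.of_forall fun s => ((hs s).sub (hs t)).aestronglyMeasurable) ?_ ?_
  · filter_upwards [mem_nhdsWithin_of_mem_nhds
      (Icc_mem_nhds (show t - 1 < t by linarith) (show t < t + 1 by linarith))] with s hst
    refine ae_restrict_of_forall_mem measurableSet_Ioo (fun x hx => ?_)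
    have hx' := Ioo_subset_Icc_self hx
    exact (abs_sub _ _).trans (add_le_add (hb s hst x hx') (hb t (by constructor <;> linarith) x hx'))
  · refine .of_forall fun x => ?_
    have h1 : Continuous fun s => a s x - a t x :=
      (ha.comp (by fun_prop : Continuous fun s => (s, x))).sub continuous_const
    have h2 := h1.tendsto t
    rw [sub_self] at h2
    exact h2.mono_left nhdsWithin_le_nhds

/-! ## Rescaling -/

lemma map_mul_mu (hc : 0 < c) : Measure.map (fun y => c * y) (mu 1) = (ofReal c)⁻¹ • mu c := by
  have hpre : (fun y => c * y) ⁻¹' Ioo 0 c = Ioo 0 1 := by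
    ext y
    simp only [mem_preimage, mem_Ioo]
    constructor
    · rintro ⟨h1, h2⟩
      exact ⟨pos_of_mul_pos_right h1 hc.le, by nlinarith⟩
    · rintro ⟨h1, h2⟩
      exact ⟨by positivity, by nlinarith⟩
  have h := Real.map_volume_mul_left hc.ne'
  unfold mu
  rw [← hpre, ← Measure.restrict_map (measurable_const_mul c) measurableSet_Ioo, h,
    Measure.restrict_smul, abs_of_pos (inv_pos.2 hc), ENNReal.ofReal_inv_of_pos hc]

lemma measurableEmbedding_mul (hc : 0 < c) : MeasurableEmbedding fun y : ℝ => c * y :=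
  (Homeomorph.mulLeft₀ c hc.ne').measurableEmbedding

lemma eLpNorm_rescale (hc : 0 < c) (f : ℝ → ℝ) : eLpNorm (fun y => f (c * y)) 2 (mu 1)
      = (ofReal c)⁻¹ ^ (1 / 2 : ℝ) * eLpNorm f 2 (mu c) := by
  have h := (measurableEmbedding_mul hc).eLpNorm_map_measure (g := f) (p := 2) (μ := mu 1)
  rw [map_mul_mu hc, eLpNorm_smul_measure_of_ne_top (by norm_num)] at h
  simpa [Function.comp_def] using h.symm

lemma memLp_rescale (hc : 0 < c) : MemLp (fun y => f (c * y)) 2 (mu 1) ↔ MemLp f 2 (mu c) := by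
  have h := (measurableEmbedding_mul hc).memLp_map_measure_iff (g := f) (p := 2) (μ := mu 1)
  rw [map_mul_mu hc] at h
  have hc1 : (ofReal c)⁻¹ ≠ 0 := by simp
  have hc2 : (ofReal c)⁻¹ ≠ ⊤ := by simpa using hc
  refine Iff.trans h.symm ⟨fun h => ?_, fun h => h.smul_measure hc2⟩
  have h3 := h.smul_measure (c := ofReal c) ofReal_ne_top
  rwa [smul_smul, ENNReal.mul_inv_cancel (by simpa using hc) ofReal_ne_top, one_smul] at h3

lemma integral_rescale (c : ℝ) (f : ℝ → ℝ) : ∫ x in 0..c, f x = c * ∫ y in 0..1, f (c * y) := by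
  simp

namespace MovContL2

variable {I : Set ℝ} {f g : ℝ → ℝ → ℝ}

lemma memLp (hpos : ∀ t, 0 < E t) (hf : MovContL2 E I f) (ht : t ∈ I) :
    MemLp (f t) 2 (mu (E t)) :=
  (memLp_rescale (hpos t)).1 (hf.1 t ht)

lemma continuousOn_integral_mul (hE : Continuous E) (hf : MovContL2 E I f) (hg : MovContL2 E I g) :
    ContinuousOn (fun t => ∫ x in 0..E t, f t x * g t x) I := by
  have h := hE.continuousOn.mul (ContL2.continuousOn_integral_mul zero_le_one hf hg)
  exact h.congr fun t _ => integral_rescale (E t) fun x => f t x * g t x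

lemma of_cont (hE : Continuous E) (I : Set ℝ) (hf : Continuous (uncurry f)) :
    MovContL2 E I f :=
  contL2_of_continuous_on 1 I (hf.comp (f := fun p : ℝ × ℝ => (p.1, E p.1 * p.2)) (by fun_prop))

lemma sub (hf : MovContL2 E I f) (hg : MovContL2 E I g) :
    MovContL2 E I (fun t x => f t x - g t x) := ContL2.sub hf hg

lemma mono (hf : MovContL2 E I f) {J : Set ℝ} (h : J ⊆ I) : MovContL2 E J f := ContL2.mono hf h

lemma exists_bound (hE : Continuous E) (hf : MovContL2 E (Icc 0 T) f) :
    ∃ C, 0 ≤ C ∧ ∀ t ∈ Icc 0 T, ∫ x in 0..E t, f t x ^ 2 ≤ C := by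
  obtain ⟨C, hC⟩ := (isCompact_Icc (a := (0 : ℝ)) (b := T)).bddAbove_image
    (hf.continuousOn_integral_mul hE hf)
  refine ⟨max C 0, le_max_right _ _, fun t ht => le_max_of_le_left ?_⟩
  have := hC ⟨t, ht, rfl⟩
  simpa [sq] using this

lemma movL2 (hE : Continuous E) (hpos : ∀ t, 0 < E t) (hf : MovContL2 E (Icc 0 T) f)
    (hm : AEStronglyMeasurable (uncurry f) (volume.restrict (domainT E T))) :
    MovL2 E T f := by
  obtain ⟨C, hC0, hC⟩ := hf.exists_bound hE
  have hm2 : AEStronglyMeasurable (fun p : ℝ × ℝ => f p.1 p.2 ^ 2)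
      (volume.restrict (domainT E T)) := hm.pow 2
  refine (memLp_two_iff_integrable_sq hm).2 (?_ : Integrable (fun p : ℝ × ℝ => f p.1 p.2 ^ 2) _)
  refine ⟨hm2, ?_⟩
  rw [hasFiniteIntegral_iff_ofReal (.of_forall fun p => sq_nonneg _),
    lintegral_domainT hE.measurable hm2.aemeasurable.ennreal_ofReal]
  have h1 : ∀ᵐ t ∂(mu T), ∫⁻ x, ofReal (f t x ^ 2) ∂(mu (E t)) ≤ ofReal C := by
    refine ae_restrict_of_forall_mem measurableSet_Ioo (fun t ht => ?_)
    have ht' := Ioo_subset_Icc_self ht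
    have h2 := (hf.memLp hpos ht').integrable_sq
    have h3 := ofReal_integral_eq_lintegral_ofReal h2 (.of_forall fun x => sq_nonneg _)
    rw [integral_mu (hpos t).le] at h3
    rw [← h3]
    exact ofReal_le_ofReal (hC t ht')
  refine (lintegral_mono_ae h1).trans_lt ?_
  rw [lintegral_const]
  exact ENNReal.mul_lt_top ENNReal.ofReal_lt_top (measure_lt_top _ _)

end MovContL2

/-! ## The fundamental lemma in time -/

lemma integral_deriv_eq_zero_imp (hT : 0 < T) {G : ℝ → ℝ} (hG : ContinuousOn G (Icc 0 T))
    (h : ∀ χ : ℝ → ℝ, ContDiff ℝ ∞ χ → HasCompactSupport χ → tsupport χ ⊆ Ioo 0 T →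
      ∫ t in 0..T, deriv χ t * G t = 0) : G T = G 0 := by
  set b : ContDiffBump (T / 2) := ⟨T / 8, T / 4, by linarith, by linarith⟩ with hb
  set ψ : ℝ → ℝ := b.normed volume with hψ
  have hψs : ContDiff ℝ ∞ ψ := b.contDiff_normed
  have hψt : tsupport ψ ⊆ Icc (T / 4) (T * 3 / 4) := by
    rw [hψ, b.tsupport_normed_eq, Real.closedBall_eq_Icc]
    exact Icc_subset_Icc (by simp only [hb]; linarith) (by simp only [hb]; linarith)
  have hψ1 : ∫ t, ψ t = 1 := b.integral_normed
  have supp_int : ∀ {g : ℝ → ℝ}, tsupport g ⊆ Ioo 0 T → ∀ F : ℝ → ℝ,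
      ∫ t, g t * F t = ∫ t in 0..T, g t * F t := by
    intro g hg F
    rw [int_of_le hT.le]
    refine (setIntegral_eq_integral_of_forall_compl_eq_zero fun t ht => ?_).symm
    have : g t = 0 := image_eq_zero_of_notMem_tsupport fun h' => ht (Ioo_subset_Ioc_self (hg h'))
    simp [this]
  have hψT : tsupport ψ ⊆ Ioo 0 T := fun t ht =>
    ⟨by linarith [(hψt ht).1], by linarith [(hψt ht).2]⟩
  set c : ℝ := ∫ t in 0..T, ψ t * G t with hc
  have hGi : IntervalIntegrable G volume 0 T := by
    refine ContinuousOn.intervalIntegrable ?_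
    rwa [uIcc_of_le hT.le]
  have key : ∀ g : ℝ → ℝ, ContDiff ℝ ∞ g → HasCompactSupport g → tsupport g ⊆ Ioo 0 T →
      ∫ t, g t * (G t - c) = 0 := by
    intro g hg hgc hgT
    obtain ⟨a₁, b₁, hab1, hab2⟩ : ∃ a₁ b₁, tsupport g ⊆ Icc a₁ b₁ ∧ 0 < a₁ ∧ b₁ < T := by
      rcases (tsupport g).eq_empty_or_nonempty with h0 | h0
      · exact ⟨T / 4, T / 2, by simp [h0], by linarith, by linarith⟩
      · have hk : IsCompact (tsupport g) := hgc
        exact ⟨sInf (tsupport g), sSup (tsupport g), fun t ht =>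
          ⟨csInf_le hk.bddBelow ht, le_csSup hk.bddAbove ht⟩, (hgT (hk.sInf_mem h0)).1,
          (hgT (hk.sSup_mem h0)).2⟩
    set m : ℝ := ∫ t, g t with hm
    set f : ℝ → ℝ := fun t => g t - m * ψ t with hf
    have hfs : ContDiff ℝ ∞ f := hg.sub (contDiff_const.mul hψs)
    set a₂ := min a₁ (T / 4) with ha2
    set b₂ := max b₁ (T * 3 / 4) with hb2
    have ha2p : 0 < a₂ := lt_min hab2.1 (by linarith)
    have hb2p : b₂ < T := max_lt hab2.2 (by linarith)
    have hf0 : ∀ t, t ∉ Icc a₂ b₂ → f t = 0 := by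
      intro t ht
      have h1 : g t = 0 := image_eq_zero_of_notMem_tsupport fun h' =>
        ht ⟨(min_le_left _ _).trans (hab1 h').1, (hab1 h').2.trans (le_max_left _ _)⟩
      have h2 : ψ t = 0 := image_eq_zero_of_notMem_tsupport fun h' =>
        ht ⟨(min_le_right _ _).trans (hψt h').1, (hψt h').2.trans (le_max_right _ _)⟩
      simp [hf, h1, h2]
    have hgi : Integrable g := hg.continuous.integrable_of_hasCompactSupport hgc
    have hψi : Integrable ψ := hψs.continuous.integrable_of_hasCompactSupport
      b.hasCompactSupport_normed
    have hfint : ∫ t, f t = 0 := by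
      rw [hf, integral_sub hgi (hψi.const_mul m), integral_const_mul, hψ1, ← hm]; ring
    set χ : ℝ → ℝ := fun t => ∫ s in 0..t, f s with hχ
    have hχs : ContDiff ℝ ∞ χ := contDiff_integral hfs 0
    have hχd : ∀ t, deriv χ t = f t := fun t =>
      (integral_hasDerivAt_right (hfs.continuous.intervalIntegrable _ _)
        (hfs.continuous.stronglyMeasurableAtFilter _ _) hfs.continuous.continuousAt).deriv
    have hχ0 : ∀ t, t ∉ Icc a₂ b₂ → χ t = 0 := by
      intro t ht
      rcases lt_or_ge t a₂ with h1 | h1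
      · refine (int_congr (g := fun _ => 0) fun s hs => hf0 s fun h' => ?_).trans (by simp)
        have := (mem_uIcc.1 hs)
        rcases this with h2 | h2 <;> linarith [h'.1, h2.1, h2.2]
      · have h2 : b₂ < t := not_le.1 fun h' => ht ⟨h1, h'⟩
        have h3 : (0 : ℝ) ≤ t := by linarith
        rw [← hfint, hχ]
        simp only
        rw [int_of_le h3]
        refine setIntegral_eq_integral_of_forall_compl_eq_zero fun s hs => hf0 s fun h' => hs ?_
        exact ⟨by linarith [h'.1], by linarith [h'.2]⟩
    have hsub : tsupport χ ⊆ Icc a₂ b₂ := closure_minimal (fun t ht => by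
        by_contra h'
        exact ht (hχ0 t h')) isClosed_Icc
    have h1 := h χ hχs (HasCompactSupport.of_support_subset_isCompact isCompact_Icc
      ((subset_tsupport χ).trans hsub)) fun t ht =>
        ⟨lt_of_lt_of_le ha2p (hsub ht).1, lt_of_le_of_lt (hsub ht).2 hb2p⟩
    simp only [hχd] at h1
    have i1 : IntervalIntegrable (fun t => g t * G t) volume 0 T :=
      hGi.continuousOn_mul hg.continuous.continuousOn
    have i2 : IntervalIntegrable (fun t => ψ t * G t) volume 0 T :=
      hGi.continuousOn_mul hψs.continuous.continuousOn
    have h2 : ∫ t in 0..T, f t * G t = (∫ t in 0..T, g t * G t) - m * c := by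
      rw [hc, ← int_const_mul, ← int_sub i1 (i2.const_mul m)]
      congr 1; ext t; simp only [hf]; ring
    have h3 : ∫ t in 0..T, g t = m := by
      have := supp_int hgT fun _ => 1
      simpa [hm] using this.symm
    rw [supp_int hgT fun t => G t - c]
    simp only [mul_sub]
    rw [int_sub i1 ((hg.continuous.intervalIntegrable _ _).mul_const c), int_mul_const, h3]
    linarith
  have hae := isOpen_Ioo.ae_eq_zero_of_integral_contDiff_smul_eq_zero (U := Ioo 0 T) (μ := volume)
    (f := fun t => G t - c) (((hG.sub continuousOn_const).mono
      Ioo_subset_Icc_self).locallyIntegrableOn measurableSet_Ioo) fun g h1 h2 h3 => by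
        simpa using key g h1 h2 h3
  have hae2 : (fun t => G t) =ᵐ[volume.restrict (Icc 0 T)] fun _ => c := by
    rw [← Measure.restrict_congr_set Ioo_ae_eq_Icc]
    refine (ae_restrict_iff' measurableSet_Ioo).2 ?_
    filter_upwards [hae] with t ht htI
    linarith [ht htI]
  have heq : ∀ t ∈ Icc 0 T, G t = c :=
    Measure.eqOn_Icc_of_ae_eq volume hT.ne hae2 hG continuousOn_const
  rw [heq T ⟨hT.le, le_rfl⟩, heq 0 ⟨le_rfl, hT.le⟩]

/-- A continuous function with integrable weak derivative is the integral of its derivative. -/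
lemma sub_eq_integral_of_weak_deriv (hT : 0 < T) {J K : ℝ → ℝ}
    (hJ : ContinuousOn J (Icc 0 T)) (hK : IntervalIntegrable K volume 0 T)
    (h : ∀ χ : ℝ → ℝ, ContDiff ℝ ∞ χ → HasCompactSupport χ → tsupport χ ⊆ Ioo 0 T →
      ∫ t in 0..T, (deriv χ t * J t + χ t * K t) = 0) :
    J T - J 0 = ∫ t in 0..T, K t := by
  set P : ℝ → ℝ := fun t => ∫ s in 0..t, K s with hP
  have hPc : ContinuousOn P (Icc 0 T) := by
    have := continuousOn_primitive_interval (a := 0) (b := T) (f := K) (μ := volume) (by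
        rw [uIcc_of_le hT.le, integrableOn_Icc_iff_integrableOn_Ioc]
        exact (intervalIntegrable_iff_integrableOn_Ioc_of_le hT.le).1 hK)
    rwa [uIcc_of_le hT.le] at this
  have ii : ∀ {F : ℝ → ℝ}, ContinuousOn F (Icc 0 T) → IntervalIntegrable F volume 0 T := fun hF =>
    ContinuousOn.intervalIntegrable (by rwa [uIcc_of_le hT.le])
  have hJP : ContinuousOn (fun t => J t - P t) (Icc 0 T) := hJ.sub hPc
  have hG := integral_deriv_eq_zero_imp hT hJP fun χ hs hc hsupp => by
    have h1 := h χ hs hc hsupp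
    have hd : ∀ t, HasDerivAt χ (deriv χ t) t := fun t =>
      ((hs.differentiable (by simp)) t).hasDerivAt
    have hdc : Continuous (deriv χ) := hs.continuous_deriv (by simp)
    have h0 : χ 0 = 0 := image_eq_zero_of_notMem_tsupport fun h' => lt_irrefl _ (hsupp h').1
    have hT0 : χ T = 0 := image_eq_zero_of_notMem_tsupport fun h' => lt_irrefl _ (hsupp h').2
    have h2 := int_mul_primitive (f := P) (g := K) hK (fun t _ => by simp [hP]) hT.le hd hdc
    rw [h0, hT0, zero_mul, zero_mul, sub_zero, zero_sub] at h2
    have i1 : IntervalIntegrable (fun t => deriv χ t * J t) volume 0 T :=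
      ii (hdc.continuousOn.mul hJ)
    have i2 : IntervalIntegrable (fun t => deriv χ t * P t) volume 0 T :=
      ii (hdc.continuousOn.mul hPc)
    rw [int_add i1 (hK.continuousOn_mul hs.continuous.continuousOn), h2] at h1
    simp only [mul_sub]
    rw [int_sub i1 i2]
    linarith
  simp only [hP, intervalIntegral.integral_same, sub_zero] at hG
  linarith

/-! ## Scalar test functions -/

/-- Test functions for the scalar problem with boundary condition `∂ₓν(t, E(t)) = κ(t) ν(t, E(t))`. -/
structure IsScalarTest (E κ : ℝ → ℝ) (T : ℝ) (ν νt νx νxx : ℝ → ℝ → ℝ) : Prop where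
  memL2 : MovL2 E T ν ∧ MovL2 E T νx ∧ MovL2 E T νxx
  memH2 : ∀ᵐ t ∂(mu T), IsH1 (E t) (ν t) (νx t) ∧ IsH1 (E t) (νx t) (νxx t)
  cont : MovContL2 E (Icc 0 T) ν
  timeDeriv : HasWeakTimeDeriv E T ν νt
  final : ∀ᵐ x ∂(mu (E T)), ν T x = 0
  bdryZero : ∀ᵐ t ∂(mu T), νx t 0 = 0
  bdryFront : ∀ᵐ t ∂(mu T), νx t (E t) = κ t * ν t (E t)

lemma exists_cutoff (n : ℕ) : ∃ r : ℝ → ℝ, ContDiff ℝ ∞ r ∧ (∀ y, |r y| ≤ 1) ∧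
    (∃ a b : ℝ, 0 < a ∧ b < 1 ∧ ∀ y, y ∉ Icc a b → r y = 0) ∧
    ∀ y, 2 ≤ (n + 1 : ℝ) * y → 2 ≤ (n + 1 : ℝ) * (1 - y) → r y = 1 := by
  set m : ℝ := n + 1 with hm
  have hm0 : 0 < m := by positivity
  refine ⟨fun y => smoothTransition (m * y - 1) * smoothTransition (m * (1 - y) - 1),
    (smoothTransition.contDiff.comp (by fun_prop)).mul
      (smoothTransition.contDiff.comp (by fun_prop)), fun y => ?_,
    ⟨1 / m, 1 - 1 / m, by positivity, by simpa using hm0, fun y hy => ?_⟩, fun y h1 h2 => ?_⟩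
  · rw [abs_mul, abs_of_nonneg (smoothTransition.nonneg _),
      abs_of_nonneg (smoothTransition.nonneg _)]
    exact mul_le_one₀ (smoothTransition.le_one _) (smoothTransition.nonneg _)
      (smoothTransition.le_one _)
  · show smoothTransition (m * y - 1) * smoothTransition (m * (1 - y) - 1) = 0
    rcases lt_or_ge y (1 / m) with h | h
    · rw [smoothTransition.zero_of_nonpos, zero_mul]
      rw [lt_div_iff₀ hm0] at h
      linarith
    · have h2 : 1 - 1 / m < y := not_le.1 fun h' => hy ⟨h, h'⟩
      rw [smoothTransition.zero_of_nonpos (x := m * (1 - y) - 1), mul_zero]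
      have h3 : 1 - y < 1 / m := by linarith
      rw [lt_div_iff₀ hm0] at h3
      linarith
  · show smoothTransition (m * y - 1) * smoothTransition (m * (1 - y) - 1) = 1
    rw [smoothTransition.one_of_one_le (by linarith),
      smoothTransition.one_of_one_le (by linarith), mul_one]

namespace IsScalarTest

/-- The trace at the front as an integral over the slice. -/
lemma mul_trace (hl : 0 ≤ l) (h : IsH1 l f g) :
    l * f l = (∫ x in 0..l, x * g x) + ∫ x in 0..l, f x := by
  have := h.integral_mul hl (u := fun x => x) (u' := fun _ => 1) (fun x => hasDerivAt_id x)
    continuous_const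
  simp only [one_mul, zero_mul, sub_zero] at this
  linarith

lemma integrable_trace (hν : IsScalarTest E κ T ν νt νx νxx) (hE : IsFront v E) :
    Integrable (fun t => ν t (E t)) (mu T) := by
  have hEc := hE.cont
  have := finite_domainT (T := T) hEc
  have h1 : IntegrableOn (fun p : ℝ × ℝ => p.2 * νx p.1 p.2) (domainT E T) :=
    (MovL2.bdd_mul (f := fun _ x => x) hEc (by fun_prop) hν.memL2.2.1).integrable (by norm_num)
  have h2 : IntegrableOn (fun p : ℝ × ℝ => ν p.1 p.2) (domainT E T) :=
    hν.memL2.1.integrable (by norm_num)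
  have h3 := integrable_int_slice hEc.measurable hE.pos h1
  have h4 := integrable_int_slice hEc.measurable hE.pos h2
  have hinv : Continuous fun t => (E t)⁻¹ := hEc.inv₀ fun t => (hE.pos t).ne'
  obtain ⟨C, hC⟩ := (isCompact_Icc (a := (0 : ℝ)) (b := T)).bddAbove_image hinv.norm.continuousOn
  refine Integrable.congr ((h3.add h4).bdd_mul (c := C) hinv.aestronglyMeasurable ?_) ?_
  · exact ae_restrict_of_forall_mem measurableSet_Ioo (fun t ht =>
      hC ⟨t, Ioo_subset_Icc_self ht, rfl⟩)
  · filter_upwards [hν.memH2] with t ht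
    have h5 := mul_trace (hE.pos t).le ht.1
    simp only [Pi.add_apply]
    rw [← h5, ← mul_assoc, inv_mul_cancel₀ (hE.pos t).ne', one_mul]

/-- Integration by parts against `x a(x)` on a slice. -/
lemma int_stretch (h : IsH1 l f g) (hl : 0 < l) (ha : ∀ x, HasDerivAt a (b x) x)
    (hb : Continuous b) :
    IntervalIntegrable (fun x => (a x + x * b x) * f x + x * a x * g x) volume 0 l ∧
      ∫ x in 0..l, ((a x + x * b x) * f x + x * a x * g x) = l * a l * f l := by
  have hac : Continuous a := continuous_iff_continuousAt.2 fun x => (ha x).continuousAt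
  have h1 := h.integral_mul hl.le (u := fun x => x * a x) (u' := fun x => a x + x * b x)
    (fun x => ((hasDerivAt_id x).mul (ha x)).congr_deriv (by simp)) (by fun_prop)
  have h2 : IntervalIntegrable (fun x => (a x + x * b x) * f x) volume 0 l :=
    ContinuousOn.intervalIntegrable_of_Icc hl.le
      (ContinuousOn.mul (by fun_prop) (h.continuousOn hl.le))
  have h3 : IntervalIntegrable (fun x => x * a x * g x) volume 0 l :=
    (h.intervalIntegrable hl.le).continuousOn_mul (by fun_prop)
  exact ⟨h2.add h3, by rw [int_add h2 h3, h1]; ring⟩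

/-- The weak time derivative tested against `χ(t) z(t, x)`. -/
lemma weak_time (hν : IsScalarTest E κ T ν νt νx νxx) (hE : IsFront v E) (hz : Smooth2 z)
    (hT : 0 < T) {χ : ℝ → ℝ} (hχ : ContDiff ℝ ∞ χ) (hχT : tsupport χ ⊆ Ioo 0 T) :
    ∫ t in 0..T, (deriv χ t * (∫ x in 0..E t, z t x * ν t x)
      + χ t * ((∫ x in 0..E t, (z t x * νt t x + pdt z t x * ν t x))
        + v * z t (E t) * ν t (E t))) = 0 := by
  have hEc := hE.cont
  have hEm := hEc.measurable
  have hχd : ∀ t, HasDerivAt χ (deriv χ t) t := fun t =>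
    ((hχ.differentiable (by simp)) t).hasDerivAt
  obtain ⟨m0, m1, m2⟩ := hν.memL2
  have mt := hν.timeDeriv.1
  -- the transported density of a smooth function
  set B : (ℝ → ℝ → ℝ) → ℝ × ℝ → ℝ := fun w p => pdt w p.1 p.2 * ν p.1 p.2 + w p.1 p.2 * νt p.1 p.2
    + v / E p.1 * ((w p.1 p.2 + p.2 * pdx w p.1 p.2) * ν p.1 p.2 + p.2 * w p.1 p.2 * νx p.1 p.2)
    with hB
  have i0 : ∀ {f g : ℝ → ℝ → ℝ}, Continuous (uncurry f) → MovL2 E T g →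
      IntegrableOn (fun p => f p.1 p.2 * g p.1 p.2) (domainT E T) := fun hf hg => by
    have := finite_domainT (T := T) hEc
    exact MemLp.integrable (by norm_num) (hg.bdd_mul hEc hf)
  have i1 : ∀ {w}, Smooth2 w → IntegrableOn (fun p => pdt w p.1 p.2 * ν p.1 p.2
      + w p.1 p.2 * νt p.1 p.2) (domainT E T) := fun hw =>
    (i0 hw.pdt.continuous m0).add (i0 hw.continuous mt)
  have i2 : ∀ {w}, Smooth2 w → IntegrableOn (fun p => v / E p.1 * ((w p.1 p.2
      + p.2 * pdx w p.1 p.2) * ν p.1 p.2 + p.2 * w p.1 p.2 * νx p.1 p.2)) (domainT E T) :=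
      fun {w} hw => by
    have h0 : Continuous fun p : ℝ × ℝ => v / E p.1 :=
      continuous_const.div (by fun_prop) fun p => (hE.pos p.1).ne'
    have h1 : Continuous fun p : ℝ × ℝ => w p.1 p.2 := hw.continuous
    have h2 : Continuous fun p : ℝ × ℝ => pdx w p.1 p.2 := hw.pdx.continuous
    refine IntegrableOn.congr_fun ((i0 (f := fun t x => v / E t * (w t x + x * pdx w t x))
      (h0.mul (h1.add (continuous_snd.mul h2))) m0).add
      (i0 (f := fun t x => v / E t * (x * w t x)) (h0.mul (continuous_snd.mul h1)) m1))
      (fun p _ => ?_) (meas_domainT hEm T)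
    simp only [Pi.add_apply]; ring
  have hsl : ∀ {w}, Smooth2 w → ∀ {t}, IsH1 (E t) (ν t) (νx t) → ∫ x in 0..E t, v / E t
      * ((w t x + x * pdx w t x) * ν t x + x * w t x * νx t x) = v * w t (E t) * ν t (E t) :=
      fun hw t ht => by
    rw [int_const_mul,
      (int_stretch ht (hE.pos t) (hw.hasDerivAt_pdx t) (hw.pdx.slice t).continuous).2]
    field_simp [(hE.pos t).ne']
  have hws : Smooth2 fun t x => χ t * z t x := (Smooth2.of_fst hχ).mul hz
  have iB : IntegrableOn (B fun t x => χ t * z t x) (domainT E T) := (i1 hws).add (i2 hws)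
  have hcut : ∀ n : ℕ, ∃ r : ℝ → ℝ, Continuous r ∧ (∀ y, |r y| ≤ 1) ∧
      (∀ y, 2 ≤ (n + 1 : ℝ) * y → 2 ≤ (n + 1 : ℝ) * (1 - y) → r y = 1) ∧
      ∫ p in domainT E T, r (p.2 / E p.1) * B (fun t x => χ t * z t x) p = 0 := by
    intro n
    obtain ⟨r, hr, hr1, ⟨a, b, ha, hb, hr0⟩, hr2⟩ := exists_cutoff n
    refine ⟨r, hr.continuous, hr1, hr2, ?_⟩
    have hrd : ∀ y, HasDerivAt r (deriv r y) y := fun y =>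
      ((hr.differentiable (by simp)) y).hasDerivAt
    set φ : ℝ → ℝ → ℝ := fun t x => χ t * z t x * r (x / E t) with hφ
    have hφs : Smooth2 φ := hws.mul (Smooth2.comp_fst hr hE.smooth_div)
    have hsub : tsupport (uncurry φ) ⊆ {p | p.1 ∈ tsupport χ ∧ p.2 / E p.1 ∈ Icc a b} := by
      refine closure_minimal (fun p hp => ⟨?_, ?_⟩) ?_
      · by_contra h
        exact hp (by simp [uncurry, hφ, image_eq_zero_of_notMem_tsupport h])
      · by_contra h
        exact hp (by simp [uncurry, hφ, hr0 _ h])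
      · exact ((isClosed_tsupport χ).preimage continuous_fst).inter
          (isClosed_Icc.preimage hE.smooth_div.continuous)
    have hsubD : tsupport (uncurry φ) ⊆ domainT E T := by
      intro p hp
      obtain ⟨h1, h2⟩ := hsub hp
      have hpos := hE.pos p.1
      refine ⟨⟨(hχT h1).1, ?_, ?_⟩, (hχT h1).2⟩
      · by_contra h
        have := div_nonpos_of_nonpos_of_nonneg (not_lt.1 h) hpos.le
        linarith [h2.1]
      · have := lt_of_le_of_lt h2.2 hb
        rwa [div_lt_one hpos] at this
    obtain ⟨R, hR⟩ := (isCompact_Icc (a := (0 : ℝ)) (b := T)).bddAbove_image hEc.continuousOn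
    have hφc : HasCompactSupport (uncurry φ) :=
      IsCompact.of_isClosed_subset (isCompact_Icc.prod isCompact_Icc) (isClosed_tsupport _)
        (hsubD.trans (domainT_subset (C := R) fun t ht => hR ⟨t, ht, rfl⟩))
    have hw := hν.timeDeriv.2 (uncurry φ) hφs hφc hsubD
    have hBφ : ∀ p ∈ domainT E T, r (p.2 / E p.1) * B (fun t x => χ t * z t x) p = B φ p := by
      rintro ⟨t, x⟩ hp
      have h1 := (hws.hasDerivAt_pdt t x).mul
        (HasDerivAt.comp (h₂ := r) t (hrd (x / E t)) (hasDerivAt_div_fst hE hp.1.1.le x))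
      have h2 := (hws.hasDerivAt_pdx t x).mul
        (HasDerivAt.comp (h₂ := r) x (hrd (x / E t)) ((hasDerivAt_id x).div_const (E t)))
      have e1 : pdt φ t x = _ := h1.deriv
      have e2 : pdx φ t x = _ := h2.deriv
      simp only [hB]
      rw [e1, e2]
      simp only [hφ, Function.comp_apply, id]
      ring
    rw [setIntegral_congr_fun (meas_domainT hEm T) hBφ]
    refine (integral_add (i1 hφs) (i2 hφs)).trans ?_
    rw [integral_domainT hEm hE.pos hT.le (i2 hφs), ← integral_mu hT.le,
      integral_eq_zero_of_ae (μ := mu T), add_zero]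
    · rw [integral_add (i0 hφs.pdt.continuous m0) (i0 hφs.continuous mt)]
      simp only [mul_comm (ν _ _), mul_comm (νt _ _)] at hw
      simp only [hφs.pdt_eq_fderiv]
      exact add_eq_zero_iff_eq_neg.2 hw
    · filter_upwards [hν.memH2] with t ht
      refine (hsl hφs ht.1).trans ?_
      simp [hφ, div_self (hE.pos t).ne', hr0 1 fun h => by linarith [h.2]]
  choose r hrc hr1 hr2 hr3 using hcut
  have hB0 : ∫ p in domainT E T, B (fun t x => χ t * z t x) p = 0 := by
    have hlim := tendsto_integral_of_dominated_convergence
      (μ := volume.restrict (domainT E T)) (f := B fun t x => χ t * z t x)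
      (F := fun n p => r n (p.2 / E p.1) * B (fun t x => χ t * z t x) p)
      (fun p => ‖B _ p‖) (fun n => ?_) iB.norm (fun n => .of_forall fun p => ?_) ?_
    · simp only [hr3] at hlim
      exact (tendsto_nhds_unique hlim tendsto_const_nhds)
    · exact ((hrc n).comp hE.smooth_div.continuous).aestronglyMeasurable.mul iB.1
    · rw [norm_mul]
      exact mul_le_of_le_one_left (norm_nonneg _) (hr1 n _)
    · refine (ae_restrict_iff' (meas_domainT hEm T)).2 (.of_forall fun p hp => ?_)
      have hEt := hE.pos p.1
      have hy0 : 0 < p.2 / E p.1 := div_pos hp.1.2.1 hEt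
      have hy1 : 0 < 1 - p.2 / E p.1 := sub_pos.2 ((div_lt_one hEt).2 hp.1.2.2)
      have ht : ∀ y : ℝ, 0 < y → ∀ᶠ n : ℕ in atTop, 2 ≤ (n + 1 : ℝ) * y := fun y hy =>
        ((tendsto_natCast_atTop_atTop.atTop_add tendsto_const_nhds).atTop_mul_const
          hy).eventually_ge_atTop 2
      refine Tendsto.congr' ?_ tendsto_const_nhds
      filter_upwards [ht _ hy0, ht _ hy1] with n h1 h2
      rw [hr2 n _ h1 h2, one_mul]
  rw [integral_domainT hEm hE.pos hT.le iB, ← integral_mu hT.le] at hB0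
  rw [← integral_mu hT.le]
  refine Eq.trans (integral_congr_ae ?_) hB0
  filter_upwards [hν.memH2, mt.slice hEm] with t ht htt
  have hEt := hE.pos t
  have czs : Continuous (z t) := (hz.slice t).continuous
  have czts : Continuous (pdt z t) := (hz.pdt.slice t).continuous
  have jj : ∀ {f : ℝ → ℝ}, Continuous f → IntervalIntegrable (fun x => f x * ν t x) volume 0 (E t) :=
    fun hf => ContinuousOn.intervalIntegrable_of_Icc hEt.le
      (hf.continuousOn.mul (ht.1.continuousOn hEt.le))
  have jt := (MemLp.ii_mu hEt.le htt).continuousOn_mul czs.continuousOn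
  have h1 : ∀ x, pdt (fun t x => χ t * z t x) t x = deriv χ t * z t x + χ t * pdt z t x := fun x =>
    ((hχd t).mul (hz.hasDerivAt_pdt t x)).deriv
  have h2 := (jj czs).const_mul (deriv χ t)
  have h3 := (jt.add (jj czts)).const_mul (χ t)
  have h4 := ((int_stretch ht.1 hEt (hws.hasDerivAt_pdx t)
    (hws.pdx.slice t).continuous).1).const_mul (v / E t)
  calc _ = (∫ x in 0..E t, (deriv χ t * (z t x * ν t x)
        + χ t * (z t x * νt t x + pdt z t x * ν t x))) + ∫ x in 0..E t, v / E t *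
        ((χ t * z t x + x * pdx (fun t x => χ t * z t x) t x) * ν t x
          + x * (χ t * z t x) * νx t x) := by
        rw [hsl hws ht.1, int_add h2 h3, int_const_mul, int_const_mul]; ring
    _ = _ := by
      rw [← int_add (h2.add h3) h4]
      congr 1; ext x; simp only [hB, h1]; ring

end IsScalarTest

namespace IsScalarTest

/-- Integration by parts in time. -/
lemma integral_time (hν : IsScalarTest E κ T ν νt νx νxx) (hE : IsFront v E) (hz : Smooth2 z)
    (hT : 0 < T) :
    ∫ t in 0..T, ((∫ x in 0..E t, (z t x * νt t x + pdt z t x * ν t x))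
        + v * z t (E t) * ν t (E t)) = -∫ x in 0..E 0, z 0 x * ν 0 x := by
  have hEc := hE.cont
  have hfin := finite_domainT (T := T) hEc
  have hJ := (MovContL2.of_cont hEc (Icc 0 T) hz.continuous).continuousOn_integral_mul
    hEc hν.cont
  have hint : ∀ {f : ℝ → ℝ → ℝ}, MovL2 E T f →
      IntegrableOn (fun p : ℝ × ℝ => f p.1 p.2) (domainT E T) := fun hf =>
    MemLp.integrable (by norm_num) hf
  have h1 := integrable_int_slice hEc.measurable hE.pos
    ((hint (hν.timeDeriv.1.bdd_mul hEc hz.continuous)).add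
      (hint (hν.memL2.1.bdd_mul hEc hz.pdt.continuous)))
  have hzE : Continuous fun t => v * z t (E t) :=
    continuous_const.mul (hz.comp_curve contDiff_id hE.smooth).continuous
  obtain ⟨C, hC⟩ := (isCompact_Icc (a := (0 : ℝ)) (b := T)).bddAbove_image hzE.norm.continuousOn
  have h2 := (hν.integrable_trace hE).bdd_mul (c := C) hzE.aestronglyMeasurable
    (ae_restrict_of_forall_mem measurableSet_Ioo (fun t ht =>
      hC ⟨t, Ioo_subset_Icc_self ht, rfl⟩))
  have hK := ii_of_mu hT.le (h1.add h2)
  have h3 := sub_eq_integral_of_weak_deriv hT hJ hK fun χ a _ c => hν.weak_time hE hz hT a c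
  have h4 : ∫ x in 0..E T, z T x * ν T x = 0 := by
    rw [← integral_mu (hE.pos T).le]
    refine integral_eq_zero_of_ae ?_
    filter_upwards [hν.final] with x hx
    simp [hx]
  rw [h4, zero_sub] at h3
  exact h3.symm

/-- The weak formulation tested with a smooth function. -/
lemma integral_smooth (hν : IsScalarTest E κ T ν νt νx νxx) (hE : IsFront v E) (hz : Smooth2 z)
    (hT : 0 < T) (hz0 : ∀ t ≥ 0, pdx z t 0 = 0) (hb : Continuous b)
    (hzE : ∀ t ≥ 0, σ * pdx z t (E t) + v * z t (E t) = b t + σ * κ t * z t (E t)) :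
    (∫ t in 0..T, ∫ x in 0..E t, z t x * (νt t x + σ * νxx t x))
      + (∫ x in 0..E 0, z 0 x * ν 0 x) + (∫ t in 0..T, b t * ν t (E t))
      = -∫ t in 0..T, ∫ x in 0..E t, (pdt z t x - σ * pdx (pdx z) t x) * ν t x := by
  have hEc := hE.cont
  have hEm := hEc.measurable
  have hfin := finite_domainT (T := T) hEc
  have hint : ∀ {f : ℝ → ℝ → ℝ}, MovL2 E T f →
      IntegrableOn (fun p : ℝ × ℝ => f p.1 p.2) (domainT E T) := fun hf =>
    MemLp.integrable (by norm_num) hf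
  obtain ⟨m0, m1, m2⟩ := hν.memL2
  have mt := hν.timeDeriv.1
  have hR : Smooth2 fun t x => pdt z t x - σ * pdx (pdx z) t x :=
    hz.pdt.sub ((Smooth2.const σ).mul hz.pdx.pdx)
  have i1 : Integrable (fun t => ∫ x in 0..E t, z t x * (νt t x + σ * νxx t x)) (mu T) := by
    refine integrable_int_slice hEm hE.pos (F := fun p => z p.1 p.2 *
      (νt p.1 p.2 + σ * νxx p.1 p.2)) ?_
    refine ((hint (mt.bdd_mul hEc hz.continuous)).add
      (hint (m2.bdd_mul hEc ((Smooth2.const σ).mul hz).continuous))).congr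
        (.of_forall fun p => ?_)
    simp only [Pi.add_apply]; ring
  have i2 := integrable_int_slice hEm hE.pos (hint (m0.bdd_mul hEc hR.continuous))
  obtain ⟨C, hC⟩ := (isCompact_Icc (a := (0 : ℝ)) (b := T)).bddAbove_image hb.norm.continuousOn
  have i3 : Integrable (fun t => b t * ν t (E t)) (mu T) :=
    (hν.integrable_trace hE).bdd_mul (c := C) hb.aestronglyMeasurable
      (ae_restrict_of_forall_mem measurableSet_Ioo (fun t ht =>
        hC ⟨t, Ioo_subset_Icc_self ht, rfl⟩))
  have htime := hν.integral_time hE hz hT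
  have hmain : ∫ t in 0..T, ((∫ x in 0..E t, (z t x * νt t x + pdt z t x * ν t x))
        + v * z t (E t) * ν t (E t))
      = (∫ t in 0..T, ∫ x in 0..E t, z t x * (νt t x + σ * νxx t x)) + (∫ t in 0..T, ∫ x in 0..E t,
          (pdt z t x - σ * pdx (pdx z) t x) * ν t x) + ∫ t in 0..T, b t * ν t (E t) := by
    have j1 := ii_of_mu hT.le i1
    have j2 := ii_of_mu hT.le i2
    have j3 := ii_of_mu hT.le i3
    rw [← int_add j1 j2, ← int_add (j1.add j2) j3, ← integral_mu hT.le, ← integral_mu hT.le]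
    refine integral_congr_ae ?_
    filter_upwards [hν.memH2, mt.slice hEm, hν.bdryZero, hν.bdryFront,
      (ae_restrict_mem measurableSet_Ioo : ∀ᵐ t ∂(mu T), t ∈ Ioo 0 T)] with t ht htt hb0 hbE htT
    have hEt := hE.pos t
    have cz := (hz.slice t).continuous
    have czx := (hz.pdx.slice t).continuous
    have czxx := (hz.pdx.pdx.slice t).continuous
    have czt := (hz.pdt.slice t).continuous
    have hνc := ht.1.continuousOn hEt.le
    have jj : ∀ {f : ℝ → ℝ}, Continuous f →
        IntervalIntegrable (fun x => f x * ν t x) volume 0 (E t) := by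
      intro f hf
      refine ContinuousOn.intervalIntegrable_of_Icc hEt.le ?_
      exact hf.continuousOn.mul hνc
    have jt : IntervalIntegrable (fun x => z t x * νt t x) volume 0 (E t) :=
      (MemLp.ii_mu hEt.le htt).continuousOn_mul cz.continuousOn
    have jxx : IntervalIntegrable (fun x => z t x * νxx t x) volume 0 (E t) :=
      (ht.2.intervalIntegrable hEt.le).continuousOn_mul cz.continuousOn
    have p1 := ht.2.integral_mul hEt.le (hz.hasDerivAt_pdx t) czx
    have p2 := ht.1.integral_mul hEt.le (hz.pdx.hasDerivAt_pdx t) czxx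
    rw [hb0, hbE] at p1
    rw [hz0 t htT.1.le] at p2
    have e1 : ∫ x in 0..E t, z t x * (νt t x + σ * νxx t x)
        = (∫ x in 0..E t, z t x * νt t x) + σ * ∫ x in 0..E t, z t x * νxx t x := by
      rw [← int_const_mul, ← int_add jt (jxx.const_mul σ)]
      congr 1; ext x; ring
    have e2 : ∫ x in 0..E t, (pdt z t x - σ * pdx (pdx z) t x) * ν t x
        = (∫ x in 0..E t, pdt z t x * ν t x) - σ * ∫ x in 0..E t, pdx (pdx z) t x * ν t x := by
      rw [← int_const_mul, ← int_sub (jj czt) ((jj czxx).const_mul σ)]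
      congr 1; ext x; ring
    rw [e1, e2, int_add jt (jj czt), p1, p2]
    linear_combination ν t (E t) * hzE t htT.1.le
  linarith

end IsScalarTest

/-! ## Growth of the kernels and bounds for the Volterra operators -/

lemma abs_bessel_kern_le (j : ℕ) (β : ℝ) (hy : 0 ≤ y) (hyx : y ≤ x) :
    |bessel j (β * (x ^ 2 - y ^ 2) / 4)| ≤ exp (√|β| * x) := by
  refine (abs_bessel_le _ _).trans (exp_le_exp.2 ?_)
  have hx : 0 ≤ x := hy.trans hyx
  have h1 : |β * (x ^ 2 - y ^ 2) / 4| ≤ |β| * (x / 2) ^ 2 := by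
    rw [abs_div, abs_mul, abs_of_nonneg (by nlinarith : (0 : ℝ) ≤ x ^ 2 - y ^ 2),
      abs_of_pos (by norm_num : (0 : ℝ) < 4)]
    have := mul_le_mul_of_nonneg_left (by nlinarith [sq_nonneg y] : x ^ 2 - y ^ 2 ≤ x ^ 2)
      (abs_nonneg β)
    nlinarith
  have h2 := sqrt_le_sqrt h1
  rw [Real.sqrt_mul (abs_nonneg β), Real.sqrt_sq (by positivity)] at h2
  linarith

/-- Exponential bound for the kernel and its first derivative on the triangle. -/
lemma exists_kern_bound (β : ℝ) : ∃ M, 0 ≤ M ∧ ∀ x y, 0 ≤ y → y ≤ x →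
    |kern β x y| ≤ M * exp ((√|β| + 1) * x) ∧
    |pdt (kern β) x y| ≤ M * exp ((√|β| + 1) * x) := by
  refine ⟨|β| / 2 * (1 + |β|), by positivity, fun x y hy hyx => ?_⟩
  have hx : 0 ≤ x := hy.trans hyx
  have b1 := abs_bessel_kern_le 1 β hy hyx
  have b2 := abs_bessel_kern_le 2 β hy hyx
  have e1 : x ≤ exp x := by linarith [Real.add_one_le_exp x]
  have e2 : x ^ 2 / 2 ≤ exp x := by
    have := Real.quadratic_le_exp_of_nonneg hx; linarith
  have e0 : 1 ≤ exp x := one_le_exp hx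
  rw [add_mul, one_mul, exp_add]
  set X := exp (√|β| * x)
  have hX : 0 < X := exp_pos _
  have hb := abs_nonneg β
  constructor
  · rw [kern, abs_mul, abs_mul, abs_neg, abs_div, abs_of_nonneg hx, abs_two]
    calc |β| / 2 * x * |bessel 1 (β * (x ^ 2 - y ^ 2) / 4)| ≤ |β| / 2 * exp x * X := by gcongr
      _ = |β| / 2 * 1 * (X * exp x) := by ring
      _ ≤ |β| / 2 * (1 + |β|) * (X * exp x) := by gcongr; linarith
  · rw [pdt_kern, abs_mul, abs_neg, abs_div, abs_two]
    have h3 : |bessel 1 (β * (x ^ 2 - y ^ 2) / 4)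
        + x * (β * x / 2) * bessel 2 (β * (x ^ 2 - y ^ 2) / 4)|
        ≤ X * exp x + (|β| * exp x) * X := by
      refine (abs_add_le _ _).trans (add_le_add (b1.trans (le_mul_of_one_le_right hX.le e0)) ?_)
      rw [abs_mul]
      refine mul_le_mul ?_ b2 (abs_nonneg _) (by positivity)
      rw [abs_mul, abs_div, abs_mul, abs_of_nonneg hx, abs_two]
      calc x * (|β| * x / 2) = |β| * (x ^ 2 / 2) := by ring
        _ ≤ _ := by gcongr
    calc _ ≤ |β| / 2 * (X * exp x + (|β| * exp x) * X) := by gcongr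
      _ = _ := by ring

lemma int_sq_mu (hl : 0 ≤ l) (hf : MemLp f 2 (mu l)) :
    IntervalIntegrable (fun y => f y ^ 2) volume 0 l :=
  ii_of_mu hl hf.integrable_sq

lemma memLp_mu_mono (hx : x ≤ l) (hf : MemLp f 2 (mu l)) : MemLp f 2 (mu x) :=
  hf.mono_measure (Measure.restrict_mono (Ioo_subset_Ioo_right hx) le_rfl)

lemma sq_integral_mul_le (hx : 0 ≤ x) {k : ℝ → ℝ} (hk : Continuous k)
    (hB : ∀ y ∈ Icc 0 x, |k y| ≤ B) (hf : MemLp f 2 (mu x)) :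
    (∫ y in 0..x, k y * f y) ^ 2 ≤ B ^ 2 * x * ∫ y in 0..x, f y ^ 2 := by
  have h1 := integral_mul_sq_le (memLp_mu_of_cont (l := x) hk.continuousOn) hf
  rw [integral_mu hx, integral_mu hx, integral_mu hx] at h1
  have h2 : ∫ y in 0..x, k y ^ 2 ≤ B ^ 2 * x := by
    have := int_mono_on (μ := volume) hx (f := fun y => k y ^ 2)
      (g := fun _ => B ^ 2) (by apply Continuous.intervalIntegrable; fun_prop) (by simp)
      (fun y hy => sq_le_sq' (by linarith [(abs_le.1 (hB y hy)).1]) (abs_le.1 (hB y hy)).2)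
    simpa [mul_comm] using this
  have n1 : 0 ≤ ∫ y in 0..x, k y ^ 2 := int_nonneg hx fun y _ => sq_nonneg _
  have n2 : 0 ≤ ∫ y in 0..x, f y ^ 2 := int_nonneg hx fun y _ => sq_nonneg _
  calc (∫ y in 0..x, k y * f y) ^ 2 = |∫ y in 0..x, k y * f y| ^ 2 := (sq_abs _).symm
    _ ≤ (√(∫ y in 0..x, k y ^ 2) * √(∫ y in 0..x, f y ^ 2)) ^ 2 := by
        gcongr
    _ = (∫ y in 0..x, k y ^ 2) * ∫ y in 0..x, f y ^ 2 := by
        rw [mul_pow, sq_sqrt n1, sq_sqrt n2]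
    _ ≤ _ := by gcongr

lemma integral_sq_mono (hx : 0 ≤ x) (hxl : x ≤ l)
    (hf : MemLp f 2 (mu l)) : ∫ y in 0..x, f y ^ 2 ≤ ∫ y in 0..l, f y ^ 2 := by
  refine intervalIntegral.integral_mono_interval le_rfl hx hxl
    (.of_forall fun y => sq_nonneg (f y)) (int_sq_mu (hx.trans hxl) hf)

/-- The integral operator with a bounded kernel on the triangle. -/
lemma sq_integral_mul_le_of_le (hk : ∀ x, Continuous (k x))
    (hB : ∀ x y, 0 ≤ y → y ≤ x → x ≤ l → |k x y| ≤ B) (hf : MemLp f 2 (mu l))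
    (hx : x ∈ Icc 0 l) :
    (∫ y in 0..x, k x y * f y) ^ 2 ≤ B ^ 2 * l * ∫ y in 0..l, f y ^ 2 := by
  have n2 : 0 ≤ ∫ y in 0..x, f y ^ 2 := int_nonneg hx.1 fun y _ => sq_nonneg _
  have h := sq_integral_mul_le hx.1 (hk x) (fun y hy => hB x y hy.1 hy.2 hx.2)
    (memLp_mu_mono hx.2 hf)
  refine h.trans (mul_le_mul ?_ (integral_sq_mono hx.1 hx.2 hf) n2
    (mul_nonneg (sq_nonneg _) (hx.1.trans hx.2)))
  exact mul_le_mul_of_nonneg_left hx.2 (sq_nonneg _)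

lemma integral_sq_le_of_sq_le (hl : 0 ≤ l) (hg : ContinuousOn g (Icc 0 l))
    (h : ∀ x ∈ Icc 0 l, g x ^ 2 ≤ C) : ∫ x in 0..l, g x ^ 2 ≤ l * C := by
  have := int_mono_on (μ := volume) hl (f := fun y => g y ^ 2)
      (g := fun _ => C) (ContinuousOn.intervalIntegrable (by rw [uIcc_of_le hl]; fun_prop))
      (by simp) h
  simpa using this

lemma continuousOn_integral_kernel (hl : 0 ≤ l)
    (hk : Continuous (uncurry k)) (hf : IntervalIntegrable f volume 0 l) :
    ContinuousOn (fun x => ∫ y in 0..x, k x y * f y) (Icc 0 l) := by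
  obtain ⟨C, hC⟩ := ((isCompact_Icc (a := (0 : ℝ)) (b := l)).prod
    (isCompact_Icc (a := (0 : ℝ)) (b := l))).bddAbove_image hk.norm.continuousOn
  have hfi : IntegrableOn f (Ioc 0 l) := (intervalIntegrable_iff_integrableOn_Ioc_of_le hl).1 hf
  have e : ∀ x ∈ Icc 0 l, ∫ y in 0..x, k x y * f y
      = ∫ y in Ioc 0 l, (Iic x).indicator (fun y => k x y * f y) y := by
    intro x hx
    rw [int_of_le hx.1, integral_indicator measurableSet_Iic,
      Measure.restrict_restrict measurableSet_Iic, inter_comm, Ioc_inter_Iic, min_eq_right hx.2]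
  refine ContinuousOn.congr (fun x0 hx0 => ?_) e
  refine tendsto_integral_filter_of_dominated_convergence (fun y => C * ‖f y‖) ?_ ?_
    (hfi.norm.const_mul C) ?_
  · refine .of_forall fun x => ?_
    have : Continuous (k x) := hk.comp (by fun_prop : Continuous fun y => (x, y))
    exact (this.aestronglyMeasurable.mul hfi.aestronglyMeasurable).indicator measurableSet_Iic
  · filter_upwards [self_mem_nhdsWithin] with x hx
    refine ae_restrict_of_forall_mem measurableSet_Ioc (fun y hy => ?_)
    refine (norm_indicator_le_norm_self _ _).trans ?_
    rw [norm_mul]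
    exact mul_le_mul_of_nonneg_right (hC ⟨(x, y), ⟨hx, hy.1.le, hy.2⟩, rfl⟩) (norm_nonneg _)
  · have hne : ∀ᵐ y ∂(volume.restrict (Ioc 0 l)), y ≠ x0 := by
      refine ae_restrict_of_ae ?_
      simp [ae_iff]
    filter_upwards [hne] with y hy
    have hc : Continuous fun x => k x y * f y :=
      (hk.comp (by fun_prop : Continuous fun x => (x, y))).mul continuous_const
    rcases lt_or_gt_of_ne hy with h | h
    · have : ∀ᶠ x in 𝓝[Icc 0 l] x0, (Iic x).indicator (fun y => k x y * f y) y = k x y * f y := by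
        filter_upwards [nhdsWithin_le_nhds (Ioi_mem_nhds h)] with x hx
        exact indicator_of_mem (mem_Iic.2 (le_of_lt hx)) _
      rw [indicator_of_mem (mem_Iic.2 h.le)]
      exact (hc.continuousAt.tendsto.mono_left nhdsWithin_le_nhds).congr'
        (this.mono fun x hx => hx.symm)
    · have : ∀ᶠ x in 𝓝[Icc 0 l] x0, (Iic x).indicator (fun y => k x y * f y) y = 0 := by
        filter_upwards [nhdsWithin_le_nhds (Iio_mem_nhds h)] with x hx
        exact indicator_of_notMem (fun h' : y ∈ Iic x => absurd (mem_Iio.1 hx) (not_lt.2 h')) _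
      rw [indicator_of_notMem (fun h' : y ∈ Iic x0 => absurd h (not_lt.2 h'))]
      exact tendsto_const_nhds.congr' (this.mono fun x hx => hx.symm)

lemma memLp_volt (β : ℝ) (hl : 0 ≤ l) (hf : MemLp f 2 (mu l)) : MemLp (volt β f) 2 (mu l) :=
  hf.sub (memLp_mu_of_cont (continuousOn_integral_kernel hl (smooth2_kern β).continuous
    (MemLp.ii_mu hl hf)))

lemma integral_volt_sq_le (β : ℝ) (hl : 0 ≤ l)
    (hB : ∀ x y, 0 ≤ y → y ≤ x → x ≤ l → |kern β x y| ≤ B) (hf : MemLp f 2 (mu l)) :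
    ∫ x in 0..l, volt β f x ^ 2 ≤ 2 * (1 + B ^ 2 * l ^ 2) * ∫ x in 0..l, f x ^ 2 := by
  have hc := continuousOn_integral_kernel hl (smooth2_kern β).continuous
    (MemLp.ii_mu hl hf)
  have h1 := integral_sq_le_of_sq_le hl hc fun x hx =>
    sq_integral_mul_le_of_le (fun x => ((smooth2_kern β).slice x).continuous) hB hf hx
  have i1 := int_sq_mu hl hf
  have i2 := int_sq_mu hl (memLp_mu_of_cont hc)
  have i3 := int_sq_mu hl (memLp_volt β hl hf)
  have h2 := int_mono_on (μ := volume) hl i3 ((i1.const_mul 2).add (i2.const_mul 2)) fun x _ => by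
      simp only [volt]
      nlinarith [sq_nonneg (f x + ∫ y in 0..x, kern β x y * f y)]
  rw [int_add (i1.const_mul 2) (i2.const_mul 2), int_const_mul, int_const_mul] at h2
  nlinarith

/-! ## Bounds for the unstepped solution -/

/-- The boundary flux `σ z_x + v z` at the front. -/
def flux (σ v : ℝ) (E : ℝ → ℝ) (z : ℝ → ℝ → ℝ) (t : ℝ) : ℝ := σ * pdx z t (E t) + v * z t (E t)

/-- The zeroth order part of the time derivative as an element of the dual of `H¹`. -/
def dual0 (σ v : ℝ) (E : ℝ → ℝ) (z : ℝ → ℝ → ℝ) (t x : ℝ) : ℝ :=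
  flux σ v E z t / E t + (pdt z t x - σ * pdx (pdx z) t x)

/-- The first order part of the time derivative as an element of the dual of `H¹`. -/
def dual1 (σ v : ℝ) (E : ℝ → ℝ) (z : ℝ → ℝ → ℝ) (t x : ℝ) : ℝ :=
  flux σ v E z t * x / E t - σ * pdx z t x

lemma smooth_flux (σ v : ℝ) (hE : ContDiff ℝ ∞ E) (hz : Smooth2 z) :
    ContDiff ℝ ∞ (flux σ v E z) :=
  (contDiff_const.mul (hz.pdx.comp_curve contDiff_id hE)).add
    (contDiff_const.mul (hz.comp_curve contDiff_id hE))

lemma continuous_dual0 (σ : ℝ) (hE : IsFront v E)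
    (hz : Smooth2 z) : Continuous (uncurry (dual0 σ v E z)) := by
  have h1 := (smooth_flux σ v hE.smooth hz).continuous
  have h2 := hz.pdt.continuous
  have h3 := hz.pdx.pdx.continuous
  have h4 := hE.cont
  have : Continuous fun p : ℝ × ℝ => flux σ v E z p.1 / E p.1 :=
    (h1.comp continuous_fst).div (h4.comp continuous_fst) fun p => (hE.pos _).ne'
  exact this.add (h2.sub (continuous_const.mul h3))

lemma continuous_dual1 (σ : ℝ) (hE : IsFront v E)
    (hz : Smooth2 z) : Continuous (uncurry (dual1 σ v E z)) := by
  have h1 := (smooth_flux σ v hE.smooth hz).continuous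
  have h3 := hz.pdx.continuous
  have h4 := hE.cont
  have : Continuous fun p : ℝ × ℝ => flux σ v E z p.1 * p.2 / E p.1 :=
    ((h1.comp continuous_fst).mul continuous_snd).div (h4.comp continuous_fst)
      fun p => (hE.pos _).ne'
  exact this.sub (continuous_const.mul h3)

set_option maxHeartbeats 1000000 in
lemma sq_unstep_slice_le (hσ : 0 < σ) (hv : 0 < v) (hE : IsFront v E) (hα : lam = σ * α)
    (hw : IsRegular σ v E w) (ht : 0 ≤ t)
    (hk : ∀ x y, 0 ≤ y → y ≤ x → x ≤ E t → |kern (-α) x y| ≤ h ∧ |pdt (kern (-α)) x y| ≤ h) :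
    (∫ x in 0..E t, unstep α w t x ^ 2) ≤ 2 * (1 + h ^ 2 * E t ^ 2) * ∫ x in 0..E t, w t x ^ 2 ∧
    (∫ x in 0..E t, (dual0 σ v E (unstep α w) t x ^ 2 + dual1 σ v E (unstep α w) t x ^ 2))
      ≤ 2 * (E t + (E t)⁻¹) * (2 * (σ * α / 2) ^ 2 * E t ^ 2 * w t (E t) ^ 2
          + 2 * ((σ + v) * h) ^ 2 * E t * ∫ x in 0..E t, w t x ^ 2)
        + 2 * (2 * (1 + h ^ 2 * E t ^ 2) * ∫ x in 0..E t, resid σ lam w t x ^ 2)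
        + 2 * σ ^ 2 * (3 * (∫ x in 0..E t, pdx w t x ^ 2)
          + 3 * (α ^ 2 / 4 + h ^ 2) * E t ^ 2 * ∫ x in 0..E t, w t x ^ 2) := by
  have hl := (hE.pos t).le
  set l := E t with hldef
  set z := unstep α w with hz
  have sz : Smooth2 z := smooth_unstep hw.smooth
  have cw : Continuous (w t) := (hw.smooth.slice t).continuous
  have cwx : Continuous (pdx w t) := (hw.smooth.pdx.slice t).continuous
  have cr : Continuous (resid σ lam w t) := ((hw.smooth.resid σ lam).slice t).continuous
  have mw : MemLp (w t) 2 (mu l) := memLp_mu_of_cont cw.continuousOn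
  have n_w : 0 ≤ ∫ x in 0..l, w t x ^ 2 := int_nonneg hl fun y _ => sq_nonneg _
  have ii : ∀ {f : ℝ → ℝ}, Continuous f → IntervalIntegrable f volume 0 l :=
    fun hf => hf.intervalIntegrable _ _
  have hkz := integral_volt_sq_le (-α) hl (fun x y a b c => (hk x y a b c).1) mw
  refine ⟨hkz, ?_⟩
  have hN := integral_volt_sq_le (-α) hl (fun x y a b c => (hk x y a b c).1)
    (memLp_mu_of_cont cr.continuousOn)
  have hh0 : 0 ≤ h := (abs_nonneg _).trans (hk 0 0 le_rfl le_rfl hl).1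
  -- the flux
  have hb : flux σ v E z t ^ 2 ≤ 2 * (σ * α / 2) ^ 2 * l ^ 2 * w t l ^ 2
      + 2 * ((σ + v) * h) ^ 2 * l * ∫ x in 0..l, w t x ^ 2 := by
    have h1 : flux σ v E z t = _ := unstep_flux hw ht
    have h2 := sq_integral_mul_le (B := (σ + v) * h) hl (((smooth2_gain σ v (-α)).slice l).continuous)
      (fun y hy => by
        obtain ⟨k1, k2⟩ := hk l y hy.1 hy.2 le_rfl
        rw [gain]
        refine (abs_add_le _ _).trans ?_
        rw [abs_mul, abs_mul, abs_of_pos hσ, abs_of_pos hv, add_mul]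
        gcongr) mw
    rw [h1]
    nlinarith [sq_nonneg (-(σ * α / 2) * l * w t l + ∫ y in 0..l, gain σ v (-α) l y * w t y)]
  -- the spatial derivative
  have hcx := continuousOn_integral_kernel hl (smooth2_kern (-α)).pdt.continuous
    (MemLp.ii_mu hl mw)
  have hzx : ∫ x in 0..l, pdx z t x ^ 2 ≤ 3 * (∫ x in 0..l, pdx w t x ^ 2)
      + 3 * (α ^ 2 / 4 + h ^ 2) * l ^ 2 * ∫ x in 0..l, w t x ^ 2 := by
    have h1 := integral_sq_le_of_sq_le hl hcx fun x hx =>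
      sq_integral_mul_le_of_le (fun x => ((smooth2_kern (-α)).pdt.slice x).continuous)
        (fun x y a b c => (hk x y a b c).2) mw hx
    have i1 := ii (f := fun x => pdx w t x ^ 2) (by fun_prop)
    have i2 := ii (f := fun x => w t x ^ 2) (by fun_prop)
    have i3 := int_sq_mu hl (memLp_mu_of_cont hcx)
    have i4 := ii (f := fun x => pdx z t x ^ 2) ((sz.pdx.slice t).continuous.pow 2)
    have h2 := int_mono_on (μ := volume) hl i4
      (((i1.const_mul 3).add (i2.const_mul (3 * (α ^ 2 / 4 * l ^ 2)))).add (i3.const_mul 3))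
      fun x hx => by
        rw [hz, pdx_unstep hw.smooth]
        set p := pdx w t x
        set I := ∫ y in 0..x, pdt (kern (-α)) x y * w t y
        have e1 : (-α / 2 * x * w t x) ^ 2 ≤ α ^ 2 / 4 * l ^ 2 * w t x ^ 2 := by
          have : x ^ 2 ≤ l ^ 2 := pow_le_pow_left₀ hx.1 hx.2 2
          have := mul_le_mul_of_nonneg_left this (by positivity : 0 ≤ α ^ 2 / 4 * w t x ^ 2)
          nlinarith
        have e2 : (p + -α / 2 * x * w t x - I) ^ 2
            ≤ 3 * p ^ 2 + 3 * (-α / 2 * x * w t x) ^ 2 + 3 * I ^ 2 := by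
          set m := -α / 2 * x * w t x
          nlinarith [sq_nonneg (p - m), sq_nonneg (p + I), sq_nonneg (m + I)]
        show _ ≤ 3 * p ^ 2 + 3 * (α ^ 2 / 4 * l ^ 2) * w t x ^ 2 + 3 * I ^ 2
        nlinarith
    rw [int_add ((i1.const_mul 3).add (i2.const_mul _)) (i3.const_mul 3),
      int_add (i1.const_mul 3) (i2.const_mul _),
      int_const_mul, int_const_mul,
      int_const_mul] at h2
    nlinarith
  -- both parts
  have hlpos : 0 < l := hE.pos t
  set b := flux σ v E z t with hbdef
  have i1 := ii (f := fun x => volt (-α) (resid σ lam w t) x ^ 2)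
    (((smooth2_volt (-α) (hw.smooth.resid σ lam)).slice t).continuous.pow 2)
  have i4 := ii (f := fun x => pdx z t x ^ 2) ((sz.pdx.slice t).continuous.pow 2)
  have i5 := ii (f := fun x => dual0 σ v E z t x ^ 2 + dual1 σ v E z t x ^ 2) (by
    have h1 : Continuous (dual0 σ v E z t) :=
      (continuous_dual0 σ hE sz).comp (by fun_prop : Continuous fun x => (t, x))
    have h2 : Continuous (dual1 σ v E z t) :=
      (continuous_dual1 σ hE sz).comp (by fun_prop : Continuous fun x => (t, x))
    fun_prop)
  have h2 := int_mono_on (μ := volume) hl i5 (((i1.const_mul 2).add (i4.const_mul (2 * σ ^ 2))).add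
      (ii (f := fun _ => 2 * (1 + (l⁻¹) ^ 2) * b ^ 2) (by fun_prop)))
    fun x hx => by
      have e0 : dual0 σ v E z t x = b * l⁻¹ + volt (-α) (resid σ lam w t) x := by
        rw [dual0, hz, heat_unstep hα hw ht, ← hz, ← hbdef, ← hldef, div_eq_mul_inv]
      have e1 : dual1 σ v E z t x = b * (x / l) - σ * pdx z t x := by
        rw [dual1, ← hbdef, ← hldef, mul_div_assoc]
      show _ ≤ 2 * volt (-α) (resid σ lam w t) x ^ 2 + 2 * σ ^ 2 * pdx z t x ^ 2
        + 2 * (1 + (l⁻¹) ^ 2) * b ^ 2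
      rw [e0, e1]
      set V := volt (-α) (resid σ lam w t) x
      set p := pdx z t x
      have hxl : (x / l) ^ 2 ≤ 1 := by
        have : x / l ≤ 1 := (div_le_one hlpos).2 hx.2
        have h0 : 0 ≤ x / l := div_nonneg hx.1 hl
        nlinarith
      have := mul_le_mul_of_nonneg_left hxl (sq_nonneg b)
      nlinarith [sq_nonneg (b * l⁻¹ - V), sq_nonneg (b * (x / l) + σ * p)]
  rw [int_add ((i1.const_mul 2).add (i4.const_mul _)) (ii (by fun_prop)),
    int_add (i1.const_mul 2) (i4.const_mul _),
    int_const_mul, int_const_mul,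
    intervalIntegral.integral_const, smul_eq_mul, sub_zero] at h2
  have h3 : l * (2 * (1 + (l⁻¹) ^ 2) * b ^ 2) = 2 * (l + l⁻¹) * b ^ 2 := by
    field_simp
  rw [h3] at h2
  have h4 := mul_le_mul_of_nonneg_left hb (by positivity : 0 ≤ 2 * (l + l⁻¹))
  have h5 := mul_le_mul_of_nonneg_left hzx (by positivity : 0 ≤ 2 * σ ^ 2)
  linarith

lemma exists_kernel_growth (hσ : 0 < σ) (hα : lam = σ * α) (hlam0 : 0 < lam) (hE : IsFront v E)
    (hlam : 2 * (√(lam / σ) + 4) * v + 2 * m + 1 ≤ lam) :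
    ∃ C, 0 < C ∧ ∀ t ≥ 0, ∃ h, 0 ≤ h ∧
      (∀ x y, 0 ≤ y → y ≤ x → x ≤ E t → |kern (-α) x y| ≤ h ∧ |pdt (kern (-α)) x y| ≤ h) ∧
      (1 + E t + E t ^ 2 + E t ^ 3) * (1 + h ^ 2) ≤ C * exp ((lam - 2 * m - 1) * t) := by
  obtain ⟨M, hM, hk⟩ := exists_kern_bound (-α)
  set r := √|-α| with hr
  have hr0 : 0 ≤ r := sqrt_nonneg _
  have hα0 : 0 ≤ α := ((mul_pos_iff_of_pos_left hσ).1 (hα ▸ hlam0)).le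
  have hrs : r = √(lam / σ) := by
    rw [hr, abs_neg, abs_of_nonneg hα0, hα, mul_div_cancel_left₀ _ hσ.ne']
  have hE0 := (hE.pos 0).le
  refine ⟨4 * (1 + M ^ 2) * exp (2 * (r + 4) * E 0), by positivity, fun t ht => ?_⟩
  have hl := (hE.pos t).le
  refine ⟨M * exp ((r + 1) * E t), by positivity, fun x y hy hyx hx => ?_, ?_⟩
  · obtain ⟨k1, k2⟩ := hk x y hy hyx
    have : M * exp ((r + 1) * x) ≤ M * exp ((r + 1) * E t) := by gcongr
    exact ⟨k1.trans this, k2.trans this⟩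
  · set l := E t with hldef
    set q := exp l with hq
    have e1 : l ≤ q := by linarith [Real.add_one_le_exp l]
    have e0 : 1 ≤ q := one_le_exp hl
    have f1 : 1 + l + l ^ 2 + l ^ 3 ≤ 4 * q ^ 3 := by
      have a1 : l ^ 3 ≤ q ^ 3 := pow_le_pow_left₀ hl e1 3
      have a2 : l ^ 2 ≤ q ^ 2 := pow_le_pow_left₀ hl e1 2
      have a3 : q ^ 2 ≤ q ^ 3 := pow_le_pow_right₀ e0 (by norm_num)
      have a4 : q ^ 1 ≤ q ^ 3 := pow_le_pow_right₀ e0 (by norm_num)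
      have a5 : (1 : ℝ) ≤ q ^ 3 := one_le_pow₀ e0
      linarith
    have f2 : q ^ 3 * (1 + (M * exp ((r + 1) * l)) ^ 2) ≤ (1 + M ^ 2) * exp (2 * (r + 4) * l) := by
      have a1 : q ^ 3 = exp (3 * l) := by rw [hq, ← exp_nat_mul]; norm_num
      have a2 : exp ((r + 1) * l) ^ 2 = exp (2 * (r + 1) * l) := by
        rw [← exp_nat_mul]; push_cast; ring_nf
      rw [mul_pow, a1, a2, mul_add, mul_one, add_mul, one_mul]
      refine add_le_add (exp_le_exp.2 (by nlinarith)) ?_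
      rw [mul_left_comm, ← exp_add]
      refine mul_le_mul_of_nonneg_left (exp_le_exp.2 (by nlinarith)) (sq_nonneg _)
    have f3 : exp (2 * (r + 4) * l) ≤ exp (2 * (r + 4) * E 0) * exp ((lam - 2 * m - 1) * t) := by
      rw [← exp_add, hldef, hE.eq t ht]
      refine exp_le_exp.2 ?_
      rw [hrs]
      nlinarith
    calc _ ≤ 4 * q ^ 3 * (1 + (M * exp ((r + 1) * l)) ^ 2) := by gcongr
      _ ≤ 4 * ((1 + M ^ 2) * exp (2 * (r + 4) * l)) := by rw [mul_assoc]; gcongr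
      _ ≤ 4 * ((1 + M ^ 2) * (exp (2 * (r + 4) * E 0) * exp ((lam - 2 * m - 1) * t))) := by gcongr
      _ = _ := by ring

set_option maxHeartbeats 1000000 in
lemma unstep_coeff_le {a d : ℝ} (hσ : 0 < σ) (hv : 0 < v) (he0 : 0 < e0)
    (hl : e0 ≤ l) (hs : 0 ≤ s) (ha : 0 ≤ a) (hc : 0 ≤ c) (hd : 0 ≤ d) :
    2 * (l + l⁻¹) * (2 * (σ * α / 2) ^ 2 * l ^ 2 * s + 2 * ((σ + v) * h) ^ 2 * l * a)
        + 2 * (2 * (1 + h ^ 2 * l ^ 2) * d)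
        + 2 * σ ^ 2 * (3 * c + 3 * (α ^ 2 / 4 + h ^ 2) * l ^ 2 * a)
      ≤ ((1 + (e0⁻¹) ^ 2) * (4 * (σ * α / 2) ^ 2 + 4 * (σ + v) ^ 2) + 4 + 6 * σ ^ 2 * (1 + α ^ 2))
        * ((1 + l + l ^ 2 + l ^ 3) * (1 + h ^ 2)) * (s + a + c + d) := by
  have hl0 : 0 < l := he0.trans_le hl
  set W := (1 + l + l ^ 2 + l ^ 3) * (1 + h ^ 2) with hW
  have hh : 0 ≤ h ^ 2 := sq_nonneg h
  have w0 : 1 ≤ W := by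
    have : W = 1 + (h ^ 2 + (l + l ^ 2 + l ^ 3) * (1 + h ^ 2)) := by rw [hW]; ring
    rw [this]; have : 0 ≤ h ^ 2 + (l + l ^ 2 + l ^ 3) * (1 + h ^ 2) := by positivity
    linarith
  have w1 : l ^ 3 ≤ W := by
    have : W = l ^ 3 + (l ^ 3 * h ^ 2 + (1 + l + l ^ 2) * (1 + h ^ 2)) := by rw [hW]; ring
    rw [this]; have : 0 ≤ l ^ 3 * h ^ 2 + (1 + l + l ^ 2) * (1 + h ^ 2) := by positivity
    linarith
  have w2 : 1 + h ^ 2 * l ^ 2 ≤ W := by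
    have : W = 1 + h ^ 2 * l ^ 2 + (l ^ 2 + h ^ 2 + (l + l ^ 3) * (1 + h ^ 2)) := by rw [hW]; ring
    rw [this]; have : 0 ≤ l ^ 2 + h ^ 2 + (l + l ^ 3) * (1 + h ^ 2) := by positivity
    linarith
  have w4 : l ^ 2 ≤ W := by
    have : W = l ^ 2 + (l ^ 2 * h ^ 2 + (1 + l + l ^ 3) * (1 + h ^ 2)) := by rw [hW]; ring
    rw [this]; have : 0 ≤ l ^ 2 * h ^ 2 + (1 + l + l ^ 3) * (1 + h ^ 2) := by positivity
    linarith
  have hinv : l⁻¹ ≤ (e0⁻¹) ^ 2 * l := by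
    rw [inv_pow, ← div_eq_inv_mul, le_div_iff₀ (by positivity), inv_mul_le_iff₀ hl0]
    nlinarith
  set g := (e0⁻¹) ^ 2 with hg
  have hg0 : 0 ≤ g := sq_nonneg _
  set A := (σ * α / 2) ^ 2
  set B := (σ + v) ^ 2 with hB
  have hA : 0 ≤ A := sq_nonneg _
  have hB0 : 0 ≤ B := sq_nonneg _
  have t1 : 2 * (l + l⁻¹) * (2 * A * l ^ 2 * s + 2 * ((σ + v) * h) ^ 2 * l * a)
      ≤ (1 + g) * (4 * A * (W * s) + 4 * B * (W * a)) := by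
    calc _ ≤ 2 * (l + g * l) * (2 * A * l ^ 2 * s + 2 * ((σ + v) * h) ^ 2 * l * a) := by gcongr
      _ = (1 + g) * (4 * A * (l ^ 3 * s) + 4 * B * ((h ^ 2 * l ^ 2) * a)) := by rw [hB]; ring
      _ ≤ _ := by
        have : h ^ 2 * l ^ 2 ≤ W := by linarith
        gcongr
  have t2 : 2 * (2 * (1 + h ^ 2 * l ^ 2) * d) ≤ 4 * (W * d) := by
    have := mul_le_mul_of_nonneg_right w2 hd
    linarith
  have t3 : 2 * σ ^ 2 * (3 * c + 3 * (α ^ 2 / 4 + h ^ 2) * l ^ 2 * a)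
      ≤ 6 * σ ^ 2 * (1 + α ^ 2) * (W * c) + 6 * σ ^ 2 * (1 + α ^ 2) * (W * a) := by
    have k1 : c ≤ (1 + α ^ 2) * (W * c) := by
      have : 1 ≤ (1 + α ^ 2) * W := one_le_mul_of_one_le_of_one_le (by linarith [sq_nonneg α]) w0
      have := mul_le_mul_of_nonneg_right this hc
      linarith
    have k2 : (α ^ 2 / 4 + h ^ 2) * l ^ 2 * a ≤ (1 + α ^ 2) * (W * a) := by
      have : (α ^ 2 / 4 + h ^ 2) * l ^ 2 ≤ (1 + α ^ 2) * W := by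
        have r1 := mul_le_mul_of_nonneg_left w4 (sq_nonneg α)
        have r2 : 0 ≤ α ^ 2 * l ^ 2 := by positivity
        linarith
      have := mul_le_mul_of_nonneg_right this ha
      linarith
    have := mul_le_mul_of_nonneg_left (add_le_add k1 k2) (by positivity : 0 ≤ 6 * σ ^ 2)
    linarith
  have u1 : 0 ≤ W * s := by positivity
  have u2 : 0 ≤ W * a := by positivity
  have u3 : 0 ≤ W * c := by positivity
  have u4 : 0 ≤ W * d := by positivity
  set p := (1 + g) * (4 * A) with hp
  set q := (1 + g) * (4 * B) with hq
  set r := 6 * σ ^ 2 * (1 + α ^ 2) with hr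
  have p0 : 0 ≤ p := by positivity
  have q0 : 0 ≤ q := by positivity
  have r0 : 0 ≤ r := by positivity
  have e1 : ((1 + g) * (4 * A + 4 * B) + 4 + r) * W * (s + a + c + d)
      = (p + q + 4 + r) * (W * s + W * a + W * c + W * d) := by rw [hp, hq]; ring
  have e2 : (1 + g) * (4 * A * (W * s) + 4 * B * (W * a)) = p * (W * s) + q * (W * a) := by
    rw [hp, hq]; ring
  rw [e1]
  rw [e2] at t1
  have m1 := mul_nonneg p0 u1
  have m2 := mul_nonneg p0 u2
  have m3 := mul_nonneg p0 u3
  have m4 := mul_nonneg p0 u4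
  have n1 := mul_nonneg q0 u1
  have n2 := mul_nonneg q0 u2
  have n3 := mul_nonneg q0 u3
  have n4 := mul_nonneg q0 u4
  have o1 := mul_nonneg r0 u1
  have o2 := mul_nonneg r0 u2
  have o3 := mul_nonneg r0 u3
  have o4 := mul_nonneg r0 u4
  linarith

set_option maxHeartbeats 1000000 in
/-- The energy estimate carried over to the unstepped solution. -/
lemma exists_unstep_bound (hσ : 0 < σ) (hv : 0 < v) (hα : lam = σ * α)
    (hlam0 : 0 < lam) (hE : IsFront v E)
    (hlam : 2 * (√(lam / σ) + 4) * v + 2 * m + 1 ≤ lam) (hm : 0 ≤ m) :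
    ∃ C, 0 < C ∧ ∀ (w : ℝ → ℝ → ℝ) (R : ℝ), IsRegular σ v E w →
      (∀ T ≥ 0, ∫ t in 0..T, exp (lam * t) * ∫ x in 0..E t, resid σ lam w t x ^ 2 ≤ R) →
      (∀ t ≥ 0, exp (2 * m * t) * ∫ x in 0..E t, unstep α w t x ^ 2
        ≤ C * ((∫ x in 0..E 0, w 0 x ^ 2) + R)) ∧
      ∀ T ≥ 0, ∫ t in 0..T, ∫ x in 0..E t,
          (dual0 σ v E (unstep α w) t x ^ 2 + dual1 σ v E (unstep α w) t x ^ 2)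
        ≤ C * ((∫ x in 0..E 0, w 0 x ^ 2) + R) := by
  obtain ⟨G, hG, hgr⟩ := exists_kernel_growth hσ hα hlam0 hE hlam
  set e0 := E 0 with he0
  have he0p : 0 < e0 := hE.pos 0
  -- one constant for all coefficients
  set P := (1 + (e0⁻¹) ^ 2) * (4 * (σ * α / 2) ^ 2 + 4 * (σ + v) ^ 2) + 4
    + 6 * σ ^ 2 * (1 + α ^ 2) with hP
  have hP0 : 0 < P := by positivity
  set Y := 1 / v + 1 / (2 * σ) + 1 with hY
  have hY0 : 0 < Y := by positivity
  refine ⟨2 * G * (1 + lam⁻¹) + P * G * (Y + 2) * (1 + lam⁻¹), by positivity, fun w R hw hR => ?_⟩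
  have en := fun T hT => hw.energy hlam0 hE (T := T) hT
  set D := (∫ x in 0..e0, w 0 x ^ 2) with hD
  have hD0 : 0 ≤ D := int_nonneg he0p.le fun y _ => sq_nonneg _
  have hR0 : 0 ≤ R := by have := hR 0 le_rfl; simpa using this
  set S := (1 + lam⁻¹) * (D + R) with hS
  have hlami : 0 < lam⁻¹ := inv_pos.2 hlam0
  have hDS : D + lam⁻¹ * R ≤ S := by rw [hS]; nlinarith [mul_nonneg hlami.le hD0]
  have hRS : R ≤ S := by
    rw [hS]; nlinarith [mul_nonneg hlami.le hD0, mul_nonneg hlami.le hR0]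
  have hS0 : 0 ≤ S := by positivity
  have n_w : ∀ t, 0 ≤ ∫ x in 0..E t, w t x ^ 2 := fun t =>
    int_nonneg (hE.pos t).le fun y _ => sq_nonneg _
  have n_wx : ∀ t, 0 ≤ ∫ x in 0..E t, pdx w t x ^ 2 := fun t =>
    int_nonneg (hE.pos t).le fun y _ => sq_nonneg _
  have n_r : ∀ t, 0 ≤ ∫ x in 0..E t, resid σ lam w t x ^ 2 := fun t =>
    int_nonneg (hE.pos t).le fun y _ => sq_nonneg _
  have en1 : ∀ t ≥ 0, exp (lam * t) * ∫ x in 0..E t, w t x ^ 2 ≤ S := by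
    intro t ht
    have h1 := en t ht
    have h2 : 0 ≤ ∫ s in 0..t, exp (lam * s)
          * (v * w s (E s) ^ 2 + 2 * σ * ∫ x in 0..E s, pdx w s x ^ 2) :=
      int_nonneg ht fun s _ => by
        have := n_wx s; positivity
    have h3 := mul_le_mul_of_nonneg_left (hR t ht) hlami.le
    linarith
  have en2 : ∀ T ≥ 0, ∫ s in 0..T, exp (lam * s)
          * (v * w s (E s) ^ 2 + 2 * σ * ∫ x in 0..E s, pdx w s x ^ 2) ≤ S := by
    intro t ht
    have h1 := en t ht
    have h2 := mul_nonneg (exp_pos (lam * t)).le (n_w t)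
    have h3 := mul_le_mul_of_nonneg_left (hR t ht) hlami.le
    linarith
  have hexp : ∀ t ≥ 0, exp ((lam - 2 * m - 1) * t) ≤ exp (lam * t) * exp (-t) := by
    intro t ht
    rw [← exp_add]
    exact exp_le_exp.2 (by nlinarith [mul_nonneg hm ht])
  constructor
  · intro t ht
    obtain ⟨h, hh, hk, hb⟩ := hgr t ht
    have h1 := (sq_unstep_slice_le hσ hv hE hα hw ht hk).1
    have hl := hE.pos t
    have h2 : 1 + h ^ 2 * E t ^ 2 ≤ G * exp ((lam - 2 * m - 1) * t) := by
      refine le_trans ?_ hb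
      have : 0 ≤ E t + E t ^ 2 + E t ^ 3 := by positivity
      have : 0 ≤ (E t + E t ^ 3) * (1 + h ^ 2) + h ^ 2 + E t ^ 2 := by positivity
      nlinarith
    calc exp (2 * m * t) * ∫ x in 0..E t, unstep α w t x ^ 2
        ≤ exp (2 * m * t) * (2 * (G * exp ((lam - 2 * m - 1) * t)) * ∫ x in 0..E t, w t x ^ 2) := by
          refine mul_le_mul_of_nonneg_left (h1.trans ?_) (exp_pos _).le
          have := n_w t
          gcongr
      _ = 2 * G * (exp (-t) * (exp (lam * t) * ∫ x in 0..E t, w t x ^ 2)) := by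
          have : exp (2 * m * t) * exp ((lam - 2 * m - 1) * t) = exp (-t) * exp (lam * t) := by
            rw [← exp_add, ← exp_add]; ring_nf
          linear_combination 2 * G * (∫ x in 0..E t, w t x ^ 2) * this
      _ ≤ 2 * G * (1 * S) := by
          have h3 : exp (-t) ≤ 1 := Real.exp_le_one_iff.2 (by linarith)
          have h4 := en1 t ht
          have h5 := mul_nonneg (exp_pos (lam * t)).le (n_w t)
          gcongr
      _ ≤ _ := by
          rw [hS]
          have : 0 ≤ P * G * (Y + 2) * (1 + lam⁻¹) * (D + R) := by positivity
          linarith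
  · intro T hT
    have sw := hw.smooth
    have cE := hE.cont
    have c1 : Continuous fun t => w t (E t) ^ 2 :=
      ((sw.comp_curve contDiff_id hE.smooth).continuous).pow 2
    have c2 : Continuous fun t => ∫ x in 0..E t, pdx w t x ^ 2 := by
      have : Smooth2 fun t x => pdx w t x ^ 2 := by
        simpa only [pow_two] using sw.pdx.mul sw.pdx
      exact this.continuous_integral hE.smooth 0
    have c3 : Continuous fun t => ∫ x in 0..E t, w t x ^ 2 := by
      have : Smooth2 fun t x => w t x ^ 2 := by simpa only [pow_two] using sw.mul sw
      exact this.continuous_integral hE.smooth 0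
    have c4 : Continuous fun t => ∫ x in 0..E t, resid σ lam w t x ^ 2 := by
      have : Smooth2 fun t x => resid σ lam w t x ^ 2 := by
        simpa only [pow_two] using (sw.resid σ lam).mul (sw.resid σ lam)
      exact this.continuous_integral hE.smooth 0
    -- the bound on one slice
    have key : ∀ t ∈ Icc 0 T, ∫ x in 0..E t,
          (dual0 σ v E (unstep α w) t x ^ 2 + dual1 σ v E (unstep α w) t x ^ 2)
        ≤ P * G * (Y * (exp (lam * t) * (v * w t (E t) ^ 2 + 2 * σ * ∫ x in 0..E t, pdx w t x ^ 2))
          + S * exp (-t) + exp (lam * t) * ∫ x in 0..E t, resid σ lam w t x ^ 2) := by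
      intro t ht
      obtain ⟨h, hh, hk, hb⟩ := hgr t ht.1
      have h1 := (sq_unstep_slice_le hσ hv hE hα hw ht.1 hk).2
      have he := en1 t ht.1
      have hex := hexp t ht.1
      have hl := hE.pos t
      have hl0 : e0 ≤ E t := hE.zero_le ht.1
      have ns : 0 ≤ w t (E t) ^ 2 := sq_nonneg _
      have na := n_w t
      have nc := n_wx t
      have nd := n_r t
      refine h1.trans ?_
      refine (unstep_coeff_le hσ hv he0p hl0 ns na nc nd).trans ?_
      rw [← hP]
      set s := w t (E t) ^ 2
      set a := ∫ x in 0..E t, w t x ^ 2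
      set c := ∫ x in 0..E t, pdx w t x ^ 2
      set d := ∫ x in 0..E t, resid σ lam w t x ^ 2
      set X := exp (lam * t)
      have hX : 0 < X := exp_pos _
      set e := exp (-t)
      have he1 : e ≤ 1 := Real.exp_le_one_iff.2 (by linarith [ht.1])
      have hepos : 0 < e := exp_pos _
      have g1 : s + c ≤ Y * (v * s + 2 * σ * c) := by
        have k1 : 1 ≤ Y * v := by
          rw [hY, add_mul, add_mul, one_div, inv_mul_cancel₀ hv.ne']
          have : 0 ≤ 1 / (2 * σ) * v + 1 * v := by positivity
          linarith
        have k2 : 1 ≤ Y * (2 * σ) := by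
          rw [hY, add_mul, add_mul, one_div_mul_cancel (by positivity : 2 * σ ≠ 0)]
          have : 0 ≤ 1 / v * (2 * σ) + 1 * (2 * σ) := by positivity
          linarith
        nlinarith
      calc P * ((1 + E t + E t ^ 2 + E t ^ 3) * (1 + h ^ 2)) * (s + a + c + d)
          ≤ P * (G * (X * e)) * (s + a + c + d) := by
            have := hb.trans (mul_le_mul_of_nonneg_left hex hG.le)
            gcongr
        _ = P * G * (X * e * (s + c) + (X * a) * e + X * e * d) := by ring
        _ ≤ _ := by
            have q1 : X * e * (s + c) ≤ X * 1 * (Y * (v * s + 2 * σ * c)) := by gcongr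
            have q2 : X * e * d ≤ X * 1 * d := by gcongr
            have q3 : X * a * e ≤ S * e := by gcongr
            refine mul_le_mul_of_nonneg_left ?_ (by positivity)
            linarith
    have z0 : Smooth2 (unstep α w) := smooth_unstep sw
    have c5 : Continuous fun t => ∫ x in 0..E t,
          (dual0 σ v E (unstep α w) t x ^ 2 + dual1 σ v E (unstep α w) t x ^ 2) :=
      continuous_parametric_intervalIntegral_of_continuous
        (f := fun t x => dual0 σ v E (unstep α w) t x ^ 2 + dual1 σ v E (unstep α w) t x ^ 2) (by
          have h1 := continuous_dual0 σ hE z0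
          have h2 := continuous_dual1 σ hE z0
          simp only [uncurry_def] at h1 h2 ⊢
          fun_prop) cE
    have i1 : ∀ {f : ℝ → ℝ}, Continuous f → IntervalIntegrable f volume 0 T :=
      fun hf => hf.intervalIntegrable _ _
    have a1 := i1 (f := fun t => exp (lam * t) * (v * w t (E t) ^ 2
            + 2 * σ * ∫ x in 0..E t, pdx w t x ^ 2)) (by fun_prop)
    have a2 := i1 (f := fun t => exp (-t)) (by fun_prop)
    have a3 := i1 (f := fun t => exp (lam * t) * ∫ x in 0..E t, resid σ lam w t x ^ 2) (by fun_prop)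
    have h2 := int_mono_on (μ := volume) hT (i1 c5)
      ((((a1.const_mul Y).add (a2.const_mul S)).add a3).const_mul (P * G)) key
    rw [int_const_mul, int_add ((a1.const_mul Y).add (a2.const_mul S)) a3,
      int_add (a1.const_mul Y) (a2.const_mul S),
      int_const_mul, int_const_mul] at h2
    have hexpint : ∫ t in 0..T, exp (-t) ≤ 1 := by
      rw [integral_comp_neg fun t => exp t, integral_exp]
      simp [Real.exp_nonneg]
    refine h2.trans ?_
    calc _ ≤ P * G * (Y * S + S * 1 + S) := by
          have := en2 T hT
          have := (hR T hT).trans hRS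
          gcongr
      _ ≤ _ := by
        rw [hS]
        have : 0 ≤ 2 * G * (1 + lam⁻¹) * (D + R) := by positivity
        linarith

/-! ## Limits in the moving domain -/

lemma tendsto_int_mul {X : Type*} [MeasurableSpace X] {μ : Measure X}
    {F : ℕ → X → ℝ} {f g : X → ℝ} (hF : ∀ n, MemLp (F n) 2 μ) (hf : MemLp f 2 μ)
    (hg : MemLp g 2 μ) (h : Tendsto (fun n => eLpNorm (F n - f) 2 μ) atTop (𝓝 0)) :
    Tendsto (fun n => ∫ x, F n x * g x ∂μ) atTop (𝓝 (∫ x, f x * g x ∂μ)) := by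
  rw [tendsto_iff_norm_sub_tendsto_zero]
  have h1 : Tendsto (fun n => (eLpNorm (F n - f) 2 μ).toReal * √(∫ x, g x ^ 2 ∂μ)) atTop (𝓝 0) := by
    have := ((ENNReal.tendsto_toReal ENNReal.zero_ne_top).comp h).mul_const (√(∫ x, g x ^ 2 ∂μ))
    simpa using this
  refine squeeze_zero (fun _ => norm_nonneg _) (fun n => ?_) h1
  have e := integral_sub ((hF n).integrable_mul hg) (hf.integrable_mul hg)
  simp only [Pi.mul_apply] at e
  rw [← e, eLpNorm_two_eq ((hF n).sub hf), toReal_ofReal (sqrt_nonneg _)]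
  refine le_trans (le_of_eq ?_) (integral_mul_sq_le ((hF n).sub hf) hg)
  rw [norm_eq_abs]
  congr 2; ext x; simp only [Pi.sub_apply]; ring

lemma tsum_geometric_ne_top (c : ℝ) : ∑' i : ℕ, ofReal (c * (1 / 2) ^ i) ≠ ⊤ :=
  ((summable_geometric_of_lt_one (by norm_num) (by norm_num)).mul_left c).tsum_ofReal_ne_top

/-- A sequence converging geometrically in `L²` has a limit. -/
lemma exists_memLp_limit {X : Type*} [MeasurableSpace X] {μ : Measure X} {F : ℕ → X → ℝ}
    (hc : 0 < c) (hF : ∀ n, MemLp (F n) 2 μ)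
    (h : ∀ n m, n ≤ m → eLpNorm (F n - F m) 2 μ ≤ ofReal (c * (1 / 2) ^ n)) :
    ∃ f, MemLp f 2 μ ∧ Tendsto (fun n => eLpNorm (F n - f) 2 μ) atTop (𝓝 0) := by
  refine Lp.cauchy_complete_eLpNorm (by norm_num) hF (tsum_geometric_ne_top (3 * c))
    fun N n m hn hm => ?_
  have e : F n - F m = (F N - F m) - (F N - F n) := by abel
  rw [e]
  refine (eLpNorm_sub_le ((hF N).sub (hF m)).1 ((hF N).sub (hF n)).1 (by norm_num)).trans_lt ?_
  refine (add_le_add (h N m hm) (h N n hn)).trans_lt ?_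
  rw [← ENNReal.ofReal_add (by positivity) (by positivity)]
  refine ENNReal.ofReal_lt_ofReal_iff_of_nonneg (by positivity) |>.2 ?_
  have : 0 < c * (1 / 2) ^ N := by positivity
  linarith

/-- A sequence converging geometrically in `L²` on every slice has a jointly measurable limit. -/
lemma exists_slice_limit {l : ℝ → ℝ} {F : ℕ → ℝ → ℝ → ℝ} (hc : 0 < c)
    (hF : ∀ n, Continuous (uncurry (F n)))
    (h : ∀ n m t, 0 ≤ t → n ≤ m → eLpNorm (F n t - F m t) 2 (mu (l t)) ≤ ofReal (c * (1 / 2) ^ n)) :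
    ∃ f : ℝ → ℝ → ℝ, StronglyMeasurable (uncurry f) ∧
      ∀ n t, 0 ≤ t → eLpNorm (F n t - f t) 2 (mu (l t)) ≤ ofReal (c * (1 / 2) ^ n) := by
  refine ⟨fun t x => limUnder atTop fun n => F n t x,
    (StronglyMeasurable.limUnder (l := atTop) (f := fun n => uncurry (F n))
      fun n => (hF n).stronglyMeasurable : _), fun n t ht => ?_⟩
  have hm : ∀ n, AEStronglyMeasurable (F n t) (mu (l t)) := fun n =>
    ((hF n).comp (by fun_prop : Continuous fun x => (t, x))).aestronglyMeasurable
  have hae := Lp.ae_tendsto_of_cauchy_eLpNorm hm (by norm_num) (tsum_geometric_ne_top (3 * c))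
    (p := 2) (fun N n m hn hm' => by
      have e : F n t - F m t = (F N t - F m t) - (F N t - F n t) := by abel
      rw [e]
      refine (eLpNorm_sub_le ((hm N).sub (hm m)) ((hm N).sub (hm n)) (by norm_num)).trans_lt ?_
      refine (add_le_add (h N m t ht hm') (h N n t ht hn)).trans_lt ?_
      rw [← ENNReal.ofReal_add (by positivity) (by positivity)]
      refine ENNReal.ofReal_lt_ofReal_iff_of_nonneg (by positivity) |>.2 ?_
      have : 0 < c * (1 / 2) ^ N := by positivity
      linarith)
  have h2 := Lp.eLpNorm_lim_le_liminf_eLpNorm (p := 2) (f := fun m => F n t - F m t)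
    (fun m => (hm n).sub (hm m)) (F n t - fun x => limUnder atTop fun n => F n t x) (by
      filter_upwards [hae] with x hx
      exact tendsto_const_nhds.sub (tendsto_nhds_limUnder hx))
  refine h2.trans (liminf_le_of_frequently_le' ?_)
  exact (eventually_ge_atTop n).frequently.mono fun m hm => h n m t ht hm

lemma eLpNorm_domainT_le (hE : Measurable E) {f : ℝ → ℝ → ℝ}
    (hf : AEStronglyMeasurable (uncurry f) (volume.restrict (domainT E T))) {c : ENNReal}
    (h : ∀ t ∈ Ioo 0 T, eLpNorm (f t) 2 (mu (E t)) ≤ c) :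
    eLpNorm (uncurry f) 2 (volume.restrict (domainT E T)) ≤ c * (ofReal T) ^ (1 / 2 : ℝ) := by
  rw [eLpNorm_eq_lintegral_rpow_enorm_toReal (by norm_num) (by norm_num)]
  have hm : AEMeasurable (fun p => ‖uncurry f p‖ₑ ^ (2 : ENNReal).toReal)
      (volume.restrict (domainT E T)) := hf.enorm.pow_const _
  rw [lintegral_domainT hE hm]
  have h1 : ∫⁻ t, ∫⁻ x, ‖uncurry f (t, x)‖ₑ ^ (2 : ENNReal).toReal ∂(mu (E t)) ∂(mu T)
      ≤ ∫⁻ _, c ^ (2 : ENNReal).toReal ∂(mu T) := by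
    refine lintegral_mono_ae ?_
    filter_upwards [(ae_restrict_mem measurableSet_Ioo : ∀ᵐ t ∂(mu T), t ∈ Ioo 0 T)] with t ht
    have := h t ht
    rw [eLpNorm_eq_lintegral_rpow_enorm_toReal (by norm_num) (by norm_num)] at this
    have h2 := ENNReal.rpow_le_rpow this (z := (2 : ENNReal).toReal) (by norm_num)
    rw [← ENNReal.rpow_mul] at h2
    simpa using h2
  refine (ENNReal.rpow_le_rpow h1 (by norm_num)).trans ?_
  rw [lintegral_const, mu, Measure.restrict_apply_univ, Real.volume_Ioo, sub_zero,
    ENNReal.mul_rpow_of_nonneg _ _ (by norm_num), ← ENNReal.rpow_mul]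
  norm_num

lemma domain_eq_iUnion (E : ℝ → ℝ) : domain E = ⋃ n : ℕ, domainT E n := by
  ext p
  simp only [mem_iUnion, domainT, mem_ofPred_eq]
  exact ⟨fun hp => (exists_nat_gt p.1).imp fun n hn => ⟨hp, hn⟩, fun ⟨_, hn⟩ => hn.1⟩

lemma domainT_mono (E : ℝ → ℝ) {S : ℝ} (h : S ≤ T) : domainT E S ⊆ domainT E T :=
  fun _ hp => ⟨hp.1, hp.2.trans_le h⟩

lemma domainT_subset_domain (E : ℝ → ℝ) (T : ℝ) : domainT E T ⊆ domain E := fun _ hp => hp.1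

lemma eLpNorm_domain_le (hE : Continuous E) (hpos : ∀ t, 0 < E t) {f : ℝ → ℝ → ℝ}
    (hf : Continuous (uncurry f)) {K : ℝ}
    (h : ∀ T ≥ 0, ∫ t in 0..T, ∫ x in 0..E t, f t x ^ 2 ≤ K) :
    eLpNorm (uncurry f) 2 (volume.restrict (domain E)) ≤ ofReal (√K) := by
  have h1 : ∀ n : ℕ, ∫⁻ p in domainT E n, ‖uncurry f p‖ₑ ^ (2 : ENNReal).toReal
      ≤ ofReal (√K) ^ (2 : ENNReal).toReal := by
    intro n
    have hm : MemLp (uncurry f) 2 (volume.restrict (domainT E n)) := movL2_of_cont hE hf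
    have h2 := eLpNorm_two_eq hm
    rw [integral_domainT hE.measurable hpos (Nat.cast_nonneg n) hm.integrable_sq] at h2
    have h3 : eLpNorm (uncurry f) 2 (volume.restrict (domainT E n)) ≤ ofReal (√K) := by
      rw [h2]
      exact ofReal_le_ofReal (sqrt_le_sqrt (h n (Nat.cast_nonneg n)))
    rw [eLpNorm_eq_lintegral_rpow_enorm_toReal (by norm_num) (by norm_num)] at h3
    have h4 := ENNReal.rpow_le_rpow h3 (z := (2 : ENNReal).toReal) (by norm_num)
    rw [← ENNReal.rpow_mul] at h4
    simpa using h4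
  rw [eLpNorm_eq_lintegral_rpow_enorm_toReal (by norm_num) (by norm_num), domain_eq_iUnion,
    setLIntegral_iUnion_of_directed _ (directed_of_isDirected_le fun a b hab =>
      domainT_mono E (Nat.cast_le.2 hab))]
  have h5 := ENNReal.rpow_le_rpow (iSup_le h1) (z := 1 / (2 : ENNReal).toReal) (by norm_num)
  rw [← ENNReal.rpow_mul] at h5
  simpa using h5

lemma MovContL2.of_uniform_limit (hE : Continuous E) (hpos : ∀ t, 0 < E t)
    (he0 : 0 < e0) {I : Set ℝ}
    (hle : ∀ t ∈ I, e0 ≤ E t) {F : ℕ → ℝ → ℝ → ℝ} {f : ℝ → ℝ → ℝ}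
    (hF : ∀ n, Continuous (uncurry (F n)))
    (hf : StronglyMeasurable (uncurry f))
    (h : ∀ n, ∀ t ∈ I, eLpNorm (F n t - f t) 2 (mu (E t)) ≤ ofReal (c * (1 / 2) ^ n)) :
    MovContL2 E I f := by
  refine ContL2.of_uniform_limit
    (δ := fun n => (ofReal e0)⁻¹ ^ (1 / 2 : ℝ) * ofReal (c * (1 / 2) ^ n)) ?_
    (fun n => MovContL2.of_cont hE I (hF n)) (fun t _ => ?_) fun n t ht => ?_
  · have h1 : Tendsto (fun n : ℕ => ofReal (c * (1 / 2) ^ n)) atTop (𝓝 0) := by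
      have := (tendsto_pow_atTop_nhds_zero_of_lt_one (r := (1 / 2 : ℝ)) (by norm_num)
        (by norm_num)).const_mul c
      have := ENNReal.tendsto_ofReal this
      simpa using this
    have h2 := ENNReal.Tendsto.const_mul (a := (ofReal e0)⁻¹ ^ (1 / 2 : ℝ)) h1
      (Or.inr (ENNReal.rpow_ne_top_of_nonneg (by norm_num)
        (ENNReal.inv_ne_top.2 (ENNReal.ofReal_pos.2 he0).ne')))
    simpa using h2
  · have : StronglyMeasurable fun y => f t (E t * y) :=
      hf.comp_measurable (by fun_prop : Measurable fun y => (t, E t * y))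
    exact this.aestronglyMeasurable
  · have := eLpNorm_rescale (hpos t) (F n t - f t)
    simp only [Pi.sub_apply] at this
    rw [this]
    refine mul_le_mul' (ENNReal.rpow_le_rpow ?_ (by norm_num)) (h n t ht)
    exact ENNReal.inv_le_inv.2 (ofReal_le_ofReal (hle t ht))

/-! ## The time derivative of a smooth function as an element of the dual of `H¹` -/

lemma dual_identity (hE : IsFront v E) (hz : Smooth2 z)
    (hz0 : ∀ t ≥ 0, pdx z t 0 = 0) {φ : ℝ × ℝ → ℝ} (hφ : ContDiff ℝ ∞ φ)
    (hc : HasCompactSupport φ) (hs : tsupport φ ⊆ {p | 0 < p.1}) :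
    -∫ p in domain E, z p.1 p.2 * fderiv ℝ φ p (1, 0)
      = ∫ p in domain E, (dual0 σ v E z p.1 p.2 * φ p
          + dual1 σ v E z p.1 p.2 * fderiv ℝ φ p (0, 1)) := by
  have hEc := hE.cont
  set Φ : ℝ → ℝ → ℝ := fun t x => φ (t, x) with hΦdef
  have hΦ : Smooth2 Φ := hφ
  have ht' : ∀ p : ℝ × ℝ, fderiv ℝ φ p (1, 0) = pdt Φ p.1 p.2 := fun p =>
    (hΦ.pdt_eq_fderiv p.1 p.2).symm
  have hx' : ∀ p : ℝ × ℝ, fderiv ℝ φ p (0, 1) = pdx Φ p.1 p.2 := fun p =>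
    (hΦ.pdx_eq_fderiv p.1 p.2).symm
  obtain ⟨T, hT, hTs⟩ : ∃ T : ℝ, 0 < T ∧ ∀ p ∈ tsupport φ, p.1 < T := by
    obtain ⟨b, hb⟩ := (IsCompact.image hc continuous_fst).bddAbove
    refine ⟨max b 0 + 1, by positivity, fun p hp => ?_⟩
    have := hb ⟨p, hp, rfl⟩
    linarith [le_max_left b 0]
  have hfd : ∀ p ∉ tsupport φ, fderiv ℝ φ p = 0 := fun p hp =>
    Function.notMem_support.1 fun h => hp (support_fderiv_subset ℝ h)
  have cut : ∀ F : ℝ × ℝ → ℝ, (∀ p ∉ tsupport φ, F p = 0) →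
      ∫ p in domain E, F p = ∫ p in domainT E T, F p := by
    intro F hF
    refine setIntegral_eq_of_subset_of_forall_sdiff_eq_zero (measurableSet_domain hEc.measurable)
      (domainT_subset_domain E T) fun p hp => hF p fun h => hp.2 ⟨hp.1, hTs p h⟩
  rw [cut _ fun p hp => by rw [hfd p hp]; simp,
    cut _ fun p hp => by rw [hfd p hp, image_eq_zero_of_notMem_tsupport hp]; simp]
  have hfin := finite_domainT (T := T) hEc
  have hio : ∀ {f : ℝ → ℝ → ℝ}, Continuous (uncurry f) →
      IntegrableOn (fun p : ℝ × ℝ => f p.1 p.2) (domainT E T) := fun hf =>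
    MemLp.integrable (by norm_num) (movL2_of_cont hEc hf)
  have c0 := continuous_dual0 σ hE hz
  have c1 := continuous_dual1 σ hE hz
  have s1 : Smooth2 fun t x => z t x * pdt Φ t x := hz.mul hΦ.pdt
  have s2 : Continuous (uncurry fun t x =>
      dual0 σ v E z t x * Φ t x + dual1 σ v E z t x * pdx Φ t x) := by
    have := hΦ.continuous
    have := hΦ.pdx.continuous
    simp only [uncurry_def] at *
    fun_prop
  simp only [ht', hx']
  rw [integral_domainT hEc.measurable hE.pos hT.le (hio s1.continuous)]
  have := integral_domainT hEc.measurable hE.pos hT.le (hio s2)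
  refine Eq.trans ?_ this.symm
  have hprod : Smooth2 fun t x => z t x * Φ t x := hz.mul hΦ
  have hJ : ∀ t ∈ uIcc 0 T, HasDerivAt (fun s => ∫ x in 0..E s, z s x * Φ s x)
      (v * (z t (E t) * Φ t (E t)) + ∫ x in 0..E t, pdt (fun t x => z t x * Φ t x) t x) t := by
    intro t ht
    rw [uIcc_of_le hT.le] at ht
    exact hprod.hasDerivAt_integral 0 (hE.hasDerivAt t ht.1)
  have cJ : Continuous fun t => v * (z t (E t) * Φ t (E t))
      + ∫ x in 0..E t, pdt (fun t x => z t x * Φ t x) t x :=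
    (continuous_const.mul ((hprod.comp_curve contDiff_id hE.smooth).continuous)).add
      (hprod.pdt.continuous_integral hE.smooth 0)
  have hFTC := integral_eq_sub_of_hasDerivAt hJ (cJ.intervalIntegrable _ _)
  have z1 : ∀ x, Φ T x = 0 := fun x =>
    image_eq_zero_of_notMem_tsupport (f := φ) (x := (T, x)) fun h => lt_irrefl T (hTs (T, x) h)
  have z2 : ∀ x, Φ 0 x = 0 := fun x =>
    image_eq_zero_of_notMem_tsupport (f := φ) (x := (0, x)) fun h =>
      lt_irrefl (0 : ℝ) (mem_ofPred_eq ▸ hs h :)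
  simp only [z1, z2, mul_zero, int_zero, sub_zero] at hFTC
  have i1 : IntervalIntegrable (fun t => ∫ x in 0..E t, z t x * pdt Φ t x) volume 0 T :=
    (s1.continuous_integral hE.smooth 0).intervalIntegrable _ _
  have hsplit : ∀ t ∈ Icc 0 T, ∫ x in 0..E t, (dual0 σ v E z t x * Φ t x
        + dual1 σ v E z t x * pdx Φ t x)
      = (v * (z t (E t) * Φ t (E t)) + ∫ x in 0..E t, pdt (fun t x => z t x * Φ t x) t x)
        - ∫ x in 0..E t, z t x * pdt Φ t x := by
    intro t ht
    have hpt : ∀ x, pdt (fun t x => z t x * Φ t x) t x = pdt z t x * Φ t x + z t x * pdt Φ t x :=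
      fun x => ((hz.hasDerivAt_pdt t x).fun_mul (hΦ.hasDerivAt_pdt t x)).deriv
    have cz : Continuous (z t) := (hz.slice t).continuous
    have czx : Continuous (pdx z t) := (hz.pdx.slice t).continuous
    have czt : Continuous (pdt z t) := (hz.pdt.slice t).continuous
    have czxx : Continuous (pdx (pdx z) t) := (hz.pdx.pdx.slice t).continuous
    have cp : Continuous (Φ t) := (hΦ.slice t).continuous
    have cpx : Continuous (pdx Φ t) := (hΦ.pdx.slice t).continuous
    have cpt : Continuous (pdt Φ t) := (hΦ.pdt.slice t).continuous
    have ii : ∀ {f : ℝ → ℝ}, Continuous f → IntervalIntegrable f volume 0 (E t) :=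
      fun hf => hf.intervalIntegrable _ _
    have hR : ∫ x in 0..E t, pdt (fun t x => z t x * Φ t x) t x
        = (∫ x in 0..E t, pdt z t x * Φ t x) + ∫ x in 0..E t, z t x * pdt Φ t x := by
      simp only [hpt]
      exact int_add (ii (by fun_prop)) (ii (by fun_prop))
    rw [hR]
    have p1 := integral_mul_deriv_eq_deriv_mul (a := 0) (b := E t)
      (fun x _ => hΦ.hasDerivAt_pdx t x) (fun x _ => hz.pdx.hasDerivAt_pdx t x) (ii cpx) (ii czxx)
    rw [hz0 t ht.1] at p1
    have p2 := integral_mul_deriv_eq_deriv_mul (a := 0) (b := E t)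
      (fun x _ => hasDerivAt_id x) (fun x _ => hΦ.hasDerivAt_pdx t x)
      (ii continuous_const) (ii cpx)
    simp only [id, one_mul, zero_mul, sub_zero] at p2
    have e1 : ∀ x, dual0 σ v E z t x * Φ t x + dual1 σ v E z t x * pdx Φ t x
        = (flux σ v E z t / E t * Φ t x + flux σ v E z t / E t * (x * pdx Φ t x))
          + (pdt z t x * Φ t x - (σ * (Φ t x * pdx (pdx z) t x) + σ * (pdx Φ t x * pdx z t x))) := by
      intro x; simp only [dual0, dual1]; ring
    simp only [e1]
    rw [int_add (ii (by fun_prop)) (ii (by fun_prop)),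
      int_add (ii (by fun_prop)) (ii (by fun_prop)),
      int_sub (ii (by fun_prop)) (ii (by fun_prop)),
      int_add (ii (by fun_prop)) (ii (by fun_prop)),
      int_const_mul, int_const_mul,
      int_const_mul, int_const_mul, p1, p2, flux]
    have := (hE.pos t).ne'
    field_simp
    ring
  have e2 : ∫ t in 0..T, ∫ x in 0..E t, (dual0 σ v E z t x * Φ t x
        + dual1 σ v E z t x * pdx Φ t x) = _ :=
    int_congr fun t ht => hsplit t (by rwa [uIcc_of_le hT.le] at ht)
  rw [e2, int_sub (cJ.intervalIntegrable _ _) i1, hFTC, zero_sub]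

/-! ## Approximation of the initial datum -/

lemma exists_continuous_sq_approx (hl : 0 ≤ l) (hf : MemLp f 2 (mu l)) (hδ : 0 < δ) :
    ∃ g : ℝ → ℝ, Continuous g ∧ ∫ x in 0..l, (g x - f x) ^ 2 ≤ δ := by
  have : IsFiniteMeasure (mu l) := by unfold mu; infer_instance
  have he : ofReal (√δ) ≠ 0 := (ENNReal.ofReal_pos.2 (Real.sqrt_pos.2 hδ)).ne'
  obtain ⟨g, hg, hgm⟩ := hf.exists_boundedContinuous_eLpNorm_sub_le (by norm_num) he
  refine ⟨g, g.continuous, ?_⟩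
  rw [eLpNorm_two_eq (hf.sub hgm), ofReal_le_ofReal_iff (sqrt_nonneg _),
    Real.sqrt_le_sqrt_iff hδ.le, integral_mu hl] at hg
  refine le_trans (le_of_eq ?_) hg
  congr 1; ext x; simp only [Pi.sub_apply]; ring

/-- Regular functions with small residual and initial datum close to a given one. -/
lemma exists_regular_near (hσ : 0 < σ) (hE : IsFront v E)
    (hlam : v ^ 2 / σ + 1 ≤ lam) (hw0 : MemLp w0 2 (mu (E 0))) (hδ : 0 < δ) :
    ∃ w, IsRegular σ v E w ∧ (∫ x in 0..E 0, (w 0 x - w0 x) ^ 2) ≤ δ ∧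
      ∀ T ≥ 0, ∫ t in 0..T, exp (lam * t) * ∫ x in 0..E t, resid σ lam w t x ^ 2 ≤ δ := by
  have hl := (hE.pos 0).le
  obtain ⟨g, hg, hgd⟩ := exists_continuous_sq_approx hl hw0 (by positivity : 0 < δ / 4)
  set η := min δ (√(δ / (4 * E 0))) with hη
  have hη0 : 0 < η := lt_min hδ (Real.sqrt_pos.2 (by have := hE.pos 0; positivity))
  obtain ⟨w, hw, hwg, hwr⟩ := exists_regular_approx hσ hE hlam hg hη0
  have cw : Continuous (w 0) := (hw.smooth.slice 0).continuous
  refine ⟨w, hw, ?_, fun T hT => ?_⟩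
  · have h1 : ∫ x in 0..E 0, (w 0 x - g x) ^ 2 ≤ E 0 * (δ / (4 * E 0)) := by
      refine integral_sq_le_of_sq_le (g := fun x => w 0 x - g x) hl (by fun_prop) fun x hx => ?_
      have h2 := abs_le.1 (hwg x hx)
      have h3 : (w 0 x - g x) ^ 2 ≤ η ^ 2 := sq_le_sq' h2.1 h2.2
      have h4 : η ^ 2 ≤ √(δ / (4 * E 0)) ^ 2 := pow_le_pow_left₀ hη0.le (min_le_right _ _) 2
      rw [sq_sqrt (by have := hE.pos 0; positivity)] at h4
      exact h3.trans h4
    have h2 : E 0 * (δ / (4 * E 0)) = δ / 4 := by have := (hE.pos 0).ne'; field_simp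
    have mg : MemLp g 2 (mu (E 0)) := memLp_mu_of_cont hg.continuousOn
    have i0 := int_sq_mu hl ((memLp_mu_of_cont cw.continuousOn).sub hw0)
    have i1 := int_sq_mu hl (mg.sub hw0)
    have i2 : IntervalIntegrable (fun x => (w 0 x - g x) ^ 2) volume 0 (E 0) :=
      cont_ii
    have h3 := int_mono_on (μ := volume) hl i0 ((i2.const_mul 2).add (i1.const_mul 2)) fun x _ => by
        simp only [Pi.sub_apply]
        nlinarith [sq_nonneg ((w 0 x - g x) - (g x - w0 x))]
    rw [int_add (i2.const_mul 2) (i1.const_mul 2), int_const_mul, int_const_mul] at h3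
    simp only [Pi.sub_apply] at h3
    linarith
  · have sr : Smooth2 fun t x => resid σ lam w t x ^ 2 := by
      simpa only [pow_two] using (hw.smooth.resid σ lam).mul (hw.smooth.resid σ lam)
    have c1 := sr.continuous_integral hE.smooth 0
    have h3 := int_mono_on (μ := volume) hT
      (f := fun t => exp (lam * t) * ∫ x in 0..E t, resid σ lam w t x ^ 2)
      (g := fun t => η * exp (-t)) cont_ii
      cont_ii fun t ht => hwr t ht.1
    rw [int_const_mul] at h3
    have hexpint : ∫ t in 0..T, exp (-t) ≤ 1 := by
      rw [integral_comp_neg fun t => exp t, integral_exp]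
      simp [Real.exp_nonneg]
    have := mul_le_mul_of_nonneg_left hexpint hη0.le
    linarith [min_le_left δ (√(δ / (4 * E 0)))]

/-! ## Existence for the scalar problem -/

/-- Weak solutions of the scalar closed loop problem in the coordinates that diagonalize the
diffusion matrix. -/
structure IsScalarSolution (σ v α : ℝ) (E : ℝ → ℝ) (z0 : ℝ → ℝ) (z : ℝ → ℝ → ℝ) : Prop where
  meas : AEStronglyMeasurable (uncurry z) (volume.restrict (domain E))
  cont : MovContL2 E (Ici 0) z
  timeDeriv : TimeDerivInDualH1 E z
  weak : ∀ T : ℝ, 0 < T → ∀ ν νt νx νxx : ℝ → ℝ → ℝ,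
    IsScalarTest E (fun t => kern α (E t) (E t)) T ν νt νx νxx →
      (∫ t in 0..T, ∫ x in 0..E t, z t x * (νt t x + σ * νxx t x)) + (∫ x in 0..E 0, z0 x * ν 0 x)
        + (∫ t in 0..T, (∫ y in 0..E t, gain σ v α (E t) y * z t y) * ν t (E t)) = 0

section sub

variable {f g : ℝ → ℝ → ℝ}

lemma unstep_sub (hf : Smooth2 f) (hg : Smooth2 g) :
    unstep α (fun t x => f t x - g t x) = fun t x => unstep α f t x - unstep α g t x := by
  ext t x
  have := volt_linear (-α) (hf.slice t).continuous (hg.slice t).continuous 1 (-1) x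
  simp only [one_mul, neg_mul, ← sub_eq_add_neg] at this
  exact this

lemma flux_sub (hf : Smooth2 f) (hg : Smooth2 g) (t : ℝ) :
    flux σ v E (fun t x => f t x - g t x) t = flux σ v E f t - flux σ v E g t := by
  simp only [flux, Smooth2.pdx_sub hf hg]; ring

lemma dual0_sub (hf : Smooth2 f) (hg : Smooth2 g) (t x : ℝ) :
    dual0 σ v E (fun t x => f t x - g t x) t x = dual0 σ v E f t x - dual0 σ v E g t x := by
  simp only [dual0, flux_sub hf hg, Smooth2.pdt_sub hf hg, Smooth2.pdx_sub hf hg,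
    Smooth2.pdx_sub hf.pdx hg.pdx]; ring

lemma dual1_sub (hf : Smooth2 f) (hg : Smooth2 g) (t x : ℝ) :
    dual1 σ v E (fun t x => f t x - g t x) t x = dual1 σ v E f t x - dual1 σ v E g t x := by
  simp only [dual1, flux_sub hf hg, Smooth2.pdx_sub hf hg]; ring

end sub

lemma eLpNorm_mu_le (hl : 0 ≤ l) (hf : MemLp f 2 (mu l)) (hc : 0 ≤ c)
    (h : ∫ x in 0..l, f x ^ 2 ≤ c ^ 2) : eLpNorm f 2 (mu l) ≤ ofReal c := by
  rw [eLpNorm_two_eq hf, integral_mu hl]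
  exact ofReal_le_ofReal (Real.sqrt_le_iff.2 ⟨hc, h⟩)

lemma integral_sq_le_of_eLpNorm (hl : 0 ≤ l) (hf : MemLp f 2 (mu l))
    (hc : 0 ≤ c) (h : eLpNorm f 2 (mu l) ≤ ofReal c) :
    √(∫ x in 0..l, f x ^ 2) ≤ c := by
  rwa [eLpNorm_two_eq hf, integral_mu hl, ofReal_le_ofReal_iff hc] at h

/-- Energy data of the difference of two regular functions with the same approximate datum. -/
lemma sub_data_le (hE : IsFront v E) {f g : ℝ → ℝ → ℝ}
    (hw0 : MemLp w0 2 (mu (E 0))) (hf : IsRegular σ v E f) (hg : IsRegular σ v E g)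
    (hf0 : (∫ x in 0..E 0, (f 0 x - w0 x) ^ 2) ≤ δ)
    (hg0 : (∫ x in 0..E 0, (g 0 x - w0 x) ^ 2) ≤ δ)
    (hfR : ∀ T ≥ 0, ∫ t in 0..T, exp (lam * t) * ∫ x in 0..E t, resid σ lam f t x ^ 2 ≤ δ)
    (hgR : ∀ T ≥ 0, ∫ t in 0..T, exp (lam * t) * ∫ x in 0..E t, resid σ lam g t x ^ 2 ≤ δ) :
    (∫ x in 0..E 0, (f 0 x - g 0 x) ^ 2) ≤ 4 * δ ∧
    ∀ T ≥ 0, ∫ t in 0..T, exp (lam * t)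
        * ∫ x in 0..E t, resid σ lam (fun t x => f t x - g t x) t x ^ 2 ≤ 4 * δ := by
  have hl := (hE.pos 0).le
  have cf : Continuous (f 0) := (hf.smooth.slice 0).continuous
  have cg : Continuous (g 0) := (hg.smooth.slice 0).continuous
  constructor
  · have i0 : IntervalIntegrable (fun x => (f 0 x - g 0 x) ^ 2) volume 0 (E 0) :=
      cont_ii
    have i1 := int_sq_mu hl ((memLp_mu_of_cont cf.continuousOn).sub hw0)
    have i2 := int_sq_mu hl ((memLp_mu_of_cont cg.continuousOn).sub hw0)
    have h3 := int_mono_on (μ := volume) hl i0 ((i1.const_mul 2).add (i2.const_mul 2)) fun x _ => by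
        simp only [Pi.sub_apply]
        nlinarith [sq_nonneg ((f 0 x - w0 x) + (g 0 x - w0 x))]
    rw [int_add (i1.const_mul 2) (i2.const_mul 2), int_const_mul, int_const_mul] at h3
    simp only [Pi.sub_apply] at h3
    linarith
  · intro T hT
    have sq : ∀ {h : ℝ → ℝ → ℝ}, Smooth2 h →
        Continuous fun t => exp (lam * t) * ∫ x in 0..E t, resid σ lam h t x ^ 2 := by
      intro h hh
      have sr : Smooth2 fun t x => resid σ lam h t x ^ 2 := by
        simpa only [pow_two] using (hh.resid σ lam).mul (hh.resid σ lam)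
      have c1 := sr.continuous_integral hE.smooth 0
      fun_prop
    have i0 := (sq (hf.sub hg).smooth).intervalIntegrable (μ := volume) 0 T
    have i1 := (sq hf.smooth).intervalIntegrable (μ := volume) 0 T
    have i2 := (sq hg.smooth).intervalIntegrable (μ := volume) 0 T
    have h3 := int_mono_on hT i0 ((i1.const_mul 2).add (i2.const_mul 2)) fun t _ => by
        have c1 : Continuous (resid σ lam f t) := ((hf.smooth.resid σ lam).slice t).continuous
        have c2 : Continuous (resid σ lam g t) := ((hg.smooth.resid σ lam).slice t).continuous
        have j1 : IntervalIntegrable (fun x => resid σ lam f t x ^ 2) volume 0 (E t) :=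
          (c1.pow 2).intervalIntegrable _ _
        have j2 : IntervalIntegrable (fun x => resid σ lam g t x ^ 2) volume 0 (E t) :=
          (c2.pow 2).intervalIntegrable _ _
        have h4 := int_mono_on (μ := volume) (hE.pos t).le
          (f := fun x => (resid σ lam f t x - resid σ lam g t x) ^ 2)
          cont_ii
          ((j1.const_mul 2).add (j2.const_mul 2)) fun x _ => by
            nlinarith [sq_nonneg (resid σ lam f t x + resid σ lam g t x)]
        rw [int_add (j1.const_mul 2) (j2.const_mul 2), int_const_mul, int_const_mul] at h4
        simp only [resid_sub hf.smooth hg.smooth]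
        have := mul_le_mul_of_nonneg_left h4 (exp_pos (lam * t)).le
        linarith
    rw [int_add (i1.const_mul 2) (i2.const_mul 2), int_const_mul, int_const_mul] at h3
    linarith [hfR T hT, hgR T hT]

section limits

variable {F : ℕ → ℝ → ℝ → ℝ}

lemma tendsto_ofReal_geometric (c : ℝ) (a : ENNReal) (ha : a ≠ ⊤) :
    Tendsto (fun n : ℕ => ofReal (c * (1 / 2) ^ n) * a) atTop (𝓝 0) := by
  have h1 : Tendsto (fun n : ℕ => ofReal (c * (1 / 2) ^ n)) atTop (𝓝 0) := by
    have := (tendsto_pow_atTop_nhds_zero_of_lt_one (r := (1 / 2 : ℝ)) (by norm_num)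
      (by norm_num)).const_mul c
    have := ENNReal.tendsto_ofReal this
    simpa using this
  have h2 := ENNReal.Tendsto.mul_const h1 (Or.inr ha)
  simpa using h2

lemma tendsto_eLpNorm_domainT (hE : Continuous E) (hF : ∀ n, Continuous (uncurry (F n)))
    (hz : StronglyMeasurable (uncurry z))
    (h : ∀ n t, 0 ≤ t → eLpNorm (F n t - z t) 2 (mu (E t)) ≤ ofReal (c * (1 / 2) ^ n))
    (T : ℝ) :
    Tendsto (fun n => eLpNorm (uncurry (F n) - uncurry z) 2
      (volume.restrict (domainT E T))) atTop (𝓝 0) := by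
  refine tendsto_of_tendsto_of_tendsto_of_le_of_le tendsto_const_nhds
    (tendsto_ofReal_geometric c ((ofReal T) ^ (1 / 2 : ℝ))
      (ENNReal.rpow_ne_top_of_nonneg (by norm_num) ofReal_ne_top))
    (fun _ => zero_le) fun n => ?_
  exact eLpNorm_domainT_le (f := fun t => F n t - z t) hE.measurable
    ((hF n).aestronglyMeasurable.sub hz.aestronglyMeasurable) fun t ht => h n t ht.1.le

/-- The time derivative of a limit of smooth functions. -/
lemma timeDerivInDualH1_of_limit (hE : IsFront v E) (hF : ∀ n, Smooth2 (F n))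
    (hF0 : ∀ n t, 0 ≤ t → pdx (F n) t 0 = 0)
    (hz : StronglyMeasurable (uncurry z)) (hzc : MovContL2 E (Ici 0) z)
    (h : ∀ n t, 0 ≤ t → eLpNorm (F n t - z t) 2 (mu (E t)) ≤ ofReal (c * (1 / 2) ^ n))
    {f0 f1 : ℝ × ℝ → ℝ}
    (hd0 : ∀ n, MemLp (uncurry (dual0 σ v E (F n))) 2 (volume.restrict (domain E)))
    (hd1 : ∀ n, MemLp (uncurry (dual1 σ v E (F n))) 2 (volume.restrict (domain E)))
    (hf0 : MemLp f0 2 (volume.restrict (domain E))) (hf1 : MemLp f1 2 (volume.restrict (domain E)))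
    (ht0 : Tendsto (fun n => eLpNorm (uncurry (dual0 σ v E (F n)) - f0) 2
      (volume.restrict (domain E))) atTop (𝓝 0))
    (ht1 : Tendsto (fun n => eLpNorm (uncurry (dual1 σ v E (F n)) - f1) 2
      (volume.restrict (domain E))) atTop (𝓝 0)) : TimeDerivInDualH1 E z := by
  have hEc := hE.cont
  refine ⟨fun t x => f0 (t, x), fun t x => f1 (t, x), hf0, hf1, fun φ hφ hφc hφs => ?_⟩
  have cφ := hφ.continuous
  have cd : Continuous (fderiv ℝ φ) := hφ.continuous_fderiv (by simp)
  have c10 : Continuous fun p => fderiv ℝ φ p (1, 0) := cd.clm_apply continuous_const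
  have c01 : Continuous fun p => fderiv ℝ φ p (0, 1) := cd.clm_apply continuous_const
  have hfd : ∀ p ∉ tsupport φ, fderiv ℝ φ p = 0 := fun p hp =>
    Function.notMem_support.1 fun h => hp (support_fderiv_subset ℝ h)
  have s10 : HasCompactSupport fun p => fderiv ℝ φ p (1, 0) :=
    HasCompactSupport.intro hφc fun p hp => by rw [hfd p hp]; simp
  have s01 : HasCompactSupport fun p => fderiv ℝ φ p (0, 1) :=
    HasCompactSupport.intro hφc fun p hp => by rw [hfd p hp]; simp
  have mφ : MemLp φ 2 (volume.restrict (domain E)) := (cφ.memLp_of_hasCompactSupport hφc).restrict _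
  have m01 : MemLp (fun p => fderiv ℝ φ p (0, 1)) 2 (volume.restrict (domain E)) :=
    (c01.memLp_of_hasCompactSupport s01).restrict _
  obtain ⟨T, hT, hTs⟩ : ∃ T : ℝ, 0 < T ∧ ∀ p ∈ tsupport φ, p.1 < T := by
    obtain ⟨b, hb⟩ := (IsCompact.image hφc continuous_fst).bddAbove
    refine ⟨max b 0 + 1, by positivity, fun p hp => ?_⟩
    have := hb ⟨p, hp, rfl⟩
    linarith [le_max_left b 0]
  have m10 : MemLp (fun p => fderiv ℝ φ p (1, 0)) 2 (volume.restrict (domainT E T)) :=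
    (c10.memLp_of_hasCompactSupport s10).restrict _
  have cut : ∀ f : ℝ → ℝ → ℝ, ∫ p in domain E, f p.1 p.2 * fderiv ℝ φ p (1, 0)
      = ∫ p in domainT E T, f p.1 p.2 * fderiv ℝ φ p (1, 0) := by
    intro f
    refine setIntegral_eq_of_subset_of_forall_sdiff_eq_zero (measurableSet_domain hEc.measurable)
      (domainT_subset_domain E T) fun p hp => ?_
    rw [hfd p fun h => hp.2 ⟨hp.1, hTs p h⟩]; simp
  have hzm : MovL2 E T z := (hzc.mono Icc_subset_Ici_self).movL2 hEc hE.pos hz.aestronglyMeasurable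
  have l1 := tendsto_int_mul
    (fun n => movL2_of_cont (T := T) hEc (hF n).continuous) hzm m10
    (tendsto_eLpNorm_domainT hEc (fun n => (hF n).continuous) hz h T)
  have l2 := (tendsto_int_mul hd0 hf0 mφ ht0).add
    (tendsto_int_mul hd1 hf1 m01 ht1)
  have i0 : Integrable (fun p : ℝ × ℝ => f0 (p.1, p.2) * φ p) (volume.restrict (domain E)) :=
    hf0.integrable_mul mφ
  have i1 : Integrable (fun p : ℝ × ℝ => f1 (p.1, p.2) * fderiv ℝ φ p (0, 1))
    (volume.restrict (domain E)) := hf1.integrable_mul m01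
  rw [cut, integral_add i0 i1]
  refine tendsto_nhds_unique l1.neg (l2.congr fun n => ?_)
  have j0 : Integrable (fun p : ℝ × ℝ => dual0 σ v E (F n) p.1 p.2 * φ p)
    (volume.restrict (domain E)) := (hd0 n).integrable_mul mφ
  have j1 : Integrable (fun p : ℝ × ℝ => dual1 σ v E (F n) p.1 p.2 * fderiv ℝ φ p (0, 1))
    (volume.restrict (domain E)) := (hd1 n).integrable_mul m01
  have := dual_identity (σ := σ) hE (hF n) (hF0 n) hφ hφc hφs
  rw [cut, integral_add j0 j1] at this
  exact this.symm

/-- The weak formulation for a limit of smooth approximate solutions. -/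
lemma weak_of_limit (hE : IsFront v E) (hT : 0 < T) (hF : ∀ n, Smooth2 (F n))
    (hF0 : ∀ n t, 0 ≤ t → pdx (F n) t 0 = 0)
    (hFE : ∀ n t, 0 ≤ t → σ * pdx (F n) t (E t) + v * F n t (E t)
      = (∫ y in 0..E t, gain σ v α (E t) y * F n t y) + σ * kern α (E t) (E t) * F n t (E t))
    (hz : StronglyMeasurable (uncurry z)) (hzc : MovContL2 E (Ici 0) z)
    (h : ∀ n t, 0 ≤ t → eLpNorm (F n t - z t) 2 (mu (E t)) ≤ ofReal (c * (1 / 2) ^ n))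
 (hz0 : MemLp z0 2 (mu (E 0)))
    (h0 : Tendsto (fun n => eLpNorm (F n 0 - z0) 2 (mu (E 0))) atTop (𝓝 0))
    (hres : Tendsto (fun n => eLpNorm (uncurry fun t x =>
        pdt (F n) t x - σ * pdx (pdx (F n)) t x) 2 (volume.restrict (domainT E T))) atTop (𝓝 0))

    (hν : IsScalarTest E (fun t => kern α (E t) (E t)) T ν νt νx νxx) :
    (∫ t in 0..T, ∫ x in 0..E t, z t x * (νt t x + σ * νxx t x)) + (∫ x in 0..E 0, z0 x * ν 0 x)
        + (∫ t in 0..T, (∫ y in 0..E t, gain σ v α (E t) y * z t y) * ν t (E t))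
      = 0 := by
  have hEc := hE.cont
  have hEm := hEc.measurable
  obtain ⟨m0, m1, m2⟩ := hν.memL2
  have mt := hν.timeDeriv.1
  have hzm : MovL2 E T z := (hzc.mono Icc_subset_Ici_self).movL2 hEc hE.pos hz.aestronglyMeasurable
  have hFm : ∀ n, MovL2 E T (F n) := fun n => movL2_of_cont hEc (hF n).continuous
  have mg : MovL2 E T fun t x => νt t x + σ * νxx t x := MemLp.add mt (m2.const_mul σ)
  have hg := smooth2_gain σ v α
  have hgE : Smooth2 fun t y => gain σ v α (E t) y := by
    have : ContDiff ℝ ∞ fun p : ℝ × ℝ => uncurry (gain σ v α) (E p.1, p.2) :=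
      ContDiff.comp (g := uncurry (gain σ v α)) hg
        ((hE.smooth.comp contDiff_fst).prodMk contDiff_snd)
    exact this
  have l1 := tendsto_int_mul hFm hzm mg
    (tendsto_eLpNorm_domainT hEc (fun n => (hF n).continuous) hz h T)
  have e1 : ∀ {f : ℝ → ℝ → ℝ}, MovL2 E T f → ∫ p in domainT E T, uncurry f p * uncurry
        (fun t x => νt t x + σ * νxx t x) p
      = ∫ t in 0..T, ∫ x in 0..E t, f t x * (νt t x + σ * νxx t x) := fun hf =>
    integral_domainT hEm hE.pos hT.le (hf.integrable_mul mg)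
  rw [e1 hzm] at l1
  have hν0 : MemLp (ν 0) 2 (mu (E 0)) := hν.cont.memLp hE.pos ⟨le_rfl, hT.le⟩
  have hF0m : ∀ n, MemLp (F n 0) 2 (mu (E 0)) := fun n =>
    memLp_mu_of_cont ((hF n).slice 0).continuous.continuousOn
  have l2 := tendsto_int_mul hF0m hz0 hν0 h0
  simp only [integral_mu (hE.pos 0).le] at l2
  -- the boundary term
  have htr := hν.integrable_trace hE
  set b : ℕ → ℝ → ℝ := fun n t => ∫ y in 0..E t, gain σ v α (E t) y * F n t y with hb
  set b' : ℝ → ℝ := fun t => ∫ y in 0..E t, gain σ v α (E t) y * z t y with hb'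
  have cb : ∀ n, Continuous (b n) := fun n => (hgE.mul (hF n)).continuous_integral hE.smooth 0
  have cb' : ContinuousOn b' (Icc 0 T) :=
    (MovContL2.of_cont hEc (Icc 0 T) hgE.continuous).continuousOn_integral_mul hEc
      (hzc.mono Icc_subset_Ici_self)
  obtain ⟨K, hK⟩ := (MovContL2.of_cont hEc (Icc 0 T) hgE.continuous).exists_bound hEc
  have hdiff : ∀ n, ∀ t ∈ Icc 0 T, |b n t - b' t| ≤ √K * |c * (1 / 2) ^ n| := by
    intro n t ht
    have hl := (hE.pos t).le
    have mgt : MemLp (gain σ v α (E t)) 2 (mu (E t)) :=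
      memLp_mu_of_cont (hg.slice _).continuous.continuousOn
    have mF : MemLp (F n t) 2 (mu (E t)) :=
      memLp_mu_of_cont ((hF n).slice t).continuous.continuousOn
    have mz : MemLp (z t) 2 (mu (E t)) := hzc.memLp hE.pos ht.1
    have := abs_integral_mul_le_eLpNorm hl mgt (mF.sub mz)
    have e : b n t - b' t = ∫ y in 0..E t, gain σ v α (E t) y * (F n t - z t) y := by
      rw [hb, hb']
      simp only [Pi.sub_apply, mul_sub]
      refine (int_sub ?_ ?_).symm
      · exact (MemLp.ii_mu hl mF).continuousOn_mul (hg.slice _).continuous.continuousOn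
      · exact (MemLp.ii_mu hl mz).continuousOn_mul (hg.slice _).continuous.continuousOn
    rw [e]
    refine this.trans (mul_le_mul ?_ ?_ ENNReal.toReal_nonneg (sqrt_nonneg _))
    · rw [eLpNorm_two_eq mgt, toReal_ofReal (sqrt_nonneg _), integral_mu hl]
      exact sqrt_le_sqrt (hK.2 t ht)
    · refine ENNReal.toReal_le_of_le_ofReal (abs_nonneg _) ((h n t ht.1).trans ?_)
      exact ofReal_le_ofReal (le_abs_self _)
  have ib : ∀ {f : ℝ → ℝ}, ContinuousOn f (Icc 0 T) → Integrable (fun t => f t * ν t (E t)) (mu T) := by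
    intro f hf
    obtain ⟨C, hC⟩ := isCompact_Icc.bddAbove_image hf.norm
    refine htr.bdd_mul (c := C) ((hf.mono Ioo_subset_Icc_self).aestronglyMeasurable
      measurableSet_Ioo) ?_
    exact ae_restrict_of_forall_mem measurableSet_Ioo (fun t ht =>
      hC ⟨t, Ioo_subset_Icc_self ht, rfl⟩)
  have l3 : Tendsto (fun n => ∫ t in 0..T, b n t * ν t (E t)) atTop
      (𝓝 (∫ t in 0..T, b' t * ν t (E t))) := by
    rw [tendsto_iff_norm_sub_tendsto_zero]
    have hlim : Tendsto (fun n : ℕ => √K * |c * (1 / 2) ^ n|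
        * ∫ t, |ν t (E t)| ∂(mu T)) atTop (𝓝 0) := by
      have h1 := ((tendsto_pow_atTop_nhds_zero_of_lt_one (r := (1 / 2 : ℝ)) (by norm_num)
        (by norm_num)).const_mul c).abs
      have h2 := (h1.const_mul (√K)).mul_const (∫ t, |ν t (E t)| ∂(mu T))
      simpa using h2
    refine squeeze_zero (fun _ => norm_nonneg _) (fun n => ?_) hlim
    rw [← integral_mu hT.le, ← integral_mu hT.le,
      ← integral_sub (ib (cb n).continuousOn) (ib cb'), ← integral_const_mul]
    refine (norm_integral_le_integral_norm _).trans (integral_mono_ae ?_ ?_ ?_)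
    · exact ((ib (cb n).continuousOn).sub (ib cb')).norm
    · exact htr.abs.const_mul _
    · filter_upwards [(ae_restrict_mem measurableSet_Ioo : ∀ᵐ t ∂(mu T), t ∈ Ioo 0 T)] with t ht
      rw [← sub_mul, norm_mul, norm_eq_abs, norm_eq_abs]
      exact mul_le_mul_of_nonneg_right (hdiff n t (Ioo_subset_Icc_self ht)) (abs_nonneg _)
  -- the residual
  have hR : ∀ n, Smooth2 fun t x => pdt (F n) t x - σ * pdx (pdx (F n)) t x := fun n =>
    (hF n).pdt.sub ((Smooth2.const σ).mul (hF n).pdx.pdx)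
  have hRm : ∀ n, MovL2 E T fun t x => pdt (F n) t x - σ * pdx (pdx (F n)) t x := fun n =>
    movL2_of_cont hEc (hR n).continuous
  have l4 := tendsto_int_mul hRm (MemLp.zero (ε := ℝ)) m0
    (by simpa only [sub_zero] using hres)
  have e4 : ∀ n, ∫ p in domainT E T, uncurry (fun t x =>
      pdt (F n) t x - σ * pdx (pdx (F n)) t x) p * uncurry ν p
      = ∫ t in 0..T, ∫ x in 0..E t, (pdt (F n) t x - σ * pdx (pdx (F n)) t x) * ν t x := fun n =>
    integral_domainT hEm hE.pos hT.le ((hRm n).integrable_mul m0)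
  simp only [Pi.zero_apply, zero_mul, integral_zero] at l4
  have l5 := (l1.add l2).add l3
  refine tendsto_nhds_unique l5 ?_
  have l6 := l4.neg
  rw [neg_zero] at l6
  refine l6.congr fun n => ?_
  rw [e4, e1 (hFm n)]
  exact (hν.integral_smooth hE (hF n) hT (hF0 n) (cb n) (hFE n)).symm

end limits

lemma exists_abs_kern_le (β l : ℝ) : ∃ B, ∀ x y, 0 ≤ y → y ≤ x → x ≤ l → |kern β x y| ≤ B := by
  obtain ⟨M, hM, h⟩ := exists_kern_bound β
  refine ⟨M * exp ((√|β| + 1) * l), fun x y hy hyx hx => (h x y hy hyx).1.trans ?_⟩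
  gcongr

lemma volt_sub (β : ℝ) (hf : IntervalIntegrable f volume 0 l)
    (hg : IntervalIntegrable g volume 0 l) (hx : x ∈ Icc 0 l) :
    volt β (f - g) x = volt β f x - volt β g x := by
  have ii : ∀ {f : ℝ → ℝ}, IntervalIntegrable f volume 0 l →
      IntervalIntegrable (fun y => kern β x y * f y) volume 0 x := fun hf =>
    (hf.mono_set (by rw [uIcc_of_le hx.1, uIcc_of_le (hx.1.trans hx.2)]
                     exact Icc_subset_Icc_right hx.2)).continuousOn_mul
      ((smooth2_kern β).slice x).continuous.continuousOn
  simp only [volt, Pi.sub_apply, mul_sub]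
  rw [int_sub (ii hf) (ii hg)]
  ring

/-- The residual of the unstepped functions tends to zero on bounded time intervals. -/
lemma eLpNorm_resid_unstep_le (hα : lam = σ * α) (hlam0 : 0 < lam)
    (hE : IsFront v E) (hT : 0 < T) : ∃ K, 0 ≤ K ∧ ∀ (w : ℝ → ℝ → ℝ) (δ : ℝ),
      IsRegular σ v E w → (∫ t in 0..T, exp (lam * t) * ∫ x in 0..E t, resid σ lam w t x ^ 2 ≤ δ) →
      eLpNorm (uncurry fun t x => pdt (unstep α w) t x
        - σ * pdx (pdx (unstep α w)) t x) 2 (volume.restrict (domainT E T))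
        ≤ ofReal (√(K * δ)) := by
  have hEc := hE.cont
  obtain ⟨B, hB⟩ := exists_abs_kern_le (-α) (E T)
  refine ⟨2 * (1 + B ^ 2 * E T ^ 2), by positivity, fun w δ hw hδ => ?_⟩
  have sz : Smooth2 (unstep α w) := smooth_unstep hw.smooth
  have sR : Smooth2 fun t x => pdt (unstep α w) t x - σ * pdx (pdx (unstep α w)) t x :=
    sz.pdt.sub ((Smooth2.const σ).mul sz.pdx.pdx)
  have sR2 : Smooth2 fun t x => (pdt (unstep α w) t x - σ * pdx (pdx (unstep α w)) t x) ^ 2 := by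
    simpa only [pow_two] using sR.mul sR
  have sr : Smooth2 fun t x => resid σ lam w t x ^ 2 := by
    simpa only [pow_two] using (hw.smooth.resid σ lam).mul (hw.smooth.resid σ lam)
  have mR : MemLp (uncurry fun t x => pdt (unstep α w) t x
        - σ * pdx (pdx (unstep α w)) t x) 2 (volume.restrict (domainT E T)) :=
    movL2_of_cont hEc sR.continuous
  rw [eLpNorm_two_eq mR]
  refine ofReal_le_ofReal (sqrt_le_sqrt ?_)
  have := integral_domainT hEc.measurable hE.pos hT.le mR.integrable_sq
  refine this.trans_le ?_
  have c1 := sR2.continuous_integral hE.smooth 0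
  have c2 := sr.continuous_integral hE.smooth 0
  have i2 : IntervalIntegrable (fun t => exp (lam * t)
        * ∫ x in 0..E t, resid σ lam w t x ^ 2) volume 0 T :=
    cont_ii
  refine (int_mono_on hT.le (c1.intervalIntegrable _ _)
    (i2.const_mul (2 * (1 + B ^ 2 * E T ^ 2))) fun t ht => ?_).trans ?_
  · have hl := (hE.pos t).le
    have hlT : E t ≤ E T := hE.mono ht.1 ht.2
    have cr : Continuous (resid σ lam w t) := ((hw.smooth.resid σ lam).slice t).continuous
    have h1 := integral_volt_sq_le (-α) hl (fun x y a b d => hB x y a b (d.trans hlT))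
      (memLp_mu_of_cont (l := E t) cr.continuousOn)
    simp only [heat_unstep hα hw ht.1]
    have n1 : 0 ≤ ∫ x in 0..E t, resid σ lam w t x ^ 2 := int_nonneg hl fun y _ => sq_nonneg _
    have hexp : 1 ≤ exp (lam * t) := one_le_exp (mul_nonneg hlam0.le ht.1)
    calc _ ≤ _ := h1
      _ ≤ 2 * (1 + B ^ 2 * E T ^ 2) * (1 * ∫ x in 0..E t, resid σ lam w t x ^ 2) := by
        rw [one_mul]; gcongr
      _ ≤ _ := by gcongr
  · rw [int_const_mul]
    exact mul_le_mul_of_nonneg_left hδ (by positivity)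

set_option maxHeartbeats 1000000 in
/-- Existence and decay for the scalar closed loop problem. -/
lemma exists_isScalarSolution (hσ : 0 < σ) (hv : 0 < v) (hα : lam = σ * α)
    (hlam0 : 0 < lam) (hE : IsFront v E)
    (hlam : 2 * (√(lam / σ) + 4) * v + 2 * m + 1 ≤ lam) (hlam' : v ^ 2 / σ + 1 ≤ lam)
    (hm : 0 ≤ m) :
    ∃ C, 0 < C ∧ ∀ z0 : ℝ → ℝ, MemLp z0 2 (mu (E 0)) → ∃ z, IsScalarSolution σ v α E z0 z ∧
      ∀ t ≥ 0, exp (2 * m * t) * ∫ x in 0..E t, z t x ^ 2 ≤ C * ∫ x in 0..E 0, z0 x ^ 2 := by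
  obtain ⟨C0, hC0, hbd⟩ := exists_unstep_bound hσ hv hα hlam0 hE hlam hm
  have hEc := hE.cont
  have hl0 := (hE.pos 0).le
  obtain ⟨B, hB⟩ := exists_abs_kern_le α (E 0)
  obtain ⟨B', hB'⟩ := exists_abs_kern_le (-α) (E 0)
  refine ⟨2 * C0 * (2 * (1 + B ^ 2 * E 0 ^ 2)), by positivity, fun z0 hz0 => ?_⟩
  set w0 := volt α z0 with hw0def
  have hw0 : MemLp w0 2 (mu (E 0)) := memLp_volt α hl0 hz0
  have hw0z := integral_volt_sq_le α hl0 hB hz0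
  have hδ : ∀ n : ℕ, (0 : ℝ) < (1 / 4) ^ n := fun n => by positivity
  choose w hw hwd hwR using fun n : ℕ => exists_regular_near hσ hE hlam' hw0 (hδ n)
  set F : ℕ → ℝ → ℝ → ℝ := fun n => unstep α (w n) with hFdef
  have sF : ∀ n, Smooth2 (F n) := fun n => smooth_unstep (hw n).smooth
  set c := √(8 * C0) with hc
  have hc0 : 0 < c := Real.sqrt_pos.2 (by positivity)
  have hcn : ∀ n : ℕ, C0 * (4 * (1 / 4) ^ n + 4 * (1 / 4) ^ n) = (c * (1 / 2) ^ n) ^ 2 := by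
    intro n
    rw [mul_pow, hc, sq_sqrt (by positivity), ← pow_mul, mul_comm n 2, pow_mul]
    norm_num
    ring
  -- differences
  have hdiff : ∀ n k, n ≤ k → (∀ t ≥ 0, ∫ x in 0..E t, (F n t x - F k t x) ^ 2
        ≤ (c * (1 / 2) ^ n) ^ 2) ∧
      ∀ T ≥ 0, ∫ t in 0..T, ∫ x in 0..E t, ((dual0 σ v E (F n) t x - dual0 σ v E (F k) t x) ^ 2
          + (dual1 σ v E (F n) t x - dual1 σ v E (F k) t x) ^ 2) ≤ (c * (1 / 2) ^ n) ^ 2 := by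
    intro n k hnk
    have hle : ((1 : ℝ) / 4) ^ k ≤ (1 / 4) ^ n :=
      pow_le_pow_of_le_one (by norm_num) (by norm_num) hnk
    have hs := sub_data_le (δ := (1 / 4) ^ n) hE hw0 (hw n) (hw k) (hwd n) ((hwd k).trans hle) (hwR n)
      fun T hT => (hwR k T hT).trans hle
    obtain ⟨b1, b2⟩ := hbd _ _ ((hw n).sub (hw k)) hs.2
    have hD := mul_le_mul_of_nonneg_left (add_le_add_left hs.1 (4 * (1 / 4) ^ n)) hC0.le
    rw [hcn] at hD
    rw [unstep_sub (hw n).smooth (hw k).smooth] at b1 b2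
    refine ⟨fun t ht => ?_, fun T hT => ?_⟩
    · have h1 := (b1 t ht).trans hD
      have hexp : 1 ≤ exp (2 * m * t) := one_le_exp (by positivity)
      have n1 : 0 ≤ ∫ x in 0..E t, (F n t x - F k t x) ^ 2 :=
        int_nonneg (hE.pos t).le fun y _ => sq_nonneg _
      exact (le_mul_of_one_le_left n1 hexp).trans h1
    · have h1 := (b2 T hT).trans hD
      simp only [dual0_sub (f := unstep α (w n)) (g := unstep α (w k)) (sF n) (sF k),
        dual1_sub (f := unstep α (w n)) (g := unstep α (w k)) (sF n) (sF k)] at h1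
      exact h1
  have hmem : ∀ n t, MemLp (F n t) 2 (mu (E t)) := fun n t =>
    memLp_mu_of_cont ((sF n).slice t).continuous.continuousOn
  have hcau : ∀ n k t, 0 ≤ t → n ≤ k →
      eLpNorm (F n t - F k t) 2 (mu (E t)) ≤ ofReal (c * (1 / 2) ^ n) :=
    fun n k t ht hnk => eLpNorm_mu_le (hE.pos t).le ((hmem n t).sub (hmem k t)) (by positivity)
      ((hdiff n k hnk).1 t ht)
  obtain ⟨z, hzm, hz⟩ := exists_slice_limit hc0 (fun n => (sF n).continuous) hcau
  have hzc : MovContL2 E (Ici 0) z := MovContL2.of_uniform_limit hEc hE.pos (hE.pos 0)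
    (fun t ht => hE.zero_le ht) (fun n => (sF n).continuous) hzm fun n t ht => hz n t ht
  -- the duals
  have cd0 : ∀ n, Continuous (uncurry (dual0 σ v E (F n))) := fun n =>
    continuous_dual0 σ hE (sF n)
  have cd1 : ∀ n, Continuous (uncurry (dual1 σ v E (F n))) := fun n =>
    continuous_dual1 σ hE (sF n)
  have hle01 : ∀ {f g : ℝ → ℝ → ℝ} {K : ℝ}, Continuous (uncurry f) → Continuous (uncurry g) →
      (∀ T ≥ 0, ∫ t in 0..T, ∫ x in 0..E t, (f t x ^ 2 + g t x ^ 2) ≤ K) →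
      (∀ T ≥ 0, ∫ t in 0..T, ∫ x in 0..E t, f t x ^ 2 ≤ K) ∧
      ∀ T ≥ 0, ∫ t in 0..T, ∫ x in 0..E t, g t x ^ 2 ≤ K := by
    intro f g K hf hg h
    have cont : ∀ {f : ℝ → ℝ → ℝ}, Continuous (uncurry f) →
        Continuous fun t => ∫ x in 0..E t, f t x := fun hf =>
      continuous_parametric_intervalIntegral_of_continuous hf hEc
    have hf2 : Continuous (uncurry fun t x => f t x ^ 2) := hf.pow 2
    have hg2 : Continuous (uncurry fun t x => g t x ^ 2) := hg.pow 2
    have hfg : Continuous (uncurry fun t x => f t x ^ 2 + g t x ^ 2) := hf2.add hg2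
    have sl : ∀ {f : ℝ → ℝ → ℝ} (t : ℝ), Continuous (uncurry f) →
        IntervalIntegrable (f t) volume 0 (E t) := fun t hf =>
      (hf.comp (by fun_prop : Continuous fun x => (t, x))).intervalIntegrable _ _
    constructor
    · refine fun T hT => (int_mono_on hT ((cont hf2).intervalIntegrable _ _)
        ((cont hfg).intervalIntegrable _ _) fun t _ => ?_).trans (h T hT)
      exact int_mono_on (hE.pos t).le (sl t hf2) (sl t hfg)
        fun x _ => by linarith [sq_nonneg (g t x)]
    · refine fun T hT => (int_mono_on hT ((cont hg2).intervalIntegrable _ _)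
        ((cont hfg).intervalIntegrable _ _) fun t _ => ?_).trans (h T hT)
      exact int_mono_on (hE.pos t).le (sl t hg2) (sl t hfg)
        fun x _ => by linarith [sq_nonneg (f t x)]
  have hd : ∀ n, MemLp (uncurry (dual0 σ v E (F n))) 2 (volume.restrict (domain E)) ∧
      MemLp (uncurry (dual1 σ v E (F n))) 2 (volume.restrict (domain E)) := by
    intro n
    obtain ⟨q1, q2⟩ := hle01 (cd0 n) (cd1 n) (hbd _ _ (hw n) (hwR n)).2
    exact ⟨⟨(cd0 n).aestronglyMeasurable,
        (eLpNorm_domain_le hEc hE.pos (cd0 n) q1).trans_lt ENNReal.ofReal_lt_top⟩,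
      ⟨(cd1 n).aestronglyMeasurable,
        (eLpNorm_domain_le hEc hE.pos (cd1 n) q2).trans_lt ENNReal.ofReal_lt_top⟩⟩
  have hdc : ∀ n k, n ≤ k → eLpNorm (uncurry (dual0 σ v E (F n)) - uncurry (dual0 σ v E (F k))) 2
        (volume.restrict (domain E)) ≤ ofReal (c * (1 / 2) ^ n) ∧
      eLpNorm (uncurry (dual1 σ v E (F n)) - uncurry (dual1 σ v E (F k))) 2
        (volume.restrict (domain E)) ≤ ofReal (c * (1 / 2) ^ n) := by
    intro n k hnk
    have s0 : Continuous (uncurry fun t x =>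
        dual0 σ v E (F n) t x - dual0 σ v E (F k) t x) := (cd0 n).sub (cd0 k)
    have s1 : Continuous (uncurry fun t x =>
        dual1 σ v E (F n) t x - dual1 σ v E (F k) t x) := (cd1 n).sub (cd1 k)
    obtain ⟨q1, q2⟩ := hle01 s0 s1 (hdiff n k hnk).2
    have r1 := eLpNorm_domain_le hEc hE.pos s0 q1
    have r2 := eLpNorm_domain_le hEc hE.pos s1 q2
    rw [Real.sqrt_sq (by positivity)] at r1 r2
    exact ⟨r1, r2⟩
  obtain ⟨f0, hf0, ht0⟩ := exists_memLp_limit hc0 (fun n => (hd n).1) fun n k h => (hdc n k h).1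
  obtain ⟨f1, hf1, ht1⟩ := exists_memLp_limit hc0 (fun n => (hd n).2) fun n k h => (hdc n k h).2
  have hFz : ∀ n t, 0 ≤ t → pdx (F n) t 0 = 0 := fun n t ht => unstep_bdryZero (hw n) ht
  -- the initial datum
  have hinit : Tendsto (fun n => eLpNorm (F n 0 - z0) 2 (mu (E 0))) atTop (𝓝 0) := by
    set K := √(2 * (1 + B' ^ 2 * E 0 ^ 2)) with hK
    have hlim := tendsto_ofReal_geometric K 1 ENNReal.one_ne_top
    refine tendsto_of_tendsto_of_tendsto_of_le_of_le tendsto_const_nhds hlim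
      (fun _ => zero_le) fun n => ?_
    rw [mul_one]
    refine eLpNorm_mu_le hl0 ((hmem n 0).sub hz0) (by positivity) ?_
    have mw : MemLp (w n 0) 2 (mu (E 0)) :=
      memLp_mu_of_cont ((hw n).smooth.slice 0).continuous.continuousOn
    have h1 := integral_volt_sq_le (-α) hl0 hB' (mw.sub hw0)
    have h2 : ∀ x ∈ Icc 0 (E 0), volt (-α) (w n 0 - w0) x = (F n 0 - z0) x := by
      intro x hx
      rw [volt_sub (-α) (MemLp.ii_mu hl0 mw) (MemLp.ii_mu hl0 hw0) hx,
        hw0def, volt_neg_volt α hx.1 ((MemLp.ii_mu hl0 hz0).mono_set (by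
          rw [uIcc_of_le hx.1, uIcc_of_le hl0]; exact Icc_subset_Icc_right hx.2))]
      rfl
    have h3 : ∫ x in 0..E 0, (F n 0 - z0) x ^ 2 = ∫ x in 0..E 0, volt (-α) (w n 0 - w0) x ^ 2 :=
      int_congr fun x hx => by
        rw [uIcc_of_le hl0] at hx
        show _ = volt (-α) (w n 0 - w0) x ^ 2
        rw [h2 x hx]
    rw [h3]
    refine h1.trans ?_
    rw [mul_pow, hK, sq_sqrt (by positivity), ← pow_mul, mul_comm n 2, pow_mul]
    have := hwd n
    simp only [Pi.sub_apply]
    norm_num at this ⊢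
    exact mul_le_mul_of_nonneg_left this (by positivity)
  refine ⟨z, ⟨hzm.aestronglyMeasurable, hzc, timeDerivInDualH1_of_limit hE sF hFz hzm hzc hz
    (fun n => (hd n).1) (fun n => (hd n).2) hf0 hf1 ht0 ht1, fun T hT ν νt νx νxx hν => ?_⟩,
    fun t ht => ?_⟩
  · refine weak_of_limit hE hT sF hFz (fun n t ht => unstep_bdryFront hE (hw n) ht) hzm hzc hz hz0
      hinit ?_ hν
    obtain ⟨K, hK, hres⟩ := eLpNorm_resid_unstep_le (v := v) hα hlam0 hE hT
    have hlim := tendsto_ofReal_geometric (√K) 1 ENNReal.one_ne_top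
    refine tendsto_of_tendsto_of_tendsto_of_le_of_le tendsto_const_nhds hlim
      (fun _ => zero_le) fun n => ?_
    refine (hres (w n) _ (hw n) (hwR n T hT.le)).trans ?_
    rw [mul_one, Real.sqrt_mul hK]
    refine ofReal_le_ofReal (mul_le_mul_of_nonneg_left (le_of_eq ?_) (sqrt_nonneg _))
    rw [show ((1 : ℝ) / 4) ^ n = ((1 / 2) ^ n) ^ 2 by
      rw [← pow_mul, mul_comm n 2, pow_mul]; norm_num]
    exact Real.sqrt_sq (by positivity)
  · have hl := (hE.pos t).le
    have mz : MemLp (z t) 2 (mu (E t)) := hzc.memLp hE.pos ht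
    set W := ∫ x in 0..E 0, w0 x ^ 2 with hW
    set X := exp (2 * m * t) with hX
    have hX0 : 0 < X := exp_pos _
    have hn : ∀ n, √(∫ x in 0..E t, z t x ^ 2)
        ≤ √(X⁻¹ * (C0 * (2 * W + 3 * (1 / 4) ^ n))) + c * (1 / 2) ^ n := by
      intro n
      have h1 := (hbd _ _ (hw n) (hwR n)).1 t ht
      have mw : MemLp (w n 0) 2 (mu (E 0)) :=
        memLp_mu_of_cont ((hw n).smooth.slice 0).continuous.continuousOn
      have h2 : ∫ x in 0..E 0, w n 0 x ^ 2 ≤ 2 * W + 2 * (1 / 4) ^ n := by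
        have i0 := int_sq_mu hl0 mw
        have i1 := int_sq_mu hl0 hw0
        have i2 := int_sq_mu hl0 (mw.sub hw0)
        have h3 := int_mono_on (μ := volume) hl0 i0
          ((i1.const_mul 2).add (i2.const_mul 2)) fun x _ => by
            simp only [Pi.sub_apply]
            nlinarith [sq_nonneg (w0 x - (w n 0 x - w0 x))]
        rw [int_add (i1.const_mul 2) (i2.const_mul 2), int_const_mul, int_const_mul] at h3
        simp only [Pi.sub_apply] at h3
        linarith [hwd n]
      have h3 : ∫ x in 0..E t, F n t x ^ 2 ≤ X⁻¹ * (C0 * (2 * W + 3 * (1 / 4) ^ n)) := by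
        rw [← div_eq_inv_mul, le_div_iff₀ hX0, mul_comm]
        refine h1.trans (mul_le_mul_of_nonneg_left ?_ hC0.le)
        linarith
      have h4 := sqrt_integral_add_sq_le (hmem n t) (mz.sub (hmem n t))
      have h5 : √(∫ x, (z t - F n t) x ^ 2 ∂(mu (E t))) ≤ c * (1 / 2) ^ n := by
        have := integral_sq_le_of_eLpNorm hl ((hmem n t).sub mz) (by positivity) (hz n t ht)
        rw [integral_mu hl]
        refine le_trans (le_of_eq ?_) this
        congr 2; ext x; simp only [Pi.sub_apply]; ring
      rw [integral_mu hl (fun x => F n t x ^ 2), integral_mu hl (fun x => _)] at h4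
      simp only [Pi.sub_apply, add_sub_cancel] at h4
      exact h4.trans (add_le_add (sqrt_le_sqrt h3) h5)
    have hlim : Tendsto (fun n : ℕ => √(X⁻¹ * (C0 * (2 * W + 3 * (1 / 4) ^ n)))
        + c * (1 / 2) ^ n) atTop (𝓝 (√(X⁻¹ * (C0 * (2 * W))))) := by
      have a1 := tendsto_pow_atTop_nhds_zero_of_lt_one (r := (1 / 4 : ℝ)) (by norm_num)
        (by norm_num)
      have a2 := tendsto_pow_atTop_nhds_zero_of_lt_one (r := (1 / 2 : ℝ)) (by norm_num)
        (by norm_num)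
      have a3 := ((((a1.const_mul 3).const_add (2 * W)).const_mul C0).const_mul X⁻¹).sqrt.add
        (a2.const_mul c)
      simpa using a3
    have hfin := ge_of_tendsto' hlim hn
    have n1 : 0 ≤ ∫ x in 0..E t, z t x ^ 2 := int_nonneg hl fun y _ => sq_nonneg _
    have hW0 : 0 ≤ W := int_nonneg hl0 fun y _ => sq_nonneg _
    rw [Real.sqrt_le_sqrt_iff (by positivity), ← div_eq_inv_mul, le_div_iff₀ hX0, mul_comm] at hfin
    refine hfin.trans ?_
    have := mul_le_mul_of_nonneg_left hw0z (by positivity : 0 ≤ 2 * C0)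
    linarith

/-! ## The adjoint transform -/

/-- The adjoint of the Volterra transform on `(0, E t)`. -/
def costep (α : ℝ) (E : ℝ → ℝ) (φ : ℝ → ℝ → ℝ) (t x : ℝ) : ℝ :=
  φ t x + ∫ y in E t..x, kern α y x * φ t y

section costep

lemma integral_volt_mul (hl : 0 ≤ l) (hf : IntervalIntegrable f volume 0 l) (hg : Continuous g) :
    ∫ x in 0..l, volt α f x * g x = ∫ x in 0..l, f x * (g x + ∫ y in l..x, kern α y x * g y) := by
  have h1 : Integrable (fun p : ℝ × ℝ => f p.2)
      ((volume.restrict (Ioc 0 l)).prod (volume.restrict (Ioc 0 l))) :=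
    ((intervalIntegrable_iff_integrableOn_Ioc_of_le hl).1 hf).comp_snd _
  rw [Measure.prod_restrict] at h1
  have hc : Continuous (fun p : ℝ × ℝ => g p.1 * kern α p.1 p.2) :=
    (hg.comp continuous_fst).mul (smooth2_kern α).continuous
  obtain ⟨C, hC⟩ := ((isCompact_Icc (a := (0 : ℝ)) (b := l)).prod
    (isCompact_Icc (a := (0 : ℝ)) (b := l))).bddAbove_image hc.norm.continuousOn
  have h2 := Integrable.bdd_mul (c := C) h1 hc.aestronglyMeasurable
    ((ae_restrict_iff' (measurableSet_Ioc.prod measurableSet_Ioc)).2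
      (.of_forall fun p hp =>
        hC ⟨p, ⟨Ioc_subset_Icc_self hp.1, Ioc_subset_Icc_self hp.2⟩, rfl⟩))
  have sw := triangle_integral_swap hl (g := fun ξ y => g ξ * kern α ξ y * f y) h2
  have ck : ContinuousOn (fun x => ∫ y in 0..x, kern α x y * f y) (Icc 0 l) :=
    continuousOn_integral_kernel hl (smooth2_kern α).continuous hf
  have e1 : ∫ x in 0..l, volt α f x * g x = (∫ x in 0..l, f x * g x)
      - ∫ ξ in 0..l, ∫ y in 0..ξ, g ξ * kern α ξ y * f y := by
    have e : ∀ ξ, ∫ y in 0..ξ, g ξ * kern α ξ y * f y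
        = (∫ y in 0..ξ, kern α ξ y * f y) * g ξ := fun ξ => by
      rw [← int_mul_const]; congr 1; ext y; ring
    simp only [e]
    rw [← int_sub (hf.mul_continuousOn hg.continuousOn)
      (ContinuousOn.intervalIntegrable_of_Icc hl (u := fun x => (∫ y in 0..x, kern α x y * f y) * g x)
      (ck.mul hg.continuousOn))]
    congr 1; ext x; simp only [volt]; ring
  have cJ : Continuous fun x => ∫ y in l..x, kern α y x * g y :=
    continuous_parametric_intervalIntegral_of_continuous (f := fun x y => kern α y x * g y)
      (((smooth2_kern α).continuous.comp continuous_swap).mul (hg.comp continuous_snd)) continuous_id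
  have e2 : ∫ y in 0..l, ∫ ξ in y..l, g ξ * kern α ξ y * f y
      = -∫ y in 0..l, f y * ∫ ξ in l..y, kern α ξ y * g ξ := by
    rw [← intervalIntegral.integral_neg]
    congr 1; ext y
    rw [int_symm l y, ← int_const_mul]
    congr 2; ext ξ; ring
  rw [e1, sw, e2, sub_neg_eq_add, ← int_add
    (hf.mul_continuousOn hg.continuousOn) (hf.mul_continuousOn cJ.continuousOn)]
  congr 1; ext x; ring

lemma costep_front (t : ℝ) : costep α E φ t (E t) = φ t (E t) := by simp [costep]

lemma smooth_costep (hE : ContDiff ℝ ∞ E) (hφ : Smooth2 φ) : Smooth2 (costep α E φ) := by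
  have hF : ContDiff ℝ ∞ (uncurry fun (p : ℝ × ℝ) y => kern α y p.2 * φ p.1 y) := by
    have h1 : ContDiff ℝ ∞ fun q : (ℝ × ℝ) × ℝ => uncurry (kern α) (q.2, q.1.2) :=
      ContDiff.comp (g := uncurry (kern α)) (smooth2_kern α)
        (contDiff_snd.prodMk (contDiff_snd.comp contDiff_fst))
    have h2 : ContDiff ℝ ∞ fun q : (ℝ × ℝ) × ℝ => uncurry φ (q.1.1, q.2) :=
      ContDiff.comp (g := uncurry φ) hφ ((contDiff_fst.comp contDiff_fst).prodMk contDiff_snd)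
    exact h1.mul h2
  have h1 := smooth2_integral hF (a := fun _ x => x) contDiff_snd 0
  have h2 := smooth2_integral hF (a := fun t _ => E t) (hE.comp contDiff_fst) 0
  have h3 := hφ.add (h1.sub h2)
  have e : costep α E φ = fun t x => φ t x + ((∫ y in 0..x, kern α y x * φ t y)
      - ∫ y in 0..E t, kern α y x * φ t y) := by
    ext t x
    have c : Continuous fun y => kern α y x * φ t y :=
      ((smooth2_kern α).continuous.comp (by fun_prop : Continuous fun y => (y, x))).mul
        (hφ.slice t).continuous
    rw [integral_interval_sub_left (c.intervalIntegrable _ _) (c.intervalIntegrable _ _)]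
    rfl
  rw [e]; exact h3

lemma Smooth2.continuous_swap {f : ℝ → ℝ → ℝ} (hf : Smooth2 f) (x : ℝ) :
    Continuous fun y => f y x :=
  hf.continuous.comp (by fun_prop : Continuous fun y => (y, x))

lemma pdt_costep (hE : IsFront v E) (hφ : Smooth2 φ) (ht : 0 ≤ t) (x : ℝ) :
    pdt (costep α E φ) t x = costep α E (pdt φ) t x - v * kern α (E t) x * φ t (E t) := by
  have hk : Smooth2 fun t y => kern α y x * φ t y := by
    have : ContDiff ℝ ∞ fun p : ℝ × ℝ => uncurry (kern α) (p.2, x) :=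
      ContDiff.comp (g := uncurry (kern α)) (smooth2_kern α) (contDiff_snd.prodMk contDiff_const)
    exact Smooth2.mul (f := fun _ y => kern α y x) this hφ
  have h1 := hk.hasDerivAt_integral x (hE.hasDerivAt t ht)
  have h2 := (hφ.hasDerivAt_pdt t x).sub h1
  have e : (fun s => costep α E φ s x)
      = (fun s => φ s x) - fun s => ∫ y in x..E s, kern α y x * φ s y := by
    ext s; simp only [costep, Pi.sub_apply]; rw [int_symm]; ring
  have h3 : pdt (costep α E φ) t x = _ := (congrArg (fun f => deriv f t) e).trans h2.deriv
  have e2 : ∀ y, pdt (fun t y => kern α y x * φ t y) t y = kern α y x * pdt φ t y := fun y =>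
    ((hφ.hasDerivAt_pdt t y).const_mul _).deriv
  rw [h3, costep, int_symm x]
  simp only [e2]
  ring

lemma hasDerivAt_costep (hφ : Smooth2 φ) (t x : ℝ) :
    HasDerivAt (costep α E φ t) (pdx φ t x + kern α x x * φ t x
      + ∫ y in E t..x, pdx (kern α) y x * φ t y) x := by
  have h := hasDerivAt_leibniz (G := fun x y => kern α y x * φ t y)
    (G' := fun x y => pdx (kern α) y x * φ t y)
    (((smooth2_kern α).continuous.comp continuous_swap).mul
      ((hφ.slice t).continuous.comp continuous_snd))
    (((smooth2_kern α).pdx.continuous.comp continuous_swap).mul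
      ((hφ.slice t).continuous.comp continuous_snd))
    (fun s y => ((smooth2_kern α).hasDerivAt_pdx y s).mul_const _) (E t) (hasDerivAt_id x)
  exact ((hφ.hasDerivAt_pdx t x).add h).congr_deriv (by simp only [id]; ring)

lemma pdx_costep (hφ : Smooth2 φ) (t x : ℝ) :
    pdx (costep α E φ) t x = pdx φ t x + kern α x x * φ t x
      + ∫ y in E t..x, pdx (kern α) y x * φ t y := (hasDerivAt_costep hφ t x).deriv

lemma pdx_pdx_costep (hφ : Smooth2 φ) (hφE : pdx φ t (E t) = 0) (x : ℝ) :
    pdx (pdx (costep α E φ)) t x = costep α E (fun t y => pdx (pdx φ) t y - α * φ t y) t x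
        - pdt (kern α) (E t) x * φ t (E t) := by
  have hk := smooth2_kern α
  have h := hasDerivAt_leibniz (G := fun x y => pdx (kern α) y x * φ t y)
    (G' := fun x y => pdx (pdx (kern α)) y x * φ t y)
    ((hk.pdx.continuous.comp continuous_swap).mul ((hφ.slice t).continuous.comp continuous_snd))
    ((hk.pdx.pdx.continuous.comp continuous_swap).mul ((hφ.slice t).continuous.comp continuous_snd))
    (fun s y => (hk.pdx.hasDerivAt_pdx y s).mul_const _) (E t) (hasDerivAt_id x)
  have h1 := ((hφ.pdx.hasDerivAt_pdx t x).add
    (((hasDerivAt_id x).const_mul (-(α / 2))).mul (hφ.hasDerivAt_pdx t x))).add h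
  have e : pdx (costep α E φ) t = fun x => pdx φ t x + -(α / 2) * x * φ t x
      + ∫ y in E t..x, pdx (kern α) y x * φ t y := by
    ext x; rw [pdx_costep hφ, kern_diag]
  have h1' : HasDerivAt (pdx (costep α E φ) t) (pdx (pdx φ) t x
      + (-(α / 2) * φ t x + -(α / 2) * x * pdx φ t x) + (pdx (kern α) x x * φ t x
        + ∫ y in E t..x, pdx (pdx (kern α)) y x * φ t y)) x := by
    rw [e]
    exact h1.congr_deriv (by simp only [id, mul_one, one_mul])
  have h2 := h1'.deriv
  have c0 : Continuous fun y => kern α y x := (smooth2_kern α).continuous_swap x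
  have c1 := hk.pdt.continuous_swap x
  have c2 := hk.pdt.pdt.continuous_swap x
  have f0 : Continuous (φ t) := (hφ.slice t).continuous
  have f1 : Continuous (pdx φ t) := (hφ.pdx.slice t).continuous
  have f2 : Continuous (pdx (pdx φ) t) := (hφ.pdx.pdx.slice t).continuous
  have i1 := integral_mul_deriv_eq_deriv_mul (a := E t) (b := x)
    (u := fun y => kern α y x) (v := pdx φ t) (fun y _ => hk.hasDerivAt_pdt y x)
    (fun y _ => hφ.pdx.hasDerivAt_pdx t y) (c1.intervalIntegrable _ _) (f2.intervalIntegrable _ _)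
  have i2 := integral_mul_deriv_eq_deriv_mul (a := E t) (b := x)
    (u := fun y => pdt (kern α) y x) (v := φ t) (fun y _ => hk.pdt.hasDerivAt_pdt y x)
    (fun y _ => hφ.hasDerivAt_pdx t y) (c2.intervalIntegrable _ _) (f1.intervalIntegrable _ _)
  have i3 : ∫ y in E t..x, pdx (pdx (kern α)) y x * φ t y
      = (∫ y in E t..x, pdt (pdt (kern α)) y x * φ t y) - α * ∫ y in E t..x, kern α y x * φ t y := by
    rw [← int_const_mul, ← int_sub cont_ii
      cont_ii]
    congr 1; ext y
    linear_combination -φ t y * kern_wave α y x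
  have i4 : ∫ y in E t..x, kern α y x * (pdx (pdx φ) t y - α * φ t y)
      = (∫ y in E t..x, kern α y x * pdx (pdx φ) t y) - α * ∫ y in E t..x, kern α y x * φ t y := by
    rw [← int_const_mul, ← int_sub cont_ii
      cont_ii]
    congr 1; ext y; ring
  rw [show pdx (pdx (costep α E φ)) t x = _ from h2, costep, i4, i1, i3, hφE]
  simp only [pdx_kern_diag, pdt_kern_diag, kern_diag] at i2 ⊢
  linear_combination i2

/-- The adjoint transform maps Neumann test functions to test functions of the closed loop. -/
lemma heat_costep (hα : lam = σ * α) (hE : IsFront v E) (hφ : Smooth2 φ) (ht : 0 ≤ t)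
    (hφE : pdx φ t (E t) = 0) (x : ℝ) :
    pdt (costep α E φ) t x + σ * pdx (pdx (costep α E φ)) t x
        + gain σ v α (E t) x * costep α E φ t (E t)
      = costep α E (fun t y => pdt φ t y + σ * pdx (pdx φ) t y - lam * φ t y) t x := by
  rw [pdt_costep hE hφ ht, pdx_pdx_costep hφ hφE, costep_front, gain]
  simp only [costep]
  have c0 : Continuous fun y => kern α y x := (smooth2_kern α).continuous_swap x
  have f0 : Continuous (φ t) := (hφ.slice t).continuous
  have f1 : Continuous (pdt φ t) := (hφ.pdt.slice t).continuous
  have f2 : Continuous (pdx (pdx φ) t) := (hφ.pdx.pdx.slice t).continuous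
  have i1 : ∫ y in E t..x, kern α y x * (pdt φ t y + σ * pdx (pdx φ) t y - lam * φ t y)
      = (∫ y in E t..x, kern α y x * pdt φ t y)
        + σ * ∫ y in E t..x, kern α y x * (pdx (pdx φ) t y - α * φ t y) := by
    rw [← int_const_mul, ← int_add cont_ii
      cont_ii]
    congr 1; ext y; rw [hα]; ring
  rw [i1, hα]
  ring

lemma costep_bdryZero (hφ : Smooth2 φ) (h0 : pdx φ t 0 = 0) : pdx (costep α E φ) t 0 = 0 := by
  rw [pdx_costep hφ, h0, kern_zero_left]
  simp [pdx_kern_zero_right]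

lemma costep_bdryFront (hφ : Smooth2 φ) (h : pdx φ t (E t) = 0) :
    pdx (costep α E φ) t (E t) = kern α (E t) (E t) * costep α E φ t (E t) := by
  rw [pdx_costep hφ, h, costep_front]
  simp

/-- Smooth functions with the right boundary values are test functions. -/
lemma isScalarTest_of_smooth (hE : IsFront v E) (hν : Smooth2 ν) (h0 : ∀ t ≥ 0, pdx ν t 0 = 0)
    (hκ : ∀ t ≥ 0, pdx ν t (E t) = κ t * ν t (E t)) (hT : ∀ x, ν T x = 0) :
    IsScalarTest E κ T ν (pdt ν) (pdx ν) (pdx (pdx ν)) := by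
  have hEc := hE.cont
  refine ⟨⟨movL2_of_cont hEc hν.continuous, movL2_of_cont hEc hν.pdx.continuous,
    movL2_of_cont hEc hν.pdx.pdx.continuous⟩, .of_forall fun t =>
      ⟨isH1_of_hasDerivAt (hν.hasDerivAt_pdx t) (hν.pdx.slice t).continuous,
        isH1_of_hasDerivAt (hν.pdx.hasDerivAt_pdx t) (hν.pdx.pdx.slice t).continuous⟩,
    MovContL2.of_cont hEc _ hν.continuous,
    ⟨movL2_of_cont hEc hν.pdt.continuous, fun φ hφ hφc hφs => ?_⟩,
    .of_forall hT, ?_, ?_⟩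
  · have hfd : ∀ p ∉ tsupport φ, fderiv ℝ φ p = 0 := fun p hp =>
      Function.notMem_support.1 fun h => hp (support_fderiv_subset ℝ h)
    have e1 : ∫ p in domainT E T, ν p.1 p.2 * fderiv ℝ φ p (1, 0)
        = ∫ p, uncurry ν p * fderiv ℝ φ p (1, 0) :=
      setIntegral_eq_integral_of_forall_compl_eq_zero fun p hp => by
        rw [hfd p fun h => hp (hφs h)]; simp
    have e2 : ∫ p in domainT E T, pdt ν p.1 p.2 * φ p
        = ∫ p, fderiv ℝ (uncurry ν) p (1, 0) * φ p := by
      rw [setIntegral_eq_integral_of_forall_compl_eq_zero fun p hp => by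
        rw [image_eq_zero_of_notMem_tsupport fun h => hp (hφs h)]; simp]
      congr 1; ext p; rw [← hν.pdt_eq_fderiv]
    rw [e1, e2]
    have cν := hν.continuous
    have cφ := hφ.continuous
    have cd : Continuous fun p => fderiv ℝ φ p (1, 0) :=
      (hφ.continuous_fderiv (by simp)).clm_apply continuous_const
    have cdν : Continuous fun p => fderiv ℝ (uncurry ν) p (1, 0) :=
      (ContDiff.continuous_fderiv hν (by simp)).clm_apply continuous_const
    refine integral_mul_fderiv_eq_neg_fderiv_mul_of_integrable ?_ ?_ ?_
      (fun x _ => hν.differentiable x) (fun x _ => hφ.differentiable (by simp) x)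
    · exact (cdν.mul cφ).integrable_of_hasCompactSupport hφc.mul_left
    · exact (cν.mul cd).integrable_of_hasCompactSupport
        (HasCompactSupport.intro hφc fun p hp => by simp [hfd p hp])
    · exact (cν.mul cφ).integrable_of_hasCompactSupport hφc.mul_left
  · exact ae_restrict_of_forall_mem measurableSet_Ioo (fun t ht => h0 t ht.1.le)
  · exact ae_restrict_of_forall_mem measurableSet_Ioo (fun t ht => hκ t ht.1.le)

end costep

/-! ## Uniqueness for the scalar problem -/

/-- Separated solutions of the adjoint heat equation on the moving interval. -/
def adjMode (σ v ν : ℝ) (E : ℝ → ℝ) (t x : ℝ) : ℝ :=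
  exp (-(v / (4 * σ) * (E t - x ^ 2 / E t))) * (sin (ν * (x / E t)) / E t)

section adjoint

variable {ν : ℝ}

lemma smooth_adjMode (hE : IsFront v E) : Smooth2 (adjMode σ v ν E) := by
  have h1 : ContDiff ℝ ∞ fun p : ℝ × ℝ => E p.1 := hE.smooth.comp contDiff_fst
  have h2 : ∀ p : ℝ × ℝ, E p.1 ≠ 0 := fun p => (hE.pos _).ne'
  have h3 : ContDiff ℝ ∞ fun p : ℝ × ℝ => p.2 ^ 2 / E p.1 := (contDiff_snd.pow 2).div h1 h2
  have h4 : ContDiff ℝ ∞ fun p : ℝ × ℝ => p.2 / E p.1 := contDiff_snd.div h1 h2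
  exact (contDiff_const.mul (h1.sub h3)).neg.exp.mul ((contDiff_const.mul h4).sin.div h1 h2)

lemma hasDerivAt_adjMode_snd (hE : IsFront v E) (t x : ℝ) : HasDerivAt (adjMode σ v ν E t)
      (exp (-(v / (4 * σ) * (E t - x ^ 2 / E t)))
        * (v / (2 * σ) * x / E t * (sin (ν * (x / E t)) / E t)
          + ν * cos (ν * (x / E t)) / E t ^ 2)) x := by
  have h0 := (hE.pos t).ne'
  have h1 : HasDerivAt (fun x => -(v / (4 * σ) * (E t - x ^ 2 / E t))) (v / (2 * σ) * x / E t) x := by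
    have := ((((hasDerivAt_id x).fun_pow 2).div_const (E t)).const_sub (E t)).const_mul
      (v / (4 * σ))
    refine this.fun_neg.congr_deriv ?_
    simp only [id]; push_cast; field_simp; ring
  have h2 : HasDerivAt (fun x => sin (ν * (x / E t)) / E t)
      (ν * cos (ν * (x / E t)) / E t ^ 2) x := by
    have := ((((hasDerivAt_id x).div_const (E t)).const_mul ν).sin).div_const (E t)
    refine this.congr_deriv ?_
    simp only [id]; field_simp
  exact (h1.exp.mul h2).congr_deriv (by ring)

lemma adjMode_heat (hσ : 0 < σ) (hE : IsFront v E) (ht : 0 ≤ t) (x : ℝ) :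
    pdt (adjMode σ v ν E) t x + σ * pdx (pdx (adjMode σ v ν E)) t x
      = -(v ^ 2 / (4 * σ) + v / (2 * E t) + σ * ν ^ 2 / E t ^ 2) * adjMode σ v ν E t x := by
  have h0 := (hE.pos t).ne'
  have hE' := hE.hasDerivAt t ht
  have e1 : pdx (adjMode σ v ν E) t = fun x => adjMode σ v ν E t x * (v / (2 * σ) / E t * x)
      + ν / E t ^ 2 * (exp (-(v / (4 * σ) * (E t - x ^ 2 / E t))) * cos (ν * (x / E t))) := by
    ext x
    rw [show pdx (adjMode σ v ν E) t x = _ from (hasDerivAt_adjMode_snd hE t x).deriv, adjMode]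
    ring
  have hx : HasDerivAt (fun x => exp (-(v / (4 * σ) * (E t - x ^ 2 / E t)))
      * cos (ν * (x / E t))) (exp (-(v / (4 * σ) * (E t - x ^ 2 / E t)))
        * (v / (2 * σ) * x / E t * cos (ν * (x / E t)) - ν * sin (ν * (x / E t)) / E t)) x := by
    have h1 : HasDerivAt (fun x => -(v / (4 * σ) * (E t - x ^ 2 / E t)))
        (v / (2 * σ) * x / E t) x := by
      have := ((((hasDerivAt_id x).fun_pow 2).div_const (E t)).const_sub (E t)).const_mul
        (v / (4 * σ))
      refine this.fun_neg.congr_deriv ?_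
      simp only [id]; push_cast; field_simp; ring
    have h2 := (((hasDerivAt_id x).div_const (E t)).const_mul ν).cos
    refine (h1.exp.mul h2).congr_deriv ?_
    simp only [id]; ring
  have hd := ((hasDerivAt_adjMode_snd (σ := σ) (ν := ν) hE t x).fun_mul
    ((hasDerivAt_id x).const_mul (v / (2 * σ) / E t))).fun_add (hx.const_mul (ν / E t ^ 2))
  have hxx := (congrArg (fun f => deriv f x) e1).trans hd.deriv
  have ht' : pdt (adjMode σ v ν E) t x = exp (-(v / (4 * σ) * (E t - x ^ 2 / E t)))
      * (-(v / (4 * σ) * (v + x ^ 2 * v / E t ^ 2)) * (sin (ν * (x / E t)) / E t)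
        - ν * x * v * cos (ν * (x / E t)) / E t ^ 3
        - v * sin (ν * (x / E t)) / E t ^ 2) := by
    have hi := hE'.fun_inv h0
    have h1 : HasDerivAt (fun t => -(v / (4 * σ) * (E t - x ^ 2 / E t)))
        (-(v / (4 * σ) * (v + x ^ 2 * v / E t ^ 2))) t := by
      simp only [div_eq_mul_inv (x ^ 2)]
      refine (((hE'.fun_sub (hi.const_mul (x ^ 2))).const_mul (v / (4 * σ))).fun_neg).congr_deriv ?_
      field_simp; ring
    have h2 : HasDerivAt (fun t => sin (ν * (x / E t)) / E t)
        (- ν * x * v * cos (ν * (x / E t)) / E t ^ 3 - v * sin (ν * (x / E t)) / E t ^ 2) t := by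
      simp only [div_eq_mul_inv]
      refine (((hi.const_mul x).const_mul ν).sin.fun_mul hi).congr_deriv ?_
      field_simp; ring
    refine (h1.exp.fun_mul h2).deriv.trans ?_
    ring
  rw [show pdx (pdx (adjMode σ v ν E)) t x = _ from hxx, ht', adjMode]
  simp only [id]
  field_simp
  ring

/-- The primitive of the adjoint mode. -/
def adjPrim (σ v ν : ℝ) (E : ℝ → ℝ) (t x : ℝ) : ℝ := ∫ y in 0..x, adjMode σ v ν E t y

lemma smooth_adjPrim (hE : IsFront v E) : Smooth2 (adjPrim σ v ν E) := by
  have hF : ContDiff ℝ ∞ (uncurry fun (p : ℝ × ℝ) y => adjMode σ v ν E p.1 y) :=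
    ContDiff.comp (g := uncurry (adjMode σ v ν E)) (smooth_adjMode hE)
      ((contDiff_fst.comp contDiff_fst).prodMk contDiff_snd)
  exact smooth2_integral hF (a := fun _ x => x) contDiff_snd 0

lemma hasDerivAt_adjPrim (hE : IsFront v E) (t x : ℝ) :
    HasDerivAt (adjPrim σ v ν E t) (adjMode σ v ν E t x) x :=
  have c : Continuous (adjMode σ v ν E t) := ((smooth_adjMode hE).slice t).continuous
  integral_hasDerivAt_right (c.intervalIntegrable _ _)
    c.aestronglyMeasurable.stronglyMeasurableAtFilter c.continuousAt

lemma pdx_adjPrim (hE : IsFront v E) : pdx (adjPrim σ v ν E) = adjMode σ v ν E := by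
  ext t x; exact (hasDerivAt_adjPrim hE t x).deriv

lemma adjPrim_heat (hσ : 0 < σ) (hE : IsFront v E) (ht : 0 ≤ t) (x : ℝ) :
    pdt (adjPrim σ v ν E) t x + σ * pdx (pdx (adjPrim σ v ν E)) t x
      = -(v ^ 2 / (4 * σ) + v / (2 * E t) + σ * ν ^ 2 / E t ^ 2) * adjPrim σ v ν E t x
        + σ * pdx (adjMode σ v ν E) t 0 := by
  have hs : Smooth2 (adjMode σ v ν E) := smooth_adjMode hE
  have h1 : pdt (adjPrim σ v ν E) t x = ∫ y in 0..x, pdt (adjMode σ v ν E) t y :=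
    ((hs.hasDerivAt_integral (x := t) 0 (hasDerivAt_const t x)).congr_deriv
      (by rw [zero_mul, zero_add])).deriv
  have c0 := (hs.slice t).continuous
  have c2 := (hs.pdx.pdx.slice t).continuous
  have h2 := integral_eq_sub_of_hasDerivAt (a := 0) (b := x)
    (fun y _ => hs.pdx.hasDerivAt_pdx t y) (c2.intervalIntegrable _ _)
  have h3 : ∫ y in 0..x, pdt (adjMode σ v ν E) t y
      = -(v ^ 2 / (4 * σ) + v / (2 * E t) + σ * ν ^ 2 / E t ^ 2) * (∫ y in 0..x,
        adjMode σ v ν E t y) - σ * ∫ y in 0..x, pdx (pdx (adjMode σ v ν E)) t y := by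
    rw [← int_const_mul, ← int_const_mul,
      ← int_sub cont_ii
        cont_ii]
    congr 1; ext y
    have := adjMode_heat (ν := ν) hσ hE ht y
    linarith
  rw [h1, h3, h2, pdx_adjPrim hE, adjPrim]
  ring

lemma adjMode_zero (t : ℝ) : adjMode σ v ν E t 0 = 0 := by simp [adjMode]

lemma adjMode_front (hE : IsFront v E) (n : ℕ) (t : ℝ) :
    adjMode σ v ((n + 1 : ℕ) * π) E t (E t) = 0 := by
  rw [adjMode, div_self (hE.pos t).ne', mul_one, sin_nat_mul_pi]; simp

end adjoint

section unique

variable {z' : ℝ → ℝ → ℝ}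

/-- The weak formulation tested with the adjoint transform of a smooth Neumann function. -/
lemma IsScalarSolution.integral_costep (hα : lam = σ * α) (hE : IsFront v E)
    (hz : IsScalarSolution σ v α E z0 z) (hT : 0 < T) (hφ : Smooth2 φ)
    (h0 : ∀ t ≥ 0, pdx φ t 0 = 0) (hφE : ∀ t ≥ 0, pdx φ t (E t) = 0)
    (hφT : ∀ x, φ T x = 0) :
    ∫ t in 0..T, ∫ x in 0..E t, z t x
        * costep α E (fun t y => pdt φ t y + σ * pdx (pdx φ) t y - lam * φ t y) t x
      = -∫ x in 0..E 0, z0 x * costep α E φ 0 x := by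
  have hEc := hE.cont
  have hν : Smooth2 (costep α E φ) := smooth_costep hE.smooth hφ
  have h := hz.weak T hT _ _ _ _ (isScalarTest_of_smooth (T := T) hE hν
    (fun t ht => costep_bdryZero hφ (h0 t ht)) (fun t ht => costep_bdryFront hφ (hφE t ht))
    fun x => by simp [costep, hφT])
  have hzc : MovContL2 E (Icc 0 T) z := hz.cont.mono Icc_subset_Ici_self
  have hc : ∀ {f : ℝ → ℝ → ℝ}, Continuous (uncurry f) →
      IntervalIntegrable (fun t => ∫ x in 0..E t, f t x * z t x) volume 0 T := fun hf =>
    ContinuousOn.intervalIntegrable_of_Icc hT.le ((MovContL2.of_cont hEc _ hf).continuousOn_integral_mul hEc hzc)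
  have c1 : Continuous (uncurry fun t x =>
      pdt (costep α E φ) t x + σ * pdx (pdx (costep α E φ)) t x) :=
    hν.pdt.continuous.add (continuous_const.mul hν.pdx.pdx.continuous)
  have c2 : Continuous (uncurry fun t y => gain σ v α (E t) y) :=
    (smooth2_gain σ v α).continuous.comp (by fun_prop : Continuous fun p : ℝ × ℝ => (E p.1, p.2))
  have cE : Continuous fun t => costep α E φ t (E t) :=
    hν.continuous.comp (by fun_prop : Continuous fun t => (t, E t))
  have i1 := hc c1
  simp only [mul_comm _ (z _ _)] at i1
  have i2 := (hc c2).mul_continuousOn cE.continuousOn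
  rw [add_right_comm, ← int_add i1 i2] at h
  refine Eq.trans ?_ (eq_neg_of_add_eq_zero_left h)
  refine int_congr_Icc hT.le fun t ht => ?_
  have hzt := MemLp.ii_mu (hE.pos t).le (hz.cont.memLp hE.pos (mem_Ici.2 ht.1))
  have ct1 : Continuous fun x => pdt (costep α E φ) t x + σ * pdx (pdx (costep α E φ)) t x :=
    c1.comp (by fun_prop : Continuous fun x => (t, x))
  have ct2 : Continuous fun x => gain σ v α (E t) x := ((smooth2_gain σ v α).slice _).continuous
  rw [← int_mul_const, ← int_add (hzt.mul_continuousOn ct1.continuousOn)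
    ((hzt.continuousOn_mul ct2.continuousOn).mul_const _)]
  congr 1; ext x
  rw [← heat_costep hα hE hφ ht.1 (hφE t ht.1) x]
  ring

lemma eq_zero_of_integral_smooth_mul {M : ℝ → ℝ} (hM : ContinuousOn M (Icc 0 T))
    (h : ∀ g, ContDiff ℝ ∞ g → ∫ t in 0..T, g t * M t = 0) : ∀ t ∈ Icc 0 T, 0 < T → M t = 0 := by
  intro t ht hT
  have hae := isOpen_Ioo.ae_eq_zero_of_integral_contDiff_smul_eq_zero (U := Ioo 0 T) (μ := volume)
    ((hM.mono Ioo_subset_Icc_self).locallyIntegrableOn measurableSet_Ioo) fun g h1 h2 h3 => by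
      refine Eq.trans ?_ (h g h1)
      rw [int_of_le hT.le]
      refine (setIntegral_eq_integral_of_forall_compl_eq_zero fun x hx => ?_).symm
      rw [image_eq_zero_of_notMem_tsupport fun h => hx (Ioo_subset_Ioc_self (h3 h)), zero_smul]
  have hae2 : M =ᵐ[volume.restrict (Icc 0 T)] fun _ => 0 := by
    rw [← Measure.restrict_congr_set Ioo_ae_eq_Icc]
    exact (ae_restrict_iff' measurableSet_Ioo).2 hae
  exact Measure.eqOn_Icc_of_ae_eq volume hT.ne hae2 hM continuousOn_const ht

lemma costep_mul_left (g : ℝ → ℝ) (H : ℝ → ℝ → ℝ) (t x : ℝ) :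
    costep α E (fun t x => g t * H t x) t x = g t * costep α E H t x := by
  simp only [costep, mul_left_comm (kern α _ x), int_const_mul]
  ring

/-- A square integrable function vanishes if its Volterra transform has zero mean and is
orthogonal to the primitives of the adjoint modes. -/
lemma ae_eq_zero_of_integral_volt (hl : 0 < l) (hf : MemLp f 2 (mu l))
    {Γ : ℕ → ℝ → ℝ} {G : ℕ → ℝ → ℝ} (hG : ∀ n x, HasDerivAt (G n) (Γ n x) x)
 (hr : Continuous r) (hr0 : ∀ x, r x ≠ 0)
    (hΓ : ∀ n x, Γ n x = r x * sin ((n + 1 : ℕ) * (π * x / l)))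
    (hm : ∫ x in 0..l, volt α f x = 0)
    (hn : ∀ n, ∫ x in 0..l, volt α f x * G n x = 0) : f =ᵐ[mu l] 0 := by
  set W := volt α f with hW
  have iW := MemLp.ii_mu hl.le (memLp_volt α hl.le hf)
  rw [← hW] at iW
  set P : ℝ → ℝ := fun x => ∫ y in 0..x, W y with hP
  have hP0 : P 0 = 0 := by simp [hP]
  have hPx : ∀ x ∈ Icc 0 l, P x = P 0 + ∫ y in 0..x, W y := fun x _ => by
    rw [hP0, zero_add]
  have hPc : ContinuousOn P (Icc 0 l) := by
    have := intervalIntegral.continuousOn_primitive_interval' iW (left_mem_uIcc)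
    rwa [uIcc_of_le hl.le] at this
  have cΓ : ∀ n, Continuous (Γ n) := fun n => by
    rw [show Γ n = fun x => _ from funext (hΓ n)]; fun_prop
  have hz := eq_zero_of_integral_sin_eq_zero hl (f := fun x => P x * r x)
    (hPc.mul hr.continuousOn) fun n => by
      have := int_mul_primitive iW hPx hl.le (hG n) (cΓ n)
      simp only [mul_comm (G n _)] at this
      rw [hP0, show P l = 0 from hm, hn n, zero_mul, zero_mul, sub_self, zero_sub, zero_eq_neg]
        at this
      refine Eq.trans ?_ this
      congr 1; ext x; rw [hΓ]; ring
  have hPz : ∀ x ∈ Icc 0 l, P x = 0 := by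
    intro x hx
    rcases hx.1.eq_or_lt with rfl | h1
    · exact hP0
    rcases hx.2.eq_or_lt with rfl | h2
    · exact hm
    exact (mul_eq_zero.1 (hz x ⟨h1, h2⟩)).resolve_right (hr0 x)
  have hae := isOpen_Ioo.ae_eq_zero_of_integral_contDiff_smul_eq_zero (U := Ioo 0 l) (μ := volume)
    (f := W) ((((intervalIntegrable_iff_integrableOn_Ioo_of_le hl.le).1 iW)).locallyIntegrableOn)
    fun g h1 h2 h3 => by
      have := int_mul_primitive iW hPx hl.le
        (fun x => (h1.differentiable (by simp) x).hasDerivAt) (h1.continuous_deriv (by simp))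
      have e : ∫ x in 0..l, deriv g x * P x = 0 := (int_congr (g := fun _ => 0) fun x hx => by
          rw [uIcc_of_le hl.le] at hx
          simp only [hPz x hx, mul_zero]).trans int_zero
      rw [hP0, hPz l ⟨hl.le, le_rfl⟩, e, mul_zero, mul_zero, sub_self, sub_self] at this
      refine Eq.trans ?_ this
      rw [int_of_le hl.le]
      refine (setIntegral_eq_integral_of_forall_compl_eq_zero fun x hx => ?_).symm
      rw [image_eq_zero_of_notMem_tsupport fun h => hx (Ioo_subset_Ioc_self (h3 h)), zero_smul]
  have hae' : ∀ᵐ x ∂volume, x ∈ Ioo 0 l → W x = 0 := hae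
  refine (ae_restrict_iff' measurableSet_Ioo).2 ?_
  filter_upwards [hae'] with x hx hxI
  have if' := (MemLp.ii_mu hl.le hf).mono_set
    (by rw [uIcc_of_le hxI.1.le, uIcc_of_le hl.le]; exact Icc_subset_Icc_right hxI.2.le)
  have e : ∫ y in 0..x, kern (-α) x y * W y = 0 := by
    rw [int_congr_ae (g := fun _ => 0) (by
      filter_upwards [hae'] with y hy hyI
      rw [uIoc_of_le hxI.1.le] at hyI
      rw [hy ⟨hyI.1, hyI.2.trans_lt hxI.2⟩, mul_zero])]
    simp
  have := volt_neg_volt α hxI.1.le if'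
  refine this.symm.trans ?_
  rw [← hW, volt, e, hx hxI]
  simp

/-- Weak solutions of the scalar closed loop problem are unique. -/
lemma IsScalarSolution.unique (hσ : 0 < σ) (hα : lam = σ * α) (hE : IsFront v E)
    (hz : IsScalarSolution σ v α E z0 z) (hz' : IsScalarSolution σ v α E z0 z')
    (ht : 0 ≤ t) : z' t =ᵐ[mu (E t)] z t := by
  have hEc := hE.cont
  set d : ℝ → ℝ → ℝ := fun t x => z' t x - z t x with hd
  have hdc : MovContL2 E (Ici 0) d := hz'.cont.sub hz.cont
  have hdi : ∀ t ≥ 0, MemLp (d t) 2 (mu (E t)) := fun t ht => hdc.memLp hE.pos ht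
  have hdint : ∀ t ≥ 0, IntervalIntegrable (d t) volume 0 (E t) := fun t ht =>
    MemLp.ii_mu (hE.pos t).le (hdi t ht)
  have hcont : ∀ {w H : ℝ → ℝ → ℝ}, MovContL2 E (Ici 0) w → Smooth2 H →
      ContinuousOn (fun t => ∫ x in 0..E t, w t x * costep α E H t x) (Ici 0) :=
    fun hw hH => hw.continuousOn_integral_mul hEc
      (MovContL2.of_cont hEc _ (smooth_costep hE.smooth hH).continuous)
  have hint : ∀ {T : ℝ} {w H : ℝ → ℝ → ℝ}, 0 < T → MovContL2 E (Ici 0) w → Smooth2 H →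
      IntervalIntegrable (fun t => ∫ x in 0..E t, w t x * costep α E H t x) volume 0 T :=
    fun hT hw hH => ContinuousOn.intervalIntegrable_of_Icc hT.le ((hcont hw hH).mono Icc_subset_Ici_self)
  have key : ∀ {T : ℝ} {φ : ℝ → ℝ → ℝ}, 0 < T → Smooth2 φ → (∀ t ≥ 0, pdx φ t 0 = 0) →
      (∀ t ≥ 0, pdx φ t (E t) = 0) → (∀ x, φ T x = 0) →
      ∫ t in 0..T, ∫ x in 0..E t, d t x
        * costep α E (fun t y => pdt φ t y + σ * pdx (pdx φ) t y - lam * φ t y) t x = 0 := by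
    intro T φ hT hφ h0 hφE hφT
    have e1 := hz.integral_costep hα hE hT hφ h0 hφE hφT
    have e2 := hz'.integral_costep hα hE hT hφ h0 hφE hφT
    have hψ : Smooth2 fun t y => pdt φ t y + σ * pdx (pdx φ) t y - lam * φ t y :=
      (hφ.pdt.add ((Smooth2.const σ).mul hφ.pdx.pdx)).sub ((Smooth2.const lam).mul hφ)
    refine Eq.trans ?_ (sub_eq_zero.2 (e2.trans e1.symm))
    rw [← int_sub (hint hT hz'.cont hψ) (hint hT hz.cont hψ)]
    refine int_congr_Icc hT.le fun t ht => ?_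
    have cψ : Continuous (costep α E
        (fun t y => pdt φ t y + σ * pdx (pdx φ) t y - lam * φ t y) t) :=
      ((smooth_costep hE.smooth hψ).slice t).continuous
    have i : ∀ {w : ℝ → ℝ → ℝ}, MovContL2 E (Ici 0) w → IntervalIntegrable (w t) volume 0 (E t) :=
      fun hw => MemLp.ii_mu (hE.pos t).le (hw.memLp hE.pos (mem_Ici.2 ht.1))
    rw [← int_sub ((i hz'.cont).mul_continuousOn cψ.continuousOn)
      ((i hz.cont).mul_continuousOn cψ.continuousOn)]
    congr 1; ext x; simp only [hd]; ring
  have zero : ∀ {H : ℝ → ℝ → ℝ}, Smooth2 H → (∀ T, 0 < T → ∀ g, ContDiff ℝ ∞ g →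
      ∫ t in 0..T, g t * ∫ x in 0..E t, d t x * costep α E H t x = 0) →
      ∀ t ≥ 0, ∫ x in 0..E t, d t x * costep α E H t x = 0 := by
    intro H hH h t ht
    exact eq_zero_of_integral_smooth_mul (T := t + 1) ((hcont hdc hH).mono Icc_subset_Ici_self)
      (h _ (by linarith)) t ⟨ht, by linarith⟩ (by linarith)
  have hone : Smooth2 fun _ _ => (1 : ℝ) := Smooth2.const 1
  have mass : ∀ t ≥ 0, ∫ x in 0..E t, d t x * costep α E (fun _ _ => 1) t x = 0 := by
    refine zero hone fun T hT g hg => ?_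
    obtain ⟨b, hb, hbT, hb'⟩ := exists_linear_ode (p := fun _ => lam) contDiff_const hg T 0
    have hφ : Smooth2 fun t _ => b t := hb.comp contDiff_fst
    have px : pdx (fun t _ => b t) = fun _ _ => 0 := by ext t x; exact deriv_const _ _
    have px2 : pdx (fun _ _ => (0 : ℝ)) = fun _ _ => 0 := by ext t x; exact deriv_const _ _
    have pt : pdt (fun t _ => b t) = fun t _ => lam * b t + g t := by
      ext t x; exact (hb' t).deriv
    have := key hT hφ (fun t _ => by rw [px]) (fun t _ => by rw [px]) fun _ => hbT
    rw [px, px2, pt] at this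
    refine Eq.trans ?_ this
    congr 1; ext t
    rw [← int_const_mul]
    congr 1; ext x
    rw [← mul_left_comm, ← costep_mul_left]
    congr 2; ext t y; ring
  have modes : ∀ n : ℕ, ∀ t ≥ 0, ∫ x in 0..E t,
      d t x * costep α E (adjPrim σ v ((n + 1 : ℕ) * π) E) t x = 0 := by
    intro n
    set ν : ℝ := (n + 1 : ℕ) * π with hν
    have hG : Smooth2 (adjPrim σ v ν E) := smooth_adjPrim hE
    refine zero hG fun T hT g hg => ?_
    have hp : ContDiff ℝ ∞ fun t => lam + (v ^ 2 / (4 * σ) + v / (2 * E t) + σ * ν ^ 2 / E t ^ 2) :=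
      contDiff_const.add ((contDiff_const.add (contDiff_const.div (contDiff_const.mul hE.smooth)
        fun t => mul_ne_zero two_ne_zero (hE.pos t).ne')).add
        (contDiff_const.div (hE.smooth.pow 2) fun t => pow_ne_zero 2 (hE.pos t).ne'))
    obtain ⟨c, hc, hcT, hc'⟩ := exists_linear_ode hp hg T 0
    have hφ : Smooth2 fun t x => c t * adjPrim σ v ν E t x :=
      Smooth2.mul (f := fun t _ => c t) (hc.comp contDiff_fst) hG
    have px : pdx (fun t x => c t * adjPrim σ v ν E t x) = fun t x => c t * adjMode σ v ν E t x := by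
      ext t x; exact ((hasDerivAt_adjPrim hE t x).const_mul _).deriv
    have px2 : pdx (fun t x => c t * adjMode σ v ν E t x)
        = fun t x => c t * pdx (adjMode σ v ν E) t x := by
      ext t x; exact (((smooth_adjMode hE).hasDerivAt_pdx t x).const_mul _).deriv
    have pt : ∀ t x, pdt (fun t x => c t * adjPrim σ v ν E t x) t x = _ := fun t x =>
      ((hc' t).fun_mul (hG.hasDerivAt_pdt t x)).deriv
    have := key hT hφ (fun t _ => by rw [px]; simp [adjMode_zero])
      (fun t _ => by rw [px]; simp [hν, -Nat.cast_add, -Nat.cast_one, adjMode_front hE]) fun x => by rw [hcT, zero_mul]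
    refine Eq.trans ?_ this
    refine int_congr_Icc hT.le fun t ht => ?_
    have e : (fun y => pdt (fun t x => c t * adjPrim σ v ν E t x) t y
        + σ * pdx (pdx fun t x => c t * adjPrim σ v ν E t x) t y
        - lam * (c t * adjPrim σ v ν E t y))
        = fun y => g t * adjPrim σ v ν E t y + c t * σ * pdx (adjMode σ v ν E) t 0 * 1 := by
      ext y
      have h := adjPrim_heat (ν := ν) hσ hE ht.1 y
      rw [pdx_adjPrim hE] at h
      rw [px, px2, pt]
      linear_combination c t * h
    have cG : Continuous (adjPrim σ v ν E t) := (hG.slice t).continuous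
    have e2 : ∀ x, costep α E (fun t y => pdt (fun t x => c t * adjPrim σ v ν E t x) t y
        + σ * pdx (pdx fun t x => c t * adjPrim σ v ν E t x) t y
        - lam * (c t * adjPrim σ v ν E t y)) t x
        = g t * costep α E (adjPrim σ v ν E) t x
          + c t * σ * pdx (adjMode σ v ν E) t 0 * costep α E (fun _ _ => 1) t x := by
      intro x
      have ck : Continuous fun y => kern α y x := (smooth2_kern α).continuous_swap x
      have e' := fun y => congrFun e y
      simp only [costep] at e' ⊢
      simp only [e', mul_add, mul_left_comm (kern α _ x)]
      rw [int_add cont_ii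
        cont_ii, int_const_mul,
        int_const_mul]
      ring
    have c1 : Continuous (costep α E (adjPrim σ v ν E) t) :=
      ((smooth_costep hE.smooth hG).slice t).continuous
    have c2 : Continuous (costep α E (fun _ _ => 1) t) :=
      ((smooth_costep hE.smooth hone).slice t).continuous
    simp only [e2, mul_add, mul_left_comm (d t _)]
    rw [int_add (((hdint t ht.1).mul_continuousOn c1.continuousOn).const_mul _)
      (((hdint t ht.1).mul_continuousOn c2.continuousOn).const_mul _),
      int_const_mul, int_const_mul, mass t ht.1,
      mul_zero, add_zero]
  have hl := hE.pos t
  have hG : ∀ n : ℕ, Smooth2 (adjPrim σ v ((n + 1 : ℕ) * π) E) := fun n => smooth_adjPrim hE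
  have := ae_eq_zero_of_integral_volt (α := α) hl (hdi t ht)
    (Γ := fun n => adjMode σ v ((n + 1 : ℕ) * π) E t)
    (G := fun n => adjPrim σ v ((n + 1 : ℕ) * π) E t)
    (r := fun x => exp (-(v / (4 * σ) * (E t - x ^ 2 / E t))) / E t)
    (fun n x => hasDerivAt_adjPrim hE t x) (by fun_prop)
    (fun x => (div_pos (exp_pos _) hl).ne')
    (fun n x => by
      rw [adjMode, mul_assoc ((n + 1 : ℕ) : ℝ), mul_div_assoc π]; ring)
    (by
      have h := integral_volt_mul (α := α) hl.le (hdint t ht) (g := fun _ => 1) continuous_const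
      have m := mass t ht
      simp only [costep, mul_one] at m h
      rw [h, m])
    (fun n => by
      rw [integral_volt_mul hl.le (hdint t ht) ((hG n).slice t).continuous]
      exact modes n t ht)
  filter_upwards [this] with x hx
  simp only [hd, Pi.zero_apply] at hx
  linarith

end unique

/-! ## Admissibility of the feedback -/

section feedback

variable {n : ℕ} {h : Fin n → Fin n → ℝ → ℝ → ℝ}
  {H : ℝ → (Fin n → ℝ → ℝ) → Fin n → ℝ}

lemma normL2_sq (hl : 0 ≤ l) {z : Fin n → ℝ → ℝ} (hz : ∀ i, MemLp (z i) 2 (mu l)) :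
    normL2 l z ^ 2 = ∑ i, ∫ x in 0..l, z i x ^ 2 := by
  rw [normL2, sq_sqrt (int_nonneg hl fun x _ => sum_nonneg fun i _ => sq_nonneg _),
    int_finsetSum fun i _ => int_sq_mu hl (hz i)]

lemma sq_sum_integral_le (hl : 0 ≤ l) {k z : Fin n → ℝ → ℝ} (hk : ∀ j, Continuous (k j))
    (hB : ∀ j, ∀ y ∈ Icc 0 l, |k j y| ≤ B) (hz : ∀ j, MemLp (z j) 2 (mu l)) :
    (∑ j, ∫ y in 0..l, k j y * z j y) ^ 2 ≤ n * (B ^ 2 * l) * normL2 l z ^ 2 := by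
  refine sq_sum_le_card_mul_sum_sq.trans ?_
  rw [Finset.card_fin, normL2_sq hl hz, mul_assoc, mul_sum _ _ (B ^ 2 * l)]
  exact mul_le_mul_of_nonneg_left (sum_le_sum fun j _ =>
    sq_integral_mul_le hl (hk j) (hB j) (hz j)) (Nat.cast_nonneg n)

lemma exists_uniform_bound (hE : Continuous E) (hc : ∀ i j, Continuous (uncurry (h i j))) (T : ℝ) :
    ∃ B, 0 ≤ B ∧ ∀ i j, ∀ t ∈ Icc 0 T, ∀ y ∈ Icc 0 (E t), |h i j t y| ≤ B := by
  choose C hC0 hC using fun i j => exists_bound_domainT hE T (hc i j)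
  refine ⟨∑ i, ∑ j, C i j, sum_nonneg fun i _ => sum_nonneg fun j _ => hC0 i j,
    fun i j t ht y hy => (hC i j t ht y hy).trans ?_⟩
  exact (single_le_sum (fun j _ => hC0 i j) (Finset.mem_univ j)).trans
    (single_le_sum (f := fun i => ∑ j, C i j)
      (fun i _ => sum_nonneg fun j _ => hC0 i j) (Finset.mem_univ i))

lemma propP1_of_kernel (hE : IsFront v E) (hc : ∀ i j, Continuous (uncurry (h i j)))
    (hH : ∀ t ≥ 0, ∀ z : Fin n → ℝ → ℝ, (∀ j, MemLp (z j) 2 (mu (E t))) → ∀ i,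
      H t z i = ∑ j, ∫ y in 0..E t, h i j t y * z j y) : PropP1 E H := by
  refine ae_restrict_of_forall_mem measurableSet_Ici (fun t ht => ?_)
  have hl := (hE.pos t).le
  have cs : ∀ i j, Continuous (h i j t) := fun i j =>
    (hc i j).comp (by fun_prop : Continuous fun y => (t, y))
  have ii : ∀ {z : Fin n → ℝ → ℝ}, (∀ j, MemLp (z j) 2 (mu (E t))) → ∀ i j,
      IntervalIntegrable (fun y => h i j t y * z j y) volume 0 (E t) := fun hz i j =>
    (MemLp.ii_mu hl (hz j)).continuousOn_mul (cs i j).continuousOn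
  refine ⟨fun z z' hz hz' => ?_, fun c z hz => ?_, ?_⟩
  · ext i
    rw [Pi.add_apply, hH t ht (z + z') fun j => (hz j).add (hz' j), hH t ht _ hz, hH t ht _ hz',
      ← sum_add_distrib]
    refine sum_congr rfl fun j _ => ?_
    rw [← int_add (ii hz i j) (ii hz' i j)]
    congr 1; ext y; simp only [Pi.add_apply]; ring
  · ext i
    rw [Pi.smul_apply, hH t ht (c • z) fun j => (hz j).const_smul c, hH t ht _ hz, smul_eq_mul,
      mul_sum]
    refine sum_congr rfl fun j _ => ?_
    rw [← int_const_mul]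
    congr 1; ext y; simp only [Pi.smul_apply, smul_eq_mul]; ring
  · obtain ⟨B, hB0, hB⟩ := exists_uniform_bound hE.cont hc t
    refine ⟨√(n * (B ^ 2 * E t)), fun z hz => ?_⟩
    have h0 : 0 ≤ √(n * (B ^ 2 * E t)) * normL2 (E t) z :=
      mul_nonneg (sqrt_nonneg _) (sqrt_nonneg _)
    refine (pi_norm_le_iff_of_nonneg h0).2 fun i => ?_
    rw [hH t ht z hz, norm_eq_abs]
    refine abs_le_of_sq_le_sq ?_ h0
    rw [mul_pow, sq_sqrt (by positivity)]
    exact sq_sum_integral_le hl (cs i) (fun j y hy => hB i j t ⟨ht, le_rfl⟩ y hy) hz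

lemma propP2_of_kernel (hE : IsFront v E) (hc : ∀ i j, Continuous (uncurry (h i j)))
    (hH : ∀ t ≥ 0, ∀ z : Fin n → ℝ → ℝ, (∀ j, MemLp (z j) 2 (mu (E t))) → ∀ i,
      H t z i = ∑ j, ∫ y in 0..E t, h i j t y * z j y) : PropP2 E H := by
  intro T hT
  have hEc := hE.cont
  obtain ⟨B, hB0, hB⟩ := exists_uniform_bound hEc hc T
  set K : ℝ := n * (B ^ 2 * E T) with hK
  have hK0 : 0 ≤ K := by have := hE.pos T; positivity
  refine ⟨√(n * K) + 1, by positivity, fun z hz => ?_⟩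
  have hfin := finite_domainT (T := T) hEc
  have hint : ∀ {f : ℝ → ℝ → ℝ}, MovL2 E T f → IntegrableOn (uncurry f) (domainT E T) :=
    fun hf => MemLp.integrable (by norm_num) hf
  have hmT : ∀ᵐ t ∂(mu T), t ∈ Ioo 0 T := ae_restrict_mem measurableSet_Ioo
  have hsl : ∀ᵐ t ∂(mu T), t ∈ Ioo 0 T ∧ ∀ j, MemLp (z j t) 2 (mu (E t)) :=
    hmT.and (ae_all_iff.2 fun j => (hz j).slice hEc.measurable)
  have hN : Integrable (fun t => normL2 (E t) (fun j => z j t) ^ 2) (mu T) := by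
    refine (integrable_finsetSum Finset.univ fun j _ => integrable_int_slice hEc.measurable
      hE.pos ((hz j).integrable_mul (hz j))).congr ?_
    filter_upwards [hsl] with t ht
    simp only [normL2_sq (hE.pos t).le ht.2, sq]
  have hle : ∀ᵐ t ∂(mu T), ∀ i, H t (fun j => z j t) i ^ 2
      ≤ K * normL2 (E t) (fun j => z j t) ^ 2 := by
    filter_upwards [hsl] with t ht i
    have htI := Ioo_subset_Icc_self ht.1
    rw [hH t htI.1 _ ht.2]
    refine (sq_sum_integral_le (hE.pos t).le
      (fun j => (hc i j).comp (by fun_prop : Continuous fun y => (t, y)))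
      (fun j y hy => hB i j t htI y hy) ht.2).trans ?_
    rw [hK]
    gcongr
    exact hE.mono htI.1 htI.2
  have hm : ∀ i, AEStronglyMeasurable (fun t => H t (fun j => z j t) i) (mu T) := fun i => by
    refine (integrable_finsetSum Finset.univ fun j _ => integrable_int_slice hEc.measurable
      hE.pos (hint (MovL2.bdd_mul hEc (hc i j) (hz j)))).aestronglyMeasurable.congr ?_
    filter_upwards [hsl] with t ht
    rw [hH t ht.1.1.le _ ht.2]
    rfl
  have hmem : ∀ i, MemLp (fun t => H t (fun j => z j t) i) 2 (mu T) := fun i =>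
    (memLp_two_iff_integrable_sq (hm i)).2 ((hN.const_mul K).mono' ((hm i).pow 2) (by
      filter_upwards [hle] with t ht
      rw [norm_eq_abs, abs_of_nonneg (sq_nonneg _)]
      exact ht i))
  refine ⟨hmem, ?_⟩
  have e : normL2 T (fun i t => H t (fun j => z j t) i) ^ 2
      ≤ n * K * ∫ t in 0..T, normL2 (E t) (fun j => z j t) ^ 2 := by
    rw [normL2_sq hT.le hmem, mul_assoc, ← int_const_mul]
    refine (Finset.sum_le_card_nsmul _ _ _ fun i _ => ?_).trans_eq
      (by rw [Finset.card_fin, nsmul_eq_mul])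
    rw [← integral_mu hT.le, ← integral_mu hT.le]
    exact integral_mono_ae ((memLp_two_iff_integrable_sq (hm i)).1 (hmem i)) (hN.const_mul K)
      (hle.mono fun t ht => ht i)
  refine (Real.le_sqrt_of_sq_le e).trans ?_
  rw [Real.sqrt_mul (by positivity)]
  gcongr
  linarith

lemma propP3_of_continuous {K : ℝ → Matrix (Fin n) (Fin n) ℝ} (hK : Continuous K) : PropP3 K := by
  intro i j
  have c : Continuous fun t => K t i j := (hK.matrix_elem i j)
  refine ⟨c.aestronglyMeasurable, fun a b _ _ => ?_⟩
  obtain ⟨C, hC⟩ := isCompact_Icc.exists_bound_of_continuousOn (s := Icc a b) c.continuousOn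
  exact ⟨C, (ae_restrict_iff' measurableSet_Icc).2 (.of_forall hC)⟩

end feedback

/-! ## Linear combinations -/

section combinations

variable {ι : Type*} [Fintype ι] {E e : ℝ → ℝ} {T : ℝ} {v : ℝ} {f g : ι → ℝ → ℝ → ℝ}

lemma memLp_sum_mul {X : Type*} [MeasurableSpace X] {μ : Measure X} (c : ι → ℝ) {f : ι → X → ℝ}
    (hf : ∀ i, MemLp (f i) 2 μ) : MemLp (fun x => ∑ i, c i * f i x) 2 μ :=
  memLp_finsetSum _ fun i _ => (hf i).const_mul (c i)

lemma integral_sum_mul {X : Type*} [MeasurableSpace X] {μ : Measure X} (c : ι → ℝ)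
    {F : ι → X → ℝ} {φ : X → ℝ} (hF : ∀ i, Integrable (fun x => F i x * φ x) μ) :
    ∫ x, (∑ i, c i * F i x) * φ x ∂μ = ∑ i, c i * ∫ x, F i x * φ x ∂μ := by
  simp only [sum_mul, mul_assoc]
  rw [integral_finsetSum _ fun i _ => (hF i).const_mul (c i)]
  simp only [MeasureTheory.integral_const_mul]

lemma IsH1.sum_mul (c : ι → ℝ) {f g : ι → ℝ → ℝ} (h : ∀ i, IsH1 l (f i) (g i)) :
    IsH1 l (fun x => ∑ i, c i * f i x) (fun x => ∑ i, c i * g i x) := by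
  refine ⟨memLp_sum_mul c fun i => (h i).1, fun x hx => ?_⟩
  rw [int_finsetSum fun i _ =>
    (((h i).mono hx.2).intervalIntegrable hx.1).const_mul _, ← sum_add_distrib]
  refine sum_congr rfl fun i _ => ?_
  rw [int_const_mul, (h i).2 x hx]
  ring

lemma MovContL2.sum_mul (c : ι → ℝ) {I : Set ℝ} (hf : ∀ i, MovContL2 E I (f i)) :
    MovContL2 E I fun t x => ∑ i, c i * f i t x := by
  refine ⟨fun t ht => memLp_sum_mul c fun i => (hf i).1 t ht, fun t ht => ?_⟩
  have h0 : Tendsto (fun s => ∑ i, ‖c i‖ₑ * eLpNorm (fun y => f i s (E s * y) - f i t (E t * y)) 2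
      (mu 1)) (𝓝[I] t) (𝓝 0) := by
    have := tendsto_finsetSum (s := Finset.univ) fun i _ =>
      ENNReal.Tendsto.const_mul (a := ‖c i‖ₑ) ((hf i).2 t ht) (Or.inr enorm_ne_top)
    simpa using this
  refine tendsto_of_tendsto_of_tendsto_of_le_of_le' tendsto_const_nhds h0
    (.of_forall fun _ => zero_le) ?_
  filter_upwards [self_mem_nhdsWithin] with s hs
  have e : (fun y => (∑ i, c i * f i s (E s * y)) - ∑ i, c i * f i t (E t * y))
      = ∑ i, c i • fun y => f i s (E s * y) - f i t (E t * y) := by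
    ext y
    simp only [← Finset.sum_sub_distrib, Finset.sum_apply, Pi.smul_apply, smul_eq_mul, mul_sub]
  simp only [e]
  refine (eLpNorm_sum_le (fun i _ => ((((hf i).1 s hs).sub ((hf i).1 t ht)).const_smul
    (c i)).aestronglyMeasurable) (by norm_num)).trans_eq (sum_congr rfl fun i _ => ?_)
  exact eLpNorm_const_smul _ _ _ _

lemma MovL2.integrableOn_mul (hE : Continuous E) {f : ℝ → ℝ → ℝ} (hf : MovL2 E T f)
    {ψ : ℝ × ℝ → ℝ} (hψ : Continuous ψ) :
    IntegrableOn (fun p : ℝ × ℝ => f p.1 p.2 * ψ p) (domainT E T) :=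
  hf.integrable_mul (movL2_of_cont (f := fun t x => ψ (t, x)) hE hψ)

lemma HasWeakTimeDeriv.sum_mul (c : ι → ℝ) (hE : Continuous E) (hf : ∀ i, MovL2 E T (f i))
    (h : ∀ i, HasWeakTimeDeriv E T (f i) (g i)) :
    HasWeakTimeDeriv E T (fun t x => ∑ i, c i * f i t x) (fun t x => ∑ i, c i * g i t x) := by
  refine ⟨memLp_sum_mul c fun i => (h i).1, fun φ hφ hφc hφs => ?_⟩
  have cφ : Continuous fun p => fderiv ℝ φ p (1, 0) :=
    (hφ.continuous_fderiv (by simp)).clm_apply continuous_const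
  rw [integral_sum_mul c fun i => (hf i).integrableOn_mul hE cφ,
    integral_sum_mul c fun i => MovL2.integrableOn_mul hE (h i).1 hφ.continuous, ← sum_neg_distrib]
  refine sum_congr rfl fun i _ => ?_
  rw [(h i).2 φ hφ hφc hφs, mul_neg]

lemma TimeDerivInDualH1.sum_mul (c : ι → ℝ) (hE : IsFront v E)
    (hm : ∀ i, AEStronglyMeasurable (uncurry (f i)) (volume.restrict (domain E)))
    (hc : ∀ i, MovContL2 E (Ici 0) (f i)) (h : ∀ i, TimeDerivInDualH1 E (f i)) :
    TimeDerivInDualH1 E fun t x => ∑ i, c i * f i t x := by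
  have hEc := hE.cont
  choose f0 f1 h0 h1 h using h
  refine ⟨fun t x => ∑ i, c i * f0 i t x, fun t x => ∑ i, c i * f1 i t x, memLp_sum_mul c h0,
    memLp_sum_mul c h1, fun φ hφ hφc hφs => ?_⟩
  have cφ : ∀ w, Continuous fun p => fderiv ℝ φ p w := fun w =>
    (hφ.continuous_fderiv (by simp)).clm_apply continuous_const
  have hz : ∀ p ∉ tsupport φ, fderiv ℝ φ p = 0 := fun p hp =>
    Function.notMem_support.1 fun h => hp (support_fderiv_subset ℝ h)
  have hfd : ∀ w, HasCompactSupport fun p => fderiv ℝ φ p w := fun w =>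
    HasCompactSupport.intro hφc fun p hp => by rw [hz p hp]; rfl
  have i2 : ∀ {k ψ : ℝ × ℝ → ℝ}, MemLp k 2 (volume.restrict (domain E)) → Continuous ψ →
      HasCompactSupport ψ → IntegrableOn (fun p => k p * ψ p) (domain E) := fun hk hψ hψc =>
    hk.integrable_mul (q := 2) ((hψ.memLp_of_hasCompactSupport hψc).restrict _)
  have i1 : ∀ i, IntegrableOn (fun p : ℝ × ℝ => f i p.1 p.2 * fderiv ℝ φ p (1, 0)) (domain E) := by
    intro i
    obtain ⟨T, hT⟩ := (hφc.isCompact.image continuous_fst).bddAbove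
    have hL : MovL2 E (T + 1) (f i) := ((hc i).mono Icc_subset_Ici_self).movL2 hEc hE.pos
      ((hm i).mono_measure (Measure.restrict_mono (domainT_subset_domain E _) le_rfl))
    refine IntegrableOn.of_forall_sdiff_eq_zero (s := domainT E (T + 1))
      (hL.integrableOn_mul hEc (cφ _)) (measurableSet_domain hEc.measurable)
      fun p hp => ?_
    rw [hz p fun h => hp.2 ⟨hp.1, lt_of_le_of_lt (hT ⟨p, h, rfl⟩) (lt_add_one T)⟩]
    simp
  have hs : ∀ i, IntegrableOn (fun p : ℝ × ℝ => f0 i p.1 p.2 * φ p + f1 i p.1 p.2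
      * fderiv ℝ φ p (0, 1)) (domain E) := fun i =>
    (i2 (h0 i) hφ.continuous hφc).add (i2 (h1 i) (cφ _) (hfd _))
  rw [integral_sum_mul c i1, ← sum_neg_distrib]
  simp_rw [← mul_neg, h _ φ hφ hφc hφs, ← MeasureTheory.integral_const_mul]
  rw [← integral_finsetSum _ fun i _ => (hs i).const_mul (c i)]
  congr 1; ext p
  simp only [Finset.sum_mul, ← sum_add_distrib]
  exact sum_congr rfl fun i _ => by ring

end combinations

section congr

variable {e : ℝ → ℝ} {f : ℝ → ℝ → ℝ}

lemma domain_congr (he : ∀ t ≥ 0, e t = E t) : domain e = domain E := by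
  ext p
  exact and_congr_right fun h => by rw [he p.1 h.le]

lemma domainT_congr (he : ∀ t ≥ 0, e t = E t) (T : ℝ) : domainT e T = domainT E T := by
  simp only [domainT, domain_congr he]

lemma movContL2_congr (he : ∀ t ≥ 0, e t = E t) {I : Set ℝ} (hI : I ⊆ Ici 0) :
    MovContL2 e I f ↔ MovContL2 E I f := by
  refine and_congr (forall₂_congr fun t ht => by simp only [he t (hI ht)])
    (forall₂_congr fun t ht => tendsto_congr' ?_)
  filter_upwards [self_mem_nhdsWithin] with s hs
  simp only [he t (hI ht), he s (hI hs)]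

end congr

/-! ## The closed loop system -/

section closedLoop

open Matrix

variable {n : ℕ} {S : TargetState n} {Q B : Matrix (Fin n) (Fin n) ℝ} {σ : Fin n → ℝ}
 {u0 : Fin n → ℝ → ℝ} {u : Fin n → ℝ → ℝ → ℝ}

lemma sum_inv_mul_sum (hQ : IsUnit Q.det) (a : Fin n → ℝ) (i : Fin n) :
    ∑ j, Q⁻¹ i j * ∑ k, Q j k * a k = a i :=
  congrFun ((mulVec_mulVec a Q⁻¹ Q).trans (by rw [nonsing_inv_mul Q hQ, one_mulVec])) i

lemma sum_mul_sum_inv (hQ : IsUnit Q.det) (a : Fin n → ℝ) (i : Fin n) :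
    ∑ j, Q i j * ∑ k, Q⁻¹ j k * a k = a i :=
  congrFun ((mulVec_mulVec a Q Q⁻¹).trans (by rw [mul_nonsing_inv Q hQ, one_mulVec])) i

lemma sum_mul_dotProduct (M : Matrix (Fin n) (Fin n) ℝ) (a w : Fin n → ℝ) :
    (fun j => ∑ i, M j i * a i) ⬝ᵥ w = ∑ i, a i * ∑ j, M j i * w j := by
  simp only [dotProduct, sum_mul, mul_sum]
  rw [sum_comm]
  exact sum_congr rfl fun i _ => sum_congr rfl fun j _ => by ring

lemma dotProduct_row (a : Fin n → ℝ) (i : Fin n) (s : ℝ) :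
    a ⬝ᵥ (fun j => Q i j * s) = (∑ j, Q i j * a j) * s := by
  simp only [dotProduct, sum_mul]
  exact sum_congr rfl fun j _ => by ring

lemma transpose_mulVec_row (hQ : IsUnit Q.det) (τ : Fin n → ℝ) (i : Fin n) (s : ℝ) :
    (Q⁻¹ * diagonal τ * Q)ᵀ *ᵥ (fun j => Q i j * s) = fun j => Q i j * (τ i * s) := by
  ext j
  have h : (Q * (Q⁻¹ * diagonal τ * Q)) i j = τ i * Q i j := by
    rw [← mul_assoc, ← mul_assoc, mul_nonsing_inv Q hQ, one_mul, diagonal_mul]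
  rw [mul_apply] at h
  simp only [mulVec, transpose_apply, dotProduct_row]
  rw [h]; ring

lemma sum_inv_transpose_mulVec (hQ : IsUnit Q.det) (τ w : Fin n → ℝ) (i : Fin n) :
    ∑ j, Q⁻¹ j i * ((Q⁻¹ * diagonal τ * Q)ᵀ *ᵥ w) j = τ i * ∑ j, Q⁻¹ j i * w j := by
  have h : (Q⁻¹)ᵀ * (Q⁻¹ * diagonal τ * Q)ᵀ = diagonal τ * (Q⁻¹)ᵀ := by
    rw [← transpose_mul, mul_assoc, mul_nonsing_inv Q hQ, mul_one, transpose_mul,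
      diagonal_transpose]
  have := congrFun ((mulVec_mulVec w (Q⁻¹)ᵀ (Q⁻¹ * diagonal τ * Q)ᵀ).trans
    ((congrArg (· *ᵥ w) h).trans (mulVec_mulVec w (diagonal τ) (Q⁻¹)ᵀ).symm)) i
  rwa [mulVec_diagonal] at this

lemma backstepNonlocal_apply (he : ∀ t ≥ 0, S.ebar t = E t) (hE : IsFront S.speed E)
    (ht : 0 ≤ t) (z : Fin n → ℝ → ℝ) :
    backstepNonlocal S Q σ (fun i => kern (lam / σ i)) (fun i => kernX (lam / σ i)) t z
      = fun j => ∑ i, Q⁻¹ j i * ∫ y in 0..E t, gain (σ i) S.speed (lam / σ i) (E t) y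
        * ∑ k, Q i k * z k y := by
  ext j
  rw [backstepNonlocal, he t ht, mulVec, dotProduct]
  refine sum_congr rfl fun i _ => congrArg (Q⁻¹ j i * ·) ?_
  refine int_congr_Icc (hE.pos t).le fun y hy => ?_
  simp only [gain, kernX, if_pos hy.2]
  rfl

lemma stabilizesFractions_props (he : ∀ t ≥ 0, S.ebar t = E t) (hE : IsFront S.speed E) :
    PropP1 S.ebar (backstepNonlocal S Q σ (fun i => kern (lam / σ i)) fun i => kernX (lam / σ i)) ∧
    PropP2 S.ebar (backstepNonlocal S Q σ (fun i => kern (lam / σ i)) fun i => kernX (lam / σ i)) ∧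
    PropP3 (backstepLocal S Q σ fun i => kern (lam / σ i)) := by
  have hEc := hE.cont
  have cg : ∀ k, Continuous (uncurry fun t y => gain (σ k) S.speed (lam / σ k) (E t) y) := fun k =>
    (smooth2_gain _ _ _).continuous.comp (by fun_prop : Continuous fun p : ℝ × ℝ => (E p.1, p.2))
  have hc : ∀ i j, Continuous (uncurry fun t y => ∑ k, Q⁻¹ i k * Q k j
      * gain (σ k) S.speed (lam / σ k) (E t) y) := fun i j =>
    continuous_finsetSum _ fun k _ => continuous_const.mul (cg k)
  have hH : ∀ t ≥ 0, ∀ z : Fin n → ℝ → ℝ, (∀ j, MemLp (z j) 2 (mu (E t))) → ∀ i,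
      backstepNonlocal S Q σ (fun i => kern (lam / σ i)) (fun i => kernX (lam / σ i)) t z i
        = ∑ j, ∫ y in 0..E t, (∑ k, Q⁻¹ i k * Q k j
          * gain (σ k) S.speed (lam / σ k) (E t) y) * z j y := by
    intro t ht z hz i
    have ii : ∀ k j, IntervalIntegrable
        (fun y => gain (σ k) S.speed (lam / σ k) (E t) y * z j y) volume 0 (E t) := fun k j =>
      (MemLp.ii_mu (hE.pos t).le (hz j)).continuousOn_mul
        ((smooth2_gain _ _ _).slice _).continuous.continuousOn
    rw [backstepNonlocal_apply he hE ht]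
    simp only [mul_sum, sum_mul, mul_assoc, mul_left_comm (gain _ _ _ _ _)]
    have e1 : ∀ k, ∫ y in 0..E t, ∑ j, Q k j * (gain (σ k) S.speed (lam / σ k) (E t) y * z j y)
        = ∑ j, Q k j * ∫ y in 0..E t, gain (σ k) S.speed (lam / σ k) (E t) y * z j y := fun k => by
      rw [int_finsetSum fun j _ => (ii k j).const_mul _]
      simp only [int_const_mul]
    have e2 : ∀ j, ∫ y in 0..E t, ∑ k, Q⁻¹ i k * (Q k j * (gain (σ k) S.speed (lam / σ k) (E t) y
        * z j y)) = ∑ k, Q⁻¹ i k * (Q k j * ∫ y in 0..E t,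
          gain (σ k) S.speed (lam / σ k) (E t) y * z j y) := fun j => by
      rw [int_finsetSum fun k _ => ((ii k j).const_mul _).const_mul _]
      simp only [int_const_mul]
    simp only [e1, e2, mul_sum]
    exact sum_comm
  have hd := domainT_congr he
  refine ⟨?_, ?_, propP3_of_continuous ?_⟩
  · filter_upwards [propP1_of_kernel hE hc hH, ae_restrict_mem measurableSet_Ici] with t ht h0
    rwa [he t h0]
  · intro T hT
    obtain ⟨C, hC, h⟩ := propP2_of_kernel hE hc hH T hT
    refine ⟨C, hC, fun z hz => ?_⟩
    simp only [MovL2, hd] at hz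
    refine (h z hz).imp_right fun h2 => h2.trans_eq ?_
    congr 2
    refine int_congr_Icc hT.le fun t ht => ?_
    simp only [he t ht.1]
  · have ce : Continuous S.ebar := by unfold TargetState.ebar; fun_prop
    have ck : ∀ i, Continuous fun t => kern (lam / σ i) (S.ebar t) (S.ebar t) := fun i =>
      (smooth2_kern _).continuous.comp (ce.prodMk ce)
    exact (continuous_const.matrix_mul (Continuous.matrix_diagonal
      (continuous_pi fun i => continuous_const.mul (ck i)))).matrix_mul continuous_const

/-- The components of a weak solution in the coordinates that diagonalize the diffusion matrix. -/
lemma IsWeakSolution.component (hd : IsDiagonalization B Q σ)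
    (he : ∀ t ≥ 0, S.ebar t = E t) (hE : IsFront S.speed E)
    (hu : IsWeakSolution B S (backstepNonlocal S Q σ (fun i => kern (lam / σ i))
      fun i => kernX (lam / σ i)) (backstepLocal S Q σ fun i => kern (lam / σ i)) u0 u) (i : Fin n) :
    IsScalarSolution (σ i) S.speed (lam / σ i) E (fun x => ∑ j, Q i j * u0 j x)
      (fun t x => ∑ j, Q i j * u j t x) := by
  obtain ⟨hQ, rfl⟩ := hd
  have hm : ∀ j, AEStronglyMeasurable (uncurry (u j)) (volume.restrict (domain E)) := fun j => by
    rw [← domain_congr he]; exact hu.meas j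
  have hc : ∀ j, MovContL2 E (Ici 0) (u j) := fun j =>
    (movContL2_congr he subset_rfl).1 (hu.cont j)
  refine ⟨?_, MovContL2.sum_mul _ hc, TimeDerivInDualH1.sum_mul _ hE hm hc fun j => ?_, ?_⟩
  · exact Finset.aestronglyMeasurable_fun_sum _ fun j _ => (hm j).const_mul _
  · have := hu.timeDeriv j
    rwa [TimeDerivInDualH1, domain_congr he] at this
  intro T hT ν νt νx νxx hν
  have hmT : ∀ᵐ t ∂(mu T), t ∈ Ioo 0 T := ae_restrict_mem measurableSet_Ioo
  have hdT := domainT_congr he T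
  have hE0 : S.e0 = E 0 := by rw [← he 0 le_rfl, TargetState.ebar]; ring
  have hL : ∀ {f : ℝ → ℝ → ℝ}, MovL2 E T f → ∀ c : ℝ, MovL2 S.ebar T fun t x => c * f t x :=
    fun hf c => by rw [MovL2, hdT]; exact MemLp.const_mul hf c
  have hH : ∀ {l : ℝ} {f g : ℝ → ℝ}, IsH1 l f g → ∀ c : ℝ,
      IsH1 l (fun x => c * f x) fun x => c * g x := fun h c => by
    simpa using IsH1.sum_mul (ι := Unit) (fun _ => c) fun _ => h
  have htest : IsTestFunction (Q⁻¹ * diagonal σ * Q) S.ebar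
      (backstepLocal S Q σ fun i => kern (lam / σ i)) T (fun j t x => Q i j * ν t x)
      (fun j t x => Q i j * νt t x) (fun j t x => Q i j * νx t x) (fun j t x => Q i j * νxx t x) := by
    refine ⟨fun j => ⟨hL hν.memL2.1 _, hL hν.memL2.2.1 _, hL hν.memL2.2.2 _⟩, ?_, fun j => ?_,
      fun j => ?_, fun j => ?_, ?_, ?_⟩
    · filter_upwards [hν.memH2, hmT] with t ht htT j
      rw [he t htT.1.le]
      exact ⟨hH ht.1 _, hH ht.2 _⟩
    · rw [movContL2_congr he Icc_subset_Ici_self]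
      simpa using MovContL2.sum_mul (ι := Unit) (fun _ => Q i j) fun _ => hν.cont
    · have := HasWeakTimeDeriv.sum_mul (ι := Unit) (fun _ => Q i j) hE.cont
        (fun _ => hν.memL2.1) fun _ => hν.timeDeriv
      simpa [HasWeakTimeDeriv, MovL2, hdT] using this
    · rw [he T hT.le]
      filter_upwards [hν.final] with x hx
      rw [hx, mul_zero]
    · filter_upwards [hν.bdryZero] with t ht
      rw [transpose_mulVec_row hQ, ht]
      ext; simp
    · filter_upwards [hν.bdryFront, hmT] with t ht htT
      rw [backstepLocal, transpose_mulVec_row hQ, transpose_mulVec_row hQ, he t htT.1.le, ht]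
      ext; simp only [Pi.sub_apply, Pi.zero_apply]; ring
  have h := hu.weak T hT _ _ _ _ htest
  rw [hE0] at h
  refine Eq.trans ?_ h
  congr 1
  · congr 1
    · refine int_congr_Icc hT.le fun t ht => ?_
      simp only [transpose_mulVec_row hQ, dotProduct_add, dotProduct_row, he t ht.1, mul_add]
    · simp only [dotProduct_row]
  · refine int_congr_Icc hT.le fun t ht => ?_
    simp only [dotProduct_row, he t ht.1, backstepNonlocal_apply he hE ht.1, sum_mul_sum_inv hQ]

/-- Scalar solutions assemble to a weak solution of the system. -/
lemma isWeakSolution_of_components (hd : IsDiagonalization B Q σ) (hσ : ∀ i, 0 < σ i)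
    (he : ∀ t ≥ 0, S.ebar t = E t) (hE : IsFront S.speed E)
    (hu0 : ∀ i, MemLp (u0 i) 2 (mu (E 0))) {ζ : Fin n → ℝ → ℝ → ℝ}
    (hζ : ∀ i, IsScalarSolution (σ i) S.speed (lam / σ i) E (fun x => ∑ j, Q i j * u0 j x) (ζ i)) :
    IsWeakSolution B S (backstepNonlocal S Q σ (fun i => kern (lam / σ i))
      fun i => kernX (lam / σ i)) (backstepLocal S Q σ fun i => kern (lam / σ i)) u0
      fun j t x => ∑ i, Q⁻¹ j i * ζ i t x := by
  obtain ⟨hQ, rfl⟩ := hd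
  have hEc := hE.cont
  have hE0 : S.e0 = E 0 := by rw [← he 0 le_rfl, TargetState.ebar]; ring
  refine ⟨fun j => ?_, fun j => ?_, fun j => ?_, ?_⟩
  · rw [domain_congr he]
    exact Finset.aestronglyMeasurable_fun_sum _ fun i _ => (hζ i).meas.const_mul _
  · exact (movContL2_congr he subset_rfl).2 (MovContL2.sum_mul _ fun i => (hζ i).cont)
  · rw [TimeDerivInDualH1, domain_congr he]
    exact TimeDerivInDualH1.sum_mul _ hE (fun i => (hζ i).meas) (fun i => (hζ i).cont)
      fun i => (hζ i).timeDeriv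
  intro T hT w wt wx wxx hw
  have hmT : ∀ᵐ t ∂(mu T), t ∈ Ioo 0 T := ae_restrict_mem measurableSet_Ioo
  have hdT := domainT_congr he T
  have hL := hw.memL2
  have hD := hw.timeDeriv
  simp only [HasWeakTimeDeriv, MovL2, hdT] at hL hD
  have hwc : ∀ j, MovContL2 E (Icc 0 T) (w j) := fun j =>
    (movContL2_congr he Icc_subset_Ici_self).1 (hw.cont j)
  have htest : ∀ i, IsScalarTest E (fun t => kern (lam / σ i) (E t) (E t)) T
      (fun t x => ∑ j, Q⁻¹ j i * w j t x) (fun t x => ∑ j, Q⁻¹ j i * wt j t x)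
      (fun t x => ∑ j, Q⁻¹ j i * wx j t x) (fun t x => ∑ j, Q⁻¹ j i * wxx j t x) := by
    intro i
    refine ⟨⟨memLp_sum_mul _ fun j => (hL j).1, memLp_sum_mul _ fun j => (hL j).2.1,
      memLp_sum_mul _ fun j => (hL j).2.2⟩, ?_, MovContL2.sum_mul _ hwc,
      HasWeakTimeDeriv.sum_mul _ hEc (fun j => (hL j).1) hD, ?_, ?_, ?_⟩
    · filter_upwards [hw.memH2, hmT] with t ht htT
      rw [he t htT.1.le] at ht
      exact ⟨IsH1.sum_mul _ fun j => (ht j).1, IsH1.sum_mul _ fun j => (ht j).2⟩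
    · have := ae_all_iff.2 hw.final
      rw [he T hT.le] at this
      filter_upwards [this] with x hx
      simp only [hx, mul_zero, Finset.sum_const_zero]
    · filter_upwards [hw.bdryZero] with t ht
      have := sum_inv_transpose_mulVec hQ σ (fun j => wx j t 0) i
      rw [ht] at this
      simpa [(hσ i).ne'] using this
    · filter_upwards [hw.bdryMoving, hmT] with t ht htT
      have h1 := sum_inv_transpose_mulVec hQ σ (fun j => wx j t (E t)) i
      have h2 := sum_inv_transpose_mulVec hQ
        (fun i => σ i * kern (lam / σ i) (E t) (E t)) (fun j => w j t (E t)) i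
      rw [backstepLocal, he t htT.1.le, sub_eq_zero] at ht
      rw [ht, h1, mul_assoc] at h2
      exact mul_left_cancel₀ (hσ i).ne' h2
  have hF : ∀ i, IntegrableOn (fun p : ℝ × ℝ => ζ i p.1 p.2 * ((∑ j, Q⁻¹ j i * wt j p.1 p.2)
      + σ i * ∑ j, Q⁻¹ j i * wxx j p.1 p.2)) (domainT E T) := fun i =>
    MovL2.integrable_mul (g := fun t x => (∑ j, Q⁻¹ j i * wt j t x)
      + σ i * ∑ j, Q⁻¹ j i * wxx j t x) (((hζ i).cont.mono Icc_subset_Ici_self).movL2 hEc hE.pos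
      ((hζ i).meas.mono_measure (Measure.restrict_mono (domainT_subset_domain E _) le_rfl)))
      ((htest i).timeDeriv.1.add (MemLp.const_mul (htest i).memL2.2.2 (σ i)))
  have key := sum_congr (s₁ := Finset.univ) rfl fun i _ =>
    (hζ i).weak T hT _ _ _ _ (htest i)
  rw [Finset.sum_const_zero, sum_add_distrib, sum_add_distrib] at key
  rw [hE0]
  refine Eq.trans ?_ key
  congr 1
  · congr 1
    · have e := (integral_domainT hEc.measurable hE.pos hT.le
        (integrable_finsetSum Finset.univ fun i _ => hF i)).symm
      rw [integral_finsetSum _ fun i _ => hF i, sum_congr rfl fun i _ =>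
        integral_domainT hEc.measurable hE.pos hT.le (hF i)] at e
      refine Eq.trans (int_congr_Icc hT.le fun t ht => ?_) e
      simp only [he t ht.1, sum_mul_dotProduct, Pi.add_apply, mul_add, sum_add_distrib,
        sum_inv_transpose_mulVec hQ]
    · have i0 : ∀ i ∈ Finset.univ, IntervalIntegrable (fun x => (∑ j, Q i j * u0 j x)
          * ∑ j, Q⁻¹ j i * w j 0 x) volume 0 (E 0) := fun i _ =>
        ii_of_mu (hE.pos 0).le ((memLp_sum_mul (Q i) hu0).integrable_mul (q := 2)
          ((htest i).cont.memLp hE.pos ⟨le_rfl, hT.le⟩))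
      rw [← int_finsetSum i0]
      congr 1; ext x
      rw [← sum_mul_dotProduct]
      simp only [sum_inv_mul_sum hQ]
  · have hG : ∀ i, IntervalIntegrable (fun t => (∫ y in 0..E t, gain (σ i) S.speed (lam / σ i) (E t) y
        * ζ i t y) * ∑ j, Q⁻¹ j i * w j t (E t)) volume 0 T := fun i => by
      have cg : Continuous (uncurry fun t y => gain (σ i) S.speed (lam / σ i) (E t) y) :=
        (smooth2_gain _ _ _).continuous.comp
          (by fun_prop : Continuous fun p : ℝ × ℝ => (E p.1, p.2))
      refine (ii_of_mu hT.le ((htest i).integrable_trace hE)).continuousOn_mul ?_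
      rw [uIcc_of_le hT.le]
      exact (MovContL2.of_cont hEc _ cg).continuousOn_integral_mul hEc
        ((hζ i).cont.mono Icc_subset_Ici_self)
    rw [← int_finsetSum fun i _ => hG i]
    refine int_congr_Icc hT.le fun t ht => ?_
    simp only [backstepNonlocal_apply he hE ht.1, sum_mul_dotProduct, he t ht.1, sum_mul_sum_inv hQ]

lemma normL2_sum_mul_le (hl : 0 ≤ l) (M : Matrix (Fin n) (Fin n) ℝ) {z : Fin n → ℝ → ℝ}
    (hz : ∀ i, MemLp (z i) 2 (mu l)) :
    normL2 l (fun j x => ∑ i, M j i * z i x) ^ 2 ≤ (∑ j, ∑ i, M j i ^ 2) * normL2 l z ^ 2 := by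
  rw [normL2_sq (z := fun j x => ∑ i, M j i * z i x) hl fun j => memLp_sum_mul (M j ·) hz,
    normL2_sq hl hz, sum_mul]
  refine sum_le_sum fun j _ => ?_
  have ii : ∀ i ∈ Finset.univ, IntervalIntegrable (fun x => z i x ^ 2) volume 0 l := fun i _ =>
    int_sq_mu hl (hz i)
  rw [← int_finsetSum ii, ← int_const_mul]
  exact int_mono_on hl (int_sq_mu hl (memLp_sum_mul _ hz))
    ((by simpa only [Finset.sum_fn] using IntervalIntegrable.sum _ ii : IntervalIntegrable
      (fun x => ∑ i, z i x ^ 2) volume 0 l).const_mul _) fun x _ =>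
      Finset.sum_mul_sq_le_sq_mul_sq _ _ _

lemma TargetState.speed_pos (S : TargetState n) : 0 < S.speed :=
  Finset.sum_pos (fun i _ => S.phi_pos i) Finset.univ_nonempty

/-- The backstepping feedback stabilizes the volume fractions. -/
lemma exists_stabilizesFractions (S : TargetState n) (hd : IsDiagonalization B Q σ)
    (hσ : ∀ i, 0 < σ i) (hm : 0 ≤ m) : ∃ lam0, 0 < lam0 ∧ ∀ lam, lam0 ≤ lam → ∃ C, 0 < C ∧
      StabilizesFractions B S m C (backstepNonlocal S Q σ (fun i => kern (lam / σ i))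
        fun i => kernX (lam / σ i)) (backstepLocal S Q σ fun i => kern (lam / σ i)) := by
  have hv := S.speed_pos
  set v := S.speed with hvdef
  obtain ⟨E, hE, hE0⟩ := exists_isFront S.e0_pos hv
  have he : ∀ t ≥ 0, S.ebar t = E t := fun t ht => by
    rw [hE.eq t ht, hE0, TargetState.ebar]
  have hpos : ∀ i, 0 ≤ 4 * v ^ 2 / σ i := fun i => by have := hσ i; positivity
  have hsum : 0 ≤ ∑ i, 4 * v ^ 2 / σ i := sum_nonneg fun i _ => hpos i
  refine ⟨(∑ i, 4 * v ^ 2 / σ i) + 16 * v + 4 * m + 2, by positivity, fun lam hlam => ?_⟩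
  have hlam0 : 0 < lam := lt_of_lt_of_le (by positivity) hlam
  have hi : ∀ i, 4 * v ^ 2 / σ i + 16 * v + 4 * m + 2 ≤ lam := fun i => by
    linarith [single_le_sum (fun i _ => hpos i) (Finset.mem_univ i)]
  have hi1 : ∀ i, 2 * (√(lam / σ i) + 4) * v + 2 * m + 1 ≤ lam := fun i => by
    have h0 := hσ i
    have h1 := sq_sqrt (div_pos hlam0 h0).le
    have h2 : lam = σ i * √(lam / σ i) ^ 2 := by rw [h1]; field_simp
    have h3 : 2 * √(lam / σ i) * v ≤ σ i * √(lam / σ i) ^ 2 / 2 + 2 * v ^ 2 / σ i := by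
      have : 0 ≤ (σ i * √(lam / σ i) - 2 * v) ^ 2 / (2 * σ i) := by positivity
      have e : (σ i * √(lam / σ i) - 2 * v) ^ 2 / (2 * σ i)
        = σ i * √(lam / σ i) ^ 2 / 2 + 2 * v ^ 2 / σ i - 2 * √(lam / σ i) * v := by
        field_simp; ring
      linarith
    rw [← h2] at h3
    have := hi i
    rw [mul_div_assoc] at this h3
    linarith
  have hi2 : ∀ i, v ^ 2 / σ i + 1 ≤ lam := fun i => by
    have h0 : 0 ≤ v ^ 2 / σ i := by have := hσ i; positivity
    have := hi i
    rw [mul_div_assoc] at this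
    linarith
  choose C hC0 hC using fun i => exists_isScalarSolution (hσ i) hv
    (mul_div_cancel₀ lam (hσ i).ne').symm hlam0 hE (hi1 i) (hi2 i) hm
  set K1 : ℝ := ∑ j, ∑ i, Q⁻¹ j i ^ 2 with hK1
  set K2 : ℝ := ∑ j, ∑ i, Q j i ^ 2 with hK2
  have hK10 : 0 ≤ K1 := sum_nonneg fun _ _ => sum_nonneg fun _ _ => sq_nonneg _
  have hK20 : 0 ≤ K2 := sum_nonneg fun _ _ => sum_nonneg fun _ _ => sq_nonneg _
  have hCs : 0 ≤ ∑ i, C i := sum_nonneg fun i _ => (hC0 i).le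
  obtain ⟨p1, p2, p3⟩ := stabilizesFractions_props (Q := Q) (σ := σ) (lam := lam) he hE
  refine ⟨√(K1 * (∑ i, C i) * K2) + 1, by positivity, p1, p2, p3, fun u0 hu0 => ?_⟩
  rw [← hE0] at hu0 ⊢
  have hz0 : ∀ i, MemLp (fun x => ∑ j, Q i j * u0 j x) 2 (mu (E 0)) := fun i =>
    memLp_sum_mul _ hu0
  choose ζ hζ hdecay using fun i => hC i _ (hz0 i)
  refine ⟨_, isWeakSolution_of_components hd hσ he hE hu0 hζ, fun u' hu' t ht j => ?_,
    fun t ht => ?_⟩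
  · have h := ae_all_iff.2 fun i => (hζ i).unique (hσ i) (mul_div_cancel₀ lam (hσ i).ne').symm hE
      (hu'.component hd he hE i) ht
    rw [he t ht]
    filter_upwards [h] with x hx
    rw [← sum_inv_mul_sum hd.1 (fun j => u' j t x) j]
    simp only [hx]
  · rw [he t ht]
    have hl := (hE.pos t).le
    have hζm : ∀ i, MemLp (ζ i t) 2 (mu (E t)) := fun i => (hζ i).cont.memLp hE.pos (mem_Ici.2 ht)
    have h1 := normL2_sum_mul_le hl Q⁻¹ hζm
    have h2 := normL2_sum_mul_le (hE.pos 0).le Q hu0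
    have h3 : normL2 (E t) (fun i => ζ i t) ^ 2 ≤ (∑ i, C i) * exp (-m * t) ^ 2
        * normL2 (E 0) (fun i x => ∑ j, Q i j * u0 j x) ^ 2 := by
      rw [normL2_sq hl hζm, normL2_sq (hE.pos 0).le hz0, mul_sum]
      refine sum_le_sum fun i _ => ?_
      have e : exp (2 * m * t) * exp (-m * t) ^ 2 = 1 := by
        rw [← exp_nat_mul, ← exp_add, Real.exp_eq_one_iff]; push_cast; ring
      have h4 := mul_le_mul_of_nonneg_right (hdecay i t ht) (sq_nonneg (exp (-m * t)))
      have h5 : C i ≤ ∑ i, C i := single_le_sum (fun i _ => (hC0 i).le) (Finset.mem_univ i)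
      have h6 : 0 ≤ ∫ x in 0..E 0, (∑ j, Q i j * u0 j x) ^ 2 :=
        int_nonneg (hE.pos 0).le fun _ _ => sq_nonneg _
      calc _ = exp (2 * m * t) * (∫ x in 0..E t, ζ i t x ^ 2) * exp (-m * t) ^ 2 := by
            rw [mul_right_comm, e, one_mul]
        _ ≤ C i * exp (-m * t) ^ 2 * ∫ x in 0..E 0, (∑ j, Q i j * u0 j x) ^ 2 := by
            exact h4.trans_eq (mul_right_comm _ _ _)
        _ ≤ _ := by gcongr
    have h0 : 0 ≤ normL2 (E 0) u0 := sqrt_nonneg _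
    refine abs_le_of_sq_le_sq' ?_ (by positivity) |>.2
    calc _ ≤ K1 * ((∑ i, C i) * exp (-m * t) ^ 2 * (K2 * normL2 (E 0) u0 ^ 2)) :=
          h1.trans (mul_le_mul_of_nonneg_left (h3.trans (by gcongr)) hK10)
      _ = √(K1 * (∑ i, C i) * K2) ^ 2 * (exp (-m * t) * normL2 (E 0) u0) ^ 2 := by
          rw [sq_sqrt (by positivity)]; ring
      _ ≤ (√(K1 * (∑ i, C i) * K2) + 1) ^ 2 * (exp (-m * t) * normL2 (E 0) u0) ^ 2 := by
          gcongr; linarith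
      _ = _ := by ring

end closedLoop
end CrossDiffusion

end

theorem theorem2 (n : ℕ) (hn : 1 ≤ n)
    (A : (Fin n → ℝ) → Matrix (Fin n) (Fin n) ℝ)
    (S : CrossDiffusion.TargetState n)
    (hA1 : S.ubar ∈ CrossDiffusion.simplex n)
    (hA2 : ∃ h : (Fin n → ℝ) → ℝ, CrossDiffusion.IsEntropyDensity A h ∧
      (CrossDiffusion.mobility A h S.ubar).IsSymm)
    (μ : ℝ) (hμ : 0 < μ) :
    CrossDiffusion.ExpStabilizable A S μ ∧
    (∃ (Q : Matrix (Fin n) (Fin n) ℝ) (σ : Fin n → ℝ),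
      (∀ i, 0 < σ i) ∧ CrossDiffusion.IsDiagonalization (A S.ubar) Q σ) ∧
    ∀ (Q : Matrix (Fin n) (Fin n) ℝ) (σ : Fin n → ℝ),
      CrossDiffusion.IsDiagonalization (A S.ubar) Q σ →
      ∃ lam0 : ℝ, 0 < lam0 ∧ ∀ lam : ℝ, lam0 ≤ lam →
        ∃ k kx ky : Fin n → ℝ → ℝ → ℝ,
          (∀ i, CrossDiffusion.IsUniqueWeakKernel (lam / σ i) (k i) (kx i) (ky i)) ∧
          ∃ Cu Ce : ℝ, 0 < Cu ∧ 0 < Ce ∧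
            CrossDiffusion.StabilizesFractions (A S.ubar) S μ Cu
              (CrossDiffusion.backstepNonlocal S Q σ k kx)
              (CrossDiffusion.backstepLocal S Q σ k) ∧
            CrossDiffusion.StabilizesThickness μ Ce (fun _ w => -μ * w) := by
  open CrossDiffusion in
  obtain ⟨h, hA, hsymm⟩ := hA2
  obtain ⟨hH, hP⟩ := hA.posDef hA1 hsymm
  obtain ⟨Q, σ, hσ, hd⟩ := exists_isDiagonalization hH hP
  have ht := stabilizesThickness_linear hμ
  refine ⟨?_, ⟨Q, σ, hσ, hd⟩, fun Q σ hd => ?_⟩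
  · obtain ⟨lam0, _, hl⟩ := exists_stabilizesFractions S hd hσ hμ.le
    obtain ⟨C, hC, hs⟩ := hl lam0 le_rfl
    exact ⟨C, 1, hC, one_pos, ⟨_, _, hs⟩, _, ht⟩
  · have hσ := hd.pos hH.posSemidef fun z hz => hP.dotProduct_mulVec_pos hz
    obtain ⟨lam0, h0, hl⟩ := exists_stabilizesFractions S hd hσ hμ.le
    refine ⟨lam0, h0, fun lam hlam => ?_⟩
    obtain ⟨C, hC, hs⟩ := hl lam hlam
    exact ⟨_, _, _, fun i => isUniqueWeakKernel_kern _, C, 1, hC, one_pos, hs, ht⟩
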